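/- Let $s,r\in(0,1]$, $p,q\in[1,+\infty)$ and $m\in\mathbb{N}$, $m\ge 1$. Let $\mathcal{M}$ be either the Euclidean space $\mathbb{R}^m$ or a (nonempty) compact Riemannian manifold of dimension $m$, and let $\mathcal{N}$ be a connected Riemannian manifold; $d_{\mathcal M}$ and $d_{\mathcal N}$ denote the geodesic distances. For an open set $A$ in $\mathcal{M}$ (or in $\mathbb{R}^m$) and a measurable map $u:A\to\mathcal{N}$, the Sobolev energy is $$\mathcal{E}_{s,p}(u,A)=\int_A\int_A\frac{d_{\mathcal N}(u(x),u(y))^p}{d_{\mathcal M}(x,y)^{m+sp}}\,\mathrm{d}x\,\mathrm{d}y\quad\text{if } 0<s<1,\qquad \mathcal{E}_{1,p}(u,A)=\int_A|Du|^p ,$$ where $\mathcal{E}_{1,p}(u,A)=+\infty$ if $u$ is not weakly differentiable on $A$. Here $u$ is weakly differentiable with weak differential $Du(x):T_x\mathcal{M}\to T_{u(x)}\mathcal{N}$ if for every smooth function $f:\mathcal{N}\to\mathbb{R}$ that is Lipschitz for $d_{\mathcal N}$, the function $f\circ u$ is locally integrable and has the locally integrable weak differential $df(u)\circ Du$; $|\cdot|$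 is the Euclidean (Hilbert--Schmidt) norm. Let $W^{s,p}(\mathcal{M},\mathcal{N})$ be the set of measurable maps $u:\mathcal{M}\to\mathcal{N}$ with $\mathcal{E}_{s,p}(u,\mathcal{M})<+\infty$. A map $u:\mathcal{M}\to\mathcal{N}$ has a weak-bounded approximation in $W^{r,q}(\mathcal{M},\mathcal{N})$ if there is a sequence $(u_i)_{i\in\mathbb{N}}$ in $C^\infty(\mathcal{M},\mathcal{N})$ converging to $u$ almost everywhere with $\sup_i\mathcal{E}_{r,q}(u_i,\mathcal{M})<+\infty$. Let $\mathbb{B}^m$ be the open unit ball of $\mathbb{R}^m$. The relaxed energy of a measurable map $u:\mathbb{B}^m\to\mathcal{N}$ is $$\mathcal{E}^{\mathrm{rel}}_{r,q}(u,\mathbb{B}^m)=\inf\Bigl\{\liminf_{i\to\infty}\mathcal{E}_{r,q}(u_i,\mathbb{B}^m)\;:\;u_i\in C^\infty(\mathbb{B}^m,\mathcal{N})\text{ for each }i,\ u_i\to u\text{ almost everywhere in }\mathbb{B}^m\Bigr\}\in[0,+\infty].$$ Theorem. If $sp=rq<m$ and if every map $u\in W^{s,p}(\mathcal{M},\mathcal{N})$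 has a weak-bounded approximation in $W^{r,q}(\mathcal{M},\mathcal{N})$, then there exists a constant $C>0$ such that for every measurable map $u:\mathbb{B}^m\to\mathcal{N}$, $$\mathcal{E}^{\mathrm{rel}}_{r,q}(u,\mathbb{B}^m)\le C\,\mathcal{E}_{s,p}(u,\mathbb{B}^m).$$ -/

import Mathlib

open MeasureTheory Measure Set Filter Topology Bundle
open scoped Manifold ContDiff

noncomputable section SobolevMaps

/-- `w` is the weak (distributional) differential of the real function `h` on the open set `U`:
both are locally integrable on `U`, and integration by parts holds against every smooth test
function with compact support in `U`. -/
def HasWeakFDerivOn {m : ℕ} (U : Set (EuclideanSpace ℝ (Fin m)))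
    (h : EuclideanSpace ℝ (Fin m) → ℝ)
    (w : EuclideanSpace ℝ (Fin m) → EuclideanSpace ℝ (Fin m) →L[ℝ] ℝ) : Prop :=
  LocallyIntegrableOn h U volume ∧ LocallyIntegrableOn w U volume ∧
    ∀ ψ : EuclideanSpace ℝ (Fin m) → ℝ, ContDiff ℝ ∞ ψ → HasCompactSupport ψ → tsupport ψ ⊆ U →
      ∀ v : EuclideanSpace ℝ (Fin m),
        ∫ y, h y * fderiv ℝ ψ y v = - ∫ y, w y v * ψ y

/-- The field of linear maps `D x : T_x M → T_{u x} N` is the weak differential of `u : M → N` on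
the open set `A ⊆ M`: for every smooth function `f : N → ℝ` that is Lipschitz for the geodesic
distance, `f ∘ u` is, in the charts of `M`, weakly differentiable on `A` with differential
`x ↦ df (u x) ∘ D x`. If `N` is complete and isometrically embedded in a Euclidean space `ℝ^ν`, and
`|D|` is locally integrable, this says that `u` is weakly differentiable as a map to `ℝ^ν`, with
differential `D`. -/
def HasWeakMFDerivOn {m n : ℕ}
    {M : Type*} [TopologicalSpace M] [ChartedSpace (EuclideanSpace ℝ (Fin m)) M]
    {N : Type*} [EMetricSpace N] [ChartedSpace (EuclideanSpace ℝ (Fin n)) N]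
    (A : Set M) (u : M → N)
    (D : ∀ x : M, TangentSpace (𝓡 m) x →L[ℝ] TangentSpace (𝓡 n) (u x)) : Prop :=
  ∀ f : N → ℝ, ContMDiff (𝓡 n) 𝓘(ℝ, ℝ) ∞ f → (∃ K, LipschitzWith K f) →
    ∀ e ∈ atlas (EuclideanSpace ℝ (Fin m)) M,
      HasWeakFDerivOn (e.target ∩ e.symm ⁻¹' A)
        (fun y ↦ f (u (e.symm y)))
        (fun y ↦ (mfderiv (𝓡 n) 𝓘(ℝ, ℝ) f (u (e.symm y))).comp
          ((D (e.symm y)).comp (mfderiv (𝓡 m) (𝓡 m) e.symm y)))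

/-- The Hilbert–Schmidt (Euclidean) norm of a linear map between finite-dimensional real inner
product spaces. -/
def hilbertSchmidtENorm {V W : Type*} [NormedAddCommGroup V] [InnerProductSpace ℝ V]
    [FiniteDimensional ℝ V] [NormedAddCommGroup W] [InnerProductSpace ℝ W] (L : V →L[ℝ] W) :
    ENNReal :=
  (∑ i, ‖L (stdOrthonormalBasis ℝ V i)‖ₑ ^ 2) ^ (1 / 2 : ℝ)

instance {m : ℕ} {M : Type*} [TopologicalSpace M] [ChartedSpace (EuclideanSpace ℝ (Fin m)) M]
    (x : M) : FiniteDimensional ℝ (TangentSpace (𝓡 m) x) :=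
  inferInstanceAs (FiniteDimensional ℝ (EuclideanSpace ℝ (Fin m)))

/-- The Dirichlet `p`-energy `∫_A |Du|^p` of a map `u : M → N` on an open set `A`. It is `+∞` if `u`
is not weakly differentiable on `A`; the weak differential is unique almost everywhere, so that
the infimum is its energy otherwise. The Riemannian volume measure of the `m`-dimensional manifold
`M` is the normalized Hausdorff measure `μHE[m]` of its geodesic distance. -/
def dirichletEnergy {m n : ℕ}
    {M : Type*} [EMetricSpace M] [MeasurableSpace M] [BorelSpace M]
    [ChartedSpace (EuclideanSpace ℝ (Fin m)) M]
    [RiemannianBundle (fun x : M ↦ TangentSpace (𝓡 m) x)]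
    {N : Type*} [EMetricSpace N] [ChartedSpace (EuclideanSpace ℝ (Fin n)) N]
    [RiemannianBundle (fun y : N ↦ TangentSpace (𝓡 n) y)]
    (p : ℝ) (A : Set M) (u : M → N) : ENNReal :=
  ⨅ (D : ∀ x : M, TangentSpace (𝓡 m) x →L[ℝ] TangentSpace (𝓡 n) (u x))
    (_ : HasWeakMFDerivOn A u D), ∫⁻ x in A, hilbertSchmidtENorm (D x) ^ p ∂μHE[m]

/-- The Gagliardo energy on `A` of a map `u : M → N`, where `m` is the dimension of `M`. -/
def gagliardoEnergy (m : ℕ) {M : Type*} [EMetricSpace M] [MeasurableSpace M] [BorelSpace M]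
    {N : Type*} [EMetricSpace N] (s p : ℝ) (A : Set M) (u : M → N) : ENNReal :=
  ∫⁻ x in A, ∫⁻ y in A, edist (u x) (u y) ^ p / edist x y ^ (m + s * p) ∂μHE[m] ∂μHE[m]

section Energies

variable (m n : ℕ)
  {M : Type*} [EMetricSpace M] [MeasurableSpace M] [BorelSpace M]
  [ChartedSpace (EuclideanSpace ℝ (Fin m)) M] [RiemannianBundle (fun x : M ↦ TangentSpace (𝓡 m) x)]
  {N : Type*} [EMetricSpace N]
  [ChartedSpace (EuclideanSpace ℝ (Fin n)) N] [RiemannianBundle (fun y : N ↦ TangentSpace (𝓡 n) y)]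

/-- The Sobolev energy `E_{s,p}(u, A)` for `0 < s ≤ 1`; here `m = dim M` and `n = dim N`. -/
def sobolevEnergy (s p : ℝ) (A : Set M) (u : M → N) : ENNReal :=
  if s = 1 then dirichletEnergy (m := m) (n := n) p A u else gagliardoEnergy m s p A u

/-- The relaxed energy `E^rel_{s,p}(u, A)`: the infimum of `liminf_k E_{s,p}(v_k, A)` over the
sequences of smooth maps `v_k` on `A` that converge to `u` almost everywhere on `A`. -/
def relaxedEnergy (s p : ℝ) (A : Set M) (u : M → N) : ENNReal :=
  ⨅ (v : ℕ → M → N) (_ : ∀ k, ContMDiffOn (𝓡 m) (𝓡 n) ∞ (v k) A)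
    (_ : ∀ᵐ x ∂(μHE[m] : Measure M).restrict A, Tendsto (fun k ↦ v k x) atTop (𝓝 (u x))),
    liminf (fun k ↦ sobolevEnergy m n s p A (v k)) atTop

/-- `u : M → N` belongs to `W^{s,p}(M, N)`. -/
def MemSobolevMap [MeasurableSpace N] (s p : ℝ) (u : M → N) : Prop :=
  AEMeasurable u (μHE[m] : Measure M) ∧ sobolevEnergy m n s p univ u < ⊤

/-- `u : M → N` has a weak-bounded approximation in `W^{r,q}(M, N)`: it is the almost everywhere
limit of a sequence of smooth maps with bounded energies `E_{r,q}`. -/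
def HasWeakBoundedApprox (r q : ℝ) (u : M → N) : Prop :=
  ∃ v : ℕ → M → N, (∀ k, ContMDiff (𝓡 m) (𝓡 n) ∞ (v k)) ∧
    (∀ᵐ x ∂(μHE[m] : Measure M), Tendsto (fun k ↦ v k x) atTop (𝓝 (u x))) ∧
    ∃ K : NNReal, ∀ k, sobolevEnergy m n r q univ (v k) ≤ K

end Energies

end SobolevMaps

/-! The theorem is a uniform boundedness principle for a nonlinear space of maps. If no constant
works, then for every `k` there are a map `u k` on the unit ball and a finite `R k > 0` such that (k
+ 1) 2^k E_{s,p}(u k) < R k < E^rel_{r,q}(u k). Because s p = r q, a copy of a map at scale ρ has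
both its energies multiplied by ρ^σ, with the same exponent σ = m - s p, and 0 < σ < m. Since σ < m,
any small ball has room for Q^m disjoint copies of `u k` of scale ρ with Q^m ρ^σ = (k + 1) / R k:
the size Q ρ of the cluster tends to 0 as Q tends to infinity. Such a cluster costs of the order of
2^(-k) for E_{s,p}, so the clusters of all the `u k` can be put together, in a chart of M, into a
map of W^{s,p}(M, N). A weak-bounded approximation of this map, with energies at most E, restricts
on each copy to an approximation of `u k`. The energies on the disjoint copies add up, so Q^m ρ^σ R
k = k + 1 is at most a constant times E for every `k`, which is impossible.

Copies can only be inserted if they are constant near infinity. This is achieved by opening: `u` is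
composed with a Lipschitz map `opening 0 a` that is the identity on the unit ball, takes its values
in the closed unit ball, and is equal to the point `a` far away. By averaging over `a`
(`exists_forall_exists_opening`), some `a` increases the energy by a constant factor at most. For s
< 1, the energy of the composition is bounded by the integral of one density composed with the
opening map (`exists_gagliardoEnergy_comp_le`). For s = 1, weak differentiability has to be proved
although the opening map collapses an open set to a point: the composition is the limit of those
with `opening ε a`, provided that `a` is a Lebesgue point (`HasBddWeakMFDerivOn.comp_opening`). This
uses a map that is defined slightly beyond the closed unit ball, so `u` is first replaced by x ↦ u
(l x) with l < 1; by lower semicontinuity, the lower bound on the relaxed energy survives for some l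
(`exists_lt_relaxedEnergy_comp_smul`).

The construction of the clusters needs only the scaling, the gluing inequality, and maps of finite
energy that join two constants; the latter exist because N is connected. These properties are
isolated in `IsGluableEnergy`, and the construction is `IsGluableEnergy.exists_concentration`. For s
= 1 the gluable energy tests weak differentiability with bounded functions only, so that limits
follow from dominated convergence. A Poincaré inequality and truncation recover all Lipschitz tests
for maps that are constant near infinity (`HasBddWeakMFDerivOn.hasWeakFDerivOn_of_lipschitzWith`).
The passage to M and back goes through one bilipschitz chart (`exists_bilipschitz_chartAt`), and
`card_mul_relaxedEnergy_le` gives the final inequality. -/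

/-! ### Weak differentials of real functions and their limits -/

section WeakDerivatives

open scoped NNReal Convolution

variable {m : ℕ}

/-- Integrable functions are continuous in `L¹` along measurable maps that are close to the identity
and do not concentrate the volume. -/
theorem MeasureTheory.Integrable.exists_lintegral_comp_sub_le {G : Type*} [NormedAddCommGroup G]
    [NormedSpace ℝ G] {F : EuclideanSpace ℝ (Fin m) → G} (hF : Integrable F) (C : ℝ≥0)
    {ε : ENNReal} (hε : ε ≠ 0) :
    ∃ δ > 0, ∀ (A : Set (EuclideanSpace ℝ (Fin m))) (T : EuclideanSpace ℝ (Fin m) →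
      EuclideanSpace ℝ (Fin m)), MeasurableSet A → Measurable T →
      (volume.restrict A).map T ≤ C • volume → (∀ x ∈ A, dist (T x) x ≤ δ) →
      ∫⁻ x in A, ‖F (T x) - F x‖ₑ ≤ ε := by
  obtain ⟨ε₁, hε₁, hε₁'⟩ : ∃ ε₁ : ENNReal, ε₁ ≠ 0 ∧ C * ε₁ + ε₁ + ε₁ ≤ ε := by
    by_cases h : ε = ⊤
    · exact ⟨1, by simp, by simp [h]⟩
    refine ⟨ε / (C + 2), ENNReal.div_ne_zero.2 ⟨hε, by simp⟩, ?_⟩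
    have : C * (ε / (C + 2)) + ε / (C + 2) + ε / (C + 2) = (C + 2) * (ε / (C + 2)) := by ring
    rw [this, ENNReal.mul_div_cancel (by simp) (by simp)]
  -- Three errors: `F ∘ T - g ∘ T` is small by the bound on the image measure, `g ∘ T - g` by
  -- uniform continuity, and `F - g` by the choice of `g`. The second one vanishes off `K`, as `T`
  -- moves points by at most 1.
  obtain ⟨g, hgs, hg, hgc, hgi⟩ := hF.exists_hasCompactSupport_lintegral_sub_le hε₁
  set K := Metric.cthickening 1 (tsupport g) with hK
  have hKc : IsCompact K := hgs.isCompact.cthickening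
  have hgu : UniformContinuous g := hgs.uniformContinuous_of_continuous hgc
  obtain ⟨η, hη0, hη⟩ : ∃ η : ℝ≥0, 0 < η ∧ η * volume K ≤ ε₁ := by
    obtain ⟨η, h0, h⟩ := ENNReal.exists_nnreal_pos_mul_lt (hKc.measure_lt_top (μ := volume)).ne hε₁
    exact ⟨η, h0, h.le⟩
  obtain ⟨δ, hδ0, hδ⟩ := Metric.uniformContinuous_iff.1 hgu η (by exact_mod_cast hη0)
  refine ⟨min (δ / 2) 1, by positivity, fun A T hA hT hTm hTd ↦ ?_⟩
  have h1 : ∫⁻ x in A, ‖F (T x) - g (T x)‖ₑ ≤ C * ε₁ := by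
    have h2 : AEStronglyMeasurable (fun x ↦ F x - g x) volume :=
      hF.aestronglyMeasurable.sub hgi.aestronglyMeasurable
    have hac : (volume.restrict A).map T ≪ volume :=
      (Measure.absolutelyContinuous_of_le hTm).trans (Measure.smul_absolutelyContinuous (μ := (volume : Measure (EuclideanSpace ℝ (Fin m)))) (c := C))
    rw [← lintegral_map' (f := fun x ↦ ‖F x - g x‖ₑ) (h2.mono_ac hac).enorm hT.aemeasurable]
    calc _ ≤ ∫⁻ x, ‖F x - g x‖ₑ ∂(C • volume) := lintegral_mono' hTm le_rfl
      _ ≤ _ := by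
        rw [lintegral_smul_measure]
        exact mul_le_mul_right hg _
  have h2 : ∫⁻ x in A, ‖g (T x) - g x‖ₑ ≤ ε₁ := by
    calc _ ≤ ∫⁻ x in A, K.indicator (fun _ ↦ (η : ENNReal)) x := by
          refine setLIntegral_mono' hA fun x hx ↦ ?_
          have hd := hTd x hx
          by_cases hxK : x ∈ K
          · rw [indicator_of_mem hxK]
            have h3 := (hδ (a := T x) (b := x)
              (lt_of_le_of_lt (hd.trans (min_le_left _ _)) (by linarith))).le
            rw [dist_eq_norm] at h3
            rw [← ofReal_norm, ← ENNReal.ofReal_coe_nnreal]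
            exact ENNReal.ofReal_le_ofReal h3
          · rw [indicator_of_notMem hxK]
            have h4 : x ∉ tsupport g := fun h ↦ hxK (Metric.self_subset_cthickening _ h)
            have h5 : T x ∉ tsupport g := fun h ↦ hxK (by
              refine Metric.mem_cthickening_of_dist_le x (T x) _ _ h ?_
              rw [dist_comm]
              exact hd.trans (min_le_right _ _))
            simp [image_eq_zero_of_notMem_tsupport h4, image_eq_zero_of_notMem_tsupport h5]
      _ ≤ ∫⁻ x, K.indicator (fun _ ↦ (η : ENNReal)) x := setLIntegral_le_lintegral _ _
      _ ≤ ε₁ := by rw [lintegral_indicator_const hKc.measurableSet]; exact hη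
  calc ∫⁻ x in A, ‖F (T x) - F x‖ₑ
      ≤ ∫⁻ x in A, ‖F (T x) - g (T x)‖ₑ + (‖g (T x) - g x‖ₑ + ‖F x - g x‖ₑ) := by
        refine lintegral_mono fun x ↦ ?_
        calc ‖F (T x) - F x‖ₑ = ‖(F (T x) - g (T x)) + ((g (T x) - g x) - (F x - g x))‖ₑ := by
              congr 1; abel
          _ ≤ _ := (enorm_add_le _ _).trans (by gcongr; exact enorm_sub_le)
    _ ≤ C * ε₁ + (ε₁ + ε₁) := by
        have hm1 : AEMeasurable (fun x ↦ ‖g (T x) - g x‖ₑ) (volume.restrict A) := by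
          have : Measurable fun x ↦ ‖g (T x) - g x‖ₑ := by
            have h6 : StronglyMeasurable g :=
              hgc.stronglyMeasurable_of_hasCompactSupport hgs
            exact ((h6.comp_measurable hT).sub h6).enorm
          exact this.aemeasurable
        have hm2 : AEMeasurable (fun x ↦ ‖F x - g x‖ₑ) (volume.restrict A) :=
          (hF.aestronglyMeasurable.sub hgi.aestronglyMeasurable).enorm.restrict
        rw [lintegral_add_right' (fun x ↦ ‖F (T x) - g (T x)‖ₑ)
          (g := fun x ↦ ‖g (T x) - g x‖ₑ + ‖F x - g x‖ₑ) (hm1.add hm2),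
          lintegral_add_right' _ hm2]
        gcongr
        exact (setLIntegral_le_lintegral _ _).trans hg
    _ ≤ ε := by rw [← add_assoc]; exact hε₁'

/-- The error of the mollification is at most the average, with weight `φ`, of the L¹ errors of the
translations by vectors in the support of `φ`. -/
theorem lintegral_normed_convolution_sub_le {G : Type*} [NormedAddCommGroup G]
    [NormedSpace ℝ G] [CompleteSpace G] {F : EuclideanSpace ℝ (Fin m) → G} (hF : Integrable F)
    {ε : ENNReal} (hε : ε ≠ 0) :
    ∃ δ > 0, ∀ φ : ContDiffBump (0 : EuclideanSpace ℝ (Fin m)), φ.rOut ≤ δ →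
      ∫⁻ x, ‖(φ.normed volume ⋆[ContinuousLinearMap.lsmul ℝ ℝ, volume] F) x - F x‖ₑ ≤ ε := by
  obtain ⟨δ, hδ0, hδ⟩ := hF.exists_lintegral_comp_sub_le 1 hε
  refine ⟨δ, hδ0, fun φ hφ ↦ ?_⟩
  have hφi : Integrable (φ.normed volume) := φ.integrable_normed
  have hconv : ∀ᵐ x, ConvolutionExistsAt (φ.normed volume) F x
      (ContinuousLinearMap.lsmul ℝ ℝ) volume :=
    Eventually.of_forall fun x ↦
      φ.hasCompactSupport_normed.convolutionExists_left _ φ.continuous_normed hF.locallyIntegrable x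
  have hFsub : AEStronglyMeasurable
      (fun q : EuclideanSpace ℝ (Fin m) × EuclideanSpace ℝ (Fin m) ↦ F (q.1 - q.2))
      (volume.prod volume) :=
    hF.aestronglyMeasurable.comp_quasiMeasurePreserving
      (quasiMeasurePreserving_sub_of_right_invariant volume volume)
  calc _ ≤ ∫⁻ x, ∫⁻ t, ‖φ.normed volume t‖ₑ * ‖F (x - t) - F x‖ₑ := by
        refine lintegral_mono_ae ?_
        filter_upwards [hconv] with x hx
        have h1 : F x = ∫ t, φ.normed volume t • F x := by
          rw [integral_smul_const, φ.integral_normed, one_smul]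
        have h2 : (φ.normed volume ⋆[ContinuousLinearMap.lsmul ℝ ℝ, volume] F) x - F x
            = ∫ t, φ.normed volume t • (F (x - t) - F x) := by
          conv_lhs => rw [h1]
          rw [convolution_def, ← integral_sub]
          · simp [smul_sub]
          · exact hx
          · exact hφi.smul_const _
        rw [h2]
        refine (enorm_integral_le_lintegral_enorm _).trans (lintegral_mono fun t ↦ ?_)
        rw [enorm_smul]
    _ = ∫⁻ t, ∫⁻ x, ‖φ.normed volume t‖ₑ * ‖F (x - t) - F x‖ₑ := by
        rw [lintegral_lintegral_swap]
        exact (hφi.aestronglyMeasurable.enorm.comp_snd).mul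
          (hFsub.sub hF.aestronglyMeasurable.comp_fst).enorm
    _ ≤ ∫⁻ t, ‖φ.normed volume t‖ₑ * ε := by
        refine lintegral_mono fun t ↦ ?_
        by_cases ht : φ.normed volume t = 0
        · simp [ht]
        rw [lintegral_const_mul' _ _ (by simp)]
        gcongr
        have htm : t ∈ Function.support (φ.normed volume) := ht
        rw [φ.support_normed_eq, Metric.mem_ball, dist_zero_right] at htm
        have := hδ univ (fun x ↦ x - t) MeasurableSet.univ (by fun_prop)
          (by rw [restrict_univ, (measurePreserving_sub_right volume t).map_eq, one_smul])
          (fun x _ ↦ by simp; linarith)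
        simpa using this
    _ = ε := by
        rw [lintegral_mul_const'' _ hφi.aestronglyMeasurable.enorm]
        have : ∫⁻ t, ‖φ.normed volume t‖ₑ = 1 := by
          simp_rw [Real.enorm_of_nonneg (φ.nonneg_normed _)]
          rw [← ofReal_integral_eq_lintegral_ofReal hφi
            (Eventually.of_forall fun t ↦ φ.nonneg_normed t), φ.integral_normed]
          simp
        rw [this, one_mul]

theorem MeasureTheory.LocallyIntegrableOn.integrable_mul_of_tsupport_subset
    {U : Set (EuclideanSpace ℝ (Fin m))} {h g : EuclideanSpace ℝ (Fin m) → ℝ}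
    (hh : LocallyIntegrableOn h U) (hg : Continuous g) (hgc : HasCompactSupport g)
    (hgU : tsupport g ⊆ U) : Integrable (fun y ↦ h y * g y) := by
  have h1 : IntegrableOn h (tsupport g) := hh.integrableOn_compact_subset hgU hgc.isCompact
  obtain ⟨C, hC⟩ := hgc.exists_bound_of_continuous hg
  have h2 : IntegrableOn (fun y ↦ h y * g y) (tsupport g) := by
    have := Integrable.bdd_mul (c := C) h1 hg.aestronglyMeasurable (Eventually.of_forall hC)
    simpa [mul_comm, IntegrableOn] using this
  rwa [integrableOn_iff_integrable_of_support_subset] at h2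
  exact (Function.support_mul_subset_right h g).trans (subset_tsupport g)

theorem MeasureTheory.LocallyIntegrableOn.clm_apply_const {F G : Type*} [NormedAddCommGroup F] [NormedSpace ℝ F]
    [NormedAddCommGroup G] [NormedSpace ℝ G]
    {U : Set (EuclideanSpace ℝ (Fin m))} {w : EuclideanSpace ℝ (Fin m) → F →L[ℝ] G}
    (hw : LocallyIntegrableOn w U) (v : F) : LocallyIntegrableOn (fun y ↦ w y v) U := by
  intro x hx
  obtain ⟨t, ht, hti⟩ := hw x hx
  exact ⟨t, ht, (ContinuousLinearMap.apply ℝ G v).integrable_comp hti⟩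

theorem tendsto_integral_mul_of_tendsto_lintegral {ι : Type*} {l : Filter ι} [l.NeBot]
    {U : Set (EuclideanSpace ℝ (Fin m))} {h : EuclideanSpace ℝ (Fin m) → ℝ}
    {hs : ι → EuclideanSpace ℝ (Fin m) → ℝ} {g : EuclideanSpace ℝ (Fin m) → ℝ}
    (hh : LocallyIntegrableOn h U) (hhs : ∀ᶠ i in l, LocallyIntegrableOn (hs i) U)
    (hg : Continuous g) (hgc : HasCompactSupport g) (hgU : tsupport g ⊆ U)
    (hlim : Tendsto (fun i ↦ ∫⁻ y in tsupport g, ‖hs i y - h y‖ₑ) l (𝓝 0)) :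
    Tendsto (fun i ↦ ∫ y, hs i y * g y) l (𝓝 (∫ y, h y * g y)) := by
  obtain ⟨C, hC⟩ := hgc.exists_bound_of_continuous hg
  refine tendsto_integral_of_L1 _ (hh.integrable_mul_of_tsupport_subset hg hgc hgU).aestronglyMeasurable ?_ ?_
  · filter_upwards [hhs] with i hi using hi.integrable_mul_of_tsupport_subset hg hgc hgU
  have hlim' := ENNReal.Tendsto.const_mul (a := ENNReal.ofReal C) hlim (Or.inr (by simp))
  rw [mul_zero] at hlim'
  refine tendsto_of_tendsto_of_tendsto_of_le_of_le tendsto_const_nhds hlim' (fun _ ↦ zero_le)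
    fun i ↦ ?_
  rw [← lintegral_const_mul' _ _ (by simp),
    ← lintegral_indicator (isClosed_tsupport g).measurableSet]
  refine lintegral_mono fun y ↦ ?_
  by_cases hy : y ∈ tsupport g
  · rw [indicator_of_mem hy, ← sub_mul, enorm_mul, mul_comm]
    gcongr
    rw [← ofReal_norm]
    exact ENNReal.ofReal_le_ofReal (hC y)
  · simp [image_eq_zero_of_notMem_tsupport hy]

/-- Both sides of the integration by parts formula are continuous for L¹ convergence on the compact
support of the test function. All weak differentials of limits below are obtained in this way. -/
theorem HasWeakFDerivOn.of_tendsto {ι : Type*} {l : Filter ι} [l.NeBot]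
    {U : Set (EuclideanSpace ℝ (Fin m))} {h : EuclideanSpace ℝ (Fin m) → ℝ}
    {w : EuclideanSpace ℝ (Fin m) → EuclideanSpace ℝ (Fin m) →L[ℝ] ℝ}
    {hs : ι → EuclideanSpace ℝ (Fin m) → ℝ}
    {ws : ι → EuclideanSpace ℝ (Fin m) → EuclideanSpace ℝ (Fin m) →L[ℝ] ℝ}
    (hhw : ∀ᶠ i in l, HasWeakFDerivOn U (hs i) (ws i))
    (hh : LocallyIntegrableOn h U) (hw : LocallyIntegrableOn w U)
    (hlimh : ∀ K ⊆ U, IsCompact K → Tendsto (fun i ↦ ∫⁻ y in K, ‖hs i y - h y‖ₑ) l (𝓝 0))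
    (hlimw : ∀ K ⊆ U, IsCompact K → Tendsto (fun i ↦ ∫⁻ y in K, ‖ws i y - w y‖ₑ) l (𝓝 0)) :
    HasWeakFDerivOn U h w := by
  refine ⟨hh, hw, fun ψ hψ hψc hψU v ↦ ?_⟩
  have hd : Continuous fun y ↦ fderiv ℝ ψ y v := by
    have := hψ.continuous_fderiv (by simp)
    fun_prop
  have hdc : HasCompactSupport fun y ↦ fderiv ℝ ψ y v :=
    hψc.of_isClosed_subset (isClosed_tsupport _) (tsupport_fderiv_apply_subset ℝ v)
  have hdU := (tsupport_fderiv_apply_subset (f := ψ) ℝ v).trans hψU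
  have h1 := tendsto_integral_mul_of_tendsto_lintegral hh (hhw.mono fun i hi ↦ hi.1) hd hdc hdU
    (hlimh _ hdU hdc.isCompact)
  have h2 := tendsto_integral_mul_of_tendsto_lintegral (hs := fun i y ↦ ws i y v)
    (hw.clm_apply_const v)
    (hhw.mono fun i hi ↦ hi.2.1.clm_apply_const v) hψ.continuous hψc hψU (by
      have := ENNReal.Tendsto.const_mul (a := ‖v‖ₑ) (hlimw _ hψU hψc.isCompact) (Or.inr (by simp))
      rw [mul_zero] at this
      refine tendsto_of_tendsto_of_tendsto_of_le_of_le tendsto_const_nhds this (fun _ ↦ zero_le)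
        fun i ↦ ?_
      rw [← lintegral_const_mul' _ _ (by simp)]
      refine lintegral_mono fun y ↦ ?_
      rw [mul_comm, ← _root_.sub_apply]
      exact (ws i y - w y).le_opENorm v)
  refine tendsto_nhds_unique h1 ((h2.neg).congr' ?_)
  filter_upwards [hhw] with i hi
  rw [hi.2.2 ψ hψ hψc hψU v]

theorem MeasureTheory.LocallyIntegrableOn.congr_ae_restrict {G : Type*} [NormedAddCommGroup G]
    {U : Set (EuclideanSpace ℝ (Fin m))} {f g : EuclideanSpace ℝ (Fin m) → G}
    (hf : LocallyIntegrableOn f U) (hU : IsOpen U) (hfg : f =ᵐ[volume.restrict U] g) :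
    LocallyIntegrableOn g U := by
  rw [locallyIntegrableOn_iff hU.isLocallyClosed] at hf ⊢
  intro K hKU hK
  exact (hf K hKU hK).congr (ae_restrict_of_ae_restrict_of_subset hKU hfg)

theorem HasWeakFDerivOn.congr_ae {U : Set (EuclideanSpace ℝ (Fin m))} (hU : IsOpen U)
    {h h' : EuclideanSpace ℝ (Fin m) → ℝ}
    {w w' : EuclideanSpace ℝ (Fin m) → EuclideanSpace ℝ (Fin m) →L[ℝ] ℝ}
    (hw : HasWeakFDerivOn U h w) (hh' : h =ᵐ[volume.restrict U] h')
    (hw' : w =ᵐ[volume.restrict U] w') : HasWeakFDerivOn U h' w' := by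
  refine ⟨hw.1.congr_ae_restrict hU hh', hw.2.1.congr_ae_restrict hU hw',
    fun ψ hψ hψc hψU v ↦ ?_⟩
  rw [ae_eq_restrict_iff_indicator_ae_eq hU.measurableSet] at hh' hw'
  have h1 : ∫ y, h' y * fderiv ℝ ψ y v = ∫ y, h y * fderiv ℝ ψ y v := by
    refine integral_congr_ae ?_
    filter_upwards [hh'] with y hy
    by_cases hyU : y ∈ U
    · simp only [indicator_of_mem hyU] at hy
      rw [hy]
    · have : fderiv ℝ ψ y v = 0 := image_eq_zero_of_notMem_tsupport
        (f := fun y ↦ fderiv ℝ ψ y v) fun h ↦ hyU (hψU (tsupport_fderiv_apply_subset ℝ v h))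
      simp [this]
  have h2 : ∫ y, w' y v * ψ y = ∫ y, w y v * ψ y := by
    refine integral_congr_ae ?_
    filter_upwards [hw'] with y hy
    by_cases hyU : y ∈ U
    · simp only [indicator_of_mem hyU] at hy
      rw [hy]
    · simp [image_eq_zero_of_notMem_tsupport fun h ↦ hyU (hψU h)]
  rw [h1, h2, hw.2.2 ψ hψ hψc hψU v]

/-- Rademacher's theorem, together with integration by parts for Lipschitz functions. -/
theorem LipschitzWith.hasWeakFDerivOn {g : EuclideanSpace ℝ (Fin m) → ℝ} {C : ℝ≥0}
    (hg : LipschitzWith C g) (U : Set (EuclideanSpace ℝ (Fin m))) :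
    HasWeakFDerivOn U g (fderiv ℝ g) := by
  have h1 : LocallyIntegrable (fderiv ℝ g) volume := by
    refine LocallyIntegrable.mono (f := fun _ ↦ (C : ℝ)) (locallyIntegrable_const _)
      (measurable_fderiv ℝ g).aestronglyMeasurable (Eventually.of_forall fun x ↦ ?_)
    simpa using norm_fderiv_le_of_lipschitz ℝ hg
  refine ⟨(hg.continuous.locallyIntegrable).locallyIntegrableOn U, h1.locallyIntegrableOn U,
    fun ψ hψ hψc hψU v ↦ ?_⟩
  obtain ⟨D, hD⟩ := hψ.lipschitzWith_of_hasCompactSupport hψc (by simp)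
  have h2 := integral_lineDeriv_mul_eq (μ := volume) hg hD hψc v
  have h3 : ∫ y, fderiv ℝ g y v * ψ y = ∫ y, lineDeriv ℝ g y v * ψ y := by
    refine integral_congr_ae ?_
    filter_upwards [hg.ae_differentiableAt] with y hy
    rw [hy.lineDeriv_eq_fderiv]
  have h4 : ∀ y, lineDeriv ℝ ψ y (-v) = - fderiv ℝ ψ y v := fun y ↦ by
    rw [((hψ.differentiable (by simp)) y).lineDeriv_eq_fderiv, map_neg]
  rw [h3, h2, ← integral_neg]
  refine integral_congr_ae (Eventually.of_forall fun y ↦ ?_)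
  simp only [h4]
  ring

end WeakDerivatives

/-! ### Smooth approximation, locality and the chain rule -/

section WeakDerivativesComp

open scoped NNReal Convolution

variable {m : ℕ}

theorem MeasureTheory.IntegrableOn.indicator_of_measurableSet {G : Type*} [NormedAddCommGroup G]
    {f : EuclideanSpace ℝ (Fin m) → G} {K : Set (EuclideanSpace ℝ (Fin m))}
    (hf : IntegrableOn f K) (hK : MeasurableSet K) : Integrable (K.indicator f) :=
  hf.integrable_indicator hK

/-- Mollification commutes with weak differentiation: the derivative of the convolution falls on the
kernel, and near `K` the translated kernels are admissible test functions. -/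
theorem HasWeakFDerivOn.exists_smooth_approx {U K : Set (EuclideanSpace ℝ (Fin m))}
    {h : EuclideanSpace ℝ (Fin m) → ℝ}
    {w : EuclideanSpace ℝ (Fin m) → EuclideanSpace ℝ (Fin m) →L[ℝ] ℝ}
    (hw : HasWeakFDerivOn U h w) (hU : IsOpen U) (hK : IsCompact K) (hKU : K ⊆ U) {ε : ENNReal}
    (hε : ε ≠ 0) :
    ∃ g : EuclideanSpace ℝ (Fin m) → ℝ, ContDiff ℝ ∞ g ∧ HasCompactSupport g ∧
      ∫⁻ y in K, ‖g y - h y‖ₑ ≤ ε ∧ ∫⁻ y in K, ‖fderiv ℝ g y - w y‖ₑ ≤ ε := by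
  obtain ⟨δ₀, hδ₀, hδ₀U⟩ := hK.exists_cthickening_subset_open hU hKU
  set K' := Metric.cthickening δ₀ K
  have hK' : IsCompact K' := hK.cthickening
  have hKK' : K ⊆ K' := Metric.self_subset_cthickening _
  -- Truncation to the thickening makes both functions integrable on the whole space. At points of
  -- `K` the mollifiers, of radius at most `δ₀`, do not see it.
  set H := K'.indicator h
  set W := K'.indicator w
  have hH : Integrable H :=
    (hw.1.integrableOn_compact_subset hδ₀U hK').integrable_indicator hK'.measurableSet
  have hwi : IntegrableOn w K' := hw.2.1.integrableOn_compact_subset hδ₀U hK'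
  have hW : Integrable W := hwi.indicator_of_measurableSet hK'.measurableSet
  obtain ⟨δ₁, hδ₁, h1⟩ := lintegral_normed_convolution_sub_le hH hε
  obtain ⟨δ₂, hδ₂, h2⟩ := lintegral_normed_convolution_sub_le hW hε
  set δ := min δ₀ (min δ₁ δ₂)
  have hδ : 0 < δ := by positivity
  let φ : ContDiffBump (0 : EuclideanSpace ℝ (Fin m)) := ⟨δ / 2, δ, by positivity, by linarith⟩
  have hφ0 : φ.rOut ≤ δ₀ := min_le_left _ _
  have hφ1 : φ.rOut ≤ δ₁ := (min_le_right _ _).trans (min_le_left _ _)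
  have hφ2 : φ.rOut ≤ δ₂ := (min_le_right _ _).trans (min_le_right _ _)
  set g := (φ.normed volume ⋆[ContinuousLinearMap.lsmul ℝ ℝ, volume] H)
  have hφs : ContDiff ℝ ∞ (φ.normed volume) := φ.contDiff_normed
  have hgs : ContDiff ℝ ∞ g :=
    φ.hasCompactSupport_normed.contDiff_convolution_left _ hφs hH.locallyIntegrable
  have hHc : HasCompactSupport H := HasCompactSupport.of_support_subset_isCompact hK'
    support_indicator_subset
  refine ⟨g, hgs, φ.hasCompactSupport_normed.convolution _ hHc, ?_, ?_⟩
  · calc _ = ∫⁻ y in K, ‖g y - H y‖ₑ := setLIntegral_congr_fun hK.measurableSet fun y hy ↦ by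
          simp only [H, indicator_of_mem (hKK' hy)]
      _ ≤ _ := (setLIntegral_le_lintegral _ _).trans (h1 φ hφ1)
  · calc _ = ∫⁻ y in K,
          ‖(φ.normed volume ⋆[ContinuousLinearMap.lsmul ℝ ℝ, volume] W) y - W y‖ₑ := ?_
      _ ≤ _ := (setLIntegral_le_lintegral _ _).trans (h2 φ hφ2)
    refine setLIntegral_congr_fun hK.measurableSet fun x hx ↦ ?_
    simp only [W, indicator_of_mem (hKK' hx)]
    congr 2
    ext v
    have hd := φ.hasCompactSupport_normed.hasFDerivAt_convolution_left
      (ContinuousLinearMap.lsmul ℝ ℝ) (μ := volume)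
      (hφs.of_le (by simp)) hH.locallyIntegrable x
    rw [hd.fderiv, convolution_eq_swap, convolution_eq_swap]
    have hi1 : ConvolutionExistsAt (fderiv ℝ (φ.normed volume)) H x
        ((ContinuousLinearMap.lsmul ℝ ℝ).precompL (EuclideanSpace ℝ (Fin m))) volume :=
      (φ.hasCompactSupport_normed.fderiv ℝ).convolutionExists_left _
        (hφs.continuous_fderiv (by simp)) hH.locallyIntegrable x
    have hi2 : ConvolutionExistsAt (φ.normed volume) W x
        (ContinuousLinearMap.lsmul ℝ ℝ) volume :=
      φ.hasCompactSupport_normed.convolutionExists_left _ φ.continuous_normed hW.locallyIntegrable x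
    rw [ContinuousLinearMap.integral_apply hi1.integrable_swap,
      ContinuousLinearMap.integral_apply hi2.integrable_swap]
    -- The test function for the point `x ∈ K`: its support is within `δ₀` of `x`, hence in `U`.
    set ψ : EuclideanSpace ℝ (Fin m) → ℝ := fun t ↦ φ.normed volume (x - t) with hψ
    have hψs : ContDiff ℝ ∞ ψ := hφs.comp (by fun_prop)
    have hψsupp : tsupport ψ ⊆ K' := by
      refine closure_minimal (fun t ht ↦ ?_) Metric.isClosed_cthickening
      have h3 : x - t ∈ Function.support (φ.normed volume) := ht
      rw [φ.support_normed_eq, Metric.mem_ball, dist_zero_right] at h3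
      refine Metric.mem_cthickening_of_dist_le t x _ _ hx ?_
      rw [dist_comm, dist_eq_norm]
      exact h3.le.trans hφ0
    have hψc : HasCompactSupport ψ := hK'.of_isClosed_subset (isClosed_tsupport _) hψsupp
    have hmain := hw.2.2 ψ hψs hψc (hψsupp.trans hδ₀U) v
    have hfd : ∀ t, fderiv ℝ ψ t v = - fderiv ℝ (φ.normed volume) (x - t) v := fun t ↦ by
      have h4 : HasFDerivAt (φ.normed volume) (fderiv ℝ (φ.normed volume) (x - t)) (x - t) :=
        (hφs.differentiable (by simp) _).hasFDerivAt
      have h5 := h4.comp t ((hasFDerivAt_id t).const_sub x)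
      rw [show ψ = φ.normed volume ∘ fun y ↦ x - y from rfl]
      rw [HasFDerivAt.fderiv h5]
      simp
    have e1 : ∫ t, ((((ContinuousLinearMap.lsmul ℝ ℝ).precompL (EuclideanSpace ℝ (Fin m)))
        (fderiv ℝ (φ.normed volume) (x - t))) (H t)) v = - ∫ t, h t * fderiv ℝ ψ t v := by
      rw [← integral_neg]
      refine integral_congr_ae (Eventually.of_forall fun t ↦ ?_)
      simp only [hfd]
      by_cases ht : t ∈ K'
      · simp [H, indicator_of_mem ht, ContinuousLinearMap.precompL_apply, mul_comm]
      · have h6 : fderiv ℝ ψ t v = 0 := image_eq_zero_of_notMem_tsupport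
          (f := fun y ↦ fderiv ℝ ψ y v) fun h ↦ ht (hψsupp (tsupport_fderiv_apply_subset ℝ v h))
        rw [hfd] at h6
        simp [H, indicator_of_notMem ht, neg_eq_zero.1 h6]
    have e2 : ∫ t, ((ContinuousLinearMap.lsmul ℝ ℝ) (φ.normed volume (x - t)) (W t)) v
        = ∫ t, w t v * ψ t := by
      refine integral_congr_ae (Eventually.of_forall fun t ↦ ?_)
      by_cases ht : t ∈ K'
      · simp [W, indicator_of_mem ht, hψ, mul_comm]
      · have h6 : ψ t = 0 := image_eq_zero_of_notMem_tsupport fun h ↦ ht (hψsupp h)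
        simp [W, indicator_of_notMem ht, h6]
    rw [e1, e2, hmain, neg_neg]

/-- A smooth partition of unity on the compact support splits each test function into finitely many
that are supported in the given neighbourhoods. -/
theorem HasWeakFDerivOn.of_locally {U : Set (EuclideanSpace ℝ (Fin m))}
    {h : EuclideanSpace ℝ (Fin m) → ℝ}
    {w : EuclideanSpace ℝ (Fin m) → EuclideanSpace ℝ (Fin m) →L[ℝ] ℝ}
    (H : ∀ x ∈ U, ∃ V ∈ 𝓝 x, HasWeakFDerivOn V h w) : HasWeakFDerivOn U h w := by
  have hat : ∀ {G : Type} [NormedAddCommGroup G] {f : EuclideanSpace ℝ (Fin m) → G} {V}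
      {x : EuclideanSpace ℝ (Fin m)}, V ∈ 𝓝 x → LocallyIntegrableOn f V →
      IntegrableAtFilter f (𝓝[U] x) := fun {G} _ {f V x} hV hf ↦ by
    have := hf x (mem_of_mem_nhds hV)
    rw [nhdsWithin_eq_nhds.2 hV] at this
    exact this.filter_mono nhdsWithin_le_nhds
  refine ⟨fun x hx ↦ ?_, fun x hx ↦ ?_, fun ψ hψ hψc hψU v ↦ ?_⟩
  · obtain ⟨V, hV, hw⟩ := H x hx
    exact hat hV hw.1
  · obtain ⟨V, hV, hw⟩ := H x hx
    exact hat hV hw.2.1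
  choose! V hV hVw using H
  obtain ⟨ρ, hρ⟩ := SmoothPartitionOfUnity.exists_isSubordinate
    𝓘(ℝ, EuclideanSpace ℝ (Fin m)) (isClosed_tsupport ψ) (fun i : tsupport ψ ↦ interior (V i))
    (fun i ↦ isOpen_interior) (fun x hx ↦ mem_iUnion.2 ⟨⟨x, hx⟩,
      mem_interior_iff_mem_nhds.2 (hV x (hψU hx))⟩)
  have hfin := ρ.locallyFinite.finite_nonempty_inter_compact hψc.isCompact
  set s := hfin.toFinset
  have hρs : ∀ i, ContDiff ℝ ∞ (ρ i) := fun i ↦ (ρ i).contMDiff.contDiff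
  have hsum : ∀ y, ψ y = ∑ i ∈ s, ρ i y * ψ y := fun y ↦ by
    by_cases hy : y ∈ tsupport ψ
    · rw [← Finset.sum_mul]
      have h1 := ρ.sum_eq_one hy
      rw [finsum_eq_sum_of_support_subset (s := s)] at h1
      · rw [h1, one_mul]
      · intro i hi
        simp only [s, Finite.coe_toFinset]
        exact ⟨y, hi, hy⟩
    · simp [image_eq_zero_of_notMem_tsupport hy]
  have hψi : ∀ i, ContDiff ℝ ∞ fun y ↦ ρ i y * ψ y := fun i ↦ (hρs i).mul hψ
  have hsi : ∀ i : tsupport ψ, tsupport (fun y ↦ ρ i y * ψ y) ⊆ V i := fun i ↦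
    (tsupport_mul_subset_left (f := ρ i) (g := ψ)).trans ((hρ i).trans interior_subset)
  have hsc : ∀ i, HasCompactSupport fun y ↦ ρ i y * ψ y := fun i ↦ hψc.mul_left
  have hid : ∀ i : tsupport ψ, ∫ y, h y * fderiv ℝ (fun y ↦ ρ i y * ψ y) y v =
      - ∫ y, w y v * (ρ i y * ψ y) := fun i ↦
    (hVw i (hψU i.2)).2.2 _ (hψi i) (hsc i) (hsi i) v
  have hfd : ∀ y, fderiv ℝ ψ y v = ∑ i ∈ s, fderiv ℝ (fun y ↦ ρ i y * ψ y) y v := fun y ↦ by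
    conv_lhs => rw [show ψ = fun y ↦ ∑ i ∈ s, ρ i y * ψ y from funext hsum]
    rw [fderiv_fun_sum fun i _ ↦ (hψi i).differentiable (by simp) y]
    simp
  calc ∫ y, h y * fderiv ℝ ψ y v
      = ∫ y, ∑ i ∈ s, h y * fderiv ℝ (fun y ↦ ρ i y * ψ y) y v := by
        simp_rw [hfd, Finset.mul_sum]
    _ = ∑ i ∈ s, - ∫ y, w y v * (ρ i y * ψ y) := by
        rw [integral_finsetSum]
        · exact Finset.sum_congr rfl fun i _ ↦ hid i
        · intro i _
          refine (hVw i (hψU i.2)).1.integrable_mul_of_tsupport_subset ?_ ?_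
            ((tsupport_fderiv_apply_subset ℝ v).trans (hsi i))
          · have := (hψi i).continuous_fderiv (by simp)
            fun_prop
          · exact (hsc i).of_isClosed_subset (isClosed_tsupport _) (tsupport_fderiv_apply_subset ℝ v)
    _ = - ∫ y, w y v * ψ y := by
        rw [Finset.sum_neg_distrib, ← integral_finsetSum]
        · simp_rw [← Finset.mul_sum, ← hsum]
        · intro i _
          exact ((hVw i (hψU i.2)).2.1.clm_apply_const v).integrable_mul_of_tsupport_subset
            (hψi i).continuous (hsc i) (hsi i)

/-- The chain rule is clear for smooth `h`, since the composition is then locally Lipschitz. The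
volume condition bounds the L¹ norm of a composition with `φ` by that of the function, and so allows
smooth approximation of `h`. It also makes `w ∘ φ` insensitive to changes of `w` on null sets. -/
theorem HasWeakFDerivOn.comp {U U' : Set (EuclideanSpace ℝ (Fin m))}
    {h : EuclideanSpace ℝ (Fin m) → ℝ}
    {w : EuclideanSpace ℝ (Fin m) → EuclideanSpace ℝ (Fin m) →L[ℝ] ℝ}
    (hw : HasWeakFDerivOn U h w) (hU : IsOpen U)
    {φ : EuclideanSpace ℝ (Fin m) → EuclideanSpace ℝ (Fin m)} (hφ : MapsTo φ U' U)
    (hloc : ∀ x ∈ U', ∃ V ∈ 𝓝 x, ∃ L C : ℝ≥0, LipschitzOnWith L φ V ∧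
      ∀ S, volume (φ ⁻¹' S ∩ V) ≤ C * volume S) :
    HasWeakFDerivOn U' (fun y ↦ h (φ y)) (fun y ↦ (w (φ y)).comp (fderiv ℝ φ y)) := by
  refine HasWeakFDerivOn.of_locally fun x hx ↦ ?_
  obtain ⟨V, hV, L, C, hL, hC⟩ := hloc x hx
  obtain ⟨r', hr', hr'U⟩ := Metric.nhds_basis_closedBall.mem_iff.1 (hU.mem_nhds (hφ hx))
  set K := Metric.closedBall (φ x) r'
  have hK : IsCompact K := isCompact_closedBall _ _
  have hcont : ContinuousAt φ x := hL.continuousOn.continuousAt hV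
  obtain ⟨r, hr, hrV⟩ := Metric.nhds_basis_ball.mem_iff.1
    (inter_mem hV (hcont.preimage_mem_nhds (Metric.closedBall_mem_nhds _ hr')))
  set V' := Metric.ball x r
  have hV'o : IsOpen V' := Metric.isOpen_ball
  have hV'V : V' ⊆ V := fun y hy ↦ (hrV hy).1
  have hV'K : ∀ y ∈ V', φ y ∈ K := fun y hy ↦ (hrV hy).2
  have hL' := hL.mono hV'V
  refine ⟨V', Metric.ball_mem_nhds _ hr, ?_⟩
  -- A global Lipschitz extension, so that `g i ∘ φ'` is Lipschitz on the whole space.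
  obtain ⟨φ', hφ', hφφ'⟩ := hL'.extend_finite_dimension
  have hφm : AEMeasurable φ (volume.restrict V') := hL'.continuousOn.aemeasurable hV'o.measurableSet
  have hle : (volume.restrict V').map φ ≤ C • volume.restrict K := by
    refine Measure.le_iff.2 fun S hS ↦ ?_
    rw [Measure.map_apply_of_aemeasurable hφm hS, Measure.restrict_apply' hV'o.measurableSet,
      Measure.smul_apply, Measure.restrict_apply hS]
    refine le_trans (measure_mono ?_) (hC (S ∩ K))
    exact fun y hy ↦ ⟨⟨hy.1, hV'K y hy.2⟩, hV'V hy.2⟩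
  have hac : (volume.restrict V').map φ ≪ volume.restrict K :=
    (Measure.absolutelyContinuous_of_le hle).trans (Measure.smul_absolutelyContinuous (c := C))
  have hlint : ∀ {G : Type} [NormedAddCommGroup G] {f : EuclideanSpace ℝ (Fin m) → G},
      AEStronglyMeasurable f (volume.restrict K) →
      ∫⁻ y in V', ‖f (φ y)‖ₑ ≤ C * ∫⁻ y in K, ‖f y‖ₑ := fun {G} _ {f} hf ↦ by
    rw [← lintegral_map' (f := fun z ↦ ‖f z‖ₑ) (hf.mono_ac hac).enorm hφm]
    refine (lintegral_mono' hle le_rfl).trans ?_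
    rw [lintegral_smul_measure]
    rfl
  have hhK : IntegrableOn h K := hw.1.integrableOn_compact_subset hr'U hK
  have hwK : IntegrableOn w K := hw.2.1.integrableOn_compact_subset hr'U hK
  have hdφ : ∀ y ∈ V', ‖fderiv ℝ φ y‖ₑ ≤ L := fun y hy ↦ by
    have := norm_fderiv_le_of_lipschitzOn ℝ (hV'o.mem_nhds hy) hL'
    rw [← ofReal_norm, ← ENNReal.ofReal_coe_nnreal]
    exact ENNReal.ofReal_le_ofReal this
  have hcomp : ∀ (A : EuclideanSpace ℝ (Fin m) →L[ℝ] ℝ), ∀ y ∈ V',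
      ‖A.comp (fderiv ℝ φ y)‖ₑ ≤ L * ‖A‖ₑ := fun A y hy ↦ by
    rw [mul_comm]
    refine le_trans ?_ (mul_le_mul_right (hdφ y hy) _)
    rw [← ofReal_norm, ← ofReal_norm, ← ofReal_norm, ← ENNReal.ofReal_mul (norm_nonneg _)]
    exact ENNReal.ofReal_le_ofReal (ContinuousLinearMap.opNorm_comp_le _ _)
  have hcm : ∀ {f : EuclideanSpace ℝ (Fin m) → EuclideanSpace ℝ (Fin m) →L[ℝ] ℝ},
      AEStronglyMeasurable f (volume.restrict K) →
      AEStronglyMeasurable (fun y ↦ (f (φ y)).comp (fderiv ℝ φ y)) (volume.restrict V') :=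
    fun {f} hf ↦ by
    have h1 : AEStronglyMeasurable (fun y ↦ f (φ y)) (volume.restrict V') :=
      (hf.mono_ac hac).comp_aemeasurable hφm
    have h2 : AEStronglyMeasurable (fderiv ℝ φ) (volume.restrict V') :=
      (measurable_fderiv ℝ φ).aestronglyMeasurable
    exact (ContinuousLinearMap.compL ℝ (EuclideanSpace ℝ (Fin m)) (EuclideanSpace ℝ (Fin m))
      ℝ).aestronglyMeasurable_comp₂ h1 h2
  have hi1 : IntegrableOn (fun y ↦ h (φ y)) V' := by
    refine ⟨(hhK.1.mono_ac hac).comp_aemeasurable hφm, (hlint hhK.1).trans_lt ?_⟩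
    exact ENNReal.mul_lt_top (by simp) hhK.2
  have hi2 : IntegrableOn (fun y ↦ (w (φ y)).comp (fderiv ℝ φ y)) V' := by
    refine ⟨hcm hwK.1, ?_⟩
    calc _ ≤ ∫⁻ y in V', L * ‖w (φ y)‖ₑ :=
          setLIntegral_mono' hV'o.measurableSet fun y hy ↦ hcomp _ y hy
      _ ≤ L * (C * ∫⁻ y in K, ‖w y‖ₑ) := by
          rw [lintegral_const_mul' _ _ (by simp)]
          exact mul_le_mul_right (hlint hwK.1) _
      _ < ⊤ := ENNReal.mul_lt_top (by simp) (ENNReal.mul_lt_top (by simp) hwK.2)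
  have happ : ∀ i : ℕ, ∃ g : EuclideanSpace ℝ (Fin m) → ℝ, ContDiff ℝ ∞ g ∧ HasCompactSupport g ∧
      ∫⁻ y in K, ‖g y - h y‖ₑ ≤ (i : ENNReal)⁻¹ ∧
      ∫⁻ y in K, ‖fderiv ℝ g y - w y‖ₑ ≤ (i : ENNReal)⁻¹ := fun i ↦
    hw.exists_smooth_approx hU hK hr'U (by simp)
  choose g hgs hgc hgh hgw using happ
  have hinv : Tendsto (fun i : ℕ ↦ (C : ENNReal) * (i : ENNReal)⁻¹) atTop (𝓝 0) := by
    have := ENNReal.Tendsto.const_mul (a := (C : ENNReal)) ENNReal.tendsto_inv_nat_nhds_zero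
      (Or.inr (by simp))
    rwa [mul_zero] at this
  have hinv' : Tendsto (fun i : ℕ ↦ (L : ENNReal) * (C * (i : ENNReal)⁻¹)) atTop (𝓝 0) := by
    have := ENNReal.Tendsto.const_mul (a := (L : ENNReal)) hinv (Or.inr (by simp))
    rwa [mul_zero] at this
  refine HasWeakFDerivOn.of_tendsto (l := atTop) (hs := fun i y ↦ g i (φ y))
    (ws := fun i y ↦ (fderiv ℝ (g i) (φ y)).comp (fderiv ℝ φ y)) (Eventually.of_forall fun i ↦ ?_)
    hi1.locallyIntegrableOn hi2.locallyIntegrableOn (fun K₀ hK₀ _ ↦ ?_) (fun K₀ hK₀ hK₀c ↦ ?_)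
  · obtain ⟨D, hD⟩ := (hgs i).lipschitzWith_of_hasCompactSupport (hgc i) (by simp)
    refine ((hD.comp hφ').hasWeakFDerivOn V').congr_ae hV'o ?_ ?_
    · filter_upwards [ae_restrict_mem hV'o.measurableSet] with y hy
      simp [hφφ' hy]
    · filter_upwards [ae_restrict_mem hV'o.measurableSet,
        ae_restrict_of_ae hφ'.ae_differentiableAt] with y hy hdy
      have he : fderiv ℝ φ' y = fderiv ℝ φ y :=
        Filter.EventuallyEq.fderiv_eq (hφφ'.symm.eventuallyEq_of_mem (hV'o.mem_nhds hy))
      rw [fderiv_comp _ ((hgs i).differentiable (by simp) _) hdy, he, hφφ' hy]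
  · refine tendsto_of_tendsto_of_tendsto_of_le_of_le tendsto_const_nhds hinv (fun _ ↦ zero_le)
      fun i ↦ ?_
    calc _ ≤ ∫⁻ y in V', ‖g i (φ y) - h (φ y)‖ₑ := lintegral_mono_set hK₀
      _ ≤ C * ∫⁻ y in K, ‖g i y - h y‖ₑ := hlint (f := fun y ↦ g i y - h y)
          ((hgs i).continuous.aestronglyMeasurable.sub hhK.1)
      _ ≤ _ := mul_le_mul_right (hgh i) _
  · refine tendsto_of_tendsto_of_tendsto_of_le_of_le tendsto_const_nhds hinv' (fun _ ↦ zero_le)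
      fun i ↦ ?_
    calc _ ≤ ∫⁻ y in V', L * ‖fderiv ℝ (g i) (φ y) - w (φ y)‖ₑ := by
          refine (setLIntegral_mono' hK₀c.measurableSet fun y hy ↦ ?_).trans (lintegral_mono_set hK₀)
          rw [← ContinuousLinearMap.sub_comp]
          exact hcomp _ y (hK₀ hy)
      _ ≤ L * (C * ∫⁻ y in K, ‖fderiv ℝ (g i) y - w y‖ₑ) := by
          rw [lintegral_const_mul' _ _ (by simp)]
          exact mul_le_mul_right (hlint (f := fun y ↦ fderiv ℝ (g i) y - w y)
            (((hgs i).continuous_fderiv (by simp)).aestronglyMeasurable.sub hwK.1)) _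
      _ ≤ _ := by gcongr; exact hgw i

end WeakDerivativesComp

/-! ### Charts of Riemannian manifolds are locally bilipschitz -/

section RiemannianCharts

open scoped NNReal

variable {m n : ℕ} {M : Type*} [EMetricSpace M] [ChartedSpace (EuclideanSpace ℝ (Fin m)) M]
  {N : Type*} [EMetricSpace N] [ChartedSpace (EuclideanSpace ℝ (Fin n)) N]

/-- The norm at `x` of a tangent vector, given in the model space. -/
noncomputable def tangentENorm [RiemannianBundle (fun x : M ↦ TangentSpace (𝓡 m) x)] (x : M)
    (v : EuclideanSpace ℝ (Fin m)) : ENNReal :=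
  @enorm (TangentSpace (𝓡 m) x) _ v

/-- The differential of a map between manifolds, in the model spaces. -/
noncomputable def mfderivModel (m n : ℕ) {M : Type*} [TopologicalSpace M]
    [ChartedSpace (EuclideanSpace ℝ (Fin m)) M] {N : Type*} [TopologicalSpace N]
    [ChartedSpace (EuclideanSpace ℝ (Fin n)) N] (f : M → N) (x : M) :
    EuclideanSpace ℝ (Fin m) →L[ℝ] EuclideanSpace ℝ (Fin n) :=
  mfderiv (𝓡 m) (𝓡 n) f x

/-- The differential of a real function on a manifold, on the model space. -/
noncomputable def mfderivReal (m : ℕ) {M : Type*} [TopologicalSpace M]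
    [ChartedSpace (EuclideanSpace ℝ (Fin m)) M] (f : M → ℝ) (x : M) : EuclideanSpace ℝ (Fin m) →L[ℝ] ℝ :=
  mfderiv (𝓡 m) 𝓘(ℝ, ℝ) f x

/-- Distances in `Y` are infima of lengths, and `f` stretches velocities in `O` by `C` at most. -/
theorem edist_comp_le_pathELength {E H E' H' X Y : Type*} [NormedAddCommGroup E] [NormedSpace ℝ E]
    [TopologicalSpace H] {I : ModelWithCorners ℝ E H} [NormedAddCommGroup E'] [NormedSpace ℝ E']
    [TopologicalSpace H'] {J : ModelWithCorners ℝ E' H'} [TopologicalSpace X] [ChartedSpace H X]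
    [∀ x : X, ENorm (TangentSpace I x)] [EMetricSpace Y] [ChartedSpace H' Y]
    [RiemannianBundle (fun y : Y ↦ TangentSpace J y)] [IsRiemannianManifold J Y]
    {f : X → Y} {O : Set X} (hO : IsOpen O) (hf : ContMDiffOn I J 1 f O) {C : ℝ≥0}
    (hC : ∀ x ∈ O, ∀ v : TangentSpace I x, ‖mfderiv I J f x v‖ₑ ≤ C * ‖v‖ₑ)
    {γ : ℝ → X} (hγ : ContMDiffOn 𝓘(ℝ, ℝ) I 1 γ (Icc 0 1)) (hγO : MapsTo γ (Icc 0 1) O) :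
    edist (f (γ 0)) (f (γ 1)) ≤ C * Manifold.pathELength I γ 0 1 := by
  rw [IsRiemannianManifold.out (I := J)]
  refine (Manifold.riemannianEDist_le_pathELength (γ := f ∘ γ) (hf.comp hγ hγO) rfl rfl zero_le_one).trans ?_
  rw [Manifold.pathELength_eq_lintegral_mfderivWithin_Icc,
    Manifold.pathELength_eq_lintegral_mfderivWithin_Icc,
    ← lintegral_const_mul' _ _ ENNReal.coe_ne_top]
  refine setLIntegral_mono' measurableSet_Icc fun t ht ↦ ?_
  have h1 : mfderivWithin 𝓘(ℝ, ℝ) J (f ∘ γ) (Icc 0 1) t =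
      (mfderiv I J f (γ t)).comp (mfderivWithin 𝓘(ℝ, ℝ) I γ (Icc 0 1) t) := by
    refine mfderiv_comp_mfderivWithin t ?_ (hγ.mdifferentiableOn one_ne_zero t ht) ?_
    · exact ((hf _ (hγO ht)).contMDiffAt (hO.mem_nhds (hγO ht))).mdifferentiableAt one_ne_zero
    · rw [uniqueMDiffWithinAt_iff_uniqueDiffWithinAt]
      exact uniqueDiffOn_Icc zero_lt_one t ht
  rw [h1]
  exact hC _ (hγO ht) _

variable [IsManifold (𝓡 m) ∞ M] [RiemannianBundle (fun x : M ↦ TangentSpace (𝓡 m) x)]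
  [IsContMDiffRiemannianBundle (𝓡 m) ∞ (EuclideanSpace ℝ (Fin m))
    (fun x : M ↦ TangentSpace (𝓡 m) x)]

theorem IsContMDiffRiemannianBundle.isContinuousRiemannianBundle :
    IsContinuousRiemannianBundle (EuclideanSpace ℝ (Fin m))
      (fun x : M ↦ TangentSpace (𝓡 m) x) := by
  obtain ⟨g, hg, hg'⟩ := IsContMDiffRiemannianBundle.exists_contMDiff (IB := 𝓡 m) (n := ∞)
    (F := EuclideanSpace ℝ (Fin m)) (E := fun x : M ↦ TangentSpace (𝓡 m) x)
  exact ⟨g, hg.continuous, hg'⟩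

/-- The differentials of the chart and of its inverse are the trivialization of the tangent bundle
and its inverse, which are locally bounded because the metric is continuous. -/
theorem exists_chartAt_bounds (x₀ : M) :
    ∃ C : ℝ≥0, ∃ W ∈ 𝓝 x₀, W ⊆ (chartAt (EuclideanSpace ℝ (Fin m)) x₀).source ∧
      ∀ y ∈ W, ∀ v : EuclideanSpace ℝ (Fin m),
        ‖mfderivModel m m (chartAt (EuclideanSpace ℝ (Fin m)) x₀) y v‖ₑ ≤ C * tangentENorm y v ∧
        tangentENorm y (mfderivModel m m (chartAt (EuclideanSpace ℝ (Fin m)) x₀).symm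
          (chartAt (EuclideanSpace ℝ (Fin m)) x₀ y) v) ≤ C * ‖v‖ₑ := by
  have := IsContMDiffRiemannianBundle.isContinuousRiemannianBundle (m := m) (M := M)
  obtain ⟨C₁, hC₁, h1⟩ := eventually_norm_trivializationAt_lt (EuclideanSpace ℝ (Fin m))
    (fun x : M ↦ TangentSpace (𝓡 m) x) x₀
  obtain ⟨C₂, hC₂, h2⟩ := eventually_norm_symmL_trivializationAt_lt (EuclideanSpace ℝ (Fin m))
    (fun x : M ↦ TangentSpace (𝓡 m) x) x₀
  refine ⟨(C₁ + C₂).toNNReal, _, inter_mem (inter_mem h1 h2) (chart_source_mem_nhds _ x₀),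
    inter_subset_right, fun y hy v ↦ ⟨?_, ?_⟩⟩
  · have h3 := ((trivializationAt (EuclideanSpace ℝ (Fin m)) (fun x : M ↦ TangentSpace (𝓡 m) x)
      x₀).continuousLinearMapAt ℝ y).le_opENorm v
    have h4 := TangentBundle.continuousLinearMapAt_trivializationAt (I := 𝓡 m) hy.2
    have h5 : (extChartAt (𝓡 m) x₀ : M → EuclideanSpace ℝ (Fin m)) =
      chartAt (EuclideanSpace ℝ (Fin m)) x₀ := by simp [mfld_simps]
    rw [h5] at h4
    have h6 : mfderivModel m m (chartAt (EuclideanSpace ℝ (Fin m)) x₀) y v =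
      ((trivializationAt (EuclideanSpace ℝ (Fin m)) (fun x : M ↦ TangentSpace (𝓡 m) x)
      x₀).continuousLinearMapAt ℝ y) v := by rw [h4]; rfl
    rw [h6]
    refine h3.trans ?_
    refine mul_le_mul_left ?_ _
    rw [← ofReal_norm]
    exact ENNReal.ofReal_le_ofReal (hy.1.1.le.trans (by linarith))
  · have h3 := ((trivializationAt (EuclideanSpace ℝ (Fin m)) (fun x : M ↦ TangentSpace (𝓡 m) x)
      x₀).symmL ℝ y).le_opENorm v
    have h4 := TangentBundle.symmL_trivializationAt (I := 𝓡 m) hy.2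
    have h5 : (extChartAt (𝓡 m) x₀ : M → EuclideanSpace ℝ (Fin m)) =
      chartAt (EuclideanSpace ℝ (Fin m)) x₀ := by simp [mfld_simps]
    have h5' : ((extChartAt (𝓡 m) x₀).symm : EuclideanSpace ℝ (Fin m) → M) =
      (chartAt (EuclideanSpace ℝ (Fin m)) x₀).symm := by simp [mfld_simps]
    rw [h5, h5', modelWithCornersSelf_coe, range_id, mfderivWithin_univ] at h4
    have h6 : tangentENorm y (mfderivModel m m (chartAt (EuclideanSpace ℝ (Fin m)) x₀).symm
          (chartAt (EuclideanSpace ℝ (Fin m)) x₀ y) v) =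
      ‖((trivializationAt (EuclideanSpace ℝ (Fin m)) (fun x : M ↦ TangentSpace (𝓡 m) x)
      x₀).symmL ℝ y) v‖ₑ := by rw [h4]; rfl
    rw [h6]
    refine h3.trans ?_
    refine mul_le_mul_left ?_ _
    rw [← ofReal_norm]
    exact ENNReal.ofReal_le_ofReal (hy.1.2.le.trans (by linarith))

/-- The bounds on the differentials are integrated along paths: along segments for the inverse
chart, and along nearly shortest paths of `M` for the chart. The latter stay in the neighbourhood
where the bounds hold because their ends are close to `x₀`. -/
theorem exists_bilipschitz_chartAt [IsRiemannianManifold (𝓡 m) M] (x₀ : M) :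
    ∃ δ > 0, ∃ C : ℝ≥0, 0 < C ∧
      Metric.closedBall (chartAt (EuclideanSpace ℝ (Fin m)) x₀ x₀) δ ⊆
        (chartAt (EuclideanSpace ℝ (Fin m)) x₀).target ∧
      (∀ y ∈ Metric.closedBall (chartAt (EuclideanSpace ℝ (Fin m)) x₀ x₀) δ,
        ∀ z ∈ Metric.closedBall (chartAt (EuclideanSpace ℝ (Fin m)) x₀ x₀) δ,
        edist ((chartAt (EuclideanSpace ℝ (Fin m)) x₀).symm y)
          ((chartAt (EuclideanSpace ℝ (Fin m)) x₀).symm z) ≤ C * edist y z ∧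
        edist y z ≤ C * edist ((chartAt (EuclideanSpace ℝ (Fin m)) x₀).symm y)
          ((chartAt (EuclideanSpace ℝ (Fin m)) x₀).symm z)) ∧
      ∀ y ∈ Metric.closedBall (chartAt (EuclideanSpace ℝ (Fin m)) x₀ x₀) δ,
        ∀ v : EuclideanSpace ℝ (Fin m),
        tangentENorm ((chartAt (EuclideanSpace ℝ (Fin m)) x₀).symm y)
          (mfderivModel m m (chartAt (EuclideanSpace ℝ (Fin m)) x₀).symm y v) ≤ C * ‖v‖ₑ ∧
        ‖mfderivModel m m (chartAt (EuclideanSpace ℝ (Fin m)) x₀)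
          ((chartAt (EuclideanSpace ℝ (Fin m)) x₀).symm y) v‖ₑ ≤
          C * tangentENorm ((chartAt (EuclideanSpace ℝ (Fin m)) x₀).symm y) v := by
  obtain ⟨C, W, hW, hWs, hC⟩ := exists_chartAt_bounds (m := m) x₀
  set e := chartAt (EuclideanSpace ℝ (Fin m)) x₀ with he
  obtain ⟨c, hc, hcW⟩ := EMetric.mem_nhds_iff.1 hW
  have hx₀ : x₀ ∈ e.source := mem_chart_source _ x₀
  -- A path of length less than 2d that starts within d of `x₀` stays within 3d ≤ c of it.
  obtain ⟨d, hd, hdt, hdc⟩ : ∃ d : ENNReal, 0 < d ∧ d ≠ ⊤ ∧ 3 * d ≤ c := by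
    refine ⟨min (c / 3) 1, lt_min (ENNReal.div_pos hc.ne' (by simp)) (by simp), by simp, ?_⟩
    exact (mul_le_mul_right (min_le_left _ _) _).trans ENNReal.mul_div_le
  have hdc' : d ≤ c := le_trans (by
    calc d = 1 * d := (one_mul _).symm
      _ ≤ 3 * d := by gcongr; norm_num) hdc
  have hnh : e.target ∩ e.symm ⁻¹' (Metric.eball x₀ d) ∈ 𝓝 (e x₀) := by
    refine inter_mem (e.open_target.mem_nhds (e.map_source hx₀)) ?_
    refine (e.continuousAt_symm (e.map_source hx₀)).preimage_mem_nhds ?_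
    rw [e.left_inv hx₀]
    exact Metric.eball_mem_nhds _ hd
  obtain ⟨δ, hδ, hδs⟩ := Metric.nhds_basis_closedBall.mem_iff.1 hnh
  have hsW : ∀ y ∈ Metric.closedBall (e x₀) δ, e.symm y ∈ W := fun y hy ↦
    hcW (Metric.eball_subset_eball hdc' (hδs hy).2)
  have hC' : ∀ y ∈ e.target, e.symm y ∈ W → ∀ v, tangentENorm (e.symm y)
      (mfderivModel m m e.symm y v) ≤ C * ‖v‖ₑ := fun y hy hyW v ↦ by
    have := (hC _ hyW v).2
    rwa [e.right_inv hy] at this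
  have hCpos : (C : ENNReal) ≤ (2 * C + 1 : ℝ≥0) := by
    exact_mod_cast (by linarith [C.2] : (C : ℝ) ≤ 2 * C + 1)
  refine ⟨δ, hδ, 2 * C + 1, by positivity, fun y hy ↦ (hδs hy).1, fun y hy z hz ↦ ⟨?_, ?_⟩,
    fun y hy v ↦ ⟨(hC' y (hδs hy).1 (hsW y hy) v).trans (by gcongr),
      (hC _ (hsW y hy) v).1.trans (by gcongr)⟩⟩
  · let O := e.target ∩ e.symm ⁻¹' (Metric.eball x₀ c)
    have hO : IsOpen O := e.isOpen_inter_preimage_symm Metric.isOpen_eball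
    have hcO : Metric.closedBall (e x₀) δ ⊆ O := fun y hy ↦ ⟨(hδs hy).1,
      Metric.eball_subset_eball hdc' (hδs hy).2⟩
    let η := ContinuousAffineMap.lineMap (R := ℝ) y z
    have hη : ContMDiffOn 𝓘(ℝ, ℝ) (𝓡 m) 1 η (Icc 0 1) := by
      apply ContMDiff.contMDiffOn
      rw [contMDiff_iff_contDiff]
      exact ContinuousAffineMap.contDiff _
    have hηO : MapsTo η (Icc 0 1) O := fun t ht ↦
      hcO ((convex_closedBall (e x₀) δ).lineMap_mem hy hz ht)
    have h1 := edist_comp_le_pathELength (J := 𝓡 m) (I := 𝓡 m) (f := e.symm) (C := C) (γ := η) hO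
      (((contMDiffOn_chart_symm (n := ∞) (x := x₀)).mono inter_subset_left).of_le (by simp))
      (fun y hy v ↦ by
        have := hC' y hy.1 (hcW hy.2) v
        rw [enorm_tangentSpace_vectorSpace]
        exact this) hη hηO
    have h2 : Manifold.pathELength (𝓡 m) η 0 1 = edist y z := by
      rw [← lintegral_fderiv_lineMap_eq_edist, Manifold.pathELength_eq_lintegral_mfderivWithin_Icc]
      refine setLIntegral_congr_fun measurableSet_Icc fun t ht ↦ ?_
      simp only [mfderivWithin_eq_fderivWithin, enorm_tangentSpace_vectorSpace]
      rfl
    rw [h2] at h1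
    simp only [η, ContinuousAffineMap.coe_lineMap_eq, AffineMap.lineMap_apply_zero,
      AffineMap.lineMap_apply_one] at h1
    exact h1.trans (by gcongr)
  · rcases eq_or_ne y z with rfl | hne
    · simp
    set D := edist (e.symm y) (e.symm z) with hD
    have hyz : D < 2 * d := by
      refine (edist_triangle_left _ _ x₀).trans_lt ?_
      have h1 := (hδs hy).2
      have h2 := (hδs hz).2
      simp only [mem_preimage, Metric.mem_eball'] at h1 h2
      rw [two_mul]
      exact ENNReal.add_lt_add h1 h2
    have hDt : D ≠ ⊤ := hyz.ne_top
    have hD0 : D ≠ 0 := by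
      rw [hD, Ne, edist_eq_zero]
      exact fun h ↦ hne (e.symm.injOn (hδs hy).1 (hδs hz).1 h)
    -- Length below 2D for the Lipschitz estimate, and below 2d in order to remain in the ball of
    -- radius `c`.
    have hr : D < min (2 * D) (2 * d) := by
      refine lt_min ?_ hyz
      rw [two_mul]
      exact ENNReal.lt_add_right hDt hD0
    obtain ⟨γ, hγ0, hγ1, hγ, hγr⟩ := Manifold.exists_lt_of_riemannianEDist_lt (I := 𝓡 m)
      (x := e.symm y) (y := e.symm z) (r := min (2 * D) (2 * d))
      (by rwa [← IsRiemannianManifold.out (I := 𝓡 m)])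
    have hγO : MapsTo γ (Icc 0 1) (Metric.eball x₀ c) := fun t ht ↦ by
      rw [Metric.mem_eball']
      have h1 := (hδs hy).2
      simp only [mem_preimage, Metric.mem_eball'] at h1
      have h2 : edist (γ 0) (γ t) < 2 * d := by
        rw [IsRiemannianManifold.out (I := 𝓡 m)]
        refine (Manifold.riemannianEDist_le_pathELength (hγ.mono (Icc_subset_Icc_right ht.2)) rfl rfl
          ht.1).trans_lt ?_
        exact ((Manifold.pathELength_mono le_rfl ht.2).trans_lt hγr).trans_le (min_le_right _ _)
      rw [hγ0] at h2
      refine (edist_triangle _ _ _).trans_lt ((ENNReal.add_lt_add h1 h2).trans_le ?_)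
      refine le_trans (le_of_eq ?_) hdc
      ring
    have h1 := edist_comp_le_pathELength (J := 𝓡 m) (I := 𝓡 m) (f := e) (C := C) (γ := γ)
      (Metric.isOpen_eball (x := x₀) (ε := c))
      (((contMDiffOn_chart (n := ∞) (x := x₀)).mono (hcW.trans hWs)).of_le (by simp))
      (fun y hy v ↦ by
        have := (hC y (hcW hy) v).1
        rw [enorm_tangentSpace_vectorSpace]
        exact this) hγ hγO
    rw [hγ0, hγ1, e.right_inv (hδs hy).1, e.right_inv (hδs hz).1] at h1
    calc edist y z ≤ C * (2 * D) := h1.trans (by gcongr; exact hγr.le.trans (min_le_left _ _))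
      _ = (2 * C : ℝ≥0) * D := by push_cast; ring
      _ ≤ _ := by gcongr; simp

/-- Finitely many charts bound the differential on the support, and it vanishes elsewhere; the bound
is integrated along a path at most twice as long as the distance. Points at infinite distance need
no estimate. -/
theorem ContMDiff.exists_lipschitzWith_of_hasCompactSupport [IsRiemannianManifold (𝓡 m) M]
    {f : M → ℝ} (hf : ContMDiff (𝓡 m) 𝓘(ℝ, ℝ) ∞ f) (hfc : HasCompactSupport f) :
    ∃ K, LipschitzWith K f := by
  have hloc : ∀ x : M, ∃ U ∈ 𝓝 x, ∃ C : ℝ≥0, ∀ y ∈ U, ∀ v : EuclideanSpace ℝ (Fin m),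
      ‖mfderivReal m f y v‖ₑ ≤ C * tangentENorm y v := by
    intro x
    obtain ⟨C, W, hW, hWs, hC⟩ := exists_chartAt_bounds (m := m) x
    set e := chartAt (EuclideanSpace ℝ (Fin m)) x
    have hx : x ∈ e.source := mem_chart_source _ x
    have hg : ContDiffOn ℝ ∞ (f ∘ e.symm) e.target := by
      rw [← contMDiffOn_iff_contDiffOn]
      exact hf.comp_contMDiffOn (contMDiffOn_chart_symm (n := ∞))
    have hgc : ContinuousAt (fun y ↦ ‖fderiv ℝ (f ∘ e.symm) y‖) (e x) :=
      ((hg.continuousOn_fderiv_of_isOpen e.open_target (by simp)).continuousAt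
        (e.open_target.mem_nhds (e.map_source hx))).norm
    have hev := hgc.eventually (gt_mem_nhds (lt_add_one _))
    refine ⟨_, inter_mem hW ((e.continuousAt hx).preimage_mem_nhds hev),
      (‖fderiv ℝ (f ∘ e.symm) (e x)‖ + 1).toNNReal * C, fun y hy v ↦ ?_⟩
    have hys : y ∈ e.source := hWs hy.1
    have h1 : mfderivReal m f y = (fderiv ℝ (f ∘ e.symm) (e y)).comp (mfderivModel m m e y) := by
      have hee : f =ᶠ[𝓝 y] (f ∘ e.symm) ∘ e := by
        filter_upwards [e.open_source.mem_nhds hys] with z hz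
        simp [e.left_inv hz]
      have h2 : mfderiv (𝓡 m) 𝓘(ℝ, ℝ) f y = mfderiv (𝓡 m) 𝓘(ℝ, ℝ) ((f ∘ e.symm) ∘ e) y :=
        hee.mfderiv_eq
      have h3 := mfderiv_comp (I := 𝓡 m) (I' := 𝓡 m) (I'' := 𝓘(ℝ, ℝ)) y (g := f ∘ e.symm) (f := e)
        (((hg.contDiffAt (e.open_target.mem_nhds (e.map_source hys))).differentiableAt
          (by simp)).mdifferentiableAt)
        (mdifferentiableAt_atlas (chart_mem_atlas _ x) hys)
      rw [mfderiv_eq_fderiv] at h3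
      exact h2.trans h3
    rw [h1]
    calc _ ≤ ‖fderiv ℝ (f ∘ e.symm) (e y)‖ₑ * ‖mfderivModel m m e y v‖ₑ :=
          ContinuousLinearMap.le_opENorm _ _
      _ ≤ _ := by
        rw [ENNReal.coe_mul, mul_assoc]
        refine mul_le_mul' ?_ (hC y hy.1 v).1
        rw [← ofReal_norm]
        exact ENNReal.ofReal_le_ofReal (le_of_lt hy.2)
  choose U hU C hC using hloc
  obtain ⟨t, -, ht⟩ := hfc.isCompact.elim_nhds_subcover U fun x _ ↦ hU x
  set K := ∑ x ∈ t, C x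
  have hK : ∀ z : M, ∀ v : EuclideanSpace ℝ (Fin m),
      ‖mfderivReal m f z v‖ₑ ≤ K * tangentENorm z v := fun z v ↦ by
    by_cases hz : z ∈ tsupport f
    · obtain ⟨x, hxt, hzx⟩ := mem_iUnion₂.1 (ht hz)
      refine (hC x z hzx v).trans ?_
      gcongr
      exact Finset.single_le_sum (f := C) (fun _ _ ↦ zero_le) hxt
    · have h1 : f =ᶠ[𝓝 z] fun _ ↦ 0 := by
        filter_upwards [(isClosed_tsupport f).isOpen_compl.mem_nhds hz] with w hw
        exact image_eq_zero_of_notMem_tsupport hw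
      have h2 : mfderivReal m f z = 0 := by
        have : mfderiv (𝓡 m) 𝓘(ℝ, ℝ) f z = 0 := by
          rw [h1.mfderiv_eq, mfderiv_const]
          rfl
        exact this
      rw [h2, _root_.zero_apply, enorm_zero]
      exact zero_le
  refine ⟨2 * K + 1, fun x y ↦ ?_⟩
  rcases eq_or_ne (edist x y) ⊤ with htop | htop
  · rw [htop, ENNReal.mul_top (by simp)]
    exact le_top
  rcases eq_or_ne x y with rfl | hne
  · simp
  have hr : edist x y < 2 * edist x y := by
    rw [two_mul]
    exact ENNReal.lt_add_right htop (by simpa using hne)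
  obtain ⟨γ, hγ0, hγ1, hγ, hγr⟩ := Manifold.exists_lt_of_riemannianEDist_lt (I := 𝓡 m)
    (x := x) (y := y) (r := 2 * edist x y) (by rwa [← IsRiemannianManifold.out (I := 𝓡 m)])
  have h1 := edist_comp_le_pathELength (J := 𝓘(ℝ, ℝ)) (I := 𝓡 m) (f := f) (C := K) (γ := γ)
    isOpen_univ (hf.of_le (by simp)).contMDiffOn (fun y _ v ↦ by
      rw [enorm_tangentSpace_vectorSpace]
      exact hK y v) hγ (mapsTo_univ _ _)
  rw [hγ0, hγ1] at h1
  calc edist (f x) (f y) ≤ K * (2 * edist x y) := h1.trans (by gcongr)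
    _ = (2 * K : ℝ≥0) * edist x y := by push_cast; ring
    _ ≤ _ := by gcongr; simp

end RiemannianCharts

/-! ### The Hilbert–Schmidt norm against operator bounds -/

section HilbertSchmidt

open scoped NNReal

theorem enorm_apply_le_hilbertSchmidtENorm {V W : Type*} [NormedAddCommGroup V]
    [InnerProductSpace ℝ V] [FiniteDimensional ℝ V] [NormedAddCommGroup W] [InnerProductSpace ℝ W]
    (L : V →L[ℝ] W) (v : V) :
    ‖L v‖ₑ ≤ Module.finrank ℝ V * hilbertSchmidtENorm L * ‖v‖ₑ := by
  have h1 : ∀ i, ‖L (stdOrthonormalBasis ℝ V i)‖ₑ ≤ hilbertSchmidtENorm L := fun i ↦ by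
    unfold hilbertSchmidtENorm
    calc ‖L (stdOrthonormalBasis ℝ V i)‖ₑ
        = (‖L (stdOrthonormalBasis ℝ V i)‖ₑ ^ 2) ^ (1 / 2 : ℝ) := by
          rw [← ENNReal.rpow_natCast, ← ENNReal.rpow_mul]
          simp
      _ ≤ _ := by
          gcongr
          exact Finset.single_le_sum (f := fun i ↦ ‖L (stdOrthonormalBasis ℝ V i)‖ₑ ^ 2)
            (fun _ _ ↦ zero_le) (Finset.mem_univ i)
  have h2 : L v = ∑ i, (inner ℝ (stdOrthonormalBasis ℝ V i) v) • L (stdOrthonormalBasis ℝ V i) := by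
    conv_lhs => rw [← (stdOrthonormalBasis ℝ V).sum_repr' v]
    simp
  rw [h2]
  calc _ ≤ ∑ i, ‖(inner ℝ (stdOrthonormalBasis ℝ V i) v) • L (stdOrthonormalBasis ℝ V i)‖ₑ :=
        enorm_sum_le _ _
    _ ≤ ∑ i : Fin (Module.finrank ℝ V), ‖v‖ₑ * hilbertSchmidtENorm L := by
        refine Finset.sum_le_sum fun i _ ↦ ?_
        rw [enorm_smul]
        refine mul_le_mul' ?_ (h1 i)
        rw [← ofReal_norm, ← ofReal_norm]
        refine ENNReal.ofReal_le_ofReal ((norm_inner_le_norm _ _).trans ?_)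
        simp
    _ = _ := by
        simp only [Finset.sum_const, Finset.card_univ, Fintype.card_fin, nsmul_eq_mul]
        ring

theorem hilbertSchmidtENorm_le {V W : Type*} [NormedAddCommGroup V]
    [InnerProductSpace ℝ V] [FiniteDimensional ℝ V] [NormedAddCommGroup W] [InnerProductSpace ℝ W]
    (L : V →L[ℝ] W) {c : ENNReal} (hc : ∀ v, ‖L v‖ₑ ≤ c * ‖v‖ₑ) :
    hilbertSchmidtENorm L ≤ Module.finrank ℝ V * c := by
  unfold hilbertSchmidtENorm
  have h1 : ∑ i, ‖L (stdOrthonormalBasis ℝ V i)‖ₑ ^ 2 ≤ (Module.finrank ℝ V * c) ^ 2 := by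
    calc _ ≤ ∑ i : Fin (Module.finrank ℝ V), c ^ 2 := by
          refine Finset.sum_le_sum fun i _ ↦ ?_
          gcongr
          refine (hc _).trans ?_
          rw [← ofReal_norm]
          simp
      _ = Module.finrank ℝ V * c ^ 2 := by simp
      _ ≤ _ := by
          rw [mul_pow]
          gcongr
          rw [sq]
          exact_mod_cast Nat.le_mul_self _
  calc _ ≤ ((Module.finrank ℝ V * c) ^ 2) ^ (1 / 2 : ℝ) := by gcongr
    _ = _ := by
        rw [← ENNReal.rpow_natCast, ← ENNReal.rpow_mul]
        simp

end HilbertSchmidt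

/-! ### Norms of tangent vectors and of differentials, in the model spaces -/

section RiemannianMaps

open scoped NNReal

variable {m n : ℕ} {M : Type*} [EMetricSpace M] [ChartedSpace (EuclideanSpace ℝ (Fin m)) M]
  [RiemannianBundle (fun x : M ↦ TangentSpace (𝓡 m) x)]
  {N : Type*} [EMetricSpace N] [ChartedSpace (EuclideanSpace ℝ (Fin n)) N]
  [RiemannianBundle (fun y : N ↦ TangentSpace (𝓡 n) y)]

theorem tangentENorm_smul (y : N) (c : ℝ) (v : EuclideanSpace ℝ (Fin n)) :
    tangentENorm y (c • v) = ‖c‖ₑ * tangentENorm y v :=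
  enorm_smul (β := TangentSpace (𝓡 n) y) c v

theorem tangentENorm_zero (y : N) : tangentENorm y (0 : EuclideanSpace ℝ (Fin n)) = 0 :=
  enorm_zero (E := TangentSpace (𝓡 n) y)

theorem tangentENorm_ne_top (y : N) (v : EuclideanSpace ℝ (Fin n)) : tangentENorm y v ≠ ⊤ :=
  enorm_ne_top (E := TangentSpace (𝓡 n) y)

theorem tangentENorm_sum_le {ι : Type*} (s : Finset ι) (y : N)
    (v : ι → EuclideanSpace ℝ (Fin n)) :
    tangentENorm y (∑ i ∈ s, v i) ≤ ∑ i ∈ s, tangentENorm y (v i) :=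
  enorm_sum_le (ε := TangentSpace (𝓡 n) y) s v

theorem tangentENorm_euclideanSpace (x v : EuclideanSpace ℝ (Fin m)) :
    tangentENorm x v = ‖v‖ₑ :=
  enorm_tangentSpace_vectorSpace (x := x) (v := v)

/-- A norm of a linear map into the tangent space at `y`, given in the model space. -/
noncomputable def tangentMapENorm (y : N)
    (L : EuclideanSpace ℝ (Fin m) →L[ℝ] EuclideanSpace ℝ (Fin n)) : ENNReal :=
  ∑ i, tangentENorm y (L (EuclideanSpace.single i 1))

theorem tangentENorm_apply_le (y : N)
    (L : EuclideanSpace ℝ (Fin m) →L[ℝ] EuclideanSpace ℝ (Fin n)) (v : EuclideanSpace ℝ (Fin m)) :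
    tangentENorm y (L v) ≤ tangentMapENorm y L * ‖v‖ₑ := by
  have h1 : L v = ∑ i, v i • L (EuclideanSpace.single i 1) := by
    have h2 : v = ∑ i, v i • EuclideanSpace.single i (1 : ℝ) := by
      have := ((EuclideanSpace.basisFun (Fin m) ℝ).sum_repr v).symm
      simpa using this
    conv_lhs => rw [h2]
    simp
  rw [h1, tangentMapENorm, Finset.sum_mul]
  refine (tangentENorm_sum_le _ _ _).trans (Finset.sum_le_sum fun i _ ↦ ?_)
  rw [tangentENorm_smul, mul_comm]
  gcongr
  rw [← ofReal_norm, ← ofReal_norm]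
  exact ENNReal.ofReal_le_ofReal (PiLp.norm_apply_le v i)

theorem tangentMapENorm_le (y : N)
    (L : EuclideanSpace ℝ (Fin m) →L[ℝ] EuclideanSpace ℝ (Fin n)) {c : ENNReal}
    (hc : ∀ v, tangentENorm y (L v) ≤ c * ‖v‖ₑ) : tangentMapENorm y L ≤ m * c := by
  calc _ ≤ ∑ i : Fin m, c := by
        refine Finset.sum_le_sum fun i _ ↦ (hc _).trans ?_
        rw [← ofReal_norm]
        simp
    _ = _ := by simp

theorem tangentMapENorm_comp_le (y : N)
    (L : EuclideanSpace ℝ (Fin m) →L[ℝ] EuclideanSpace ℝ (Fin n))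
    (A : EuclideanSpace ℝ (Fin m) →L[ℝ] EuclideanSpace ℝ (Fin m)) :
    tangentMapENorm y (L.comp A) ≤ m * (tangentMapENorm y L * ‖A‖ₑ) :=
  tangentMapENorm_le y _ fun v ↦ by
    refine (tangentENorm_apply_le y L (A v)).trans ?_
    rw [mul_assoc]
    gcongr
    exact A.le_opENorm v

theorem hilbertSchmidtENorm_tangent_le (x : M) (y : N)
    (L : EuclideanSpace ℝ (Fin m) →L[ℝ] EuclideanSpace ℝ (Fin n)) {c : ENNReal}
    (hc : ∀ v, tangentENorm y (L v) ≤ c * tangentENorm x v) :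
    hilbertSchmidtENorm (V := TangentSpace (𝓡 m) x) (W := TangentSpace (𝓡 n) y) L ≤ m * c := by
  have h := hilbertSchmidtENorm_le (V := TangentSpace (𝓡 m) x) (W := TangentSpace (𝓡 n) y) L hc
  have h2 : Module.finrank ℝ (TangentSpace (𝓡 m) x) = m := finrank_euclideanSpace_fin
  rwa [h2] at h

theorem tangentENorm_apply_le_hilbertSchmidtENorm (x : M) (y : N)
    (L : EuclideanSpace ℝ (Fin m) →L[ℝ] EuclideanSpace ℝ (Fin n)) (v : EuclideanSpace ℝ (Fin m)) :
    tangentENorm y (L v) ≤ m * hilbertSchmidtENorm (V := TangentSpace (𝓡 m) x)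
      (W := TangentSpace (𝓡 n) y) L * tangentENorm x v := by
  have h := enorm_apply_le_hilbertSchmidtENorm (V := TangentSpace (𝓡 m) x)
    (W := TangentSpace (𝓡 n) y) L v
  have h2 : Module.finrank ℝ (TangentSpace (𝓡 m) x) = m := finrank_euclideanSpace_fin
  rwa [h2] at h

variable [IsManifold (𝓡 n) ∞ N] [IsContMDiffRiemannianBundle (𝓡 n) ∞ (EuclideanSpace ℝ (Fin n))
      (fun y : N ↦ TangentSpace (𝓡 n) y)]

/-- The inverse trivialization is continuous into the total space, where the inner product is
continuous. This turns measurable coordinates into measurable norms along a measurable map. -/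
theorem continuousOn_tangentENorm_chartAt_symm (y₀ : N) :
    ContinuousOn (fun q : N × EuclideanSpace ℝ (Fin n) ↦
      tangentENorm q.1 (mfderivModel n n (chartAt (EuclideanSpace ℝ (Fin n)) y₀).symm
        (chartAt (EuclideanSpace ℝ (Fin n)) y₀ q.1) q.2))
      ((chartAt (EuclideanSpace ℝ (Fin n)) y₀).source ×ˢ univ) := by
  have := IsContMDiffRiemannianBundle.isContinuousRiemannianBundle (m := n) (M := N)
  set T := trivializationAt (EuclideanSpace ℝ (Fin n)) (fun y : N ↦ TangentSpace (𝓡 n) y) y₀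
  have hb : T.baseSet = (chartAt (EuclideanSpace ℝ (Fin n)) y₀).source :=
    TangentBundle.trivializationAt_baseSet _
  have h1 : ContinuousOn (fun q : N × EuclideanSpace ℝ (Fin n) ↦
      (⟨q.1, T.symmL ℝ q.1 q.2⟩ : TotalSpace (EuclideanSpace ℝ (Fin n))
        (fun y : N ↦ TangentSpace (𝓡 n) y)))
      ((chartAt (EuclideanSpace ℝ (Fin n)) y₀).source ×ˢ univ) := by
    have h2 := T.toOpenPartialHomeomorph.continuousOn_symm
    rw [T.target_eq, hb] at h2
    refine h2.congr fun q hq ↦ ?_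
    have := T.mk_symm (b := q.1) (by rw [hb]; exact hq.1) q.2
    rw [← Trivialization.symmL_apply (R := ℝ) _ (by rw [hb]; exact hq.1)] at this
    exact this
  have h2 := ContinuousOn.inner_bundle h1 h1
  have h3 : ContinuousOn (fun q : N × EuclideanSpace ℝ (Fin n) ↦ ‖T.symmL ℝ q.1 q.2‖ₑ)
      ((chartAt (EuclideanSpace ℝ (Fin n)) y₀).source ×ˢ univ) := by
    have h4 := ENNReal.continuous_ofReal.comp_continuousOn h2.sqrt
    refine h4.congr fun q _ ↦ ?_
    rw [← ofReal_norm, norm_eq_sqrt_real_inner]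
    rfl
  refine h3.congr fun q hq ↦ ?_
  have h4 := TangentBundle.symmL_trivializationAt (I := 𝓡 n) hq.1
  have h5 : (extChartAt (𝓡 n) y₀ : N → EuclideanSpace ℝ (Fin n)) =
    chartAt (EuclideanSpace ℝ (Fin n)) y₀ := by simp [mfld_simps]
  have h5' : ((extChartAt (𝓡 n) y₀).symm : EuclideanSpace ℝ (Fin n) → N) =
    (chartAt (EuclideanSpace ℝ (Fin n)) y₀).symm := by simp [mfld_simps]
  rw [h5, h5', modelWithCornersSelf_coe, range_id, mfderivWithin_univ] at h4
  simp only [T, h4]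
  rfl

end RiemannianMaps

/-! ### Differentials of Lipschitz functions -/

section ChartDerivatives

open scoped NNReal

variable {n : ℕ} {N : Type*} [EMetricSpace N] [ChartedSpace (EuclideanSpace ℝ (Fin n)) N]
  [IsManifold (𝓡 n) ∞ N]

theorem mfderivReal_eq_comp_chartAt {f : N → ℝ} (hf : ContMDiff (𝓡 n) 𝓘(ℝ, ℝ) ∞ f) (x : N) {y : N}
    (hy : y ∈ (chartAt (EuclideanSpace ℝ (Fin n)) x).source) :
    mfderivReal n f y = (fderiv ℝ (f ∘ (chartAt (EuclideanSpace ℝ (Fin n)) x).symm)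
      (chartAt (EuclideanSpace ℝ (Fin n)) x y)).comp
      (mfderivModel n n (chartAt (EuclideanSpace ℝ (Fin n)) x) y) := by
  set e := chartAt (EuclideanSpace ℝ (Fin n)) x
  have hg : ContDiffOn ℝ ∞ (f ∘ e.symm) e.target := by
    rw [← contMDiffOn_iff_contDiffOn]
    exact hf.comp_contMDiffOn (contMDiffOn_chart_symm (n := ∞))
  have hee : f =ᶠ[𝓝 y] (f ∘ e.symm) ∘ e := by
    filter_upwards [e.open_source.mem_nhds hy] with z hz
    simp [e.left_inv hz]
  have h2 : mfderiv (𝓡 n) 𝓘(ℝ, ℝ) f y = mfderiv (𝓡 n) 𝓘(ℝ, ℝ) ((f ∘ e.symm) ∘ e) y :=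
    hee.mfderiv_eq
  have h3 := mfderiv_comp (I := 𝓡 n) (I' := 𝓡 n) (I'' := 𝓘(ℝ, ℝ)) y (g := f ∘ e.symm) (f := e)
    (((hg.contDiffAt (e.open_target.mem_nhds (e.map_source hy))).differentiableAt
      (by simp)).mdifferentiableAt)
    (mdifferentiableAt_atlas (chart_mem_atlas _ x) hy)
  rw [mfderiv_eq_fderiv] at h3
  exact h2.trans h3

theorem mfderivModel_chartAt_symm_apply (x : N) {y : N}
    (hy : y ∈ (chartAt (EuclideanSpace ℝ (Fin n)) x).source) (v : EuclideanSpace ℝ (Fin n)) :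
    mfderivModel n n (chartAt (EuclideanSpace ℝ (Fin n)) x).symm
      (chartAt (EuclideanSpace ℝ (Fin n)) x y)
      (mfderivModel n n (chartAt (EuclideanSpace ℝ (Fin n)) x) y v) = v := by
  have h := OpenPartialHomeomorph.MDifferentiable.symm_comp_deriv
    (mdifferentiable_chart (I := 𝓡 n) x) hy
  exact DFunLike.congr_fun h v

omit [IsManifold (𝓡 n) ∞ N] in
theorem mfderivReal_real_comp {f : N → ℝ} (hf : ContMDiff (𝓡 n) 𝓘(ℝ, ℝ) ∞ f) {g : ℝ → ℝ}
    (hg : Differentiable ℝ g) (y : N) :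
    mfderivReal n (g ∘ f) y = deriv g (f y) • mfderivReal n f y := by
  have h := mfderiv_comp (I := 𝓡 n) (I' := 𝓘(ℝ, ℝ)) (I'' := 𝓘(ℝ, ℝ)) y (g := g) (f := f)
    (hg _).mdifferentiableAt (hf.mdifferentiableAt (by simp))
  rw [mfderiv_eq_fderiv] at h
  refine ContinuousLinearMap.ext fun v ↦ ?_
  have h2 : mfderivReal n (g ∘ f) y v = fderiv ℝ g (f y) (mfderivReal n f y v) :=
    DFunLike.congr_fun h v
  rw [h2]
  simp [fderiv_eq_smul_deriv, mul_comm]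

omit [IsManifold (𝓡 n) ∞ N] in
theorem mfderivReal_sub_const {f : N → ℝ} (hf : ContMDiff (𝓡 n) 𝓘(ℝ, ℝ) ∞ f) (c : ℝ) (y : N) :
    mfderivReal n (fun z ↦ f z - c) y = mfderivReal n f y := by
  have := mfderivReal_real_comp hf (g := fun t ↦ t - c) (by fun_prop) y
  simpa [Function.comp_def, deriv_sub_const] using this

variable [RiemannianBundle (fun y : N ↦ TangentSpace (𝓡 n) y)]
  [IsContMDiffRiemannianBundle (𝓡 n) ∞ (EuclideanSpace ℝ (Fin n))
    (fun y : N ↦ TangentSpace (𝓡 n) y)] [IsRiemannianManifold (𝓡 n) N]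

/-- For `c` larger than the norm of `v`, the coordinate line through `y` with velocity `v` has speed
less than `c` near `y` by continuity of the metric. So `f` is Lipschitz along it with constant `K
c`, which bounds its derivative at `y`; then `c` decreases to the norm of `v`. -/
theorem LipschitzWith.enorm_mfderivReal_le {f : N → ℝ} {K : ℝ≥0} (hK : LipschitzWith K f)
    (hf : ContMDiff (𝓡 n) 𝓘(ℝ, ℝ) ∞ f) (y : N) (v : EuclideanSpace ℝ (Fin n)) :
    ‖mfderivReal n f y v‖ₑ ≤ K * tangentENorm y v := by
  set e := chartAt (EuclideanSpace ℝ (Fin n)) y with he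
  have hy : y ∈ e.source := mem_chart_source _ y
  have hey : e y ∈ e.target := e.map_source hy
  set w := mfderivModel n n e y v with hw
  have hg : ContDiffOn ℝ ∞ (f ∘ e.symm) e.target := by
    rw [← contMDiffOn_iff_contDiffOn]
    exact hf.comp_contMDiffOn (contMDiffOn_chart_symm (n := ∞))
  have hes := contMDiffOn_chart_symm (I := 𝓡 n) (n := ∞) (x := y)
  have key : ∀ c : ℝ≥0, tangentENorm y v < c → ‖mfderivReal n f y v‖ ≤ K * c := by
    intro c hc
    have h1 : ∀ᶠ z in 𝓝 (e y), z ∈ e.target ∧ tangentENorm (e.symm z)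
        (mfderivModel n n e.symm z w) < c := by
      have h2 := (continuousOn_tangentENorm_chartAt_symm y).comp (s := e.target)
        (f := fun z ↦ (e.symm z, w)) (e.continuousOn_symm.prodMk continuousOn_const)
        fun z hz ↦ ⟨e.map_target hz, mem_univ _⟩
      have h3 := Tendsto.eventually_lt_const (u := (c : ENNReal)) (by
          change tangentENorm (e.symm (e y)) (mfderivModel n n e.symm (e (e.symm (e y))) w) < c
          rw [e.left_inv hy, mfderivModel_chartAt_symm_apply y hy]
          exact hc) (h2.continuousAt (e.open_target.mem_nhds hey))
      filter_upwards [h3, e.open_target.mem_nhds hey] with z hz hz'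
      refine ⟨hz', ?_⟩
      change tangentENorm (e.symm z) (mfderivModel n n e.symm (e (e.symm z)) w) < c at hz
      rwa [e.right_inv hz'] at hz
    have hline : Continuous fun t : ℝ ↦ e y + t • w := by fun_prop
    have h2 : ∀ᶠ t : ℝ in 𝓝 0, e y + t • w ∈ e.target ∧ tangentENorm (e.symm (e y + t • w))
        (mfderivModel n n e.symm (e y + t • w) w) < c := by
      have h3 : Tendsto (fun t : ℝ ↦ e y + t • w) (𝓝 0) (𝓝 (e y)) := by
        simpa using hline.tendsto 0
      exact h3.eventually h1
    obtain ⟨ε, hε, hεs⟩ := Metric.eventually_nhds_iff_ball.1 h2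
    have hlip : ∀ t ∈ Metric.ball (0 : ℝ) ε,
        edist (e.symm (e y + (0 : ℝ) • w)) (e.symm (e y + t • w)) ≤ c * edist 0 t := by
      intro t ht
      let γ := ContinuousAffineMap.lineMap (R := ℝ) 0 t
      have hγ : ContMDiffOn 𝓘(ℝ, ℝ) 𝓘(ℝ, ℝ) 1 γ (Icc 0 1) := by
        apply ContMDiff.contMDiffOn
        rw [contMDiff_iff_contDiff]
        exact ContinuousAffineMap.contDiff _
      have hγO : MapsTo γ (Icc 0 1) (Metric.ball (0 : ℝ) ε) := fun τ hτ ↦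
        (convex_ball (0 : ℝ) ε).lineMap_mem (Metric.mem_ball_self hε) ht hτ
      have hcd : ContMDiff 𝓘(ℝ, ℝ) (𝓡 n) ∞ fun t : ℝ ↦ e y + t • w := by
        rw [contMDiff_iff_contDiff]
        fun_prop
      have h3 := edist_comp_le_pathELength (J := 𝓡 n) (I := 𝓘(ℝ, ℝ))
        (f := fun t : ℝ ↦ e.symm (e y + t • w)) (C := c) (γ := γ) (Metric.isOpen_ball)
        ((hes.comp hcd.contMDiffOn fun t ht ↦ (hεs t ht).1).of_le (by simp))
        (fun τ hτ (a : ℝ) ↦ by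
          have h4 := mfderiv_comp (I := 𝓘(ℝ, ℝ)) (I' := 𝓡 n) (I'' := 𝓡 n) τ (g := e.symm)
            (f := fun t : ℝ ↦ e y + t • w)
            (mdifferentiableAt_atlas_symm (chart_mem_atlas _ y) (hεs τ hτ).1)
            (hcd.mdifferentiableAt (by simp))
          have h5 : fderiv ℝ (fun t : ℝ ↦ e y + t • w) τ a = a • w := by
            have := (((hasFDerivAt_id (𝕜 := ℝ) τ).smul_const w).const_add (e y)).fderiv
            simp only [id] at this
            rw [this]
            rfl
          rw [mfderiv_eq_fderiv] at h4
          have h6 : mfderiv 𝓘(ℝ, ℝ) (𝓡 n) (e.symm ∘ fun t : ℝ ↦ e y + t • w) τ a =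
            mfderivModel n n e.symm (e y + τ • w) (a • w) := by
            rw [h4, ← h5]
            rfl
          have h8 : @enorm (TangentSpace 𝓘(ℝ, ℝ) τ) _ a = ‖a‖ₑ := enorm_tangentSpace_vectorSpace
          refine le_trans ?_ (mul_le_mul_right h8.ge _)
          calc _ = tangentENorm (e.symm (e y + τ • w))
                (mfderivModel n n e.symm (e y + τ • w) (a • w)) := by
                rw [← h6]
                rfl
            _ ≤ _ := by
                rw [map_smul, tangentENorm_smul, mul_comm]
                gcongr
                exact (hεs τ hτ).2.le) hγ hγO
      have h7 : Manifold.pathELength 𝓘(ℝ, ℝ) γ 0 1 = edist 0 t := by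
        rw [← lintegral_fderiv_lineMap_eq_edist,
          Manifold.pathELength_eq_lintegral_mfderivWithin_Icc]
        refine setLIntegral_congr_fun measurableSet_Icc fun τ _ ↦ ?_
        simp only [mfderivWithin_eq_fderivWithin, enorm_tangentSpace_vectorSpace]
        rfl
      rw [h7] at h3
      simpa [γ, ContinuousAffineMap.coe_lineMap_eq] using h3
    have hd : HasDerivAt (fun t : ℝ ↦ f (e.symm (e y + t • w))) (mfderivReal n f y v) 0 := by
      have h3 := ((hg.contDiffAt (e.open_target.mem_nhds hey)).differentiableAt
        (by simp)).hasFDerivAt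
      rw [mfderivReal_eq_comp_chartAt hf y hy]
      have h4 : HasDerivAt (fun t : ℝ ↦ e y + t • w) w 0 := by
        simpa using ((hasDerivAt_id (0 : ℝ)).smul_const w).const_add (e y)
      have h5 : e y = e y + (0 : ℝ) • w := by simp
      rw [h5] at h3
      have := h3.comp_hasDerivAt (0 : ℝ) h4
      rw [← h5] at this
      exact this
    refine hd.le_of_lip' (by positivity) ?_
    filter_upwards [Metric.ball_mem_nhds (0 : ℝ) hε] with t ht
    have h3 := (hK _ _).trans (mul_le_mul_right (hlip t ht) (K : ENNReal))
    rw [edist_comm, edist_eq_enorm_sub, edist_comm, edist_eq_enorm_sub, ← ofReal_norm, ← ofReal_norm,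
      ← mul_assoc, ← ENNReal.coe_mul, ← ENNReal.ofReal_coe_nnreal,
      ← ENNReal.ofReal_mul (by positivity), ENNReal.ofReal_le_ofReal_iff (by positivity)] at h3
    simpa using h3
  have hfin := tangentENorm_ne_top y v
  obtain ⟨a, ha⟩ := WithTop.ne_top_iff_exists.1 hfin
  replace ha : (a : ENNReal) = tangentENorm y v := ha
  rw [← ha, ← ofReal_norm, ← ENNReal.coe_mul, ← ENNReal.ofReal_coe_nnreal]
  refine ENNReal.ofReal_le_ofReal ?_
  refine le_of_forall_pos_le_add fun ε hε ↦ ?_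
  obtain ⟨δ, hδ, hδε⟩ : ∃ δ : ℝ≥0, 0 < δ ∧ (K : ℝ) * δ ≤ ε := by
    refine ⟨(ε / (K + 1)).toNNReal, by simpa using by positivity, ?_⟩
    rw [Real.coe_toNNReal _ (by positivity), mul_div_assoc', div_le_iff₀ (by positivity)]
    nlinarith [K.2]
  have h1 := key (a + δ) (by
    rw [← ha]
    exact_mod_cast lt_add_of_pos_right a hδ)
  refine h1.trans ?_
  push_cast
  rw [mul_add]
  gcongr

end ChartDerivatives

/-! ### Weak differentials tested with bounded functions -/

section BoundedTests

open scoped NNReal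

variable {m n : ℕ} {N : Type*} [EMetricSpace N] [ChartedSpace (EuclideanSpace ℝ (Fin n)) N]

/-- `D` is the weak differential of `u` on the open set `A`, as far as bounded smooth Lipschitz test
functions are concerned. -/
def HasBddWeakMFDerivOn (A : Set (EuclideanSpace ℝ (Fin m))) (u : EuclideanSpace ℝ (Fin m) → N)
    (D : EuclideanSpace ℝ (Fin m) → EuclideanSpace ℝ (Fin m) →L[ℝ] EuclideanSpace ℝ (Fin n)) :
    Prop :=
  ∀ f : N → ℝ, ContMDiff (𝓡 n) 𝓘(ℝ, ℝ) ∞ f → (∃ K, LipschitzWith K f) → (∃ c, ∀ y, |f y| ≤ c) →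
    HasWeakFDerivOn A (fun x ↦ f (u x)) (fun x ↦ (mfderivReal n f (u x)).comp (D x))

variable [IsManifold (𝓡 n) ∞ N] [RiemannianBundle (fun y : N ↦ TangentSpace (𝓡 n) y)]
  [IsContMDiffRiemannianBundle (𝓡 n) ∞ (EuclideanSpace ℝ (Fin n))
    (fun y : N ↦ TangentSpace (𝓡 n) y)] [IsRiemannianManifold (𝓡 n) N]

/-- Coordinates multiplied by a bump function: compact support makes them bounded and Lipschitz, and
near `y₀` their differentials determine a tangent vector. -/
theorem exists_chartAt_test_functions (y₀ : N) :
    ∃ O : Set N, IsOpen O ∧ y₀ ∈ O ∧ O ⊆ (chartAt (EuclideanSpace ℝ (Fin n)) y₀).source ∧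
      ∃ f : Fin n → N → ℝ, ∀ i, ContMDiff (𝓡 n) 𝓘(ℝ, ℝ) ∞ (f i) ∧ (∃ K, LipschitzWith K (f i)) ∧
        (∃ c, ∀ y, |f i y| ≤ c) ∧ ∀ y ∈ O, ∀ v,
          mfderivReal n (f i) y v = mfderivModel n n (chartAt (EuclideanSpace ℝ (Fin n)) y₀) y v i := by
  set e := chartAt (EuclideanSpace ℝ (Fin n)) y₀ with he
  let χ : SmoothBumpFunction (𝓡 n) y₀ := Classical.choice inferInstance
  obtain ⟨O', hO', hO, hyO⟩ := mem_nhds_iff.1 χ.eventuallyEq_one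
  let f : Fin n → N → ℝ := fun i y ↦ χ y • (e y i)
  have hf : ∀ i, ContMDiff (𝓡 n) 𝓘(ℝ, ℝ) ∞ (f i) := fun i ↦ by
    refine χ.contMDiff_smul ?_
    have h1 := contMDiffOn_chart (I := 𝓡 n) (n := ∞) (x := y₀)
    exact ((EuclideanSpace.proj i : EuclideanSpace ℝ (Fin n) →L[ℝ] ℝ).contMDiff (n := ∞)).comp_contMDiffOn h1
  have hfc : ∀ i, HasCompactSupport (f i) := fun i ↦ χ.hasCompactSupport.smul_right
  refine ⟨O' ∩ e.source, hO.inter e.open_source, ⟨hyO, mem_chart_source _ _⟩, inter_subset_right,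
    f, fun i ↦ ⟨hf i, (hf i).exists_lipschitzWith_of_hasCompactSupport (hfc i), ?_, ?_⟩⟩
  · obtain ⟨c, hc⟩ := (hf i).continuous.bounded_above_of_compact_support (hfc i)
    exact ⟨c, hc⟩
  · intro y hy v
    have h1 : f i =ᶠ[𝓝 y] (EuclideanSpace.proj i : EuclideanSpace ℝ (Fin n) →L[ℝ] ℝ) ∘ e := by
      filter_upwards [hO.mem_nhds hy.1] with z hz
      have : χ z = 1 := hO' hz
      simp [f, this]
    have h2 : mfderiv (𝓡 n) 𝓘(ℝ, ℝ) (f i) y = _ := h1.mfderiv_eq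
    have h3 := mfderiv_comp (I := 𝓡 n) (I' := 𝓡 n) (I'' := 𝓘(ℝ, ℝ)) y
      (g := (EuclideanSpace.proj i : EuclideanSpace ℝ (Fin n) →L[ℝ] ℝ)) (f := e)
      ((EuclideanSpace.proj i : EuclideanSpace ℝ (Fin n) →L[ℝ] ℝ).differentiableAt.mdifferentiableAt)
      (mdifferentiableAt_atlas (chart_mem_atlas _ y₀) hy.2)
    rw [mfderiv_eq_fderiv, ContinuousLinearMap.fderiv] at h3
    exact DFunLike.congr_fun (h2.trans h3) v

variable [MeasurableSpace N] [BorelSpace N] [SecondCountableTopology N]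

/-- No measurability of `D` is assumed. The coordinates of `D x v` in a chart around `u x` are
values of weak differentials of test functions, which are measurable, and countably many charts
cover `N`. -/
theorem HasBddWeakMFDerivOn.aemeasurable_tangentENorm_apply {A : Set (EuclideanSpace ℝ (Fin m))}
    (hA : IsOpen A) {u : EuclideanSpace ℝ (Fin m) → N} (hu : Measurable u)
    {D : EuclideanSpace ℝ (Fin m) → EuclideanSpace ℝ (Fin m) →L[ℝ] EuclideanSpace ℝ (Fin n)}
    (hD : HasBddWeakMFDerivOn A u D) (v : EuclideanSpace ℝ (Fin m)) :
    AEMeasurable (fun x ↦ tangentENorm (u x) (D x v)) (volume.restrict A) := by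
  classical
  choose O hO hyO hOs f hf using exists_chartAt_test_functions (n := n) (N := N)
  obtain ⟨t, ht, htU⟩ := TopologicalSpace.countable_cover_nhds (f := O)
    fun y ↦ (hO y).mem_nhds (hyO y)
  have hcov : ⋃ y ∈ t, A ∩ u ⁻¹' O y = A := by
    rw [← inter_iUnion₂]
    refine inter_eq_left.2 fun x _ ↦ ?_
    have : u x ∈ ⋃ y ∈ t, O y := htU ▸ mem_univ _
    simpa using this
  rw [← hcov, biUnion_eq_iUnion]
  have := ht.to_subtype
  rw [aemeasurable_iUnion_iff]
  rintro ⟨y, -⟩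
  set e := chartAt (EuclideanSpace ℝ (Fin n)) y
  let T : EuclideanSpace ℝ (Fin m) → EuclideanSpace ℝ (Fin n) := fun x ↦
    WithLp.toLp 2 fun i ↦ mfderivReal n (f y i) (u x) (D x v)
  have hT : AEMeasurable T (volume.restrict A) := by
    refine (PiLp.continuous_toLp 2 _).measurable.comp_aemeasurable
      (aemeasurable_pi_lambda _ fun i ↦ ?_)
    obtain ⟨h1, h2, h3, -⟩ := hf y i
    have h4 := (hD _ h1 h2 h3).2.1.aestronglyMeasurable
    exact (h4.apply_continuousLinearMap v).aemeasurable
  have hΦ := continuousOn_tangentENorm_chartAt_symm (n := n) y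
  have hS : MeasurableSet (e.source ×ˢ (univ : Set (EuclideanSpace ℝ (Fin n)))) :=
    e.open_source.measurableSet.prod .univ
  have h1 := hΦ.measurable_piecewise (g := fun _ ↦ 0) continuousOn_const hS
  have h2 := (h1.comp_aemeasurable (hu.aemeasurable.prodMk hT)).mono_measure
    (Measure.restrict_mono (inter_subset_left (s := A) (t := u ⁻¹' O y)) le_rfl)
  refine h2.congr ?_
  filter_upwards [ae_restrict_mem (hA.measurableSet.inter (hu (hO y).measurableSet))] with x hx
  have hxs : u x ∈ e.source := hOs y hx.2
  have hTx : T x = mfderivModel n n e (u x) (D x v) := by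
    ext i
    exact (hf y i).2.2.2 _ hx.2 _
  simp only [Function.comp, piecewise]
  rw [if_pos ⟨hxs, mem_univ _⟩, hTx, mfderivModel_chartAt_symm_apply y hxs]

theorem HasBddWeakMFDerivOn.aemeasurable_tangentMapENorm {A : Set (EuclideanSpace ℝ (Fin m))}
    (hA : IsOpen A) {u : EuclideanSpace ℝ (Fin m) → N} (hu : Measurable u)
    {D : EuclideanSpace ℝ (Fin m) → EuclideanSpace ℝ (Fin m) →L[ℝ] EuclideanSpace ℝ (Fin n)}
    (hD : HasBddWeakMFDerivOn A u D) :
    AEMeasurable (fun x ↦ tangentMapENorm (u x) (D x)) (volume.restrict A) :=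
  Finset.aemeasurable_fun_sum _ fun _ _ ↦ hD.aemeasurable_tangentENorm_apply hA hu _

end BoundedTests

/-! ### Locally constant functions and a Poincaré inequality -/

section WeakDerivatives

open scoped NNReal

variable {m : ℕ}

theorem ContinuousLinearMap.ext_single {G : Type*} [NormedAddCommGroup G] [NormedSpace ℝ G]
    {L L' : EuclideanSpace ℝ (Fin m) →L[ℝ] G}
    (h : ∀ i, L (EuclideanSpace.single i 1) = L' (EuclideanSpace.single i 1)) : L = L' := by
  refine ContinuousLinearMap.coe_injective ((EuclideanSpace.basisFun (Fin m) ℝ).toBasis.ext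
    fun i ↦ ?_)
  simpa using h i

/-- Against test functions supported in `O`, `h` may be replaced by the constant, so `w` has zero
integrals and the fundamental lemma of the calculus of variations applies. -/
theorem HasWeakFDerivOn.ae_eq_zero_of_eq_const {U O : Set (EuclideanSpace ℝ (Fin m))}
    {h : EuclideanSpace ℝ (Fin m) → ℝ}
    {w : EuclideanSpace ℝ (Fin m) → EuclideanSpace ℝ (Fin m) →L[ℝ] ℝ}
    (hw : HasWeakFDerivOn U h w) (hO : IsOpen O) (hOU : O ⊆ U) {c : ℝ} (hc : ∀ x ∈ O, h x = c) :
    ∀ᵐ x ∂volume.restrict O, w x = 0 := by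
  rw [ae_restrict_iff' hO.measurableSet]
  have h1 : ∀ i : Fin m, ∀ᵐ x, x ∈ O → w x (EuclideanSpace.single i 1) = 0 := fun i ↦ by
    refine hO.ae_eq_zero_of_integral_contDiff_smul_eq_zero
      ((hw.2.1.clm_apply_const _).mono_set hOU) fun ψ hψ hψc hψO ↦ ?_
    have h2 := hw.2.2 ψ hψ hψc (hψO.trans hOU) (EuclideanSpace.single i 1)
    have h3 := ((LipschitzWith.const c).hasWeakFDerivOn U).2.2 ψ hψ hψc (hψO.trans hOU)
      (EuclideanSpace.single i 1)
    have h4 : ∫ y, h y * fderiv ℝ ψ y (EuclideanSpace.single i 1) =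
        ∫ y, c * fderiv ℝ ψ y (EuclideanSpace.single i 1) := by
      refine integral_congr_ae (Eventually.of_forall fun y ↦ ?_)
      by_cases hy : y ∈ O
      · simp only [hc y hy]
      · have : fderiv ℝ ψ y (EuclideanSpace.single i 1) = 0 := by
          refine image_eq_zero_of_notMem_tsupport (f := fun y ↦ fderiv ℝ ψ y _) fun hy' ↦ hy (hψO ?_)
          exact tsupport_fderiv_apply_subset ℝ _ hy'
        simp [this]
    rw [h4, h3] at h2
    simp only [fderiv_fun_const, Pi.zero_apply, _root_.zero_apply, zero_mul, integral_zero,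
      neg_zero] at h2
    simp only [smul_eq_mul, mul_comm (ψ _)]
    linarith
  filter_upwards [ae_all_iff.2 h1] with x hx hxO
  exact ContinuousLinearMap.ext_single fun i ↦ by simpa using hx i hxO

theorem ContDiff.hasWeakFDerivOn_of_hasCompactSupport_sub {h : EuclideanSpace ℝ (Fin m) → ℝ}
    (hh : ContDiff ℝ 1 h) {c : ℝ} (hc : HasCompactSupport fun x ↦ h x - c)
    (U : Set (EuclideanSpace ℝ (Fin m))) : HasWeakFDerivOn U h (fderiv ℝ h) := by
  obtain ⟨K, hK⟩ := ContDiff.lipschitzWith_of_hasCompactSupport hc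
    (hh.sub (contDiff_const (n := 1))) one_ne_zero
  have : LipschitzWith K h := fun x y ↦ by
    have := hK x y
    rwa [edist_sub_right] at this
  exact this.hasWeakFDerivOn U

/-- The fundamental theorem of calculus on the segments from `x` to `x + a`, integrated over `x`
first. -/
theorem lintegral_enorm_comp_add_sub_le {g : EuclideanSpace ℝ (Fin m) → ℝ} (hg : ContDiff ℝ 1 g)
    (a : EuclideanSpace ℝ (Fin m)) {A B : Set (EuclideanSpace ℝ (Fin m))}
    (hAB : ∀ x ∈ A, ∀ t ∈ Icc (0 : ℝ) 1, x + t • a ∈ B) :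
    ∫⁻ x in A, ‖g (x + a) - g x‖ₑ ≤ ‖a‖ₑ * ∫⁻ x in B, ‖fderiv ℝ g x‖ₑ := by
  have hc : Continuous (fderiv ℝ g) := hg.continuous_fderiv one_ne_zero
  have h1 : ∀ x, ‖g (x + a) - g x‖ₑ ≤ ∫⁻ t in Icc (0 : ℝ) 1, ‖fderiv ℝ g (x + t • a)‖ₑ * ‖a‖ₑ := by
    intro x
    have h2 : ∫ t in (0 : ℝ)..1, fderiv ℝ g (x + t • a) a = g (x + a) - g x := by
      have := intervalIntegral.integral_eq_sub_of_hasDerivAt (a := 0) (b := 1)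
        (f := fun t : ℝ ↦ g (x + t • a)) (f' := fun t ↦ fderiv ℝ g (x + t • a) a)
        (fun t _ ↦ by
          have h3 : HasDerivAt (fun t : ℝ ↦ x + t • a) a t := by
            simpa using ((hasDerivAt_id t).smul_const a).const_add x
          exact ((hg.differentiable one_ne_zero _).hasFDerivAt).comp_hasDerivAt t h3)
        (Continuous.intervalIntegrable (by fun_prop) _ _)
      simpa using this
    rw [← h2, intervalIntegral.integral_of_le zero_le_one]
    refine (enorm_integral_le_lintegral_enorm _).trans ?_
    refine (lintegral_mono fun t ↦ ContinuousLinearMap.le_opENorm _ _).trans ?_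
    exact lintegral_mono_set Ioc_subset_Icc_self
  calc ∫⁻ x in A, ‖g (x + a) - g x‖ₑ
      ≤ ∫⁻ x in A, ∫⁻ t in Icc (0 : ℝ) 1, ‖fderiv ℝ g (x + t • a)‖ₑ * ‖a‖ₑ := lintegral_mono h1
    _ = ∫⁻ t in Icc (0 : ℝ) 1, ∫⁻ x in A, ‖fderiv ℝ g (x + t • a)‖ₑ * ‖a‖ₑ := by
        refine lintegral_lintegral_swap (Continuous.aemeasurable ?_)
        unfold Function.uncurry
        have : ‖a‖ₑ ≠ ⊤ := enorm_ne_top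
        fun_prop (disch := assumption)
    _ ≤ ∫⁻ t in Icc (0 : ℝ) 1, ‖a‖ₑ * ∫⁻ x in B, ‖fderiv ℝ g x‖ₑ := by
        refine setLIntegral_mono' measurableSet_Icc fun t ht ↦ ?_
        rw [lintegral_mul_const _ (by fun_prop), mul_comm]
        refine mul_le_mul_right ?_ _
        calc ∫⁻ x in A, ‖fderiv ℝ g (x + t • a)‖ₑ
            ≤ ∫⁻ x in (fun x ↦ x + t • a) ⁻¹' B, ‖fderiv ℝ g (x + t • a)‖ₑ :=
              lintegral_mono_set fun x hx ↦ hAB x hx t ht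
          _ = _ := (measurePreserving_add_right volume (t • a)).setLIntegral_comp_preimage_emb
              (measurableEmbedding_addRight _) (fun x ↦ ‖fderiv ℝ g x‖ₑ) B
    _ = _ := by simp

/-- A translation `a` of length 3ρ moves the ball of radius ρ off itself, so on this ball `h x` is
minus the increment from `x` to `x + a`, and the increment is bounded by the differential. Smooth
approximation is made on the ball of radius 4ρ, which contains the segments. -/
theorem HasWeakFDerivOn.lintegral_enorm_le_of_eq_zero (hm : 0 < m)
    {h : EuclideanSpace ℝ (Fin m) → ℝ}
    {w : EuclideanSpace ℝ (Fin m) → EuclideanSpace ℝ (Fin m) →L[ℝ] ℝ}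
    (hw : HasWeakFDerivOn univ h w) {ρ : ℝ} (hρ : 0 < ρ)
    (h0 : ∀ x ∉ Metric.closedBall (0 : EuclideanSpace ℝ (Fin m)) ρ, h x = 0) :
    ∫⁻ x, ‖h x‖ₑ ≤ ENNReal.ofReal (3 * ρ) * ∫⁻ x, ‖w x‖ₑ := by
  set a : EuclideanSpace ℝ (Fin m) := (3 * ρ) • EuclideanSpace.single ⟨0, hm⟩ 1
  have ha : ‖a‖ = 3 * ρ := by simp [a, norm_smul, abs_of_pos hρ]
  have hae : ‖a‖ₑ = ENNReal.ofReal (3 * ρ) := by rw [← ofReal_norm, ha]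
  set B := Metric.closedBall (0 : EuclideanSpace ℝ (Fin m)) ρ
  set K := Metric.closedBall (0 : EuclideanSpace ℝ (Fin m)) (4 * ρ)
  have hBK : ∀ x ∈ B, ∀ t ∈ Icc (0 : ℝ) 1, x + t • a ∈ K := fun x hx t ht ↦ by
    simp only [B, K, mem_closedBall_zero_iff] at hx ⊢
    refine (norm_add_le _ _).trans ?_
    rw [norm_smul, ha, Real.norm_of_nonneg ht.1]
    nlinarith [ht.2]
  have key : ∀ ε : ENNReal, ε ≠ 0 → ∫⁻ x, ‖h x‖ₑ ≤
      ε + (ε + ENNReal.ofReal (3 * ρ) * ((∫⁻ x, ‖w x‖ₑ) + ε)) := by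
    intro ε hε
    obtain ⟨g, hg, hgc, hg1, hg2⟩ := hw.exists_smooth_approx isOpen_univ
      (isCompact_closedBall (0 : EuclideanSpace ℝ (Fin m)) (4 * ρ)) (subset_univ _) hε
    have hg1' : ContDiff ℝ 1 g := hg.of_le (by simp)
    have hgcont := hg1'.continuous
    have hfc : Continuous (fderiv ℝ g) := hg1'.continuous_fderiv one_ne_zero
    have hhm : AEStronglyMeasurable h volume :=
      (locallyIntegrableOn_univ.1 hw.1).aestronglyMeasurable
    have hwm : AEStronglyMeasurable w volume :=
      (locallyIntegrableOn_univ.1 hw.2.1).aestronglyMeasurable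
    have e1 : ∫⁻ x, ‖h x‖ₑ = ∫⁻ x in B, ‖h x‖ₑ := by
      rw [← lintegral_indicator Metric.isClosed_closedBall.measurableSet]
      refine lintegral_congr fun x ↦ ?_
      by_cases hx : x ∈ B
      · rw [indicator_of_mem hx]
      · rw [indicator_of_notMem hx, h0 x hx, enorm_zero]
    have hBKs : B ⊆ K := Metric.closedBall_subset_closedBall (by linarith)
    have e2 : ∫⁻ x in B, ‖h x‖ₑ ≤ (∫⁻ x in B, ‖g x - h x‖ₑ) + ∫⁻ x in B, ‖g x‖ₑ := by
      rw [← lintegral_add_right _ hgcont.enorm.measurable]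
      refine lintegral_mono fun x ↦ ?_
      have : h x = -(g x - h x) + g x := by ring
      calc ‖h x‖ₑ = ‖-(g x - h x) + g x‖ₑ := by rw [← this]
        _ ≤ _ := (enorm_add_le _ _).trans (by rw [enorm_neg])
    have e3 : ∫⁻ x in B, ‖g x‖ₑ ≤ (∫⁻ x in B, ‖g (x + a)‖ₑ) + ∫⁻ x in B, ‖g (x + a) - g x‖ₑ := by
      rw [← lintegral_add_left (Continuous.measurable (by fun_prop))]
      refine lintegral_mono fun x ↦ ?_
      have : g x = g (x + a) + -(g (x + a) - g x) := by ring
      calc ‖g x‖ₑ = ‖g (x + a) + -(g (x + a) - g x)‖ₑ := by rw [← this]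
        _ ≤ _ := (enorm_add_le _ _).trans (by rw [enorm_neg])
    have e4 : ∫⁻ x in B, ‖g (x + a)‖ₑ ≤ ∫⁻ x in K, ‖g x - h x‖ₑ := by
      have h3 : ∀ x ∈ B, ‖g (x + a)‖ₑ = ‖g (x + a) - h (x + a)‖ₑ := fun x hx ↦ by
        rw [h0 (x + a), sub_zero]
        simp only [B, mem_closedBall_zero_iff, not_le] at hx ⊢
        have := norm_sub_norm_le a (-x)
        rw [norm_neg, sub_neg_eq_add, ha, add_comm a] at this
        linarith
      rw [setLIntegral_congr_fun Metric.isClosed_closedBall.measurableSet h3]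
      calc _ ≤ ∫⁻ x in (fun x ↦ x + a) ⁻¹' K, ‖g (x + a) - h (x + a)‖ₑ :=
            lintegral_mono_set fun x hx ↦ by simpa using hBK x hx 1 (by simp)
        _ = _ := (measurePreserving_add_right volume a).setLIntegral_comp_preimage_emb
            (measurableEmbedding_addRight _) (fun x ↦ ‖g x - h x‖ₑ) K
    have e5 := lintegral_enorm_comp_add_sub_le hg1' a hBK
    have e6 : ∫⁻ x in K, ‖fderiv ℝ g x‖ₑ ≤ (∫⁻ x, ‖w x‖ₑ) + ε := by
      calc _ ≤ ∫⁻ x in K, (‖w x‖ₑ + ‖fderiv ℝ g x - w x‖ₑ) := by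
            refine lintegral_mono fun x ↦ ?_
            have : fderiv ℝ g x = w x + (fderiv ℝ g x - w x) := by abel
            calc ‖fderiv ℝ g x‖ₑ = ‖w x + (fderiv ℝ g x - w x)‖ₑ := by rw [← this]
              _ ≤ _ := enorm_add_le (w x) (fderiv ℝ g x - w x)
        _ = (∫⁻ x in K, ‖w x‖ₑ) + ∫⁻ x in K, ‖fderiv ℝ g x - w x‖ₑ :=
            lintegral_add_left' hwm.enorm.restrict _
        _ ≤ _ := add_le_add (setLIntegral_le_lintegral _ _) hg2
    rw [e1]
    refine e2.trans (add_le_add ((lintegral_mono_set hBKs).trans hg1) (e3.trans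
      (add_le_add (e4.trans hg1) (e5.trans ?_))))
    rw [hae]
    gcongr
  have h1 : Tendsto (fun ε : ENNReal ↦ ε + (ε + ENNReal.ofReal (3 * ρ) * ((∫⁻ x, ‖w x‖ₑ) + ε)))
      (𝓝[≠] 0) (𝓝 (0 + (0 + ENNReal.ofReal (3 * ρ) * ((∫⁻ x, ‖w x‖ₑ) + 0)))) := by
    refine Tendsto.mono_left ?_ nhdsWithin_le_nhds
    refine tendsto_id.add (tendsto_id.add (ENNReal.Tendsto.const_mul
      (tendsto_const_nhds.add tendsto_id) (Or.inr ENNReal.ofReal_ne_top)))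
  have : (𝓝[≠] (0 : ENNReal)).NeBot := inferInstance
  have h2 := ge_of_tendsto h1 (eventually_mem_nhdsWithin.mono fun ε hε ↦ key ε hε)
  simpa using h2

end WeakDerivatives

/-! ### Calculus with bounded tests, and the passage to all Lipschitz tests -/

section BoundedTestsCalculus

open scoped NNReal

variable {m n : ℕ} {N : Type*} [EMetricSpace N] [ChartedSpace (EuclideanSpace ℝ (Fin n)) N]

theorem HasBddWeakMFDerivOn.of_locally {A : Set (EuclideanSpace ℝ (Fin m))}
    {u : EuclideanSpace ℝ (Fin m) → N}
    {D : EuclideanSpace ℝ (Fin m) → EuclideanSpace ℝ (Fin m) →L[ℝ] EuclideanSpace ℝ (Fin n)}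
    (H : ∀ x ∈ A, ∃ V ∈ 𝓝 x, HasBddWeakMFDerivOn V u D) : HasBddWeakMFDerivOn A u D :=
  fun f h1 h2 h3 ↦ .of_locally fun x hx ↦ (H x hx).imp fun _ hV ↦ ⟨hV.1, hV.2 f h1 h2 h3⟩

theorem HasBddWeakMFDerivOn.comp {A A' : Set (EuclideanSpace ℝ (Fin m))}
    {u : EuclideanSpace ℝ (Fin m) → N}
    {D : EuclideanSpace ℝ (Fin m) → EuclideanSpace ℝ (Fin m) →L[ℝ] EuclideanSpace ℝ (Fin n)}
    (h : HasBddWeakMFDerivOn A u D) (hA : IsOpen A)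
    {φ : EuclideanSpace ℝ (Fin m) → EuclideanSpace ℝ (Fin m)} (hφ : MapsTo φ A' A)
    (hloc : ∀ x ∈ A', ∃ V ∈ 𝓝 x, ∃ L C : ℝ≥0, LipschitzOnWith L φ V ∧
      ∀ S, volume (φ ⁻¹' S ∩ V) ≤ C * volume S) :
    HasBddWeakMFDerivOn A' (fun x ↦ u (φ x)) (fun x ↦ (D (φ x)).comp (fderiv ℝ φ x)) :=
  fun f h1 h2 h3 ↦ (h f h1 h2 h3).comp hA hφ hloc

theorem HasBddWeakMFDerivOn.congr {A : Set (EuclideanSpace ℝ (Fin m))} (hA : IsOpen A)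
    {u u' : EuclideanSpace ℝ (Fin m) → N}
    {D D' : EuclideanSpace ℝ (Fin m) → EuclideanSpace ℝ (Fin m) →L[ℝ] EuclideanSpace ℝ (Fin n)}
    (h : HasBddWeakMFDerivOn A u D) (hu : EqOn u u' A) (hD : EqOn D D' A) :
    HasBddWeakMFDerivOn A u' D' := by
  intro f h1 h2 h3
  refine (h f h1 h2 h3).congr_ae hA ?_ ?_
  · filter_upwards [ae_restrict_mem hA.measurableSet] with x hx
    rw [hu hx]
  · filter_upwards [ae_restrict_mem hA.measurableSet] with x hx
    rw [hu hx, hD hx]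

theorem hasBddWeakMFDerivOn_of_eq_const {A : Set (EuclideanSpace ℝ (Fin m))} (hA : IsOpen A)
    {u : EuclideanSpace ℝ (Fin m) → N} {b : N} (hu : ∀ x ∈ A, u x = b)
    {D : EuclideanSpace ℝ (Fin m) → EuclideanSpace ℝ (Fin m) →L[ℝ] EuclideanSpace ℝ (Fin n)}
    (hD : ∀ x ∈ A, D x = 0) : HasBddWeakMFDerivOn A u D := by
  have : HasBddWeakMFDerivOn A (fun _ ↦ b) (fun _ : EuclideanSpace ℝ (Fin m) ↦
      (0 : EuclideanSpace ℝ (Fin m) →L[ℝ] EuclideanSpace ℝ (Fin n))) := by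
    intro f _ _ _
    have := (LipschitzWith.const (α := EuclideanSpace ℝ (Fin m)) (f b)).hasWeakFDerivOn A
    simp only [fderiv_fun_const] at this
    simp only [ContinuousLinearMap.comp_zero]
    exact this
  exact this.congr hA (fun x hx ↦ (hu x hx).symm) (fun x hx ↦ (hD x hx).symm)

/-- The differential may be assumed to vanish on an open set where the map is constant. -/
theorem HasBddWeakMFDerivOn.indicator_compl {A O : Set (EuclideanSpace ℝ (Fin m))} (hA : IsOpen A)
    {u : EuclideanSpace ℝ (Fin m) → N}
    {D : EuclideanSpace ℝ (Fin m) → EuclideanSpace ℝ (Fin m) →L[ℝ] EuclideanSpace ℝ (Fin n)}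
    (h : HasBddWeakMFDerivOn A u D) (hO : IsOpen O) (hOA : O ⊆ A) {b : N} (hb : ∀ x ∈ O, u x = b) :
    HasBddWeakMFDerivOn A u (Oᶜ.indicator D) := by
  intro f h1 h2 h3
  have h4 := h f h1 h2 h3
  have h5 := h4.ae_eq_zero_of_eq_const hO hOA (c := f b) fun x hx ↦ by simp [hb x hx]
  refine h4.congr_ae hA .rfl ?_
  rw [ae_restrict_iff' hO.measurableSet] at h5
  filter_upwards [ae_restrict_of_ae h5] with x hx
  by_cases hxO : x ∈ O
  · rw [hx hxO, indicator_of_notMem (by simpa using hxO)]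
    simp
  · rw [indicator_of_mem hxO]

/-- `g ∘ f` is a bounded test even if `f` is not bounded. -/
theorem HasBddWeakMFDerivOn.real_comp {A : Set (EuclideanSpace ℝ (Fin m))}
    {u : EuclideanSpace ℝ (Fin m) → N}
    {D : EuclideanSpace ℝ (Fin m) → EuclideanSpace ℝ (Fin m) →L[ℝ] EuclideanSpace ℝ (Fin n)}
    (h : HasBddWeakMFDerivOn A u D) {f : N → ℝ} (hf : ContMDiff (𝓡 n) 𝓘(ℝ, ℝ) ∞ f)
    (hfl : ∃ K, LipschitzWith K f) {g : ℝ → ℝ} (hg : ContDiff ℝ ∞ g) (hgl : ∃ K, LipschitzWith K g)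
    (hgb : ∃ c, ∀ t, |g t| ≤ c) :
    HasWeakFDerivOn A (fun x ↦ g (f (u x)))
      (fun x ↦ deriv g (f (u x)) • (mfderivReal n f (u x)).comp (D x)) := by
  obtain ⟨K, hK⟩ := hfl
  obtain ⟨K', hK'⟩ := hgl
  obtain ⟨c, hc⟩ := hgb
  have h1 := h (g ∘ f) (hg.contMDiff.comp hf) ⟨_, hK'.comp hK⟩ ⟨c, fun y ↦ hc _⟩
  have h2 : ∀ x, mfderivReal n (g ∘ f) (u x) = deriv g (f (u x)) • mfderivReal n f (u x) :=
    fun x ↦ mfderivReal_real_comp hf (hg.differentiable (by simp)) _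
  simp only [h2, ContinuousLinearMap.smul_comp] at h1
  exact h1

variable [RiemannianBundle (fun y : N ↦ TangentSpace (𝓡 n) y)]

@[simp] theorem tangentMapENorm_zero (y : N) :
    tangentMapENorm y (0 : EuclideanSpace ℝ (Fin m) →L[ℝ] EuclideanSpace ℝ (Fin n)) = 0 := by
  simp [tangentMapENorm, tangentENorm_zero]

variable [IsManifold (𝓡 n) ∞ N]
  [IsContMDiffRiemannianBundle (𝓡 n) ∞ (EuclideanSpace ℝ (Fin n))
    (fun y : N ↦ TangentSpace (𝓡 n) y)] [IsRiemannianManifold (𝓡 n) N]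

theorem LipschitzWith.enorm_mfderivReal_comp_le {f : N → ℝ} {K : ℝ≥0} (hK : LipschitzWith K f)
    (hf : ContMDiff (𝓡 n) 𝓘(ℝ, ℝ) ∞ f) (y : N)
    (L : EuclideanSpace ℝ (Fin m) →L[ℝ] EuclideanSpace ℝ (Fin n)) :
    ‖(mfderivReal n f y).comp L‖ₑ ≤ K * tangentMapENorm y L := by
  refine ContinuousLinearMap.opENorm_le_bound _ fun v ↦ ?_
  refine (hK.enorm_mfderivReal_le hf y (L v)).trans ?_
  rw [mul_assoc]
  gcongr
  exact tangentENorm_apply_le y L v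

/-- Truncation of the real line at height of order `k`. -/
noncomputable def arctanTruncation (k : ℕ) (t : ℝ) : ℝ := (k + 1) * Real.arctan (t / (k + 1))

theorem contDiff_arctanTruncation (k : ℕ) : ContDiff ℝ ∞ (arctanTruncation k) := by
  unfold arctanTruncation
  have := Real.contDiff_arctan (n := ∞)
  fun_prop

theorem deriv_arctanTruncation (k : ℕ) (t : ℝ) :
    deriv (arctanTruncation k) t = 1 / (1 + (t / (k + 1)) ^ 2) := by
  have h1 : HasDerivAt (arctanTruncation k)
      ((k + 1) * (1 / (1 + (t / (k + 1)) ^ 2) * (1 / (k + 1)))) t :=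
    (((hasDerivAt_id t).div_const _).arctan).const_mul _
  rw [h1.deriv]
  have : (k : ℝ) + 1 ≠ 0 := by positivity
  field_simp

theorem norm_deriv_arctanTruncation_le (k : ℕ) (t : ℝ) : ‖deriv (arctanTruncation k) t‖ ≤ 1 := by
  rw [deriv_arctanTruncation, Real.norm_of_nonneg (by positivity), div_le_one (by positivity)]
  nlinarith [sq_nonneg (t / (k + 1))]

theorem lipschitzWith_arctanTruncation (k : ℕ) : LipschitzWith 1 (arctanTruncation k) :=
  lipschitzWith_of_nnnorm_deriv_le ((contDiff_arctanTruncation k).differentiable (by simp))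
    fun t ↦ norm_deriv_arctanTruncation_le k t

theorem arctanTruncation_zero (k : ℕ) : arctanTruncation k 0 = 0 := by simp [arctanTruncation]

theorem abs_arctanTruncation_le (k : ℕ) (t : ℝ) : |arctanTruncation k t| ≤ |t| := by
  have := (lipschitzWith_arctanTruncation k).dist_le_mul t 0
  simpa [arctanTruncation_zero] using this

theorem abs_arctanTruncation_le_const (k : ℕ) (t : ℝ) :
    |arctanTruncation k t| ≤ (k + 1) * (Real.pi / 2) := by
  unfold arctanTruncation
  rw [abs_mul, abs_of_nonneg (by positivity : (0 : ℝ) ≤ k + 1)]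
  gcongr
  exact (abs_lt.2 ⟨Real.neg_pi_div_two_lt_arctan _, Real.arctan_lt_pi_div_two _⟩).le

theorem tendsto_natCast_add_one_atTop : Tendsto (fun k : ℕ ↦ (k : ℝ) + 1) atTop atTop :=
  tendsto_atTop_add_const_right _ _ tendsto_natCast_atTop_atTop

theorem tendsto_arctanTruncation (t : ℝ) :
    Tendsto (fun k ↦ arctanTruncation k t) atTop (𝓝 t) := by
  have h1 := (Real.hasDerivAt_arctan 0).hasFDerivAt.lim t (l := atTop) (c := fun k : ℕ ↦ (k : ℝ) + 1)
    (tendsto_norm_atTop_atTop.comp tendsto_natCast_add_one_atTop)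
  simp only [zero_add, Real.arctan_zero, sub_zero, smul_eq_mul] at h1
  have h2 : ∀ k : ℕ, arctanTruncation k t = (k + 1) * Real.arctan (((k : ℝ) + 1)⁻¹ * t) :=
    fun k ↦ by rw [arctanTruncation, div_eq_inv_mul]
  simp only [h2]
  simpa using h1

theorem tendsto_deriv_arctanTruncation (t : ℝ) :
    Tendsto (fun k ↦ deriv (arctanTruncation k) t) atTop (𝓝 1) := by
  simp only [deriv_arctanTruncation]
  have h1 : Tendsto (fun k : ℕ ↦ t / ((k : ℝ) + 1)) atTop (𝓝 0) :=
    tendsto_const_nhds.div_atTop tendsto_natCast_add_one_atTop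
  have h2 : Tendsto (fun k : ℕ ↦ 1 / (1 + (t / ((k : ℝ) + 1)) ^ 2)) atTop
      (𝓝 (1 / (1 + 0 ^ 2))) :=
    tendsto_const_nhds.div (tendsto_const_nhds.add (h1.pow 2)) (by norm_num)
  simpa using h2

variable [MeasurableSpace N] [BorelSpace N]

/-- The truncations of `f - f b` give bounded tests whose compositions with `u` vanish off the ball.
The Poincaré inequality bounds them in L¹ independently of the height of the truncation, Fatou's
lemma then gives the integrability of `f ∘ u - f b`, and dominated convergence removes the
truncation. -/
theorem HasBddWeakMFDerivOn.hasWeakFDerivOn_of_lipschitzWith (hm : 0 < m)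
    {u : EuclideanSpace ℝ (Fin m) → N} (hu : Measurable u)
    {D : EuclideanSpace ℝ (Fin m) → EuclideanSpace ℝ (Fin m) →L[ℝ] EuclideanSpace ℝ (Fin n)}
    (h : HasBddWeakMFDerivOn univ u D) (hD : ∫⁻ x, tangentMapENorm (u x) (D x) ≠ ⊤)
    {b : N} {ρ : ℝ} (hρ : 0 < ρ)
    (hb : ∀ x ∉ Metric.closedBall (0 : EuclideanSpace ℝ (Fin m)) ρ, u x = b)
    {f : N → ℝ} (hf : ContMDiff (𝓡 n) 𝓘(ℝ, ℝ) ∞ f) (hfl : ∃ K, LipschitzWith K f) :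
    HasWeakFDerivOn univ (fun x ↦ f (u x)) (fun x ↦ (mfderivReal n f (u x)).comp (D x)) := by
  obtain ⟨K, hK⟩ := hfl
  set F : N → ℝ := fun y ↦ f y - f b with hF
  have hFs : ContMDiff (𝓡 n) 𝓘(ℝ, ℝ) ∞ F := hf.sub contMDiff_const
  have hFl : LipschitzWith K F := fun x y ↦ by
    simp only [F, edist_sub_right]
    exact hK x y
  set h₀ : EuclideanSpace ℝ (Fin m) → ℝ := fun x ↦ F (u x)
  set w : EuclideanSpace ℝ (Fin m) → EuclideanSpace ℝ (Fin m) →L[ℝ] ℝ :=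
    fun x ↦ (mfderivReal n f (u x)).comp (D x)
  have hw : ∀ x, (mfderivReal n F (u x)).comp (D x) = w x := fun x ↦ by
    rw [hF, mfderivReal_sub_const hf]
  have hweak : ∀ k, HasWeakFDerivOn univ (fun x ↦ arctanTruncation k (h₀ x))
      (fun x ↦ deriv (arctanTruncation k) (h₀ x) • w x) := fun k ↦ by
    have := h.real_comp hFs ⟨K, hFl⟩ (contDiff_arctanTruncation k)
      ⟨_, lipschitzWith_arctanTruncation k⟩ ⟨_, abs_arctanTruncation_le_const k⟩
    simp only [hw] at this
    exact this
  -- The constant is put back inside the test, so that the limit is `f ∘ u` itself.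
  have hweak' : ∀ k, HasWeakFDerivOn univ (fun x ↦ arctanTruncation k (h₀ x) + f b)
      (fun x ↦ deriv (arctanTruncation k) (h₀ x) • w x) := fun k ↦ by
    have hd : ∀ t, HasDerivAt (fun t ↦ arctanTruncation k t + f b)
        (deriv (arctanTruncation k) t) t := fun t ↦
      (((contDiff_arctanTruncation k).differentiable (by simp) t).hasDerivAt).add_const _
    have := h.real_comp hFs ⟨K, hFl⟩ (g := fun t ↦ arctanTruncation k t + f b)
      ((contDiff_arctanTruncation k).add contDiff_const)
      ⟨1, fun x y ↦ by simpa [edist_add_right] using lipschitzWith_arctanTruncation k x y⟩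
      ⟨(k + 1) * (Real.pi / 2) + |f b|, fun t ↦ (abs_add_le _ _).trans
        (add_le_add (abs_arctanTruncation_le_const k t) le_rfl)⟩
    simp only [hw, (hd _).deriv] at this
    exact this
  have hh₀ : Measurable h₀ := hFs.continuous.measurable.comp hu
  have hwlim : ∀ x, Tendsto (fun k ↦ deriv (arctanTruncation k) (h₀ x) • w x) atTop (𝓝 (w x)) :=
    fun x ↦ by simpa using (tendsto_deriv_arctanTruncation (h₀ x)).smul_const (w x)
  have hwk : ∀ k, AEStronglyMeasurable (fun x ↦ deriv (arctanTruncation k) (h₀ x) • w x) volume :=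
    fun k ↦ (locallyIntegrableOn_univ.1 (hweak k).2.1).aestronglyMeasurable
  have hwm : AEStronglyMeasurable w volume :=
    aestronglyMeasurable_of_tendsto_ae atTop hwk (Eventually.of_forall hwlim)
  have hwle : ∀ k x, ‖deriv (arctanTruncation k) (h₀ x) • w x‖ ≤ ‖w x‖ := fun k x ↦ by
    rw [norm_smul]
    exact mul_le_of_le_one_left (norm_nonneg _) (norm_deriv_arctanTruncation_le k _)
  have hwfin : ∫⁻ x, ‖w x‖ₑ ≠ ⊤ := by
    refine ne_top_of_le_ne_top (ENNReal.mul_ne_top (ENNReal.coe_ne_top (r := K)) hD) ?_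
    rw [← lintegral_const_mul' _ _ ENNReal.coe_ne_top]
    exact lintegral_mono fun x ↦ hK.enorm_mfderivReal_comp_le hf _ _
  have hwi : Integrable w := ⟨hwm, hwfin.lt_top⟩
  have hhk : ∀ k, ∫⁻ x, ‖arctanTruncation k (h₀ x)‖ₑ ≤ ENNReal.ofReal (3 * ρ) * ∫⁻ x, ‖w x‖ₑ := by
    intro k
    refine ((hweak k).lintegral_enorm_le_of_eq_zero hm hρ fun x hx ↦ ?_).trans ?_
    · simp [h₀, F, hb x hx, arctanTruncation_zero]
    · gcongr with x
      exact enorm_le_iff_norm_le.2 (hwle k x)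
  have hhi : Integrable h₀ := by
    refine ⟨hh₀.aestronglyMeasurable, ?_⟩
    have h1 : ∀ x, liminf (fun k ↦ ‖arctanTruncation k (h₀ x)‖ₑ) atTop = ‖h₀ x‖ₑ := fun x ↦
      ((tendsto_arctanTruncation (h₀ x)).enorm).liminf_eq
    have h2 := lintegral_liminf_le (μ := volume) (u := atTop)
      (f := fun k x ↦ ‖arctanTruncation k (h₀ x)‖ₑ) fun k ↦
        (((contDiff_arctanTruncation k).continuous.measurable.comp hh₀).enorm)
    simp only [h1] at h2
    exact (h2.trans (liminf_le_of_frequently_le' (Eventually.of_forall hhk).frequently)).trans_lt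
      (ENNReal.mul_lt_top ENNReal.ofReal_lt_top hwfin.lt_top)
  refine HasWeakFDerivOn.of_tendsto (l := atTop) (Eventually.of_forall hweak') ?_
    (hwi.locallyIntegrable.locallyIntegrableOn _) ?_ ?_
  · have : (fun x ↦ f (u x)) = fun x ↦ h₀ x + f b := by
      ext x
      simp [h₀, F]
    rw [this]
    exact (hhi.locallyIntegrable.add (locallyIntegrable_const _)).locallyIntegrableOn _
  · intro K _ _
    have h1 := tendsto_lintegral_norm_of_dominated_convergence (μ := volume)
      (F := fun k x ↦ arctanTruncation k (h₀ x)) (f := h₀) (bound := fun x ↦ ‖h₀ x‖)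
      (fun k ↦ (locallyIntegrableOn_univ.1 (hweak k).1).aestronglyMeasurable)
      hhi.norm.2 (fun k ↦ Eventually.of_forall fun x ↦ abs_arctanTruncation_le k _)
      (Eventually.of_forall fun x ↦ tendsto_arctanTruncation _)
    refine tendsto_of_tendsto_of_tendsto_of_le_of_le tendsto_const_nhds h1 (fun _ ↦ zero_le)
      fun k ↦ ?_
    refine (setLIntegral_le_lintegral _ _).trans (lintegral_mono fun x ↦ ?_)
    rw [ofReal_norm]
    simp [h₀, F, sub_sub_eq_add_sub, add_sub_assoc]
  · intro K _ _
    have h1 := tendsto_lintegral_norm_of_dominated_convergence (μ := volume)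
      (F := fun k x ↦ deriv (arctanTruncation k) (h₀ x) • w x) (f := w) (bound := fun x ↦ ‖w x‖)
      hwk hwi.norm.2 (fun k ↦ Eventually.of_forall fun x ↦ hwle k x)
      (Eventually.of_forall hwlim)
    refine tendsto_of_tendsto_of_tendsto_of_le_of_le tendsto_const_nhds h1 (fun _ ↦ zero_le)
      fun k ↦ ?_
    refine (setLIntegral_le_lintegral _ _).trans (lintegral_mono fun x ↦ ?_)
    rw [ofReal_norm]

end BoundedTestsCalculus

/-! ### Maps that do not concentrate the Hausdorff measure -/

section AntilipschitzOn

open scoped NNReal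

/-- In the subtype `P` the map is antilipschitz on a whole space, and the inclusion of `P` is an
isometry. -/
theorem euclideanHausdorffMeasure_preimage_inter_le {X Y : Type*} [EMetricSpace X]
    [MeasurableSpace X] [BorelSpace X] [EMetricSpace Y] [MeasurableSpace Y] [BorelSpace Y]
    {P : Set X} {g : X → Y} {K : ℝ≥0}
    (h : ∀ x ∈ P, ∀ y ∈ P, edist x y ≤ K * edist (g x) (g y)) (d : ℕ) (S : Set Y) :
    (μHE[d] : Measure X) (g ⁻¹' S ∩ P) ≤ (K ^ d : ℝ≥0) * (μHE[d] : Measure Y) S := by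
  have h1 : AntilipschitzWith K (fun x : P ↦ g x) := fun x y ↦ h x x.2 y y.2
  have h2 := h1.hausdorffMeasure_preimage_le (d := d) (by positivity) S
  have h3 : g ⁻¹' S ∩ P = Subtype.val '' ((fun x : P ↦ g x) ⁻¹' S) := by
    ext x
    simp [and_comm]
  have h4 := (isometry_subtype_coe (s := P)).hausdorffMeasure_image (d := d) (Or.inl (by positivity))
    ((fun x : P ↦ g x) ⁻¹' S)
  rw [euclideanHausdorffMeasure_def, euclideanHausdorffMeasure_def, Measure.smul_apply,
    Measure.smul_apply, h3, h4, ENNReal.smul_def, ENNReal.smul_def, smul_eq_mul, smul_eq_mul,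
    mul_left_comm]
  gcongr
  refine h2.trans_eq ?_
  simp [ENNReal.rpow_natCast]

theorem volume_preimage_inter_le {m : ℕ} {P : Set (EuclideanSpace ℝ (Fin m))}
    {g : EuclideanSpace ℝ (Fin m) → EuclideanSpace ℝ (Fin m)} {K : ℝ≥0}
    (h : ∀ x ∈ P, ∀ y ∈ P, edist x y ≤ K * edist (g x) (g y))
    (S : Set (EuclideanSpace ℝ (Fin m))) :
    volume (g ⁻¹' S ∩ P) ≤ (K ^ m : ℝ≥0) * volume S := by
  have := euclideanHausdorffMeasure_preimage_inter_le h m S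
  rwa [EuclideanSpace.euclideanHausdorffMeasure_eq_volume] at this

theorem lintegral_comp_le_of_measure_preimage_le {X Y : Type*} [MeasurableSpace X]
    [MeasurableSpace Y] {μ : Measure X} {ν : Measure Y} {g : X → Y} (hg : Measurable g) {C : ℝ≥0}
    (h : ∀ S, MeasurableSet S → μ (g ⁻¹' S) ≤ C * ν S) {G : Y → ENNReal} (hG : AEMeasurable G ν) :
    ∫⁻ x, G (g x) ∂μ ≤ C * ∫⁻ y, G y ∂ν := by
  have h1 : μ.map g ≤ C • ν := Measure.le_iff.2 fun S hS ↦ by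
    rw [Measure.map_apply hg hS]
    exact h S hS
  have h2 : AEMeasurable G (μ.map g) := (hG.smul_measure C).mono_measure h1
  calc ∫⁻ x, G (g x) ∂μ = ∫⁻ y, G y ∂(μ.map g) := (lintegral_map' h2 hg.aemeasurable).symm
    _ ≤ ∫⁻ y, G y ∂(C • ν) := lintegral_mono' h1 le_rfl
    _ = _ := by rw [lintegral_smul_measure, ENNReal.smul_def, smul_eq_mul]

end AntilipschitzOn

/-! ### Radial collapsing maps -/

section Collapse

open scoped NNReal

variable {m : ℕ}

/-- The radial profile of the maps `collapse ε`. -/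
noncomputable def collapseProfile (ε t : ℝ) : ℝ := max ε (min 1 (3 - 2 * t))

/-- The map that is the identity on the unit ball and the homothety of ratio `ε` far away. -/
noncomputable def collapse (ε : ℝ) (x : EuclideanSpace ℝ (Fin m)) : EuclideanSpace ℝ (Fin m) :=
  collapseProfile ε ‖x‖ • x

theorem le_collapseProfile (ε t : ℝ) : ε ≤ collapseProfile ε t := le_max_left _ _

theorem collapseProfile_le_one {ε : ℝ} (hε : ε ≤ 1) (t : ℝ) : collapseProfile ε t ≤ 1 :=
  max_le hε (min_le_left _ _)

theorem collapseProfile_of_le_one {ε t : ℝ} (hε : ε ≤ 1) (ht : t ≤ 1) : collapseProfile ε t = 1 := by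
  rw [collapseProfile, min_eq_left (by linarith), max_eq_right hε]

theorem collapseProfile_of_le {ε t : ℝ} (ht : 1 ≤ t) (h : ε ≤ 3 - 2 * t) :
    collapseProfile ε t = 3 - 2 * t := by
  rw [collapseProfile, min_eq_right (by linarith), max_eq_right h]

theorem collapseProfile_of_ge {ε t : ℝ} (h : 3 - 2 * t ≤ ε) :
    collapseProfile ε t = ε := by
  rw [collapseProfile, max_eq_left ((min_le_right _ _).trans h)]

theorem abs_collapseProfile_sub_le (ε t t' : ℝ) :
    |collapseProfile ε t - collapseProfile ε t'| ≤ 2 * |t - t'| := by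
  have h1 : |max ε (min 1 (3 - 2 * t)) - max ε (min 1 (3 - 2 * t'))| ≤
      max |ε - ε| |min 1 (3 - 2 * t) - min 1 (3 - 2 * t')| := abs_max_sub_max_le_max _ _ _ _
  have h2 : |min 1 (3 - 2 * t) - min 1 (3 - 2 * t')| ≤
      max |(1 : ℝ) - 1| |(3 - 2 * t) - (3 - 2 * t')| := abs_min_sub_min_le_max _ _ _ _
  have h3 : |(3 - 2 * t) - (3 - 2 * t')| = 2 * |t - t'| := by
    rw [show (3 - 2 * t) - (3 - 2 * t') = 2 * (t' - t) by ring, abs_mul, abs_sub_comm]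
    norm_num
  simp only [sub_self, abs_zero, h3] at h1 h2
  have h4 : (0 : ℝ) ≤ 2 * |t - t'| := by positivity
  rw [max_eq_right h4] at h2
  exact h1.trans (max_le h4 h2)

/-- With ‖x‖ ≤ ‖y‖, the profile takes different values only if ‖x‖ ≤ 3/2; its slope 2 then
contributes 2 · 3/2 = 3, and the scaling factor contributes 1. -/
theorem lipschitzWith_collapse {ε : ℝ} (h0 : 0 ≤ ε) (hε : ε ≤ 1) :
    LipschitzWith 4 (collapse (m := m) ε) := by
  have key : ∀ x y : EuclideanSpace ℝ (Fin m), ‖x‖ ≤ ‖y‖ →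
      ‖collapse ε x - collapse ε y‖ ≤ 4 * ‖x - y‖ := by
    intro x y hxy
    have h1 : collapse ε x - collapse ε y =
        (collapseProfile ε ‖x‖ - collapseProfile ε ‖y‖) • x + collapseProfile ε ‖y‖ • (x - y) := by
      simp only [collapse, sub_smul, smul_sub]
      abel
    have h2 : |collapseProfile ε ‖x‖ - collapseProfile ε ‖y‖| * ‖x‖ ≤ 3 * ‖x - y‖ := by
      rcases le_or_gt ‖x‖ (3 / 2) with h | h
      · have h3 := abs_collapseProfile_sub_le ε ‖x‖ ‖y‖
        have h4 := abs_norm_sub_norm_le x y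
        calc _ ≤ (2 * ‖x - y‖) * (3 / 2) := by gcongr; linarith
          _ = _ := by ring
      · rw [collapseProfile_of_ge (by linarith), collapseProfile_of_ge (by linarith)]
        simp
    rw [h1]
    refine (norm_add_le _ _).trans ?_
    rw [norm_smul, norm_smul, Real.norm_eq_abs, Real.norm_of_nonneg
      (h0.trans (le_collapseProfile _ _))]
    have := mul_le_mul_of_nonneg_right (collapseProfile_le_one hε ‖y‖) (norm_nonneg (x - y))
    linarith
  refine LipschitzWith.of_dist_le_mul fun x y ↦ ?_
  rw [dist_eq_norm, dist_eq_norm]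
  rcases le_total ‖x‖ ‖y‖ with h | h
  · exact key x y h
  · rw [norm_sub_rev, norm_sub_rev x]
    exact key y x h

theorem collapse_of_norm_le_one {ε : ℝ} (hε : ε ≤ 1) {x : EuclideanSpace ℝ (Fin m)} (hx : ‖x‖ ≤ 1) :
    collapse ε x = x := by
  rw [collapse, collapseProfile_of_le_one hε hx, one_smul]

theorem collapse_of_ge {ε : ℝ} {x : EuclideanSpace ℝ (Fin m)} (hx : 3 - 2 * ‖x‖ ≤ ε) :
    collapse ε x = ε • x := by
  rw [collapse, collapseProfile_of_ge hx]

theorem collapse_eq_collapse_zero {ε : ℝ} (h0 : 0 ≤ ε) (h1 : ε ≤ 1) {x : EuclideanSpace ℝ (Fin m)}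
    (hx : ε ≤ 3 - 2 * ‖x‖) : collapse ε x = collapse 0 x := by
  rw [collapse, collapse, collapseProfile, collapseProfile, max_eq_right (le_min h1 hx),
    max_eq_right (le_min zero_le_one (h0.trans hx))]

theorem norm_collapse_le {ε : ℝ} (h0 : 0 ≤ ε) (hε : ε ≤ 1) (x : EuclideanSpace ℝ (Fin m)) :
    ‖collapse ε x‖ ≤ max 1 (ε * ‖x‖) := by
  rw [collapse, norm_smul, Real.norm_of_nonneg (h0.trans (le_collapseProfile _ _))]
  rcases le_or_gt ‖x‖ 1 with h | h
  · rw [collapseProfile_of_le_one hε h, one_mul]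
    exact le_max_of_le_left h
  rcases le_total ε (3 - 2 * ‖x‖) with h' | h'
  · rw [collapseProfile_of_le h.le h']
    exact le_max_of_le_left (by nlinarith)
  · rw [collapseProfile_of_ge h']
    exact le_max_right _ _

theorem norm_collapse_half_le {x : EuclideanSpace ℝ (Fin m)} (hx : ‖x‖ ≤ 2) :
    ‖collapse (1 / 2) x‖ ≤ 1 :=
  (norm_collapse_le (by norm_num) (by norm_num) x).trans (max_le le_rfl (by linarith))

theorem edist_le_mul_edist_of_norm_le {K : ℝ} (hK : 0 ≤ K) {x y x' y' : EuclideanSpace ℝ (Fin m)}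
    (h : ‖x - y‖ ≤ K * ‖x' - y'‖) : edist x y ≤ K.toNNReal * edist x' y' := by
  rw [edist_dist, edist_dist, dist_eq_norm, dist_eq_norm]
  refine (ENNReal.ofReal_le_ofReal h).trans ?_
  rw [ENNReal.ofReal_mul hK]
  rfl

/-- On this shell the radius t becomes t (3 - 2t). The radial part of the distance is multiplied by
|3 - 2s - 2t| ≥ 1, as s, t ≥ 1, and the angular part by √((3 - 2s)(3 - 2t)) ≥ ε. -/
theorem norm_sub_le_of_collapse {ε : ℝ} (h0 : 0 < ε) (hε : ε ≤ 1) {x y : EuclideanSpace ℝ (Fin m)}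
    (hx1 : 1 ≤ ‖x‖) (hx : ε ≤ 3 - 2 * ‖x‖) (hy1 : 1 ≤ ‖y‖) (hy : ε ≤ 3 - 2 * ‖y‖) :
    ‖x - y‖ ≤ ε⁻¹ * ‖collapse ε x - collapse ε y‖ := by
  rw [collapse, collapse, collapseProfile_of_le hx1 hx, collapseProfile_of_le hy1 hy]
  set s := ‖x‖
  set t := ‖y‖
  have h1 : ‖(3 - 2 * s) • x - (3 - 2 * t) • y‖ ^ 2 = (3 - 2 * s) ^ 2 * s ^ 2 -
      2 * ((3 - 2 * s) * (3 - 2 * t)) * inner ℝ x y + (3 - 2 * t) ^ 2 * t ^ 2 := by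
    rw [norm_sub_sq_real, norm_smul, norm_smul, real_inner_smul_left, real_inner_smul_right,
      mul_pow, mul_pow, Real.norm_eq_abs, Real.norm_eq_abs, sq_abs, sq_abs]
    ring
  have h2 : ‖x - y‖ ^ 2 = s ^ 2 - 2 * inner ℝ x y + t ^ 2 := norm_sub_sq_real x y
  have h3 : inner ℝ x y ≤ s * t := real_inner_le_norm x y
  have h4 : (ε * ‖x - y‖) ^ 2 ≤ ‖(3 - 2 * s) • x - (3 - 2 * t) • y‖ ^ 2 := by
    rw [mul_pow, h1, h2]
    have e1 : ε ^ 2 ≤ (3 - 2 * s) * (3 - 2 * t) := by nlinarith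
    have e2 : (1 : ℝ) ≤ (3 - 2 * s - 2 * t) ^ 2 := by nlinarith
    have e3 : ε ^ 2 ≤ 1 := by nlinarith
    have e4 : ε ^ 2 * (s * t - inner ℝ x y) ≤ ((3 - 2 * s) * (3 - 2 * t)) * (s * t - inner ℝ x y) :=
      mul_le_mul_of_nonneg_right e1 (by linarith)
    have e5 : ε ^ 2 * (s - t) ^ 2 ≤ (3 - 2 * s - 2 * t) ^ 2 * (s - t) ^ 2 :=
      mul_le_mul_of_nonneg_right (e3.trans e2) (sq_nonneg _)
    nlinarith
  have h5 := abs_le_of_sq_le_sq' h4 (norm_nonneg _)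
  rw [inv_mul_eq_div, le_div_iff₀ h0]
  linarith [h5.2]

/-- The map folds the shell back over the ball, so it is not injective; but on the ball, on the
shell and on the exterior it contracts distances by ε at worst, and the three contributions are
added. -/
theorem exists_volume_preimage_collapse_le {ε : ℝ} (h0 : 0 < ε) (hε : ε ≤ 1) :
    ∃ C : ℝ≥0, ∀ S : Set (EuclideanSpace ℝ (Fin m)), volume (collapse ε ⁻¹' S) ≤ C * volume S := by
  set P₁ : Set (EuclideanSpace ℝ (Fin m)) := {x | ‖x‖ ≤ 1}
  set P₂ : Set (EuclideanSpace ℝ (Fin m)) := {x | 1 ≤ ‖x‖ ∧ ε ≤ 3 - 2 * ‖x‖}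
  set P₃ : Set (EuclideanSpace ℝ (Fin m)) := {x | 3 - 2 * ‖x‖ ≤ ε}
  have hinv : (1 : ℝ) ≤ ε⁻¹ := (one_le_inv₀ h0).2 hε
  have h1 : ∀ x ∈ P₁, ∀ y ∈ P₁, edist x y ≤ (ε⁻¹).toNNReal * edist (collapse ε x) (collapse ε y) := by
    intro x hx y hy
    refine edist_le_mul_edist_of_norm_le (by positivity) ?_
    rw [collapse_of_norm_le_one hε hx, collapse_of_norm_le_one hε hy]
    exact le_mul_of_one_le_left (norm_nonneg _) hinv
  have h2 : ∀ x ∈ P₂, ∀ y ∈ P₂, edist x y ≤ (ε⁻¹).toNNReal * edist (collapse ε x) (collapse ε y) :=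
    fun x hx y hy ↦ edist_le_mul_edist_of_norm_le (by positivity)
      (norm_sub_le_of_collapse h0 hε hx.1 hx.2 hy.1 hy.2)
  have h3 : ∀ x ∈ P₃, ∀ y ∈ P₃, edist x y ≤ (ε⁻¹).toNNReal * edist (collapse ε x) (collapse ε y) := by
    intro x hx y hy
    refine edist_le_mul_edist_of_norm_le (by positivity) ?_
    rw [collapse_of_ge hx, collapse_of_ge hy, ← smul_sub, norm_smul, Real.norm_of_nonneg h0.le,
      inv_mul_cancel_left₀ h0.ne']
  refine ⟨3 * (ε⁻¹).toNNReal ^ m, fun S ↦ ?_⟩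
  have h4 : collapse ε ⁻¹' S ⊆ (collapse ε ⁻¹' S ∩ P₁) ∪
      ((collapse ε ⁻¹' S ∩ P₂) ∪ (collapse ε ⁻¹' S ∩ P₃)) := by
    intro x hx
    rcases le_total ‖x‖ 1 with h | h
    · exact Or.inl ⟨hx, h⟩
    rcases le_total ε (3 - 2 * ‖x‖) with h' | h'
    · exact Or.inr (Or.inl ⟨hx, h, h'⟩)
    · exact Or.inr (Or.inr ⟨hx, h'⟩)
  refine (measure_mono h4).trans ((measure_union_le _ _).trans ?_)
  refine (add_le_add (volume_preimage_inter_le h1 S) ((measure_union_le _ _).trans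
    (add_le_add (volume_preimage_inter_le h2 S) (volume_preimage_inter_le h3 S)))).trans
    (le_of_eq ?_)
  push_cast
  ring

end Collapse

/-! ### Opening maps and averaging -/

section Opening

open scoped NNReal

variable {m : ℕ}

/-- The opening maps: the identity on the unit ball, close to the constant `a` far away. -/
noncomputable def opening (ε : ℝ) (a x : EuclideanSpace ℝ (Fin m)) : EuclideanSpace ℝ (Fin m) :=
  -- The inner map fixes the ball of radius 5/4 about `a`, which contains the unit ball if ‖a‖ ≤
  -- 1/4. Its values have norm at most 1/4 + 5/4 < 2 as long as ε ‖x - a‖ ≤ 5/4, and the outer map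
  -- sends the ball of radius 2 into the closed unit ball. For fixed x - a, the argument of the
  -- outer map is a translate of `a`, as averaging requires.
  collapse (1 / 2) (a + (5 / 4 : ℝ) • collapse ε ((4 / 5 : ℝ) • (x - a)))

theorem lipschitzWith_opening {ε : ℝ} (h0 : 0 ≤ ε) (h1 : ε ≤ 1) (a : EuclideanSpace ℝ (Fin m)) :
    LipschitzWith 16 (opening ε a) := by
  have e1 : LipschitzWith 4 (collapse (m := m) (1 / 2)) :=
    lipschitzWith_collapse (by norm_num) (by norm_num)
  have e2 : LipschitzWith 4 (collapse (m := m) ε) := lipschitzWith_collapse h0 h1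
  refine LipschitzWith.of_dist_le_mul fun x y ↦ ?_
  have e3 := e1.dist_le_mul (a + (5 / 4 : ℝ) • collapse ε ((4 / 5 : ℝ) • (x - a)))
    (a + (5 / 4 : ℝ) • collapse ε ((4 / 5 : ℝ) • (y - a)))
  have e4 := e2.dist_le_mul ((4 / 5 : ℝ) • (x - a)) ((4 / 5 : ℝ) • (y - a))
  simp only [dist_add_left, dist_smul₀, dist_sub_right] at e3 e4
  norm_num at e3 e4 ⊢
  change dist (collapse (1 / 2) _) (collapse (1 / 2) _) ≤ _
  norm_num at e3 e4 ⊢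
  linarith

theorem continuous_uncurry_opening {ε : ℝ} (h0 : 0 ≤ ε) (h1 : ε ≤ 1) :
    Continuous fun q : EuclideanSpace ℝ (Fin m) × EuclideanSpace ℝ (Fin m) ↦ opening ε q.1 q.2 := by
  have e1 : Continuous (collapse (m := m) (1 / 2)) :=
    (lipschitzWith_collapse (by norm_num) (by norm_num)).continuous
  have e2 : Continuous (collapse (m := m) ε) := (lipschitzWith_collapse h0 h1).continuous
  unfold opening
  fun_prop

theorem norm_opening_aux {ε : ℝ} (h0 : 0 ≤ ε) (h1 : ε ≤ 1) {a x : EuclideanSpace ℝ (Fin m)}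
    (ha : ‖a‖ ≤ 1 / 4) (hx : ε * ‖x - a‖ ≤ 5 / 4) :
    ‖a + (5 / 4 : ℝ) • collapse ε ((4 / 5 : ℝ) • (x - a))‖ ≤ 3 / 2 := by
  have e1 := norm_collapse_le h0 h1 ((4 / 5 : ℝ) • (x - a))
  have e2 : max 1 (ε * ‖(4 / 5 : ℝ) • (x - a)‖) ≤ 1 := by
    refine max_le le_rfl ?_
    rw [norm_smul, Real.norm_of_nonneg (by norm_num)]
    linarith
  refine (norm_add_le _ _).trans ?_
  rw [norm_smul, Real.norm_of_nonneg (by norm_num)]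
  linarith [e1.trans e2]

theorem norm_opening_le {ε : ℝ} (h0 : 0 ≤ ε) (h1 : ε ≤ 1) {a x : EuclideanSpace ℝ (Fin m)}
    (ha : ‖a‖ ≤ 1 / 4) (hx : ε * ‖x - a‖ ≤ 5 / 4) : ‖opening ε a x‖ ≤ 1 :=
  norm_collapse_half_le ((norm_opening_aux h0 h1 ha hx).trans (by norm_num))

theorem opening_of_norm_le_one {ε : ℝ} (h1 : ε ≤ 1) {a x : EuclideanSpace ℝ (Fin m)}
    (ha : ‖a‖ ≤ 1 / 4) (hx : ‖x‖ ≤ 1) : opening ε a x = x := by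
  have e1 : ‖(4 / 5 : ℝ) • (x - a)‖ ≤ 1 := by
    rw [norm_smul, Real.norm_of_nonneg (by norm_num)]
    linarith [norm_sub_le x a]
  rw [opening, collapse_of_norm_le_one h1 e1, smul_smul]
  norm_num
  exact collapse_of_norm_le_one (by norm_num) hx

/-- The radius is 5/4 · 3/2, beyond which the inner profile vanishes for ε = 0. -/
theorem opening_zero_of_ge {a x : EuclideanSpace ℝ (Fin m)} (ha : ‖a‖ ≤ 1 / 4)
    (hx : 15 / 8 ≤ ‖x - a‖) : opening 0 a x = a := by
  have e1 : 3 - 2 * ‖(4 / 5 : ℝ) • (x - a)‖ ≤ 0 := by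
    rw [norm_smul, Real.norm_of_nonneg (by norm_num)]
    linarith
  rw [opening, collapse_of_ge e1, zero_smul, smul_zero, add_zero]
  exact collapse_of_norm_le_one (by norm_num) (by linarith)

theorem opening_eq_opening_zero {ε : ℝ} (h0 : 0 ≤ ε) (h1 : ε ≤ 1) {a x : EuclideanSpace ℝ (Fin m)}
    (hx : ε ≤ 3 - 8 / 5 * ‖x - a‖) : opening ε a x = opening 0 a x := by
  rw [opening, opening, collapse_eq_collapse_zero h0 h1]
  rw [norm_smul, Real.norm_of_nonneg (by norm_num)]
  linarith

theorem opening_eq_homothety {ε : ℝ} (h0 : 0 ≤ ε) {a x : EuclideanSpace ℝ (Fin m)}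
    (ha : ‖a‖ ≤ 1 / 4) (hx : 3 - 8 / 5 * ‖x - a‖ ≤ ε) (hεx : ε * ‖x - a‖ ≤ 3 / 4) :
    opening ε a x = a + ε • (x - a) := by
  have e1 : 3 - 2 * ‖(4 / 5 : ℝ) • (x - a)‖ ≤ ε := by
    rw [norm_smul, Real.norm_of_nonneg (by norm_num)]
    linarith
  rw [opening, collapse_of_ge e1, smul_smul, smul_smul,
    show (5 / 4 : ℝ) * ε * (4 / 5) = ε by ring]
  refine collapse_of_norm_le_one (by norm_num) ((norm_add_le _ _).trans ?_)
  rw [norm_smul, Real.norm_of_nonneg h0]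
  linarith

theorem exists_volume_preimage_opening_le {ε : ℝ} (h0 : 0 < ε) (h1 : ε ≤ 1)
    (a : EuclideanSpace ℝ (Fin m)) :
    ∃ C : ℝ≥0, ∀ S : Set (EuclideanSpace ℝ (Fin m)), volume (opening ε a ⁻¹' S) ≤ C * volume S := by
  obtain ⟨C₁, hC₁⟩ := exists_volume_preimage_collapse_le (m := m) (ε := 1 / 2) (by norm_num)
    (by norm_num)
  obtain ⟨C₂, hC₂⟩ := exists_volume_preimage_collapse_le (m := m) h0 h1
  have h3 : ∀ S : Set (EuclideanSpace ℝ (Fin m)),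
      volume ((fun x ↦ a + (5 / 4 : ℝ) • x) ⁻¹' S) ≤ ((4 / 5 : ℝ).toNNReal ^ m : ℝ≥0) * volume S :=
    fun S ↦ by
      have := volume_preimage_inter_le (P := univ) (g := fun x ↦ a + (5 / 4 : ℝ) • x)
        (K := (4 / 5 : ℝ).toNNReal) (fun x _ y _ ↦ by
          refine edist_le_mul_edist_of_norm_le (by norm_num) (le_of_eq ?_)
          rw [add_sub_add_left_eq_sub, ← smul_sub, norm_smul, Real.norm_of_nonneg (by norm_num)]
          ring) S
      simpa using this
  have h4 : ∀ S : Set (EuclideanSpace ℝ (Fin m)),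
      volume ((fun x ↦ (4 / 5 : ℝ) • (x - a)) ⁻¹' S) ≤ ((5 / 4 : ℝ).toNNReal ^ m : ℝ≥0) * volume S :=
    fun S ↦ by
      have := volume_preimage_inter_le (P := univ) (g := fun x ↦ (4 / 5 : ℝ) • (x - a))
        (K := (5 / 4 : ℝ).toNNReal) (fun x _ y _ ↦ by
          refine edist_le_mul_edist_of_norm_le (by norm_num) (le_of_eq ?_)
          rw [← smul_sub, sub_sub_sub_cancel_right, norm_smul, Real.norm_of_nonneg (by norm_num)]
          ring) S
      simpa using this
  refine ⟨(5 / 4 : ℝ).toNNReal ^ m * (C₂ * ((4 / 5 : ℝ).toNNReal ^ m * C₁)), fun S ↦ ?_⟩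
  have e1 : opening ε a ⁻¹' S = (fun x ↦ (4 / 5 : ℝ) • (x - a)) ⁻¹' (collapse ε ⁻¹'
    ((fun x ↦ a + (5 / 4 : ℝ) • x) ⁻¹' (collapse (1 / 2) ⁻¹' S))) := rfl
  rw [e1]
  refine (h4 _).trans ?_
  rw [ENNReal.coe_mul, ENNReal.coe_mul, ENNReal.coe_mul, mul_assoc, mul_assoc, mul_assoc]
  gcongr
  refine (hC₂ _).trans ?_
  gcongr
  refine (h3 _).trans ?_
  gcongr
  exact hC₁ _

theorem closedBall_ae_eq_ball (x : EuclideanSpace ℝ (Fin m)) {r : ℝ} (hr : r ≠ 0) :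
    Metric.closedBall x r =ᵐ[volume] Metric.ball x r := by
  refine ae_eq_set.2 ⟨?_, ?_⟩
  · rw [Metric.closedBall_sdiff_ball]
    exact Measure.addHaar_sphere_of_ne_zero volume x hr
  · rw [sdiff_eq_empty.2 Metric.ball_subset_closedBall]
    exact measure_empty

/-- Averaging over the parameter of the opening maps. -/
theorem exists_lintegral_lintegral_opening_le :
    ∃ C : ℝ≥0, ∀ G : EuclideanSpace ℝ (Fin m) → ENNReal, Measurable G →
      ∫⁻ a in Metric.ball 0 (1 / 4), ∫⁻ x in Metric.ball 0 4, G (opening 0 a x) ≤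
        C * ∫⁻ x in Metric.ball 0 1, G x := by
  obtain ⟨C₁, hC₁⟩ := exists_volume_preimage_collapse_le (m := m) (ε := 1 / 2) (by norm_num)
    (by norm_num)
  set B := Metric.ball (0 : EuclideanSpace ℝ (Fin m)) (17 / 4) with hB
  have hBfin : volume B ≠ ⊤ := measure_ball_lt_top.ne
  refine ⟨(volume B).toNNReal * C₁, fun G hG ↦ ?_⟩
  have c1 : Continuous (collapse (m := m) (1 / 2)) :=
    (lipschitzWith_collapse (by norm_num) (by norm_num)).continuous
  have c2 : Continuous (collapse (m := m) 0) :=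
    (lipschitzWith_collapse (by norm_num) (by norm_num)).continuous
  have hm : Measurable fun q : EuclideanSpace ℝ (Fin m) × EuclideanSpace ℝ (Fin m) ↦
      G (collapse (1 / 2) (q.1 + (5 / 4 : ℝ) • collapse 0 ((4 / 5 : ℝ) • q.2))) :=
    hG.comp (Continuous.measurable (by fun_prop))
  have h1 : ∀ a ∈ Metric.ball (0 : EuclideanSpace ℝ (Fin m)) (1 / 4),
      ∫⁻ x in Metric.ball 0 4, G (opening 0 a x) ≤
        ∫⁻ y in B, G (collapse (1 / 2) (a + (5 / 4 : ℝ) • collapse 0 ((4 / 5 : ℝ) • y))) := by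
    intro a ha
    have h2 := (measurePreserving_sub_right volume a).setLIntegral_comp_preimage_emb
      (measurableEmbedding_subRight a)
      (fun y ↦ G (collapse (1 / 2) (a + (5 / 4 : ℝ) • collapse 0 ((4 / 5 : ℝ) • y)))) B
    rw [← h2]
    refine lintegral_mono_set fun x hx ↦ ?_
    simp only [hB, mem_preimage, mem_ball_zero_iff] at hx ha ⊢
    linarith [norm_sub_le x a]
  -- With y = x - a fixed and `a` varying, the map is a translation followed by `collapse (1 / 2)`,
  -- which does not concentrate the volume, whereas x ↦ `opening 0 a x` does. Hence the integral in
  -- `a` is taken first.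
  have h3 : ∀ y, ∫⁻ a in Metric.ball 0 (1 / 4),
      G (collapse (1 / 2) (a + (5 / 4 : ℝ) • collapse 0 ((4 / 5 : ℝ) • y))) ≤
      C₁ * ∫⁻ x in Metric.ball 0 1, G x := by
    intro y
    set b := (5 / 4 : ℝ) • collapse (m := m) 0 ((4 / 5 : ℝ) • y)
    have hb : ‖b‖ ≤ 5 / 4 := by
      have := norm_collapse_le (m := m) (le_refl (0 : ℝ)) zero_le_one ((4 / 5 : ℝ) • y)
      simp only [zero_mul, max_eq_left zero_le_one] at this
      simp only [b]
      rw [norm_smul, Real.norm_of_nonneg (by norm_num)]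
      linarith
    have h4 := (measurePreserving_add_right volume b).setLIntegral_comp_preimage_emb
      (measurableEmbedding_addRight b) (fun z ↦ G (collapse (1 / 2) z)) (Metric.ball 0 2)
    calc ∫⁻ a in Metric.ball 0 (1 / 4), G (collapse (1 / 2) (a + b))
        ≤ ∫⁻ a in (fun a ↦ a + b) ⁻¹' Metric.ball 0 2, G (collapse (1 / 2) (a + b)) := by
          refine lintegral_mono_set fun a ha ↦ ?_
          simp only [mem_preimage, mem_ball_zero_iff] at ha ⊢
          linarith [norm_add_le a b]
      _ = ∫⁻ z in Metric.ball 0 2, G (collapse (1 / 2) z) := h4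
      _ ≤ ∫⁻ z, (Metric.closedBall 0 1).indicator G (collapse (1 / 2) z) := by
          rw [← lintegral_indicator Metric.isOpen_ball.measurableSet]
          refine lintegral_mono fun z ↦ ?_
          by_cases hz : z ∈ Metric.ball (0 : EuclideanSpace ℝ (Fin m)) 2
          · have : collapse (1 / 2) z ∈ Metric.closedBall (0 : EuclideanSpace ℝ (Fin m)) 1 := by
              rw [mem_closedBall_zero_iff]
              exact norm_collapse_half_le (mem_ball_zero_iff.1 hz).le
            rw [indicator_of_mem hz, indicator_of_mem this]
          · rw [indicator_of_notMem hz]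
            exact zero_le
      _ ≤ C₁ * ∫⁻ z, (Metric.closedBall 0 1).indicator G z :=
          lintegral_comp_le_of_measure_preimage_le c1.measurable (fun S _ ↦ hC₁ S)
            (hG.indicator Metric.isClosed_closedBall.measurableSet).aemeasurable
      _ = _ := by
          rw [lintegral_indicator Metric.isClosed_closedBall.measurableSet,
            Measure.restrict_congr_set (closedBall_ae_eq_ball _ one_ne_zero)]
  calc _ ≤ ∫⁻ a in Metric.ball 0 (1 / 4), ∫⁻ y in B,
        G (collapse (1 / 2) (a + (5 / 4 : ℝ) • collapse 0 ((4 / 5 : ℝ) • y))) :=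
        setLIntegral_mono' Metric.isOpen_ball.measurableSet h1
    _ = ∫⁻ y in B, ∫⁻ a in Metric.ball 0 (1 / 4),
        G (collapse (1 / 2) (a + (5 / 4 : ℝ) • collapse 0 ((4 / 5 : ℝ) • y))) :=
        lintegral_lintegral_swap hm.aemeasurable
    _ ≤ ∫⁻ y in B, C₁ * ∫⁻ x in Metric.ball 0 1, G x := lintegral_mono h3
    _ = _ := by
        rw [setLIntegral_const, ENNReal.coe_mul, ENNReal.coe_toNNReal hBfin]
        ring

/-- Outside any null set some `a` does no worse than the average, so a generic property `P` can be
required as well. -/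
theorem exists_forall_exists_opening :
    ∃ C : ℝ≥0, ∀ (G : EuclideanSpace ℝ (Fin m) → ENNReal) (P : EuclideanSpace ℝ (Fin m) → Prop),
      Measurable G → (∀ᵐ a, P a) → ∃ a, ‖a‖ ≤ 1 / 4 ∧ P a ∧
        ∫⁻ x in Metric.ball 0 4, G (opening 0 a x) ≤ C * ∫⁻ x in Metric.ball 0 1, G x := by
  obtain ⟨C, hC⟩ := exists_lintegral_lintegral_opening_le (m := m)
  set B := Metric.ball (0 : EuclideanSpace ℝ (Fin m)) (1 / 4) with hB
  have hBfin : volume B ≠ ⊤ := measure_ball_lt_top.ne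
  have hB0 : volume B ≠ 0 := (Metric.measure_ball_pos _ _ (by norm_num)).ne'
  refine ⟨C * (volume B)⁻¹.toNNReal, fun G P hG hP ↦ ?_⟩
  have hmeas : Measurable fun a ↦ ∫⁻ x in Metric.ball 0 4, G (opening 0 a x) :=
    (hG.comp (continuous_uncurry_opening le_rfl zero_le_one).measurable).lintegral_prod_right'
  have hN : volume.restrict B {a | ¬ (P a ∧ a ∈ B)} = 0 := by
    have := (ae_restrict_of_ae hP).and (ae_restrict_mem (μ := volume) (s := B)
      Metric.isOpen_ball.measurableSet)
    exact this
  have : IsFiniteMeasure (volume.restrict B) := ⟨by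
    rw [Measure.restrict_apply_univ]
    exact hBfin.lt_top⟩
  obtain ⟨a, haN, ha⟩ := exists_notMem_null_le_laverage (μ := volume.restrict B)
    (by rwa [Ne, Measure.restrict_eq_zero]) hmeas.aemeasurable hN
  simp only [mem_ofPred_eq, not_not] at haN
  refine ⟨a, (mem_ball_zero_iff.1 haN.2).le, haN.1, ha.trans ?_⟩
  rw [laverage_eq, Measure.restrict_apply_univ, ENNReal.div_eq_inv_mul, ENNReal.coe_mul,
    ENNReal.coe_toNNReal (ENNReal.inv_ne_top.2 hB0), mul_comm (C : ENNReal), mul_assoc]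
  gcongr
  exact hC G hG

end Opening

/-! ### Lebesgue points -/

section LebesguePoints

open scoped NNReal

/-- The majorant has to hold at every point: it will be composed with `opening 0 a`, for which the
preimage of the null set {a} has positive volume. -/
theorem AEMeasurable.exists_measurable_ge {X : Type*} [MeasurableSpace X] {μ : Measure X}
    {f : X → ENNReal} (hf : AEMeasurable f μ) :
    ∃ g : X → ENNReal, Measurable g ∧ (∀ x, f x ≤ g x) ∧ f =ᵐ[μ] g := by
  obtain ⟨Z, hZ, hZm, hZ0⟩ := exists_measurable_superset_of_null (ae_iff.1 hf.ae_eq_mk)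
  refine ⟨fun x ↦ hf.mk f x + Z.indicator (fun _ ↦ ⊤) x,
    hf.measurable_mk.add (measurable_const.indicator hZm), fun x ↦ ?_, ?_⟩
  · by_cases hx : x ∈ Z
    · simp [hx]
    · have : f x = hf.mk f x := by
        by_contra h
        exact hx (hZ h)
      simp [hx, this]
  · filter_upwards [hf.ae_eq_mk, measure_eq_zero_iff_ae_notMem.1 hZ0] with x hx hxZ
    simp [hxZ, hx]

variable {m : ℕ}

/-- The change of variables produces a mean over a small ball, whose limit as ε tends to 0 is known
at Lebesgue points. -/
theorem lintegral_homothety_le (a : EuclideanSpace ℝ (Fin m)) {ε ρ : ℝ} (hε : 0 < ε) (hρ : 0 < ρ)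
    {H : EuclideanSpace ℝ (Fin m) → ENNReal} (hH : Measurable H) :
    ∫⁻ x in Metric.closedBall a ρ, H (a + ε • (x - a)) ≤ volume (Metric.closedBall a ρ) *
      ((∫⁻ z in Metric.closedBall a (ε * ρ), H z) / volume (Metric.closedBall a (ε * ρ))) := by
  have h1 : ∀ S : Set (EuclideanSpace ℝ (Fin m)), MeasurableSet S →
      (volume.restrict (Metric.closedBall a ρ)) ((fun x ↦ a + ε • (x - a)) ⁻¹' S) ≤
        ((ε⁻¹).toNNReal ^ m : ℝ≥0) * (volume.restrict (Metric.closedBall a (ε * ρ))) S := by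
    intro S hS
    rw [Measure.restrict_apply' Metric.isClosed_closedBall.measurableSet,
      Measure.restrict_apply' Metric.isClosed_closedBall.measurableSet]
    refine le_trans (measure_mono ?_) (volume_preimage_inter_le (P := Metric.closedBall a ρ)
      (g := fun x ↦ a + ε • (x - a)) (fun x _ y _ ↦ ?_) (S ∩ Metric.closedBall a (ε * ρ)))
    · rintro x ⟨hxS, hx⟩
      refine ⟨⟨hxS, ?_⟩, hx⟩
      rw [mem_closedBall_iff_norm] at hx ⊢
      rw [add_sub_cancel_left, norm_smul, Real.norm_of_nonneg hε.le]
      gcongr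
    · refine edist_le_mul_edist_of_norm_le (by positivity) (le_of_eq ?_)
      rw [add_sub_add_left_eq_sub, ← smul_sub, sub_sub_sub_cancel_right, norm_smul,
        Real.norm_of_nonneg hε.le, inv_mul_cancel_left₀ hε.ne']
  refine (lintegral_comp_le_of_measure_preimage_le (by fun_prop) h1 hH.aemeasurable).trans
    (le_of_eq ?_)
  have h2 : volume (Metric.closedBall a (ε * ρ)) =
      ENNReal.ofReal (ε ^ m) * volume (Metric.closedBall a ρ) := by
    have := Measure.addHaar_closedBall_mul (volume : Measure (EuclideanSpace ℝ (Fin m))) a hε.le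
      hρ.le
    rw [this, finrank_euclideanSpace_fin, Measure.addHaar_closedBall_center volume a]
  have h3 : volume (Metric.closedBall a ρ) ≠ 0 := (Metric.measure_closedBall_pos _ _ hρ).ne'
  have h4 : volume (Metric.closedBall a ρ) ≠ ⊤ := measure_closedBall_lt_top.ne
  have h5 : ((ε⁻¹).toNNReal ^ m : ℝ≥0) = (ENNReal.ofReal (ε ^ m))⁻¹ := by
    rw [← ENNReal.ofReal_inv_of_pos (by positivity), ← inv_pow, ENNReal.ofReal_pow (by positivity)]
    simp [ENNReal.ofReal]
  rw [h2, h5, ENNReal.div_eq_inv_mul, ENNReal.mul_inv (Or.inr h4) (Or.inr h3), mul_left_comm,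
    mul_assoc, ← mul_assoc (volume _)⁻¹, ENNReal.inv_mul_cancel h3 h4,
    one_mul]

theorem ae_tendsto_lintegral_closedBall_div {f : EuclideanSpace ℝ (Fin m) → ENNReal}
    (hf : Measurable f) {O : Set (EuclideanSpace ℝ (Fin m))} (hO : IsOpen O)
    (hfi : ∫⁻ x in O, f x ≠ ⊤) : ∀ᵐ a, a ∈ O → Tendsto (fun r ↦
      (∫⁻ z in Metric.closedBall a r, f z) / volume (Metric.closedBall a r)) (𝓝[>] 0) (𝓝 (f a)) := by
  have h1 := (Besicovitch.vitaliFamily (volume : Measure (EuclideanSpace ℝ (Fin m)))).ae_tendsto_lintegral_div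
    (hf.indicator hO.measurableSet).aemeasurable
    (by rwa [lintegral_indicator hO.measurableSet])
  filter_upwards [h1] with a ha haO
  have h2 := ha.comp (Besicovitch.tendsto_filterAt volume a)
  rw [indicator_of_mem haO] at h2
  refine h2.congr' ?_
  obtain ⟨r₀, hr₀, hr₀O⟩ := Metric.isOpen_iff.1 hO a haO
  filter_upwards [Ioo_mem_nhdsGT hr₀] with r hr
  simp only [Function.comp]
  congr 1
  refine setLIntegral_congr_fun Metric.isClosed_closedBall.measurableSet fun z hz ↦ ?_
  exact indicator_of_mem (hr₀O (Metric.closedBall_subset_ball hr.2 hz)) _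

/-- Distances are truncated because `u` is only measurable. Lebesgue's theorem is applied to the
truncated distances to the points of a dense sequence, one of which is close to `u a`. -/
theorem ae_tendsto_lintegral_edist_div {N : Type*} [EMetricSpace N] [MeasurableSpace N]
    [BorelSpace N] [SecondCountableTopology N] {u : EuclideanSpace ℝ (Fin m) → N}
    (hu : Measurable u) {O : Set (EuclideanSpace ℝ (Fin m))} (hO : IsOpen O)
    (hOfin : volume O ≠ ⊤) : ∀ᵐ a, a ∈ O → Tendsto (fun r ↦
      (∫⁻ z in Metric.closedBall a r, min (edist (u z) (u a)) 1) / volume (Metric.closedBall a r))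
      (𝓝[>] 0) (𝓝 0) := by
  rcases isEmpty_or_nonempty N with hN | hN
  · exact Eventually.of_forall fun a ↦ (hN.false (u a)).elim
  have hm : ∀ y, Measurable fun z ↦ min (edist (u z) y) 1 := fun y ↦
    (measurable_edist_left.comp hu).min measurable_const
  have h1 : ∀ j : ℕ, ∀ᵐ a, a ∈ O → Tendsto (fun r ↦
      (∫⁻ z in Metric.closedBall a r, min (edist (u z) (TopologicalSpace.denseSeq N j)) 1) /
        volume (Metric.closedBall a r)) (𝓝[>] 0)
      (𝓝 (min (edist (u a) (TopologicalSpace.denseSeq N j)) 1)) := fun j ↦ by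
    refine ae_tendsto_lintegral_closedBall_div (hm _) hO (ne_top_of_le_ne_top hOfin ?_)
    calc _ ≤ ∫⁻ x in O, 1 := lintegral_mono fun x ↦ min_le_right _ _
      _ = _ := by simp
  filter_upwards [ae_all_iff.2 h1] with a ha haO
  rw [ENNReal.tendsto_nhds_zero]
  intro η hη
  set η' := η / 2
  have hη' : 0 < η' := ENNReal.half_pos hη.ne'
  obtain ⟨j, hj⟩ := (TopologicalSpace.denseRange_denseSeq N).exists_mem_open
    (Metric.isOpen_eball (x := u a) (ε := η')) ⟨u a, Metric.mem_eball_self hη'⟩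
  rw [Metric.mem_eball] at hj
  have h2 : min (edist (u a) (TopologicalSpace.denseSeq N j)) 1 < η' := by
    rw [edist_comm]
    exact min_lt_of_left_lt hj
  filter_upwards [(ha j haO).eventually_lt_const h2] with r hr
  calc _ ≤ (∫⁻ z in Metric.closedBall a r,
        (min (edist (u z) (TopologicalSpace.denseSeq N j)) 1 + η')) /
        volume (Metric.closedBall a r) := by
        gcongr with z
        refine (min_le_min_right 1 ((edist_triangle _ (TopologicalSpace.denseSeq N j) _).trans
          (add_le_add_right hj.le _))).trans ?_
        rw [min_le_iff]
        rcases le_total (edist (u z) (TopologicalSpace.denseSeq N j)) 1 with h | h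
        · rw [min_eq_left h]
          exact Or.inl le_rfl
        · rw [min_eq_right h]
          exact Or.inr le_self_add
    _ ≤ η' + η' := by
        rw [lintegral_add_left (hm _), setLIntegral_const, ENNReal.add_div, mul_div_assoc]
        exact add_le_add hr.le (mul_le_of_le_one_right' ENNReal.div_self_le_one)
    _ = η := ENNReal.add_halves η

end LebesguePoints

/-! ### Weak differentiability of the opened map -/

section OpeningWeakDifferential

open scoped NNReal

variable {m n : ℕ}

/-- The shell on which `opening ε a` is neither `opening 0 a` nor a homothety. -/
def openingShell (a : EuclideanSpace ℝ (Fin m)) (ε : ℝ) : Set (EuclideanSpace ℝ (Fin m)) :=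
  {x | 0 < 3 - 8 / 5 * ‖x - a‖ ∧ 3 - 8 / 5 * ‖x - a‖ < ε}

theorem measurableSet_openingShell (a : EuclideanSpace ℝ (Fin m)) (ε : ℝ) :
    MeasurableSet (openingShell a ε) := by
  have hc : Continuous fun x : EuclideanSpace ℝ (Fin m) ↦ 3 - 8 / 5 * ‖x - a‖ := by fun_prop
  exact (measurableSet_lt measurable_const hc.measurable).inter
    (measurableSet_lt hc.measurable measurable_const)

theorem tendsto_volume_openingShell (a : EuclideanSpace ℝ (Fin m)) :
    Tendsto (fun ε ↦ volume (openingShell a ε)) (𝓝[>] 0) (𝓝 0) := by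
  have hm : ∀ ε, MeasurableSet (openingShell a ε) := measurableSet_openingShell a
  have h := tendsto_measure_biInter_gt (μ := volume) (s := openingShell a) (a := 0)
    (fun r _ ↦ (hm r).nullMeasurableSet) (fun i j _ hij x hx ↦ ⟨hx.1, hx.2.trans_le hij⟩)
    ⟨1, one_pos, ?_⟩
  · have h0 : ⋂ r > 0, openingShell a r = ∅ := by
      refine eq_empty_of_forall_notMem fun x hx ↦ ?_
      rw [mem_iInter₂] at hx
      have h1 := hx 1 one_pos
      exact lt_irrefl _ (hx _ h1.1).2
    rw [h0, measure_empty] at h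
    exact h
  · refine ((measure_mono fun x hx ↦ ?_).trans_lt
      (measure_ball_lt_top (μ := volume) (x := a) (r := 2))).ne
    rw [mem_ball_iff_norm]
    linarith [hx.1]

theorem ae_openingShell_boundary (a : EuclideanSpace ℝ (Fin m)) {ε : ℝ} (hε : ε < 3) :
    ∀ᵐ x, 3 - 8 / 5 * ‖x - a‖ ≠ ε := by
  have h := Measure.addHaar_sphere_of_ne_zero (volume : Measure (EuclideanSpace ℝ (Fin m))) a
    (r := 5 / 8 * (3 - ε)) (by
      have : 0 < 3 - ε := by linarith
      positivity)
  filter_upwards [measure_eq_zero_iff_ae_notMem.1 h] with x hx h'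
  refine hx ?_
  rw [mem_sphere_iff_norm]
  linarith

theorem fderiv_opening_of_lt {ε : ℝ} (h0 : 0 ≤ ε) (h1 : ε ≤ 1) {a x : EuclideanSpace ℝ (Fin m)}
    (hx : ε < 3 - 8 / 5 * ‖x - a‖) : fderiv ℝ (opening ε a) x = fderiv ℝ (opening 0 a) x := by
  refine Filter.EventuallyEq.fderiv_eq ?_
  have hc : Continuous fun x : EuclideanSpace ℝ (Fin m) ↦ 3 - 8 / 5 * ‖x - a‖ := by fun_prop
  filter_upwards [(isOpen_lt continuous_const hc).mem_nhds hx] with y hy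
  exact opening_eq_opening_zero h0 h1 (le_of_lt hy)

theorem fderiv_opening_of_gt {ε : ℝ} (h0 : 0 ≤ ε) {a x : EuclideanSpace ℝ (Fin m)}
    (ha : ‖a‖ ≤ 1 / 4) (hx : 3 - 8 / 5 * ‖x - a‖ < ε) (hεx : ε * ‖x - a‖ < 3 / 4) :
    fderiv ℝ (opening ε a) x = ε • ContinuousLinearMap.id ℝ _ := by
  have h1 : opening ε a =ᶠ[𝓝 x] fun x ↦ a + ε • (x - a) := by
    have hc : Continuous fun x : EuclideanSpace ℝ (Fin m) ↦ 3 - 8 / 5 * ‖x - a‖ := by fun_prop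
    have hc' : Continuous fun x : EuclideanSpace ℝ (Fin m) ↦ ε * ‖x - a‖ := by fun_prop
    filter_upwards [(isOpen_lt hc continuous_const).mem_nhds hx,
      (isOpen_lt hc' continuous_const).mem_nhds hεx] with y hy hy'
    exact opening_eq_homothety h0 ha (le_of_lt hy) (le_of_lt hy')
  rw [h1.fderiv_eq]
  exact ((((hasFDerivAt_id (𝕜 := ℝ) x).sub_const a).const_smul ε).const_add a).fderiv

theorem enorm_fderiv_opening_le {ε : ℝ} (h0 : 0 ≤ ε) (h1 : ε ≤ 1)
    (a x : EuclideanSpace ℝ (Fin m)) : ‖fderiv ℝ (opening ε a) x‖ₑ ≤ 16 := by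
  have := norm_fderiv_le_of_lipschitz ℝ (lipschitzWith_opening h0 h1 a) (x₀ := x)
  rw [← ofReal_norm]
  exact (ENNReal.ofReal_le_ofReal this).trans (by simp)

variable {N : Type*} [EMetricSpace N] [ChartedSpace (EuclideanSpace ℝ (Fin n)) N]
  [IsManifold (𝓡 n) ∞ N] [RiemannianBundle (fun y : N ↦ TangentSpace (𝓡 n) y)]
  [IsContMDiffRiemannianBundle (𝓡 n) ∞ (EuclideanSpace ℝ (Fin n))
    (fun y : N ↦ TangentSpace (𝓡 n) y)] [IsRiemannianManifold (𝓡 n) N]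
  [MeasurableSpace N] [BorelSpace N]

omit [MeasurableSpace N] [BorelSpace N] [IsManifold (𝓡 n) ∞ N] [ChartedSpace (EuclideanSpace ℝ (Fin n)) N]
    [RiemannianBundle (fun y : N ↦ TangentSpace (𝓡 n) y)] in
theorem LipschitzWith.exists_enorm_sub_le_min {f : N → ℝ} {K : ℝ≥0} (hK : LipschitzWith K f)
    (hb : ∃ c, ∀ y, |f y| ≤ c) :
    ∃ C : ℝ≥0, ∀ y z, ‖f y - f z‖ₑ ≤ C * min (edist y z) 1 := by
  obtain ⟨c, hc⟩ := hb
  refine ⟨K + (2 * c).toNNReal, fun y z ↦ ?_⟩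
  rcases le_total (edist y z) 1 with h | h
  · rw [min_eq_left h, ← edist_eq_enorm_sub]
    refine (hK y z).trans ?_
    gcongr
    exact_mod_cast le_self_add
  · rw [min_eq_right h, mul_one, ← ofReal_norm]
    have h1 : ‖f y - f z‖ ≤ 2 * c := by
      refine (_root_.norm_sub_le _ _).trans ?_
      have := hc y
      have := hc z
      simp only [Real.norm_eq_abs]
      linarith
    refine (ENNReal.ofReal_le_ofReal h1).trans ?_
    · push_cast
      exact le_add_self

/-- For ε > 0, `opening ε a` does not concentrate the volume and the chain rule applies. It differs
from `opening 0 a` only on a shell, whose volume tends to 0, and in the far region, where it is the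
homothety of ratio ε about `a`. There the values converge because `a` is a Lebesgue point of `w`,
and the differentials tend to 0 because of the factor ε in front of bounded means of `G`. -/
theorem HasBddWeakMFDerivOn.comp_opening {w : EuclideanSpace ℝ (Fin m) → N} (hw : Measurable w)
    {D : EuclideanSpace ℝ (Fin m) → EuclideanSpace ℝ (Fin m) →L[ℝ] EuclideanSpace ℝ (Fin n)}
    {R : ℝ} (hR : 1 < R) (hD : HasBddWeakMFDerivOn (Metric.ball 0 R) w D)
    {G : EuclideanSpace ℝ (Fin m) → ENNReal} (hG : Measurable G)
    (hDG : ∀ x, tangentMapENorm (w x) (D x) ≤ G x)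
    {a : EuclideanSpace ℝ (Fin m)} (ha : ‖a‖ ≤ 1 / 4)
    (hGa : ∫⁻ x in Metric.ball 0 4, G (opening 0 a x) ≠ ⊤)
    (hwa : Tendsto (fun r ↦ (∫⁻ z in Metric.closedBall a r, min (edist (w z) (w a)) 1) /
      volume (Metric.closedBall a r)) (𝓝[>] 0) (𝓝 0))
    {c : ENNReal} (hc : c ≠ ⊤) (hGc : Tendsto (fun r ↦ (∫⁻ z in Metric.closedBall a r, G z) /
      volume (Metric.closedBall a r)) (𝓝[>] 0) (𝓝 c)) :
    HasBddWeakMFDerivOn (Metric.ball 0 4) (fun x ↦ w (opening 0 a x))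
      ((Metric.ball a (15 / 8)).indicator
        fun x ↦ (D (opening 0 a x)).comp (fderiv ℝ (opening 0 a) x)) := by
  set D' := (Metric.ball a (15 / 8)).indicator
        fun x ↦ (D (opening 0 a x)).comp (fderiv ℝ (opening 0 a) x) with hD'
  set U₀ := Metric.ball a (15 / 8)
  have hU₀ : IsOpen U₀ := Metric.isOpen_ball
  set B := Metric.ball (0 : EuclideanSpace ℝ (Fin m)) 4
  have hB : ∀ x ∈ B, ‖x - a‖ < 17 / 4 := fun x hx ↦ by
    have := norm_sub_le x a
    rw [mem_ball_zero_iff] at hx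
    linarith
  have hshell : ∀ x, x ∈ U₀ ↔ 0 < 3 - 8 / 5 * ‖x - a‖ := fun x ↦ by
    rw [mem_ball_iff_norm]
    constructor <;> intro h <;> linarith
  have hcont : Continuous fun x : EuclideanSpace ℝ (Fin m) ↦ 3 - 8 / 5 * ‖x - a‖ := by fun_prop
  -- On `B` one has ‖x - a‖ < 17/4, so ε < 1/8 gives ε ‖x - a‖ < 3/4: the homothety keeps its values
  -- in the unit ball, which the outer collapse fixes.
  have hev : ∀ᶠ ε : ℝ in 𝓝[>] 0, 0 < ε ∧ ε < 1 / 8 := by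
    filter_upwards [Ioo_mem_nhdsGT (show (0 : ℝ) < 1 / 8 by norm_num)] with ε hε using hε
  have hmapsR : ∀ {ε : ℝ} {x}, 0 ≤ ε → ε ≤ 1 → ε * ‖x - a‖ ≤ 5 / 4 →
      opening ε a x ∈ Metric.ball (0 : EuclideanSpace ℝ (Fin m)) R := fun h0 h1 hx ↦ by
    rw [mem_ball_zero_iff]
    exact (norm_opening_le h0 h1 ha hx).trans_lt hR
  have hv : Measurable fun x ↦ w (opening 0 a x) :=
    hw.comp (lipschitzWith_opening le_rfl zero_le_one a).continuous.measurable
  have hweak : ∀ᶠ ε : ℝ in 𝓝[>] 0, HasBddWeakMFDerivOn B (fun x ↦ w (opening ε a x))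
      (fun x ↦ (D (opening ε a x)).comp (fderiv ℝ (opening ε a) x)) := by
    filter_upwards [hev] with ε hε
    obtain ⟨C, hC⟩ := exists_volume_preimage_opening_le hε.1 (by linarith [hε.2]) a
    refine hD.comp Metric.isOpen_ball (fun x hx ↦ hmapsR hε.1.le (by linarith [hε.2]) ?_)
      fun x _ ↦ ⟨univ, univ_mem, 16, C,
        (lipschitzWith_opening hε.1.le (by linarith [hε.2]) a).lipschitzOnWith, fun S ↦ ?_⟩
    · have := hB x hx
      nlinarith [norm_nonneg (x - a)]
    · rw [inter_univ]
      exact hC S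
  -- Near each point of `U₀`, `opening 0 a` coincides with some `opening ε a`, ε > 0. This local
  -- chain rule is also the source of the measurability of the limit differential.
  have hweak0 : HasBddWeakMFDerivOn U₀ (fun x ↦ w (opening 0 a x)) D' := by
    refine (hD.comp Metric.isOpen_ball (φ := opening 0 a) (fun x hx ↦ hmapsR le_rfl zero_le_one
      (by norm_num)) fun x hx ↦ ?_).congr hU₀ (fun _ _ ↦ rfl)
      (fun x hx ↦ by rw [hD', indicator_of_mem hx])
    obtain ⟨ε, hε, hε1, hεx⟩ : ∃ ε : ℝ, 0 < ε ∧ ε ≤ 1 ∧ ε < 3 - 8 / 5 * ‖x - a‖ := by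
      have := (hshell x).1 hx
      exact ⟨min 1 ((3 - 8 / 5 * ‖x - a‖) / 2), by positivity, min_le_left _ _,
        (min_le_right _ _).trans_lt (by linarith)⟩
    obtain ⟨C, hC⟩ := exists_volume_preimage_opening_le hε hε1 a
    refine ⟨{y | ε < 3 - 8 / 5 * ‖y - a‖}, (isOpen_lt continuous_const hcont).mem_nhds hεx, 16, C,
        (lipschitzWith_opening le_rfl zero_le_one a).lipschitzOnWith, fun S ↦ ?_⟩
    refine (measure_mono ?_).trans (hC S)
    rintro y ⟨hyS, hy⟩
    rw [mem_preimage, opening_eq_opening_zero hε.le hε1 (le_of_lt hy)]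
    exact hyS
  intro f hf ⟨K, hK⟩ hfb
  obtain ⟨Cf, hCf⟩ := hK.exists_enorm_sub_le_min hfb
  set W : EuclideanSpace ℝ (Fin m) → EuclideanSpace ℝ (Fin m) →L[ℝ] ℝ :=
    fun x ↦ (mfderivReal n f (w (opening 0 a x))).comp (D' x)
  have hWm : AEStronglyMeasurable W volume := by
    have h1 : W = U₀.indicator W := by
      ext1 x
      by_cases hx : x ∈ U₀
      · rw [indicator_of_mem hx]
      · rw [indicator_of_notMem hx]
        simp only [W, hD', indicator_of_notMem hx, ContinuousLinearMap.comp_zero]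
    rw [h1, aestronglyMeasurable_indicator_iff hU₀.measurableSet]
    exact (hweak0 f hf ⟨K, hK⟩ hfb).2.1.aestronglyMeasurable
  have hD'le : ∀ x, tangentMapENorm (w (opening 0 a x)) (D' x) ≤ m * 16 * G (opening 0 a x) := by
    intro x
    by_cases hx : x ∈ U₀
    · rw [hD', indicator_of_mem hx]
      refine (tangentMapENorm_comp_le _ _ _).trans ?_
      rw [mul_assoc, mul_comm (16 : ENNReal)]
      gcongr
      · exact hDG _
      · exact enorm_fderiv_opening_le le_rfl zero_le_one a x
    · rw [hD', indicator_of_notMem hx, tangentMapENorm_zero]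
      exact zero_le
  have hWfin : ∫⁻ x in B, ‖W x‖ₑ ≠ ⊤ := by
    have h1 : ∀ x, ‖W x‖ₑ ≤ K * (m * 16) * G (opening 0 a x) := fun x ↦ by
      rw [mul_assoc]
      exact (hK.enorm_mfderivReal_comp_le hf _ _).trans (by gcongr; exact hD'le x)
    refine ne_top_of_le_ne_top ?_ (lintegral_mono h1)
    have h2 : (K * (m * 16) : ENNReal) ≠ ⊤ := ENNReal.mul_ne_top ENNReal.coe_ne_top
      (ENNReal.mul_ne_top (ENNReal.natCast_ne_top m) (by simp))
    rw [lintegral_const_mul' _ _ h2]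
    exact ENNReal.mul_ne_top h2 hGa
  have hWi : IntegrableOn W B := ⟨hWm.restrict, hWfin.lt_top⟩
  have hfv : Measurable fun x ↦ f (w (opening 0 a x)) := hf.continuous.measurable.comp hv
  have hscale : Tendsto (fun ε : ℝ ↦ ε * (17 / 4)) (𝓝[>] 0) (𝓝[>] 0) := by
    refine tendsto_nhdsWithin_iff.2 ⟨?_, ?_⟩
    · have : Tendsto (fun ε : ℝ ↦ ε * (17 / 4)) (𝓝 0) (𝓝 (0 * (17 / 4))) :=
        tendsto_id.mul_const _
      rw [zero_mul] at this
      exact this.mono_left nhdsWithin_le_nhds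
    · filter_upwards [self_mem_nhdsWithin] with ε hε
      exact mul_pos (mem_Ioi.1 hε) (by norm_num : (0 : ℝ) < 17 / 4)
  have hVfin : volume (Metric.closedBall a (17 / 4)) ≠ ⊤ := measure_closedBall_lt_top.ne
  have hBsub : B ⊆ Metric.closedBall a (17 / 4) := fun x hx ↦ by
    rw [mem_closedBall_iff_norm]
    exact (hB x hx).le
  have hhom : ∀ {ε : ℝ} {x}, 0 < ε → ε < 1 / 8 → x ∈ B → ε * ‖x - a‖ < 3 / 4 :=
    fun {ε x} h0 h1 hx ↦ by nlinarith [hB _ hx, norm_nonneg (x - a)]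
  have hint : ∀ {ε : ℝ} {H : EuclideanSpace ℝ (Fin m) → ENNReal}, 0 < ε → Measurable H →
      ∫⁻ x in B, H (a + ε • (x - a)) ≤ volume (Metric.closedBall a (17 / 4)) *
      ((∫⁻ z in Metric.closedBall a (ε * (17 / 4)), H z) /
        volume (Metric.closedBall a (ε * (17 / 4)))) := fun hε hH ↦
    (lintegral_mono_set hBsub).trans (lintegral_homothety_le a hε (by norm_num) hH)
  refine HasWeakFDerivOn.of_tendsto (l := 𝓝[>] (0 : ℝ)) (hweak.mono fun ε hε ↦ hε f hf ⟨K, hK⟩ hfb)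
    ?_ (hWi.locallyIntegrableOn) ?_ ?_
  · obtain ⟨c', hc'⟩ := hfb
    refine LocallyIntegrable.locallyIntegrableOn ?_ _
    refine LocallyIntegrable.mono (f := fun _ ↦ c') (locallyIntegrable_const _)
      hfv.aestronglyMeasurable (Eventually.of_forall fun x ↦ (hc' _).trans (le_abs_self _))
  · intro S hSB _
    have hlim : Tendsto (fun ε ↦ Cf * volume (openingShell a ε) +
        Cf * (volume (Metric.closedBall a (17 / 4)) *
          ((∫⁻ z in Metric.closedBall a (ε * (17 / 4)), min (edist (w z) (w a)) 1) /
          volume (Metric.closedBall a (ε * (17 / 4)))))) (𝓝[>] 0)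
        (𝓝 (Cf * 0 + Cf * (volume (Metric.closedBall a (17 / 4)) * 0))) := by
      refine (ENNReal.Tendsto.const_mul (tendsto_volume_openingShell a)
        (Or.inr ENNReal.coe_ne_top)).add (ENNReal.Tendsto.const_mul (ENNReal.Tendsto.const_mul
        (hwa.comp hscale) (Or.inr hVfin)) (Or.inr ENNReal.coe_ne_top))
    simp only [mul_zero, add_zero] at hlim
    refine tendsto_of_tendsto_of_tendsto_of_le_of_le' tendsto_const_nhds hlim
      (Eventually.of_forall fun _ ↦ zero_le) ?_
    filter_upwards [hev] with ε hε
    have hmin : Measurable fun z ↦ min (edist (w z) (w a)) 1 :=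
      (measurable_edist_left.comp hw).min measurable_const
    have hpt : ∀ x ∈ B, ‖f (w (opening ε a x)) - f (w (opening 0 a x))‖ₑ ≤
        (openingShell a ε).indicator (fun _ ↦ (Cf : ENNReal)) x +
          Cf * min (edist (w (a + ε • (x - a))) (w a)) 1 := by
      intro x hx
      rcases le_or_gt ε (3 - 8 / 5 * ‖x - a‖) with h | h
      · rw [opening_eq_opening_zero hε.1.le (by linarith [hε.2]) h]
        simp
      rcases lt_or_ge 0 (3 - 8 / 5 * ‖x - a‖) with h' | h'
      · have hxs : x ∈ openingShell a ε := ⟨h', h⟩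
        rw [indicator_of_mem hxs]
        refine le_trans ((hCf _ _).trans ?_) le_self_add
        exact mul_le_of_le_one_right' (min_le_right _ _)
      · rw [opening_eq_homothety hε.1.le ha h.le (hhom hε.1 hε.2 hx).le,
          opening_zero_of_ge ha (by linarith)]
        exact (hCf _ _).trans le_add_self
    calc ∫⁻ x in S, ‖f (w (opening ε a x)) - f (w (opening 0 a x))‖ₑ
        ≤ ∫⁻ x in B, ‖f (w (opening ε a x)) - f (w (opening 0 a x))‖ₑ := lintegral_mono_set hSB
      _ ≤ ∫⁻ x in B, ((openingShell a ε).indicator (fun _ ↦ (Cf : ENNReal)) x +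
          Cf * min (edist (w (a + ε • (x - a))) (w a)) 1) :=
          setLIntegral_mono' Metric.isOpen_ball.measurableSet hpt
      _ = (∫⁻ x in B, (openingShell a ε).indicator (fun _ ↦ (Cf : ENNReal)) x) +
          Cf * ∫⁻ x in B, min (edist (w (a + ε • (x - a))) (w a)) 1 := by
          rw [lintegral_add_left (measurable_const.indicator (measurableSet_openingShell a ε)),
            lintegral_const_mul' _ _ ENNReal.coe_ne_top]
      _ ≤ _ := by
          refine add_le_add ?_ (mul_le_mul_right (hint hε.1 hmin) _)
          refine (setLIntegral_le_lintegral _ _).trans_eq ?_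
          rw [lintegral_indicator_const (measurableSet_openingShell a ε)]
  · intro S hSB _
    -- Absolute continuity of the integral: on the shell only the integrability of the limit
    -- differential is used, in addition to the smallness of the other one.
    have hlim1 : Tendsto (fun ε ↦ ∫⁻ x in openingShell a ε, ‖W x‖ₑ ∂(volume.restrict B)) (𝓝[>] 0)
        (𝓝 0) :=
      tendsto_setLIntegral_zero hWfin (tendsto_of_tendsto_of_tendsto_of_le_of_le
        tendsto_const_nhds (tendsto_volume_openingShell a) (fun _ ↦ zero_le)
        fun ε ↦ Measure.restrict_apply_le _ _)
    have hlim2 : Tendsto (fun ε ↦ ENNReal.ofReal ε * (volume (Metric.closedBall a (17 / 4)) *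
          ((∫⁻ z in Metric.closedBall a (ε * (17 / 4)), G z) /
          volume (Metric.closedBall a (ε * (17 / 4)))))) (𝓝[>] 0)
        (𝓝 (0 * (volume (Metric.closedBall a (17 / 4)) * c))) := by
      refine ENNReal.Tendsto.mul ?_ (Or.inr (ENNReal.mul_ne_top hVfin hc))
        (ENNReal.Tendsto.const_mul (hGc.comp hscale) (Or.inr hVfin)) (Or.inr (by simp))
      have := (ENNReal.continuous_ofReal.tendsto 0).mono_left (nhdsWithin_le_nhds (s := Ioi 0))
      simpa using this
    have hlim := hlim1.add (ENNReal.Tendsto.const_mul (a := (K * m : ENNReal)) hlim2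
      (Or.inr (ENNReal.mul_ne_top ENNReal.coe_ne_top (ENNReal.natCast_ne_top m))))
    simp only [mul_zero, add_zero, zero_mul] at hlim
    refine tendsto_of_tendsto_of_tendsto_of_le_of_le' tendsto_const_nhds hlim
      (Eventually.of_forall fun _ ↦ zero_le) ?_
    filter_upwards [hev] with ε hε
    have hε1 : ε ≤ 1 := by linarith [hε.2]
    have hpt : ∀ᵐ x ∂volume.restrict B, ‖(mfderivReal n f (w (opening ε a x))).comp
        ((D (opening ε a x)).comp (fderiv ℝ (opening ε a) x)) - W x‖ₑ ≤
        (openingShell a ε).indicator (fun x ↦ ‖W x‖ₑ) x +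
          K * m * (ENNReal.ofReal ε * G (a + ε • (x - a))) := by
      -- The inner boundary sphere of the shell, across which `opening ε a` need not be
      -- differentiable, is a null set.
      filter_upwards [ae_restrict_of_ae (ae_openingShell_boundary a (by linarith : ε < 3)),
        ae_restrict_mem Metric.isOpen_ball.measurableSet] with x hxne hx
      rcases lt_or_gt_of_ne hxne with h | h
      · have e1 : ‖(mfderivReal n f (w (opening ε a x))).comp
            ((D (opening ε a x)).comp (fderiv ℝ (opening ε a) x))‖ₑ ≤
              K * m * (ENNReal.ofReal ε * G (a + ε • (x - a))) := by
          refine (hK.enorm_mfderivReal_comp_le hf _ _).trans ?_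
          rw [mul_assoc (K : ENNReal)]
          gcongr
          refine (tangentMapENorm_comp_le _ _ _).trans ?_
          rw [fderiv_opening_of_gt hε.1.le ha h (hhom hε.1 hε.2 hx),
            opening_eq_homothety hε.1.le ha h.le (hhom hε.1 hε.2 hx).le,
            mul_comm (ENNReal.ofReal ε)]
          gcongr
          · exact hDG _
          · rw [← ofReal_norm]
            refine ENNReal.ofReal_le_ofReal ?_
            rw [norm_smul, Real.norm_of_nonneg hε.1.le]
            exact mul_le_of_le_one_right hε.1.le ContinuousLinearMap.norm_id_le
        rcases lt_or_ge 0 (3 - 8 / 5 * ‖x - a‖) with h' | h'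
        · have hxs : x ∈ openingShell a ε := ⟨h', h⟩
          rw [indicator_of_mem hxs, add_comm]
          exact (enorm_sub_le).trans (add_le_add e1 le_rfl)
        · have hxU : x ∉ U₀ := fun hxU ↦ absurd ((hshell x).1 hxU) (not_lt.2 h')
          have : W x = 0 := by
            simp only [W, hD', indicator_of_notMem hxU, ContinuousLinearMap.comp_zero]
          rw [this, sub_zero]
          exact e1.trans le_add_self
      · have hxU : x ∈ U₀ := (hshell x).2 (hε.1.trans h)
        have : (mfderivReal n f (w (opening ε a x))).comp
            ((D (opening ε a x)).comp (fderiv ℝ (opening ε a) x)) = W x := by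
          simp only [W, hD', indicator_of_mem hxU]
          rw [opening_eq_opening_zero hε.1.le hε1 h.le, fderiv_opening_of_lt hε.1.le hε1 h]
        rw [this, sub_self, ← ofReal_norm, norm_zero, ENNReal.ofReal_zero]
        exact zero_le
    calc _ ≤ ∫⁻ x in B, ‖(mfderivReal n f (w (opening ε a x))).comp
            ((D (opening ε a x)).comp (fderiv ℝ (opening ε a) x)) - W x‖ₑ := lintegral_mono_set hSB
      _ ≤ ∫⁻ x in B, ((openingShell a ε).indicator (fun x ↦ ‖W x‖ₑ) x +
          K * m * (ENNReal.ofReal ε * G (a + ε • (x - a)))) := lintegral_mono_ae hpt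
      _ = (∫⁻ x in openingShell a ε, ‖W x‖ₑ ∂(volume.restrict B)) +
          K * m * (ENNReal.ofReal ε * ∫⁻ x in B, G (a + ε • (x - a))) := by
          rw [lintegral_add_left' ((hWm.enorm.indicator (measurableSet_openingShell a ε)).restrict),
            lintegral_const_mul' _ _ (ENNReal.mul_ne_top ENNReal.coe_ne_top
              (ENNReal.natCast_ne_top m)), lintegral_const_mul' _ _ ENNReal.ofReal_ne_top,
            lintegral_indicator (measurableSet_openingShell a ε)]
      _ ≤ _ := by
          gcongr
          exact hint hε.1 hG

end OpeningWeakDifferential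

/-! ### The energy of the opened map -/

section OpeningEnergy

open scoped NNReal

variable {m n : ℕ}

theorem lintegral_ne_top_of_lintegral_rpow_ne_top {X : Type*} [MeasurableSpace X] {μ : Measure X}
    [IsFiniteMeasure μ] {G : X → ENNReal} {p : ℝ} (hp : 1 ≤ p) (h : ∫⁻ x, G x ^ p ∂μ ≠ ⊤) :
    ∫⁻ x, G x ∂μ ≠ ⊤ := by
  have h1 : ∀ x, G x ≤ 1 + G x ^ p := fun x ↦ by
    rcases le_total (G x) 1 with hx | hx
    · exact hx.trans le_self_add
    · refine le_trans ?_ le_add_self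
      calc G x = G x ^ (1 : ℝ) := (ENNReal.rpow_one _).symm
        _ ≤ _ := ENNReal.rpow_le_rpow_of_exponent_le hx hp
  refine ne_top_of_le_ne_top ?_ (lintegral_mono h1)
  rw [lintegral_add_left measurable_const]
  exact ENNReal.add_ne_top.2 ⟨by simp, h⟩

variable {N : Type*} [EMetricSpace N] [ChartedSpace (EuclideanSpace ℝ (Fin n)) N]
  [IsManifold (𝓡 n) ∞ N] [RiemannianBundle (fun y : N ↦ TangentSpace (𝓡 n) y)]
  [IsContMDiffRiemannianBundle (𝓡 n) ∞ (EuclideanSpace ℝ (Fin n))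
    (fun y : N ↦ TangentSpace (𝓡 n) y)] [IsRiemannianManifold (𝓡 n) N]
  [MeasurableSpace N] [BorelSpace N] [SecondCountableTopology N]

/-- Almost every `a` is a Lebesgue point of `w` and of a majorant `G` of the differential, with `G
a` finite. Among these, averaging for `G ^ p` selects one that controls the energy. Beyond the ball
of radius 3 the map is constant, and weak differentiability is local. -/
theorem HasBddWeakMFDerivOn.exists_opening {p : ℝ} (hp : 1 ≤ p) :
    ∃ C : ℝ≥0, ∀ (R : ℝ) (w : EuclideanSpace ℝ (Fin m) → N)
      (D : EuclideanSpace ℝ (Fin m) → EuclideanSpace ℝ (Fin m) →L[ℝ] EuclideanSpace ℝ (Fin n)),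
      1 < R → Measurable w → HasBddWeakMFDerivOn (Metric.ball 0 R) w D →
      ∫⁻ x in Metric.ball 0 R, tangentMapENorm (w x) (D x) ^ p ≠ ⊤ →
      ∃ (v : EuclideanSpace ℝ (Fin m) → N) (b : N)
        (D' : EuclideanSpace ℝ (Fin m) → EuclideanSpace ℝ (Fin m) →L[ℝ] EuclideanSpace ℝ (Fin n)),
        Measurable v ∧ (∀ x ∈ Metric.ball 0 1, v x = w x) ∧
        (∀ x ∉ Metric.closedBall (0 : EuclideanSpace ℝ (Fin m)) 3, v x = b) ∧
        HasBddWeakMFDerivOn univ v D' ∧ ∫⁻ x, tangentMapENorm (v x) (D' x) ^ p ≤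
          C * ∫⁻ x in Metric.ball 0 R, tangentMapENorm (w x) (D x) ^ p := by
  obtain ⟨C, hC⟩ := exists_forall_exists_opening (m := m)
  have hp0 : 0 < p := by linarith
  set c₁ : ENNReal := (m * 16 : ENNReal) ^ p
  have hc₁ : c₁ ≠ ⊤ := ENNReal.rpow_ne_top_of_nonneg hp0.le
    (ENNReal.mul_ne_top (ENNReal.natCast_ne_top m) (by simp))
  refine ⟨c₁.toNNReal * C, fun R w D hR hw hD hfin ↦ ?_⟩
  obtain ⟨G, hG, hDG, hGe⟩ := (hD.aemeasurable_tangentMapENorm Metric.isOpen_ball hw).exists_measurable_ge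
  have hsub : Metric.ball (0 : EuclideanSpace ℝ (Fin m)) 1 ⊆ Metric.ball 0 R :=
    Metric.ball_subset_ball hR.le
  have hGp : ∫⁻ x in Metric.ball 0 1, G x ^ p ≤
      ∫⁻ x in Metric.ball 0 R, tangentMapENorm (w x) (D x) ^ p := by
    calc _ ≤ ∫⁻ x in Metric.ball 0 R, G x ^ p := lintegral_mono_set hsub
      _ = _ := lintegral_congr_ae (hGe.mono fun x hx ↦ by simp only [hx])
  have : IsFiniteMeasure (volume.restrict (Metric.ball (0 : EuclideanSpace ℝ (Fin m)) 1)) :=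
    ⟨by simpa using measure_ball_lt_top⟩
  have : IsFiniteMeasure (volume.restrict (Metric.ball (0 : EuclideanSpace ℝ (Fin m)) 4)) :=
    ⟨by simpa using measure_ball_lt_top⟩
  have hG1 : ∫⁻ x in Metric.ball 0 1, G x ≠ ⊤ :=
    lintegral_ne_top_of_lintegral_rpow_ne_top hp (ne_top_of_le_ne_top hfin hGp)
  have ae1 := ae_tendsto_lintegral_closedBall_div hG Metric.isOpen_ball hG1
  have ae2 := ae_tendsto_lintegral_edist_div hw
    (Metric.isOpen_ball (x := (0 : EuclideanSpace ℝ (Fin m))) (ε := 1)) measure_ball_lt_top.ne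
  have ae3 := (ae_restrict_iff' Metric.isOpen_ball.measurableSet).1 (ae_lt_top hG hG1)
  obtain ⟨a, ha, ⟨h1, h2, h3⟩, ha4⟩ := hC (fun x ↦ G x ^ p) _ (hG.pow_const p)
    (ae1.and (ae2.and ae3))
  have ha1 : a ∈ Metric.ball (0 : EuclideanSpace ℝ (Fin m)) 1 := by
    rw [mem_ball_zero_iff]
    linarith
  have hGa : ∫⁻ x in Metric.ball 0 4, G (opening 0 a x) ≠ ⊤ :=
    lintegral_ne_top_of_lintegral_rpow_ne_top hp (ne_top_of_le_ne_top
      (ENNReal.mul_ne_top ENNReal.coe_ne_top (ne_top_of_le_ne_top hfin hGp)) ha4)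
  have hop := hD.comp_opening hw hR hG hDG ha hGa (h2 ha1) (h3 ha1).ne (h1 ha1)
  have hcont := (lipschitzWith_opening (le_refl (0 : ℝ)) zero_le_one a).continuous
  have hfar : ∀ x : EuclideanSpace ℝ (Fin m), 3 < ‖x‖ → 15 / 8 ≤ ‖x - a‖ := fun x hx ↦ by
    linarith [norm_sub_norm_le x a]
  refine ⟨fun x ↦ w (opening 0 a x), w a, (Metric.ball a (15 / 8)).indicator
        fun x ↦ (D (opening 0 a x)).comp (fderiv ℝ (opening 0 a) x), hw.comp hcont.measurable, fun x hx ↦ ?_, fun x hx ↦ ?_,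
    .of_locally fun x _ ↦ ?_, ?_⟩
  · change w (opening 0 a x) = _
    rw [opening_of_norm_le_one zero_le_one ha (mem_ball_zero_iff.1 hx).le]
  · rw [mem_closedBall_zero_iff, not_le] at hx
    change w (opening 0 a x) = _
    rw [opening_zero_of_ge ha (hfar x hx)]
  · by_cases hx : x ∈ Metric.ball (0 : EuclideanSpace ℝ (Fin m)) 4
    · exact ⟨_, Metric.isOpen_ball.mem_nhds hx, hop⟩
    · have hO : IsOpen {x : EuclideanSpace ℝ (Fin m) | 3 < ‖x‖} :=
        isOpen_lt continuous_const continuous_norm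
      refine ⟨_, hO.mem_nhds ?_, hasBddWeakMFDerivOn_of_eq_const hO (b := w a)
        (fun y hy ↦ ?_) fun y hy ↦ ?_⟩
      · rw [mem_ball_zero_iff] at hx
        change 3 < ‖x‖
        linarith
      · rw [opening_zero_of_ge ha (hfar y hy)]
      · refine indicator_of_notMem (fun hy' ↦ ?_) _
        rw [mem_ball_iff_norm] at hy'
        linarith [hfar y hy]
  · calc _ ≤ ∫⁻ x in Metric.ball 0 4, c₁ * G (opening 0 a x) ^ p := by
          rw [← lintegral_indicator Metric.isOpen_ball.measurableSet]
          refine lintegral_mono fun x ↦ ?_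
          by_cases hx : x ∈ Metric.ball a (15 / 8)
          · have hx4 : x ∈ Metric.ball (0 : EuclideanSpace ℝ (Fin m)) 4 := by
              rw [mem_ball_iff_norm] at hx
              rw [mem_ball_zero_iff]
              linarith [norm_sub_norm_le x a]
            rw [indicator_of_mem hx4, indicator_of_mem hx, ← ENNReal.mul_rpow_of_nonneg _ _ hp0.le]
            gcongr
            refine (tangentMapENorm_comp_le _ _ _).trans ?_
            rw [mul_assoc, mul_comm (16 : ENNReal)]
            gcongr
            · exact hDG _
            · exact enorm_fderiv_opening_le le_rfl zero_le_one a x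
          · rw [indicator_of_notMem hx, tangentMapENorm_zero, ENNReal.zero_rpow_of_pos hp0]
            exact zero_le
      _ = c₁ * ∫⁻ x in Metric.ball 0 4, G (opening 0 a x) ^ p := lintegral_const_mul' _ _ hc₁
      _ ≤ c₁ * (C * ∫⁻ x in Metric.ball 0 1, G x ^ p) := by gcongr
      _ ≤ _ := by
          rw [ENNReal.coe_mul, ENNReal.coe_toNNReal hc₁, mul_assoc]
          gcongr

end OpeningEnergy

/-! ### Gluing maps into balls on which a given map is constant -/

section Glue

open scoped NNReal

variable {m n : ℕ}

theorem tendsto_lintegral_filter_of_dominated_convergence_ae {X ι : Type*} [MeasurableSpace X]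
    {μ : Measure X} {l : Filter ι} [l.IsCountablyGenerated] {F : ι → X → ENNReal}
    {f : X → ENNReal} (G : X → ENNReal) (hF : ∀ i, AEMeasurable (F i) μ) (hFG : ∀ i x, F i x ≤ G x)
    (hG : ∫⁻ x, G x ∂μ ≠ ⊤) (hlim : ∀ x, Tendsto (fun i ↦ F i x) l (𝓝 (f x))) :
    Tendsto (fun i ↦ ∫⁻ x, F i x ∂μ) l (𝓝 (∫⁻ x, f x ∂μ)) :=
  tendsto_of_seq_tendsto fun u hu ↦ tendsto_lintegral_of_dominated_convergence' G
    (fun k ↦ hF (u k)) (fun k ↦ Eventually.of_forall fun x ↦ hFG (u k) x) hG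
    (Eventually.of_forall fun x ↦ (hlim x).comp hu)

theorem HasWeakFDerivOn.add {U : Set (EuclideanSpace ℝ (Fin m))}
    {h h' : EuclideanSpace ℝ (Fin m) → ℝ}
    {w w' : EuclideanSpace ℝ (Fin m) → EuclideanSpace ℝ (Fin m) →L[ℝ] ℝ}
    (hw : HasWeakFDerivOn U h w) (hw' : HasWeakFDerivOn U h' w') :
    HasWeakFDerivOn U (fun x ↦ h x + h' x) (fun x ↦ w x + w' x) := by
  refine ⟨fun x hx ↦ (hw.1 x hx).add (hw'.1 x hx), fun x hx ↦ ?_,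
    fun ψ hψ hψc hψU v ↦ ?_⟩
  · obtain ⟨S, hS, h1⟩ := hw.2.1 x hx
    obtain ⟨S', hS', h2⟩ := hw'.2.1 x hx
    have h3 : Integrable w (volume.restrict (S ∩ S')) := h1.mono_set inter_subset_left
    have h4 : Integrable w' (volume.restrict (S ∩ S')) := h2.mono_set inter_subset_right
    refine ⟨S ∩ S', Filter.inter_mem hS hS', h3.1.add h4.1, ?_⟩
    refine lt_of_le_of_lt (lintegral_mono fun y ↦ enorm_add_le (w y) (w' y)) ?_
    rw [lintegral_add_left' h3.1.enorm]
    exact ENNReal.add_lt_top.2 ⟨h3.2, h4.2⟩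
  have hψ1 : Continuous fun y ↦ fderiv ℝ ψ y v :=
    (hψ.continuous_fderiv (by simp)).clm_apply continuous_const
  have hs : tsupport (fun y ↦ fderiv ℝ ψ y v) ⊆ tsupport ψ := tsupport_fderiv_apply_subset ℝ v
  have hc1 : HasCompactSupport fun y ↦ fderiv ℝ ψ y v := hψc.of_isClosed_subset (isClosed_tsupport _) hs
  simp only [add_mul, _root_.add_apply]
  rw [integral_add (hw.1.integrable_mul_of_tsupport_subset hψ1 hc1 (hs.trans hψU))
    (hw'.1.integrable_mul_of_tsupport_subset hψ1 hc1 (hs.trans hψU)),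
    integral_add ((hw.2.1.clm_apply_const v).integrable_mul_of_tsupport_subset hψ.continuous hψc hψU)
    ((hw'.2.1.clm_apply_const v).integrable_mul_of_tsupport_subset hψ.continuous hψc hψU),
    hw.2.2 ψ hψ hψc hψU v, hw'.2.2 ψ hψ hψc hψU v]
  ring

theorem HasWeakFDerivOn.sub_const {U : Set (EuclideanSpace ℝ (Fin m))}
    {h : EuclideanSpace ℝ (Fin m) → ℝ}
    {w : EuclideanSpace ℝ (Fin m) → EuclideanSpace ℝ (Fin m) →L[ℝ] ℝ}
    (hw : HasWeakFDerivOn U h w) (c : ℝ) : HasWeakFDerivOn U (fun x ↦ h x - c) w := by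
  have h1 := hw.add ((LipschitzWith.const (α := EuclideanSpace ℝ (Fin m)) (-c)).hasWeakFDerivOn U)
  simp only [fderiv_fun_const, Pi.zero_apply, add_zero] at h1
  exact h1

theorem HasWeakFDerivOn.add_finsetSum {U : Set (EuclideanSpace ℝ (Fin m))} {ι : Type*}
    {h : EuclideanSpace ℝ (Fin m) → ℝ}
    {w : EuclideanSpace ℝ (Fin m) → EuclideanSpace ℝ (Fin m) →L[ℝ] ℝ}
    {h' : ι → EuclideanSpace ℝ (Fin m) → ℝ}
    {w' : ι → EuclideanSpace ℝ (Fin m) → EuclideanSpace ℝ (Fin m) →L[ℝ] ℝ}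
    (hw : HasWeakFDerivOn U h w) (s : Finset ι) (hw' : ∀ i ∈ s, HasWeakFDerivOn U (h' i) (w' i)) :
    HasWeakFDerivOn U (fun x ↦ h x + ∑ i ∈ s, h' i x) (fun x ↦ w x + ∑ i ∈ s, w' i x) := by
  classical
  induction s using Finset.induction_on with
  | empty => simpa using hw
  | insert i s hi ih =>
    have h1 := (ih fun j hj ↦ hw' j (Finset.mem_insert_of_mem hj)).add
      (hw' i (Finset.mem_insert_self i s))
    have e1 : (fun x ↦ h x + ∑ j ∈ insert i s, h' j x) =
        fun x ↦ h x + ∑ j ∈ s, h' j x + h' i x := by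
      ext x
      rw [Finset.sum_insert hi]
      ring
    have e2 : (fun x ↦ w x + ∑ j ∈ insert i s, w' j x) =
        fun x ↦ w x + ∑ j ∈ s, w' j x + w' i x := by
      ext1 x
      rw [Finset.sum_insert hi]
      abel
    rw [e1, e2]
    exact h1

/-- The map that is `V j` on `O j` and `Γ` off these sets. -/
noncomputable def glue {X N ι : Type*} (O : ι → Set X) (V : ι → X → N) (Γ : X → N) (x : X) : N :=
  open Classical in if h : ∃ j, x ∈ O j then V h.choose x else Γ x

theorem glue_of_mem {X N ι : Type*} {O : ι → Set X} (hO : Pairwise (Function.onFun Disjoint O))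
    (V : ι → X → N) (Γ : X → N) {j : ι} {x : X} (hx : x ∈ O j) : glue O V Γ x = V j x := by
  have h : ∃ j, x ∈ O j := ⟨j, hx⟩
  have h1 : h.choose = j := by
    by_contra hne
    exact disjoint_left.1 (hO hne) h.choose_spec hx
  rw [glue, dif_pos h, h1]

theorem glue_of_notMem {X N ι : Type*} {O : ι → Set X} (V : ι → X → N) (Γ : X → N) {x : X}
    (hx : ∀ j, x ∉ O j) : glue O V Γ x = Γ x := by
  rw [glue, dif_neg (by simpa using hx)]

theorem measurable_glue {X N ι : Type*} [MeasurableSpace X] [MeasurableSpace N] [Countable ι]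
    {O : ι → Set X} (hO : Pairwise (Function.onFun Disjoint O)) (hOm : ∀ j, MeasurableSet (O j))
    {V : ι → X → N} {Γ : X → N} (hV : ∀ j, Measurable (V j)) (hΓ : Measurable Γ) :
    Measurable (glue O V Γ) := by
  intro S hS
  have h1 : glue O V Γ ⁻¹' S = (⋃ j, O j ∩ V j ⁻¹' S) ∪ ((⋃ j, O j)ᶜ ∩ Γ ⁻¹' S) := by
    ext x
    by_cases h : ∃ j, x ∈ O j
    · obtain ⟨j, hj⟩ := h
      rw [mem_preimage, glue_of_mem hO V Γ hj]
      constructor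
      · exact fun hx ↦ Or.inl (mem_iUnion.2 ⟨j, hj, hx⟩)
      · rintro (hx | hx)
        · obtain ⟨i, hi, hx⟩ := mem_iUnion.1 hx
          have : i = j := by
            by_contra hne
            exact disjoint_left.1 (hO hne) hi hj
          rwa [this] at hx
        · exact absurd (mem_iUnion.2 ⟨j, hj⟩) hx.1
    · push Not at h
      rw [mem_preimage, glue_of_notMem V Γ h]
      simp [h]
  rw [h1]
  exact (MeasurableSet.iUnion fun j ↦ (hOm j).inter (hV j hS)).union
    ((MeasurableSet.iUnion hOm).compl.inter (hΓ hS))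

variable {N : Type*} [EMetricSpace N] [ChartedSpace (EuclideanSpace ℝ (Fin n)) N]

theorem HasBddWeakMFDerivOn.indicator_compl_iUnion {ι : Type*} [Countable ι]
    {u : EuclideanSpace ℝ (Fin m) → N}
    {D : EuclideanSpace ℝ (Fin m) → EuclideanSpace ℝ (Fin m) →L[ℝ] EuclideanSpace ℝ (Fin n)}
    (h : HasBddWeakMFDerivOn univ u D) {O : ι → Set (EuclideanSpace ℝ (Fin m))}
    (hO : ∀ j, IsOpen (O j)) {b : ι → N} (hb : ∀ j, ∀ x ∈ O j, u x = b j) :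
    HasBddWeakMFDerivOn univ u ((⋃ j, O j)ᶜ.indicator D) := by
  intro f h1 h2 h3
  have h4 := h f h1 h2 h3
  have h5 := fun j ↦ h4.ae_eq_zero_of_eq_const (hO j) (subset_univ _) (c := f (b j))
    fun x hx ↦ by simp [hb j x hx]
  refine h4.congr_ae isOpen_univ .rfl ?_
  have h6 := ae_all_iff.2 fun j ↦ (ae_restrict_iff' (hO j).measurableSet).1 (h5 j)
  filter_upwards [ae_restrict_of_ae h6] with x hx
  by_cases hxO : x ∈ ⋃ j, O j
  · obtain ⟨j, hj⟩ := mem_iUnion.1 hxO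
    rw [hx j hj, indicator_of_notMem (by simpa using hxO)]
    simp
  · rw [indicator_of_mem hxO]

variable [RiemannianBundle (fun y : N ↦ TangentSpace (𝓡 n) y)]

/-- The Dirichlet `p`-energy on the whole Euclidean space, tested with bounded functions only, and
with an equivalent norm of the differential. -/
noncomputable def bddDirichletEnergy (p : ℝ) (u : EuclideanSpace ℝ (Fin m) → N) : ENNReal :=
  ⨅ (D : EuclideanSpace ℝ (Fin m) → EuclideanSpace ℝ (Fin m) →L[ℝ] EuclideanSpace ℝ (Fin n))
    (_ : HasBddWeakMFDerivOn univ u D), ∫⁻ x, tangentMapENorm (u x) (D x) ^ p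

theorem HasBddWeakMFDerivOn.bddDirichletEnergy_le {p : ℝ} {u : EuclideanSpace ℝ (Fin m) → N}
    {D : EuclideanSpace ℝ (Fin m) → EuclideanSpace ℝ (Fin m) →L[ℝ] EuclideanSpace ℝ (Fin n)}
    (h : HasBddWeakMFDerivOn univ u D) :
    bddDirichletEnergy (n := n) p u ≤ ∫⁻ x, tangentMapENorm (u x) (D x) ^ p :=
  iInf₂_le D h

theorem exists_hasBddWeakMFDerivOn_of_lt {p : ℝ} {u : EuclideanSpace ℝ (Fin m) → N} {c : ENNReal}
    (h : bddDirichletEnergy (n := n) p u < c) :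
    ∃ D : EuclideanSpace ℝ (Fin m) → EuclideanSpace ℝ (Fin m) →L[ℝ] EuclideanSpace ℝ (Fin n),
      HasBddWeakMFDerivOn univ u D ∧ ∫⁻ x, tangentMapENorm (u x) (D x) ^ p < c := by
  simpa [bddDirichletEnergy, iInf_lt_iff] using h

variable [IsManifold (𝓡 n) ∞ N]
  [IsContMDiffRiemannianBundle (𝓡 n) ∞ (EuclideanSpace ℝ (Fin n))
    (fun y : N ↦ TangentSpace (𝓡 n) y)] [IsRiemannianManifold (𝓡 n) N]
  [MeasurableSpace N] [BorelSpace N] [SecondCountableTopology N]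

/-- For a bounded test `f`, the composition of `f` with the glued map is the limit over finite sets
`s` of `f ∘ Γ` plus the sum over `j ∈ s` of `f ∘ V j - f (b j)`, and finite sums of weak
differentials are available. At each point at most one summand is nonzero, which gives bounds
uniform in `s` and dominated convergence. The differentials are first set to 0 where the maps are
constant, so that these identities hold at every point. -/
theorem HasBddWeakMFDerivOn.glue {ι : Type*} [Countable ι] {p : ℝ} (hp : 1 ≤ p)
    {O A : ι → Set (EuclideanSpace ℝ (Fin m))} (hO : Pairwise (Function.onFun Disjoint O))
    (hOo : ∀ j, IsOpen (O j)) (hA : ∀ j, IsClosed (A j)) (hAO : ∀ j, A j ⊆ O j)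
    {Γ : EuclideanSpace ℝ (Fin m) → N} {V : ι → EuclideanSpace ℝ (Fin m) → N} {b : ι → N}
    {DΓ : EuclideanSpace ℝ (Fin m) → EuclideanSpace ℝ (Fin m) →L[ℝ] EuclideanSpace ℝ (Fin n)}
    {D : ι → EuclideanSpace ℝ (Fin m) → EuclideanSpace ℝ (Fin m) →L[ℝ] EuclideanSpace ℝ (Fin n)}
    (hΓ : Measurable Γ) (hV : ∀ j, Measurable (V j)) (hΓb : ∀ j, ∀ x ∈ O j, Γ x = b j)
    (hVb : ∀ j, ∀ x ∉ A j, V j x = b j)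
    (hDΓ : HasBddWeakMFDerivOn univ Γ DΓ) (hD : ∀ j, HasBddWeakMFDerivOn univ (V j) (D j))
    (hfin : (∫⁻ x, tangentMapENorm (Γ x) (DΓ x) ^ p) +
      ∑' j, ∫⁻ x, tangentMapENorm (V j x) (D j x) ^ p ≠ ⊤) :
    ∃ D' : EuclideanSpace ℝ (Fin m) → EuclideanSpace ℝ (Fin m) →L[ℝ] EuclideanSpace ℝ (Fin n),
      HasBddWeakMFDerivOn univ (glue O V Γ) D' ∧
      ∫⁻ x, tangentMapENorm (glue O V Γ x) (D' x) ^ p ≤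
        (∫⁻ x, tangentMapENorm (Γ x) (DΓ x) ^ p) +
          ∑' j, ∫⁻ x, tangentMapENorm (V j x) (D j x) ^ p := by
  classical
  have hp0 : 0 < p := by linarith
  set U := _root_.glue O V Γ with hU
  have hUm : Measurable U := measurable_glue hO (fun j ↦ (hOo j).measurableSet) hV hΓ
  set DΓ₀ := (⋃ j, O j)ᶜ.indicator DΓ
  set D₀ := fun j ↦ (A j).indicator (D j)
  have hDΓ₀ : HasBddWeakMFDerivOn univ Γ DΓ₀ := hDΓ.indicator_compl_iUnion hOo hΓb
  have hD₀ : ∀ j, HasBddWeakMFDerivOn univ (V j) (D₀ j) := fun j ↦ by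
    have := (hD j).indicator_compl isOpen_univ (hA j).isOpen_compl (subset_univ _) (hVb j)
    rwa [compl_compl] at this
  set D' := _root_.glue O D₀ DΓ₀
  have hD'j : ∀ {j x}, x ∈ O j → D' x = D₀ j x := fun hx ↦ glue_of_mem hO _ _ hx
  have hUj : ∀ {j x}, x ∈ O j → U x = V j x := fun hx ↦ glue_of_mem hO _ _ hx
  have hnot : ∀ {j i x}, x ∈ O j → i ≠ j → x ∉ A i := fun {j i x} hx hne hxi ↦
    disjoint_left.1 (hO hne) (hAO i hxi) hx
  have hptE : ∀ x, tangentMapENorm (U x) (D' x) ^ p ≤ tangentMapENorm (Γ x) (DΓ x) ^ p +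
      ∑' j, tangentMapENorm (V j x) (D j x) ^ p := by
    intro x
    by_cases h : ∃ j, x ∈ O j
    · obtain ⟨j, hj⟩ := h
      refine le_trans ?_ (le_trans (ENNReal.le_tsum j) le_add_self)
      rw [hD'j hj, hUj hj]
      gcongr
      by_cases hA' : x ∈ A j
      · simp only [D₀, indicator_of_mem hA', le_refl]
      · simp only [D₀, indicator_of_notMem hA', tangentMapENorm_zero, zero_le]
    · push Not at h
      refine le_trans ?_ le_self_add
      have hx : x ∈ (⋃ j, O j)ᶜ := by simpa using h
      simp only [hU, D', glue_of_notMem _ _ h, DΓ₀, indicator_of_mem hx, le_refl]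
  have haeΓ : AEMeasurable (fun x ↦ tangentMapENorm (Γ x) (DΓ x) ^ p) volume := by
    have := hDΓ.aemeasurable_tangentMapENorm isOpen_univ hΓ
    rw [Measure.restrict_univ] at this
    exact this.pow_const p
  have haeV : ∀ j, AEMeasurable (fun x ↦ tangentMapENorm (V j x) (D j x) ^ p) volume := fun j ↦ by
    have := (hD j).aemeasurable_tangentMapENorm isOpen_univ (hV j)
    rw [Measure.restrict_univ] at this
    exact this.pow_const p
  have hE : ∫⁻ x, tangentMapENorm (U x) (D' x) ^ p ≤
        (∫⁻ x, tangentMapENorm (Γ x) (DΓ x) ^ p) +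
          ∑' j, ∫⁻ x, tangentMapENorm (V j x) (D j x) ^ p := by
    refine (lintegral_mono hptE).trans_eq ?_
    rw [lintegral_add_left' haeΓ, lintegral_tsum haeV]
  refine ⟨D', ?_, hE⟩
  intro f hf ⟨K, hK⟩ hfb
  obtain ⟨c, hc⟩ := hfb
  set h : EuclideanSpace ℝ (Fin m) → ℝ := fun x ↦ f (U x)
  set w : EuclideanSpace ℝ (Fin m) → EuclideanSpace ℝ (Fin m) →L[ℝ] ℝ :=
    fun x ↦ (mfderivReal n f (U x)).comp (D' x)
  set hs : Finset ι → EuclideanSpace ℝ (Fin m) → ℝ :=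
    fun s x ↦ f (Γ x) + ∑ j ∈ s, (f (V j x) - f (b j)) with hhs
  set ws : Finset ι → EuclideanSpace ℝ (Fin m) → EuclideanSpace ℝ (Fin m) →L[ℝ] ℝ :=
    fun s x ↦ (mfderivReal n f (Γ x)).comp (DΓ₀ x) +
      ∑ j ∈ s, (mfderivReal n f (V j x)).comp (D₀ j x) with hws
  have hweak : ∀ s, HasWeakFDerivOn univ (hs s) (ws s) := fun s ↦
    (hDΓ₀ f hf ⟨K, hK⟩ ⟨c, hc⟩).add_finsetSum s fun j _ ↦
      (hD₀ j f hf ⟨K, hK⟩ ⟨c, hc⟩).sub_const _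
  have hVout : ∀ {j i x}, x ∈ O j → i ≠ j → V i x = b i := fun hx hne ↦ hVb _ _ (hnot hx hne)
  have hs_in : ∀ {s : Finset ι} {j x}, x ∈ O j → j ∈ s → hs s x = h x ∧ ws s x = w x := by
    intro s j x hx hjs
    have e1 : ∑ i ∈ s, (f (V i x) - f (b i)) = f (V j x) - f (b j) :=
      Finset.sum_eq_single_of_mem j hjs fun i _ hne ↦ by rw [hVout hx hne, sub_self]
    have e2 : ∑ i ∈ s, (mfderivReal n f (V i x)).comp (D₀ i x) =
        (mfderivReal n f (V j x)).comp (D₀ j x) :=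
      Finset.sum_eq_single_of_mem j hjs fun i _ hne ↦ by
        simp only [D₀, indicator_of_notMem (hnot hx hne), ContinuousLinearMap.comp_zero]
    have hx' : x ∉ (⋃ j, O j)ᶜ := fun h ↦ h (mem_iUnion.2 ⟨j, hx⟩)
    simp only [hhs, hws, e1, e2, h, w, hUj hx, hD'j hx, hΓb j x hx, DΓ₀, indicator_of_notMem hx',
      ContinuousLinearMap.comp_zero, zero_add]
    exact ⟨by ring, trivial⟩
  have hs_out : ∀ {s : Finset ι} {j x}, x ∈ O j → j ∉ s → hs s x = f (b j) ∧ ws s x = 0 := by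
    intro s j x hx hjs
    have e1 : ∑ i ∈ s, (f (V i x) - f (b i)) = 0 :=
      Finset.sum_eq_zero fun i hi ↦ by
        rw [hVout hx (ne_of_mem_of_not_mem hi hjs), sub_self]
    have e2 : ∑ i ∈ s, (mfderivReal n f (V i x)).comp (D₀ i x) = 0 :=
      Finset.sum_eq_zero fun i hi ↦ by
        simp only [D₀, indicator_of_notMem (hnot hx (ne_of_mem_of_not_mem hi hjs)),
          ContinuousLinearMap.comp_zero]
    have hx' : x ∉ (⋃ j, O j)ᶜ := fun h ↦ h (mem_iUnion.2 ⟨j, hx⟩)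
    simp only [hhs, hws, e1, e2, hΓb j x hx, DΓ₀, indicator_of_notMem hx',
      ContinuousLinearMap.comp_zero, add_zero, and_self]
  have hs_none : ∀ {s : Finset ι} {x}, (∀ j, x ∉ O j) → hs s x = h x ∧ ws s x = w x := by
    intro s x hx
    have hxA : ∀ j, x ∉ A j := fun j hj ↦ hx j (hAO j hj)
    have e1 : ∑ i ∈ s, (f (V i x) - f (b i)) = 0 :=
      Finset.sum_eq_zero fun i hi ↦ by rw [hVb i x (hxA i), sub_self]
    have e2 : ∑ i ∈ s, (mfderivReal n f (V i x)).comp (D₀ i x) = 0 :=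
      Finset.sum_eq_zero fun i hi ↦ by
        simp only [D₀, indicator_of_notMem (hxA i), ContinuousLinearMap.comp_zero]
    simp only [hhs, hws, e1, e2, add_zero, h, w, hU, D', glue_of_notMem _ _ hx, and_self]
  have hev : ∀ x, ∀ᶠ s : Finset ι in atTop, hs s x = h x ∧ ws s x = w x := by
    intro x
    by_cases hx : ∃ j, x ∈ O j
    · obtain ⟨j, hj⟩ := hx
      filter_upwards [eventually_ge_atTop {j}] with s hsj
      exact hs_in hj (by simpa using hsj)
    · push Not at hx
      exact Eventually.of_forall fun s ↦ hs_none hx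
  have hbound : ∀ s x, ‖hs s x - h x‖ₑ ≤ ENNReal.ofReal (2 * c) ∧ ‖ws s x - w x‖ₑ ≤ ‖w x‖ₑ := by
    intro s x
    by_cases hx : ∃ j, x ∈ O j
    · obtain ⟨j, hj⟩ := hx
      by_cases hjs : j ∈ s
      · rw [(hs_in hj hjs).1, (hs_in hj hjs).2, sub_self, sub_self, ← ofReal_norm, ← ofReal_norm,
          norm_zero, norm_zero, ENNReal.ofReal_zero]
        exact ⟨zero_le, zero_le⟩
      · rw [(hs_out hj hjs).1, (hs_out hj hjs).2, zero_sub, ← ofReal_norm, ← ofReal_norm,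
          norm_neg]
        refine ⟨?_, (ofReal_norm _).le⟩
        refine ENNReal.ofReal_le_ofReal ?_
        refine (norm_sub_le _ _).trans ?_
        have h1 := hc (b j)
        have h2 := hc (U x)
        simp only [Real.norm_eq_abs, h]
        linarith
    · push Not at hx
      rw [(hs_none hx).1, (hs_none hx).2, sub_self, sub_self, ← ofReal_norm, ← ofReal_norm,
        norm_zero, norm_zero, ENNReal.ofReal_zero]
      exact ⟨zero_le, zero_le⟩
  have hhm : Measurable h := hf.continuous.measurable.comp hUm
  have hwm : AEStronglyMeasurable w volume :=
    aestronglyMeasurable_of_tendsto_ae (atTop : Filter (Finset ι))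
      (fun s ↦ (locallyIntegrableOn_univ.1 (hweak s).2.1).aestronglyMeasurable)
      (Eventually.of_forall fun x ↦ tendsto_const_nhds.congr' ((hev x).mono fun s hs ↦ hs.2.symm))
  have hwK : ∀ S : Set (EuclideanSpace ℝ (Fin m)), IsCompact S → ∫⁻ x in S, ‖w x‖ₑ ≠ ⊤ := by
    intro S hS
    have : IsFiniteMeasure (volume.restrict S) := ⟨by simpa using hS.measure_lt_top⟩
    have h1 : ∫⁻ x in S, tangentMapENorm (U x) (D' x) ^ p ≠ ⊤ :=
      ne_top_of_le_ne_top hfin ((setLIntegral_le_lintegral _ _).trans hE)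
    refine ne_top_of_le_ne_top (ENNReal.mul_ne_top (ENNReal.coe_ne_top (r := K))
      (lintegral_ne_top_of_lintegral_rpow_ne_top hp h1)) ?_
    rw [← lintegral_const_mul' _ _ ENNReal.coe_ne_top]
    exact lintegral_mono fun x ↦ hK.enorm_mfderivReal_comp_le hf _ _
  have hwloc : LocallyIntegrable w volume := by
    rw [locallyIntegrable_iff]
    exact fun S hS ↦ ⟨hwm.restrict, (hwK S hS).lt_top⟩
  refine HasWeakFDerivOn.of_tendsto (l := (atTop : Filter (Finset ι))) (Eventually.of_forall hweak)
    ?_ (hwloc.locallyIntegrableOn _) ?_ ?_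
  · refine LocallyIntegrable.locallyIntegrableOn ?_ _
    exact LocallyIntegrable.mono (f := fun _ ↦ c) (locallyIntegrable_const _)
      hhm.aestronglyMeasurable (Eventually.of_forall fun x ↦ (hc _).trans (le_abs_self _))
  · intro S _ hS
    have := tendsto_lintegral_filter_of_dominated_convergence_ae (μ := volume.restrict S)
      (l := (atTop : Filter (Finset ι))) (F := fun s x ↦ ‖hs s x - h x‖ₑ) (f := fun _ ↦ 0)
      (fun _ ↦ ENNReal.ofReal (2 * c))
      (fun s ↦ (((locallyIntegrableOn_univ.1 (hweak s).1).aestronglyMeasurable.sub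
        hhm.aestronglyMeasurable).enorm).restrict)
      (fun s x ↦ (hbound s x).1)
      (by
        rw [lintegral_const, Measure.restrict_apply_univ]
        exact ENNReal.mul_ne_top ENNReal.ofReal_ne_top hS.measure_lt_top.ne)
      (fun x ↦ tendsto_const_nhds.congr' ((hev x).mono fun s hs ↦ by
        simp only [hs.1, sub_self, enorm_zero]))
    simpa using this
  · intro S _ hS
    have := tendsto_lintegral_filter_of_dominated_convergence_ae (μ := volume.restrict S)
      (l := (atTop : Filter (Finset ι))) (F := fun s x ↦ ‖ws s x - w x‖ₑ) (f := fun _ ↦ 0)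
      (fun x ↦ ‖w x‖ₑ)
      (fun s ↦ (((locallyIntegrableOn_univ.1 (hweak s).2.1).aestronglyMeasurable.sub
        hwm).enorm).restrict)
      (fun s x ↦ (hbound s x).2)
      (hwK S hS)
      (fun x ↦ tendsto_const_nhds.congr' ((hev x).mono fun s hs ↦ by
        simp only [hs.2, sub_self, ← ofReal_norm, norm_zero, ENNReal.ofReal_zero]))
    simpa using this

end Glue

/-! ### Transitions between constants -/

section Transition

open scoped NNReal

variable {m n : ℕ} {N : Type*} [EMetricSpace N] [ChartedSpace (EuclideanSpace ℝ (Fin n)) N]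
  [IsManifold (𝓡 n) ∞ N] [RiemannianBundle (fun y : N ↦ TangentSpace (𝓡 n) y)]
  [IsContMDiffRiemannianBundle (𝓡 n) ∞ (EuclideanSpace ℝ (Fin n))
    (fun y : N ↦ TangentSpace (𝓡 n) y)] [IsRiemannianManifold (𝓡 n) N]

omit [IsRiemannianManifold (𝓡 n) N] in
theorem ContMDiff.exists_tangentENorm_mfderivModel_le {Γ : EuclideanSpace ℝ (Fin m) → N}
    (hΓ : ContMDiff (𝓡 m) (𝓡 n) 1 Γ) (x : EuclideanSpace ℝ (Fin m)) :
    ∃ V ∈ 𝓝 x, ∃ C : ℝ≥0, ∀ y ∈ V, ∀ v : EuclideanSpace ℝ (Fin m),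
      tangentENorm (Γ y) (mfderivModel m n Γ y v) ≤ C * ‖v‖ₑ := by
  obtain ⟨C, W, hW, hWs, hC⟩ := exists_chartAt_bounds (m := n) (Γ x)
  set e := chartAt (EuclideanSpace ℝ (Fin n)) (Γ x)
  have hx : Γ x ∈ e.source := mem_chart_source _ (Γ x)
  have hO : IsOpen (Γ ⁻¹' e.source) := e.open_source.preimage hΓ.continuous
  have hg : ContDiffOn ℝ 1 (e ∘ Γ) (Γ ⁻¹' e.source) := by
    rw [← contMDiffOn_iff_contDiffOn]
    exact ((contMDiffOn_chart (n := ∞) (x := Γ x)).of_le (by simp)).comp hΓ.contMDiffOn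
      (mapsTo_preimage _ _)
  have hgc : ContinuousAt (fun y ↦ ‖fderiv ℝ (e ∘ Γ) y‖) x :=
    ((hg.continuousOn_fderiv_of_isOpen hO (by simp)).continuousAt (hO.mem_nhds hx)).norm
  have hev := hgc.eventually (gt_mem_nhds (lt_add_one _))
  refine ⟨_, inter_mem (hΓ.continuous.continuousAt.preimage_mem_nhds hW) hev,
    C * (‖fderiv ℝ (e ∘ Γ) x‖ + 1).toNNReal, fun y hy v ↦ ?_⟩
  have hys : Γ y ∈ e.source := hWs hy.1
  have h1 : mfderivModel m n Γ y v =
      mfderivModel n n e.symm (e (Γ y)) (fderiv ℝ (e ∘ Γ) y v) := by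
    have h3 := mfderiv_comp (I := 𝓡 m) (I' := 𝓡 n) (I'' := 𝓡 n) y (g := e) (f := Γ)
      (mdifferentiableAt_atlas (chart_mem_atlas _ (Γ x)) hys) (hΓ.mdifferentiableAt (by simp))
    rw [mfderiv_eq_fderiv] at h3
    rw [h3]
    exact (mfderivModel_chartAt_symm_apply (Γ x) hys _).symm
  rw [h1]
  refine (hC _ hy.1 _).2.trans ?_
  rw [ENNReal.coe_mul, mul_assoc]
  gcongr
  refine (ContinuousLinearMap.le_opENorm _ _).trans ?_
  gcongr
  rw [← ofReal_norm]
  exact ENNReal.ofReal_le_ofReal (le_of_lt hy.2)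

/-- The points at finite distance from `b'` form an open and closed set. -/
theorem edist_ne_top_of_connectedSpace [ConnectedSpace N] (b b' : N) : edist b b' ≠ ⊤ := by
  have h1 : IsClopen (Metric.eball b' ⊤) := by
    refine ⟨⟨?_⟩, Metric.isOpen_eball⟩
    rw [EMetric.isOpen_iff]
    intro y hy
    refine ⟨1, by simp, fun z hz hz' ↦ hy ?_⟩
    rw [Metric.mem_eball] at hz hz' ⊢
    rw [edist_comm] at hz
    exact (edist_triangle y z b').trans_lt (ENNReal.add_lt_top.2 ⟨hz.trans (by simp), hz'⟩)
  have h2 := h1.eq_univ ⟨b', Metric.mem_eball_self (by simp)⟩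
  exact (Metric.mem_eball.1 (h2.symm ▸ mem_univ b)).ne

/-- Any two points are joined by a map that is constant near the origin and near infinity. -/
theorem exists_contMDiff_transition (m : ℕ) [ConnectedSpace N] (b b' : N) :
    ∃ (Γ : EuclideanSpace ℝ (Fin m) → N) (C : ℝ≥0), ContMDiff (𝓡 m) (𝓡 n) 1 Γ ∧
      (∀ x ∈ Metric.closedBall (0 : EuclideanSpace ℝ (Fin m)) 1, Γ x = b) ∧
      (∀ x ∉ Metric.closedBall (0 : EuclideanSpace ℝ (Fin m)) 2, Γ x = b') ∧
      (∀ x v : EuclideanSpace ℝ (Fin m),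
        tangentENorm (Γ x) (mfderivModel m n Γ x v) ≤ C * ‖v‖ₑ) ∧
      (∀ x ∉ Metric.closedBall (0 : EuclideanSpace ℝ (Fin m)) 2, mfderivModel m n Γ x = 0) ∧
      LipschitzWith C Γ := by
  obtain ⟨r, hr⟩ := ENNReal.lt_iff_exists_nnreal_btwn.1 (edist_ne_top_of_connectedSpace b' b).lt_top
  obtain ⟨γ, h0, h1, hγ, -⟩ := Manifold.exists_lt_locally_constant_of_riemannianEDist_lt (I := 𝓡 n)
    (x := b') (y := b) (r := r) (by rw [← IsRiemannianManifold.out (I := 𝓡 n)]; exact hr.1)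
    zero_lt_one
  -- The bump function is the time along a C¹ path from `b'` to `b`: it is 1 on the unit ball and 0
  -- off the ball of radius 2.
  let τ : ContDiffBump (0 : EuclideanSpace ℝ (Fin m)) := ⟨1, 2, by simp, by norm_num⟩
  set Γ : EuclideanSpace ℝ (Fin m) → N := fun x ↦ γ (τ x)
  have hΓ : ContMDiff (𝓡 m) (𝓡 n) 1 Γ := hγ.comp τ.contDiff.contMDiff
  have hout : ∀ x ∉ Metric.closedBall (0 : EuclideanSpace ℝ (Fin m)) 2, Γ x = b' := fun x hx ↦ by
    have : τ x = 0 := τ.zero_of_le_dist (by simpa using (not_le.1 (by simpa using hx)).le)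
    simp [Γ, this, h0]
  have hD0 : ∀ x ∉ Metric.closedBall (0 : EuclideanSpace ℝ (Fin m)) 2,
      mfderivModel m n Γ x = 0 := fun x hx ↦ by
    have hee : Γ =ᶠ[𝓝 x] fun _ ↦ b' := by
      filter_upwards [Metric.isClosed_closedBall.isOpen_compl.mem_nhds hx] with y hy using hout y hy
    have : mfderiv (𝓡 m) (𝓡 n) Γ x = 0 := by
      rw [hee.mfderiv_eq, mfderiv_const]
      rfl
    exact this
  choose V hV C hC using fun x ↦ hΓ.exists_tangentENorm_mfderivModel_le x
  obtain ⟨t, -, ht⟩ := (isCompact_closedBall (0 : EuclideanSpace ℝ (Fin m)) 2).elim_nhds_subcover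
    V fun x _ ↦ hV x
  set K := ∑ x ∈ t, C x
  have hK : ∀ x v : EuclideanSpace ℝ (Fin m),
      tangentENorm (Γ x) (mfderivModel m n Γ x v) ≤ K * ‖v‖ₑ := fun x v ↦ by
    by_cases hx : x ∈ Metric.closedBall (0 : EuclideanSpace ℝ (Fin m)) 2
    · obtain ⟨y, hyt, hxy⟩ := mem_iUnion₂.1 (ht hx)
      refine (hC y x hxy v).trans ?_
      gcongr
      exact Finset.single_le_sum (f := C) (fun _ _ ↦ zero_le) hyt
    · rw [hD0 x hx, _root_.zero_apply, tangentENorm_zero]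
      exact zero_le
  refine ⟨Γ, K, hΓ, fun x hx ↦ ?_, hout, hK, hD0, fun x y ↦ ?_⟩
  · simp [Γ, τ.one_of_mem_closedBall hx, h1]
  · let η := ContinuousAffineMap.lineMap (R := ℝ) x y
    have hη : ContMDiffOn 𝓘(ℝ, ℝ) (𝓡 m) 1 η (Icc 0 1) := by
      apply ContMDiff.contMDiffOn
      rw [contMDiff_iff_contDiff]
      exact ContinuousAffineMap.contDiff _
    have h1 := edist_comp_le_pathELength (J := 𝓡 n) (I := 𝓡 m) (f := Γ) (C := K) (γ := η) isOpen_univ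
      hΓ.contMDiffOn (fun y hy v ↦ by
        rw [enorm_tangentSpace_vectorSpace]
        exact hK y v) hη (mapsTo_univ _ _)
    have h2 : Manifold.pathELength (𝓡 m) η 0 1 = edist x y := by
      rw [← lintegral_fderiv_lineMap_eq_edist, Manifold.pathELength_eq_lintegral_mfderivWithin_Icc]
      refine setLIntegral_congr_fun measurableSet_Icc fun t ht ↦ ?_
      simp only [mfderivWithin_eq_fderivWithin, enorm_tangentSpace_vectorSpace]
      rfl
    rw [h2] at h1
    simpa only [η, ContinuousAffineMap.coe_lineMap_eq, AffineMap.lineMap_apply_zero,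
      AffineMap.lineMap_apply_one] using h1

theorem exists_transition_bddDirichletEnergy_lt_top [ConnectedSpace N] {p : ℝ} (hp : 0 < p)
    (b b' : N) : ∃ Γ : EuclideanSpace ℝ (Fin m) → N, Continuous Γ ∧
      (∀ x ∈ Metric.closedBall (0 : EuclideanSpace ℝ (Fin m)) 1, Γ x = b) ∧
      (∀ x ∉ Metric.closedBall (0 : EuclideanSpace ℝ (Fin m)) 2, Γ x = b') ∧
      bddDirichletEnergy (n := n) p Γ < ⊤ := by
  obtain ⟨Γ, C, hΓ, hin, hout, hC, hD0, -⟩ := exists_contMDiff_transition (n := n) m b b'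
  refine ⟨Γ, hΓ.continuous, hin, hout, ?_⟩
  have hD : HasBddWeakMFDerivOn univ Γ (mfderivModel m n Γ) := by
    intro f hf _ _
    have h1 : ContDiff ℝ 1 (fun x ↦ f (Γ x)) := by
      rw [← contMDiff_iff_contDiff]
      exact (hf.of_le (by simp)).comp hΓ
    have h2 := h1.hasWeakFDerivOn_of_hasCompactSupport_sub (c := f b')
      (HasCompactSupport.intro (isCompact_closedBall (0 : EuclideanSpace ℝ (Fin m)) 2)
        fun x hx ↦ by rw [hout x hx, sub_self]) univ
    have h3 : fderiv ℝ (fun x ↦ f (Γ x)) =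
        fun x ↦ (mfderivReal n f (Γ x)).comp (mfderivModel m n Γ x) := by
      ext1 x
      rw [← mfderiv_eq_fderiv]
      exact mfderiv_comp (I := 𝓡 m) (I' := 𝓡 n) (I'' := 𝓘(ℝ, ℝ)) x (g := f) (f := Γ)
        (hf.mdifferentiableAt (by simp)) (hΓ.mdifferentiableAt (by simp))
    rwa [h3] at h2
  refine hD.bddDirichletEnergy_le.trans_lt ?_
  calc _ ≤ ∫⁻ x in Metric.closedBall (0 : EuclideanSpace ℝ (Fin m)) 2, (m * C : ENNReal) ^ p := by
        rw [← lintegral_indicator Metric.isClosed_closedBall.measurableSet]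
        refine lintegral_mono fun x ↦ ?_
        by_cases hx : x ∈ Metric.closedBall (0 : EuclideanSpace ℝ (Fin m)) 2
        · rw [indicator_of_mem hx]
          gcongr
          exact tangentMapENorm_le _ _ (hC x)
        · rw [indicator_of_notMem hx, hD0 x hx, tangentMapENorm_zero, ENNReal.zero_rpow_of_pos hp]
    _ < ⊤ := by
        rw [setLIntegral_const]
        exact ENNReal.mul_lt_top (ENNReal.rpow_lt_top_of_nonneg hp.le
          (ENNReal.mul_ne_top (ENNReal.natCast_ne_top m) ENNReal.coe_ne_top)) measure_closedBall_lt_top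

end Transition

/-! ### Affine changes of variables -/

section Scaling

open scoped NNReal

variable {m n : ℕ}

theorem measurableEmbedding_add_smul (c : EuclideanSpace ℝ (Fin m)) {ρ : ℝ} (hρ : 0 < ρ) :
    MeasurableEmbedding fun x : EuclideanSpace ℝ (Fin m) ↦ c + ρ • x :=
  ((Homeomorph.smulOfNeZero ρ hρ.ne').trans (Homeomorph.addLeft c)).measurableEmbedding

theorem map_add_smul_volume (c : EuclideanSpace ℝ (Fin m)) {ρ : ℝ} (hρ : 0 < ρ) :
    (volume : Measure (EuclideanSpace ℝ (Fin m))).map (fun x ↦ c + ρ • x) =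
      ENNReal.ofReal (ρ ^ (-m : ℝ)) • volume := by
  have h1 : (fun x : EuclideanSpace ℝ (Fin m) ↦ c + ρ • x) = (fun x ↦ c + x) ∘ (fun x ↦ ρ • x) := rfl
  rw [h1, ← Measure.map_map (by fun_prop) (by fun_prop), Measure.map_addHaar_smul volume hρ.ne',
    Measure.map_smul, map_add_left_eq_self, finrank_euclideanSpace_fin, Real.rpow_neg hρ.le,
    Real.rpow_natCast, abs_of_pos (by positivity)]

theorem setLIntegral_comp_add_smul (c : EuclideanSpace ℝ (Fin m)) {ρ : ℝ} (hρ : 0 < ρ)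
    {A : Set (EuclideanSpace ℝ (Fin m))} (f : EuclideanSpace ℝ (Fin m) → ENNReal) :
    ∫⁻ x in (fun x ↦ c + ρ • x) ⁻¹' A, f (c + ρ • x) =
      ENNReal.ofReal (ρ ^ (-m : ℝ)) * ∫⁻ x in A, f x := by
  have h := measurableEmbedding_add_smul c hρ
  rw [← smul_eq_mul, ← lintegral_smul_measure, ← Measure.restrict_smul, ← map_add_smul_volume c hρ,
    h.restrict_map, h.lintegral_map]

theorem preimage_add_smul_ball (c y : EuclideanSpace ℝ (Fin m)) {ρ : ℝ} (hρ : 0 < ρ) (r : ℝ) :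
    (fun x : EuclideanSpace ℝ (Fin m) ↦ c + ρ • x) ⁻¹' Metric.ball (c + ρ • y) (ρ * r) =
      Metric.ball y r := by
  ext x
  rw [mem_preimage, mem_ball_iff_norm, mem_ball_iff_norm, add_sub_add_left_eq_sub, ← smul_sub,
    norm_smul, Real.norm_of_nonneg hρ.le, mul_lt_mul_iff_right₀ hρ]

variable {N : Type*} [EMetricSpace N] [ChartedSpace (EuclideanSpace ℝ (Fin n)) N]

theorem HasBddWeakMFDerivOn.comp_add_smul {A : Set (EuclideanSpace ℝ (Fin m))} (hA : IsOpen A)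
    {u : EuclideanSpace ℝ (Fin m) → N}
    {D : EuclideanSpace ℝ (Fin m) → EuclideanSpace ℝ (Fin m) →L[ℝ] EuclideanSpace ℝ (Fin n)}
    (h : HasBddWeakMFDerivOn A u D) (c : EuclideanSpace ℝ (Fin m)) {ρ : ℝ} (hρ : 0 < ρ) :
    HasBddWeakMFDerivOn ((fun x ↦ c + ρ • x) ⁻¹' A) (fun x ↦ u (c + ρ • x))
      (fun x ↦ ρ • D (c + ρ • x)) := by
  have h1 := h.comp hA (φ := fun x ↦ c + ρ • x) (mapsTo_preimage _ A) fun x _ ↦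
    ⟨univ, univ_mem, ρ.toNNReal, (ρ ^ (-m : ℝ)).toNNReal, ?_, fun S ↦ ?_⟩
  · convert h1 using 2 with x
    have h2 : fderiv ℝ (fun x : EuclideanSpace ℝ (Fin m) ↦ c + ρ • x) x =
        ρ • ContinuousLinearMap.id ℝ _ := by
      rw [fderiv_const_add, fderiv_fun_const_smul differentiableAt_fun_id, fderiv_fun_id]
    rw [h2, ContinuousLinearMap.comp_smul, ContinuousLinearMap.comp_id]
  · refine LipschitzWith.lipschitzOnWith (.of_dist_le_mul fun x y ↦ ?_)
    rw [dist_add_left, dist_smul₀, Real.norm_of_nonneg hρ.le, Real.coe_toNNReal _ hρ.le]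
  · rw [inter_univ, ← (measurableEmbedding_add_smul c hρ).map_apply, map_add_smul_volume c hρ]
    rfl

variable [RiemannianBundle (fun y : N ↦ TangentSpace (𝓡 n) y)]

theorem tangentMapENorm_smul (y : N) (c : ℝ)
    (L : EuclideanSpace ℝ (Fin m) →L[ℝ] EuclideanSpace ℝ (Fin n)) :
    tangentMapENorm y (c • L) = ‖c‖ₑ * tangentMapENorm y L := by
  simp only [tangentMapENorm, _root_.smul_apply, tangentENorm_smul, Finset.mul_sum]

theorem setLIntegral_tangentMapENorm_comp_add_smul {p : ℝ} (hp : 0 ≤ p)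
    (A : Set (EuclideanSpace ℝ (Fin m))) (u : EuclideanSpace ℝ (Fin m) → N)
    (D : EuclideanSpace ℝ (Fin m) → EuclideanSpace ℝ (Fin m) →L[ℝ] EuclideanSpace ℝ (Fin n))
    (c : EuclideanSpace ℝ (Fin m)) {ρ : ℝ} (hρ : 0 < ρ) :
    ∫⁻ x in (fun x ↦ c + ρ • x) ⁻¹' A, tangentMapENorm (u (c + ρ • x)) (ρ • D (c + ρ • x)) ^ p =
      ENNReal.ofReal (ρ ^ (p - m)) * ∫⁻ x in A, tangentMapENorm (u x) (D x) ^ p := by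
  have h1 : ∀ x, tangentMapENorm (u (c + ρ • x)) (ρ • D (c + ρ • x)) ^ p =
      ENNReal.ofReal (ρ ^ p) * tangentMapENorm (u (c + ρ • x)) (D (c + ρ • x)) ^ p := fun x ↦ by
    rw [tangentMapENorm_smul, ENNReal.mul_rpow_of_nonneg _ _ hp, Real.enorm_eq_ofReal hρ.le,
      ENNReal.ofReal_rpow_of_pos hρ]
  simp only [h1]
  rw [lintegral_const_mul' _ _ ENNReal.ofReal_ne_top,
    setLIntegral_comp_add_smul c hρ (fun x ↦ tangentMapENorm (u x) (D x) ^ p), ← mul_assoc,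
    ← ENNReal.ofReal_mul (by positivity), ← Real.rpow_add hρ, sub_eq_add_neg]

theorem bddDirichletEnergy_comp_add_smul_le {p : ℝ} (hp : 0 ≤ p) (u : EuclideanSpace ℝ (Fin m) → N)
    (c : EuclideanSpace ℝ (Fin m)) {ρ : ℝ} (hρ : 0 < ρ) :
    bddDirichletEnergy (n := n) p (fun x ↦ u (c + ρ • x)) ≤
      ENNReal.ofReal (ρ ^ (p - m)) * bddDirichletEnergy (n := n) p u := by
  -- A factor that is neither 0 nor ⊤ commutes with the infimum, even over an empty family.
  have h0 : ENNReal.ofReal (ρ ^ (p - m)) ≠ 0 := by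
    rw [Ne, ENNReal.ofReal_eq_zero, not_le]
    positivity
  simp only [bddDirichletEnergy, ENNReal.mul_iInf_of_ne h0 ENNReal.ofReal_ne_top]
  refine le_iInf₂ fun D hD ↦ ?_
  have h1 := hD.comp_add_smul isOpen_univ c hρ
  have h2 := setLIntegral_tangentMapENorm_comp_add_smul hp univ u D c hρ
  rw [preimage_univ] at h1 h2
  rw [Measure.restrict_univ] at h2
  exact (iInf₂_le _ h1).trans_eq h2

omit [RiemannianBundle (fun y : N ↦ TangentSpace (𝓡 n) y)] in
theorem HasWeakMFDerivOn.hasBddWeakMFDerivOn {A : Set (EuclideanSpace ℝ (Fin m))}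
    {u : EuclideanSpace ℝ (Fin m) → N}
    {D : ∀ x, TangentSpace (𝓡 m) x →L[ℝ] TangentSpace (𝓡 n) (u x)} (h : HasWeakMFDerivOn A u D) :
    HasBddWeakMFDerivOn A u D := by
  intro f hf hfl _
  have h1 := h f hf hfl (OpenPartialHomeomorph.refl _) (chartedSpaceSelf_atlas.2 rfl)
  have h2 : ∀ y, mfderiv (𝓡 m) (𝓡 m) (OpenPartialHomeomorph.refl (EuclideanSpace ℝ (Fin m))).symm y =
    ContinuousLinearMap.id ℝ _ := fun y ↦ mfderiv_id
  have h3 : (OpenPartialHomeomorph.refl (EuclideanSpace ℝ (Fin m))).target ∩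
      (OpenPartialHomeomorph.refl (EuclideanSpace ℝ (Fin m))).symm ⁻¹' A = A := univ_inter A
  simp only [h2] at h1
  rw [h3] at h1
  exact h1

theorem tangentMapENorm_le_hilbertSchmidtENorm (x : EuclideanSpace ℝ (Fin m)) (y : N)
    (L : EuclideanSpace ℝ (Fin m) →L[ℝ] EuclideanSpace ℝ (Fin n)) :
    tangentMapENorm y L ≤ m * (m * hilbertSchmidtENorm (V := TangentSpace (𝓡 m) x)
      (W := TangentSpace (𝓡 n) y) L) :=
  tangentMapENorm_le y L fun v ↦ by
    have := tangentENorm_apply_le_hilbertSchmidtENorm x y L v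
    rwa [tangentENorm_euclideanSpace] at this

theorem exists_hasBddWeakMFDerivOn_of_dirichletEnergy_lt {p : ℝ} (hp : 0 ≤ p)
    {A : Set (EuclideanSpace ℝ (Fin m))} {u : EuclideanSpace ℝ (Fin m) → N} {c : ENNReal}
    (h : dirichletEnergy (m := m) (n := n) p A u < c) :
    ∃ D : EuclideanSpace ℝ (Fin m) → EuclideanSpace ℝ (Fin m) →L[ℝ] EuclideanSpace ℝ (Fin n),
      HasBddWeakMFDerivOn A u D ∧
      ∫⁻ x in A, tangentMapENorm (u x) (D x) ^ p ≤ (m * m : ENNReal) ^ p * c := by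
  simp only [dirichletEnergy, iInf_lt_iff] at h
  obtain ⟨D, hD, hDc⟩ := h
  rw [EuclideanSpace.euclideanHausdorffMeasure_eq_volume] at hDc
  refine ⟨D, hD.hasBddWeakMFDerivOn, ?_⟩
  refine le_trans ?_ (mul_le_mul_right hDc.le _)
  rw [← lintegral_const_mul' _ _ (ENNReal.rpow_ne_top_of_nonneg hp (by finiteness))]
  refine lintegral_mono fun x ↦ ?_
  rw [← ENNReal.mul_rpow_of_nonneg _ _ hp, mul_assoc]
  gcongr
  exact tangentMapENorm_le_hilbertSchmidtENorm x _ _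

end Scaling

/-! ### Opening for the Dirichlet energy -/

section OpeningDirichlet

open scoped NNReal

variable {m n : ℕ} {N : Type*} [EMetricSpace N] [ChartedSpace (EuclideanSpace ℝ (Fin n)) N]
  [IsManifold (𝓡 n) ∞ N] [RiemannianBundle (fun y : N ↦ TangentSpace (𝓡 n) y)]
  [IsContMDiffRiemannianBundle (𝓡 n) ∞ (EuclideanSpace ℝ (Fin n))
    (fun y : N ↦ TangentSpace (𝓡 n) y)] [IsRiemannianManifold (𝓡 n) N]
  [MeasurableSpace N] [BorelSpace N] [SecondCountableTopology N]

/-- After the contraction the map is weakly differentiable on the ball of radius l⁻¹ > 1, which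
contains the closed unit ball and hence the values of the opening maps. As l ≥ 1/2, the scaling
factor l^(p - m) is at most 2^m, independently of l. -/
theorem exists_opening_bddDirichletEnergy_le {p : ℝ} (hp : 1 ≤ p) :
    ∃ C : ℝ≥0, ∀ (l : ℝ) (u : EuclideanSpace ℝ (Fin m) → N) (c : ENNReal), 1 / 2 ≤ l → l < 1 →
      Measurable u → c ≠ ⊤ → dirichletEnergy (m := m) (n := n) p (Metric.ball 0 1) u < c →
      ∃ (v : EuclideanSpace ℝ (Fin m) → N) (b : N), Measurable v ∧
        (∀ x ∈ Metric.ball 0 1, v x = u (l • x)) ∧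
        (∀ x ∉ Metric.closedBall (0 : EuclideanSpace ℝ (Fin m)) 3, v x = b) ∧
        bddDirichletEnergy (n := n) p v ≤ C * c := by
  obtain ⟨C, hC⟩ := HasBddWeakMFDerivOn.exists_opening (m := m) (n := n) (N := N) hp
  have hp0 : 0 ≤ p := by linarith
  set c₁ : ENNReal := (m * m : ENNReal) ^ p
  have hc₁ : c₁ ≠ ⊤ := ENNReal.rpow_ne_top_of_nonneg hp0 (by finiteness)
  refine ⟨C * ((2 ^ m : ℝ≥0) * c₁.toNNReal), fun l u c hl hl1 hu hc huc ↦ ?_⟩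
  have hl0 : 0 < l := by linarith
  obtain ⟨D, hD, hDc⟩ := exists_hasBddWeakMFDerivOn_of_dirichletEnergy_lt hp0 huc
  have h1 := hD.comp_add_smul Metric.isOpen_ball 0 hl0
  have h2 := setLIntegral_tangentMapENorm_comp_add_smul hp0 (Metric.ball 0 1) u D 0 hl0
  have h3 := preimage_add_smul_ball (0 : EuclideanSpace ℝ (Fin m)) 0 hl0 l⁻¹
  rw [smul_zero, add_zero, mul_inv_cancel₀ hl0.ne'] at h3
  rw [h3] at h1 h2
  simp only [zero_add] at h1 h2
  have hlm : ENNReal.ofReal (l ^ (p - m)) ≤ (2 ^ m : ℝ≥0) := by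
    rw [ENNReal.coe_nnreal_eq]
    refine ENNReal.ofReal_le_ofReal ?_
    calc l ^ (p - m) ≤ l ^ (-m : ℝ) :=
          Real.rpow_le_rpow_of_exponent_ge hl0 hl1.le (by linarith)
      _ ≤ (1 / 2 : ℝ) ^ (-m : ℝ) := Real.rpow_le_rpow_of_nonpos (by norm_num) hl (by simp)
      _ = _ := by
          rw [Real.rpow_neg (by norm_num), Real.rpow_natCast]
          simp
  have h4 : ∫⁻ x in Metric.ball 0 l⁻¹, tangentMapENorm (u (l • x)) (l • D (l • x)) ^ p ≤
      (2 ^ m : ℝ≥0) * (c₁ * c) := by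
    rw [h2]
    gcongr
  obtain ⟨v, b, D', hv, hvu, hvb, hD', hle⟩ := hC l⁻¹ (fun x ↦ u (l • x)) _ (one_lt_inv_iff₀.2 ⟨hl0, hl1⟩)
    (hu.comp (measurable_const_smul l)) h1 (ne_top_of_le_ne_top (by finiteness) h4)
  refine ⟨v, b, hv, hvu, hvb, hD'.bddDirichletEnergy_le.trans (hle.trans ?_)⟩
  rw [ENNReal.coe_mul, ENNReal.coe_mul, ENNReal.coe_toNNReal hc₁, mul_assoc, mul_assoc]
  gcongr

end OpeningDirichlet

/-! ### Transplanting maps to the manifold through a chart -/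

section Transplant

open scoped NNReal

/-- The map that is `V` in the chart `e` and `b` off its domain. -/
noncomputable def transplant {X H N : Type*} [TopologicalSpace X] [TopologicalSpace H]
    (e : OpenPartialHomeomorph X H) (b : N) (V : H → N) (x : X) : N :=
  open Classical in if x ∈ e.source then V (e x) else b

theorem transplant_of_mem {X H N : Type*} [TopologicalSpace X] [TopologicalSpace H]
    {e : OpenPartialHomeomorph X H} (b : N) (V : H → N) {x : X} (hx : x ∈ e.source) :
    transplant e b V x = V (e x) :=
  if_pos hx

theorem transplant_symm {X H N : Type*} [TopologicalSpace X] [TopologicalSpace H]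
    {e : OpenPartialHomeomorph X H} (b : N) (V : H → N) {y : H} (hy : y ∈ e.target) :
    transplant e b V (e.symm y) = V y := by
  rw [transplant_of_mem _ _ (e.map_target hy), e.right_inv hy]

theorem transplant_eq_const {X H N : Type*} [TopologicalSpace X] [TopologicalSpace H]
    {e : OpenPartialHomeomorph X H} {b : N} {V : H → N} {A : Set H}
    (hV : ∀ y ∉ A, V y = b) {x : X} (hx : x ∉ e.symm '' A) : transplant e b V x = b := by
  by_cases hxe : x ∈ e.source
  · rw [transplant_of_mem _ _ hxe]
    exact hV _ fun h ↦ hx ⟨e x, h, e.left_inv hxe⟩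
  · exact if_neg hxe

theorem measurable_transplant {X H N : Type*} [TopologicalSpace X] [MeasurableSpace X]
    [BorelSpace X] [TopologicalSpace H] [MeasurableSpace H] [BorelSpace H] [MeasurableSpace N]
    (e : OpenPartialHomeomorph X H) (b : N) {V : H → N} (hV : Measurable V) :
    Measurable (transplant e b V) := by
  classical
  rcases e.source.eq_empty_or_nonempty with h | ⟨x₀, -⟩
  · have : transplant e b V = fun _ ↦ b := by
      ext x
      simp [transplant, h]
    rw [this]
    exact measurable_const
  have h1 : Measurable (e.source.piecewise e fun _ ↦ e x₀) :=
    e.continuousOn.measurable_piecewise continuousOn_const e.open_source.measurableSet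
  have h2 : transplant e b V = e.source.piecewise (V ∘ e.source.piecewise e fun _ ↦ e x₀)
      fun _ ↦ b := by
    ext x
    by_cases hx : x ∈ e.source
    · simp [transplant_of_mem b V hx, hx]
    · simp [transplant, hx]
  rw [h2]
  exact (hV.comp h1).piecewise e.open_source.measurableSet measurable_const

variable {m : ℕ}

/-- C¹ maps are locally Lipschitz; the Lipschitz bound for the inverse `ψ` prevents concentration of
the volume. -/
theorem exists_lipschitzOnWith_volume_preimage_le {O O' : Set (EuclideanSpace ℝ (Fin m))}
    (hO : IsOpen O) (hO' : IsOpen O') {φ ψ : EuclideanSpace ℝ (Fin m) → EuclideanSpace ℝ (Fin m)}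
    (hφ : ContDiffOn ℝ 1 φ O) (hψ : ContDiffOn ℝ 1 ψ O') (hφO : MapsTo φ O O')
    (hψφ : ∀ x ∈ O, ψ (φ x) = x) {x : EuclideanSpace ℝ (Fin m)} (hx : x ∈ O) :
    ∃ V ∈ 𝓝 x, ∃ L C : ℝ≥0, LipschitzOnWith L φ V ∧ ∀ S, volume (φ ⁻¹' S ∩ V) ≤ C * volume S := by
  have hφx := hφ.contDiffAt (hO.mem_nhds hx)
  obtain ⟨L, V, hV, hL⟩ := hφx.exists_lipschitzOnWith
  obtain ⟨K, V', hV', hK⟩ := (hψ.contDiffAt (hO'.mem_nhds (hφO hx))).exists_lipschitzOnWith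
  refine ⟨V ∩ φ ⁻¹' V' ∩ O, inter_mem (inter_mem hV (hφx.continuousAt.preimage_mem_nhds hV'))
    (hO.mem_nhds hx), L, K ^ m, hL.mono fun y hy ↦ hy.1.1, volume_preimage_inter_le fun y hy z hz ↦ ?_⟩
  have := hK hy.1.2 hz.1.2
  rwa [hψφ y hy.2, hψφ z hz.2] at this

variable {M : Type*} [EMetricSpace M] [ChartedSpace (EuclideanSpace ℝ (Fin m)) M]
  [IsManifold (𝓡 m) ∞ M]

/-- Transitions between charts can be inserted into weakly differentiable functions. -/
theorem exists_lipschitzOnWith_transition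
    {e e' : OpenPartialHomeomorph M (EuclideanSpace ℝ (Fin m))}
    (he : e ∈ atlas (EuclideanSpace ℝ (Fin m)) M) (he' : e' ∈ atlas (EuclideanSpace ℝ (Fin m)) M) :
    ∀ x ∈ e'.target ∩ e'.symm ⁻¹' e.source, ∃ V ∈ 𝓝 x, ∃ L C : ℝ≥0,
      LipschitzOnWith L (fun y ↦ e (e'.symm y)) V ∧
      ∀ S, volume ((fun y ↦ e (e'.symm y)) ⁻¹' S ∩ V) ≤ C * volume S := by
  have hs : ∀ {f f' : OpenPartialHomeomorph M (EuclideanSpace ℝ (Fin m))},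
      f ∈ atlas (EuclideanSpace ℝ (Fin m)) M → f' ∈ atlas (EuclideanSpace ℝ (Fin m)) M →
      ContDiffOn ℝ 1 (fun y ↦ f (f'.symm y)) (f'.target ∩ f'.symm ⁻¹' f.source) :=
    fun {f f'} hf hf' ↦ by
      rw [← contMDiffOn_iff_contDiffOn]
      refine ContMDiffOn.of_le (n := ∞) ?_ (by simp)
      exact (contMDiffOn_of_mem_maximalAtlas (IsManifold.subset_maximalAtlas hf)).comp
        ((contMDiffOn_symm_of_mem_maximalAtlas (IsManifold.subset_maximalAtlas hf')).mono
          inter_subset_left) fun y hy ↦ hy.2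
  refine fun x hx ↦ exists_lipschitzOnWith_volume_preimage_le
    (e'.isOpen_inter_preimage_symm e.open_source) (e.isOpen_inter_preimage_symm e'.open_source)
    (hs he he') (hs he' he) (fun y hy ↦ ⟨e.map_source hy.2, ?_⟩) (fun y hy ↦ ?_) hx
  · rw [mem_preimage, e.left_inv hy.2]
    exact e'.map_target hy.1
  · rw [e.left_inv hy.2, e'.right_inv hy.1]

variable {n : ℕ} [RiemannianBundle (fun x : M ↦ TangentSpace (𝓡 m) x)]
  {N : Type*} [EMetricSpace N] [ChartedSpace (EuclideanSpace ℝ (Fin n)) N]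
  [IsManifold (𝓡 n) ∞ N] [RiemannianBundle (fun y : N ↦ TangentSpace (𝓡 n) y)]
  [IsContMDiffRiemannianBundle (𝓡 n) ∞ (EuclideanSpace ℝ (Fin n))
    (fun y : N ↦ TangentSpace (𝓡 n) y)] [IsRiemannianManifold (𝓡 n) N]
  [MeasurableSpace N] [BorelSpace N] [SecondCountableTopology N]

-- In a chart `e'` there are two kinds of points: those in the domain of `e`, where the chain rule
-- applies to the transition map, and those off the image of the closed ball, which is compact and
-- hence closed in `M`, where the map is constant.
omit [RiemannianBundle (fun x : M ↦ TangentSpace (𝓡 m) x)] [SecondCountableTopology N] in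
theorem hasWeakMFDerivOn_transplant (hm : 0 < m)
    {e : OpenPartialHomeomorph M (EuclideanSpace ℝ (Fin m))}
    (he : e ∈ atlas (EuclideanSpace ℝ (Fin m)) M) {c : EuclideanSpace ℝ (Fin m)} {δ : ℝ}
    (hδ : 0 < δ) (hT : Metric.closedBall c δ ⊆ e.target) {V : EuclideanSpace ℝ (Fin m) → N} {b : N}
    (hV : Measurable V) (hVb : ∀ y ∉ Metric.closedBall c δ, V y = b)
    {D : EuclideanSpace ℝ (Fin m) → EuclideanSpace ℝ (Fin m) →L[ℝ] EuclideanSpace ℝ (Fin n)}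
    (hD : HasBddWeakMFDerivOn univ V D) (hD0 : ∀ y ∉ Metric.closedBall c δ, D y = 0)
    (hD1 : ∫⁻ x, tangentMapENorm (V x) (D x) ≠ ⊤) :
    HasWeakMFDerivOn univ (transplant e b V) (fun x ↦ (transplant e 0
      (fun y ↦ (D y).comp (mfderivModel m m e (e.symm y))) x :
        EuclideanSpace ℝ (Fin m) →L[ℝ] EuclideanSpace ℝ (Fin n))) := by
  intro f hf hfl e' he'
  have hVb' : ∀ x ∉ Metric.closedBall (0 : EuclideanSpace ℝ (Fin m)) (‖c‖ + δ), V x = b :=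
    fun x hx ↦ hVb x fun h ↦ hx <| by
      rw [mem_closedBall_iff_norm] at h
      rw [mem_closedBall_zero_iff]
      linarith [norm_sub_norm_le x c]
  -- Here bounded tests are replaced by arbitrary Lipschitz ones, as the definition of the Dirichlet
  -- energy on `M` demands.
  have hw := hD.hasWeakFDerivOn_of_lipschitzWith hm hV hD1 (by positivity) hVb' hf hfl
  rw [preimage_univ, inter_univ]
  refine .of_locally fun y hy ↦ ?_
  by_cases hye : e'.symm y ∈ e.source
  · have hO := e'.isOpen_inter_preimage_symm e.open_source
    refine ⟨_, hO.mem_nhds ⟨hy, hye⟩, ?_⟩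
    have h1 := hw.comp isOpen_univ (mapsTo_univ _ _) (exists_lipschitzOnWith_transition he he')
    refine h1.congr_ae hO ?_ ?_
    · filter_upwards [ae_restrict_mem hO.measurableSet] with z hz
      rw [transplant_of_mem _ _ hz.2]
    · filter_upwards [ae_restrict_mem hO.measurableSet] with z hz
      have h2 := mfderiv_comp (I := 𝓡 m) (I' := 𝓡 m) (I'' := 𝓡 m) z (g := e) (f := e'.symm)
        (mdifferentiableAt_atlas he hz.2) (mdifferentiableAt_atlas_symm he' hz.1)
      rw [mfderiv_eq_fderiv] at h2
      have h3 : fderiv ℝ (fun y ↦ e (e'.symm y)) z =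
        (mfderivModel m m e (e'.symm z)).comp (mfderivModel m m e'.symm z) := h2
      rw [h3, transplant_of_mem _ _ hz.2, transplant_of_mem _ _ hz.2, e.left_inv hz.2]
      rfl
  · have hF : IsClosed (e.symm '' Metric.closedBall c δ) :=
      ((isCompact_closedBall c δ).image_of_continuousOn (e.symm.continuousOn.mono hT)).isClosed
    have hO := e'.isOpen_inter_preimage_symm hF.isOpen_compl
    refine ⟨_, hO.mem_nhds ⟨hy, ?_⟩, ?_⟩
    · rintro ⟨z, hz, hzy⟩
      exact hye (hzy ▸ e.map_target (hT hz))
    have h1 := (LipschitzWith.const (α := EuclideanSpace ℝ (Fin m)) (f b)).hasWeakFDerivOn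
      (e'.target ∩ e'.symm ⁻¹' (e.symm '' Metric.closedBall c δ)ᶜ)
    simp only [fderiv_fun_const] at h1
    refine h1.congr_ae hO ?_ ?_
    · filter_upwards [ae_restrict_mem hO.measurableSet] with z hz
      rw [transplant_eq_const hVb hz.2]
    · filter_upwards [ae_restrict_mem hO.measurableSet] with z hz
      have h2 : transplant e (0 : EuclideanSpace ℝ (Fin m) →L[ℝ] EuclideanSpace ℝ (Fin n))
          (fun y ↦ (D y).comp (mfderivModel m m e (e.symm y))) (e'.symm z) = 0 :=
        transplant_eq_const (fun y hy ↦ by rw [hD0 y hy, ContinuousLinearMap.zero_comp]) hz.2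
      rw [h2]
      exact ((congrArg _ (ContinuousLinearMap.zero_comp _)).trans
        (ContinuousLinearMap.comp_zero _)).symm

-- The Lipschitz bound on `e.symm` says that the chart is antilipschitz, and the volume of `M` is a
-- Hausdorff measure.
omit [IsManifold (𝓡 m) ∞ M] [ChartedSpace (EuclideanSpace ℝ (Fin m)) M]
  [RiemannianBundle (fun x : M ↦ TangentSpace (𝓡 m) x)] in
theorem lintegral_comp_chart_le [MeasurableSpace M] [BorelSpace M]
    {e : OpenPartialHomeomorph M (EuclideanSpace ℝ (Fin m))} {A : Set (EuclideanSpace ℝ (Fin m))}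
    (hA : IsCompact A) (hT : A ⊆ e.target) {K : ℝ≥0}
    (hK : ∀ y ∈ A, ∀ z ∈ A, edist (e.symm y) (e.symm z) ≤ K * edist y z)
    {G : EuclideanSpace ℝ (Fin m) → ENNReal} (hG : AEMeasurable G) :
    ∫⁻ x in e.symm '' A, G (e x) ∂μHE[m] ≤ (K ^ m : ℝ≥0) * ∫⁻ y, G y := by
  classical
  have hF : IsClosed (e.symm '' A) :=
    (hA.image_of_continuousOn (e.symm.continuousOn.mono hT)).isClosed
  have hFs : e.symm '' A ⊆ e.source := by
    rintro x ⟨y, hy, rfl⟩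
    exact e.map_target (hT hy)
  have hg : Measurable ((e.symm '' A).piecewise e fun _ ↦ 0) :=
    (e.continuousOn.mono hFs).measurable_piecewise continuousOn_const hF.measurableSet
  have h1 := lintegral_comp_le_of_measure_preimage_le
    (μ := (μHE[m] : Measure M).restrict (e.symm '' A)) hg (C := K ^ m) (fun S hS ↦ ?_) hG
  · refine le_trans (le_of_eq (setLIntegral_congr_fun hF.measurableSet fun x hx ↦ ?_)) h1
    simp only [piecewise_eq_of_mem _ _ _ hx]
  · rw [Measure.restrict_apply (hg hS), ← EuclideanSpace.euclideanHausdorffMeasure_eq_volume]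
    refine euclideanHausdorffMeasure_preimage_inter_le (fun x hx y hy ↦ ?_) m S
    rw [piecewise_eq_of_mem _ _ _ hx, piecewise_eq_of_mem _ _ _ hy]
    obtain ⟨x', hx', rfl⟩ := hx
    obtain ⟨y', hy', rfl⟩ := hy
    rw [e.right_inv (hT hx'), e.right_inv (hT hy')]
    exact hK _ hx' _ hy'

theorem dirichletEnergy_transplant_lt_top [MeasurableSpace M] [BorelSpace M] (hm : 0 < m) {p : ℝ}
    (hp : 1 ≤ p) {e : OpenPartialHomeomorph M (EuclideanSpace ℝ (Fin m))}
    (he : e ∈ atlas (EuclideanSpace ℝ (Fin m)) M) {c : EuclideanSpace ℝ (Fin m)} {δ : ℝ}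
    (hδ : 0 < δ) (hT : Metric.closedBall c δ ⊆ e.target) {K : ℝ≥0}
    (hK : ∀ y ∈ Metric.closedBall c δ, ∀ z ∈ Metric.closedBall c δ,
      edist (e.symm y) (e.symm z) ≤ K * edist y z)
    (hKD : ∀ y ∈ Metric.closedBall c δ, ∀ v : EuclideanSpace ℝ (Fin m),
      ‖mfderivModel m m e (e.symm y) v‖ₑ ≤ K * tangentENorm (e.symm y) v)
    {V : EuclideanSpace ℝ (Fin m) → N} {b : N}
    (hV : Measurable V) (hVb : ∀ y ∉ Metric.closedBall c δ, V y = b)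
    (hVE : bddDirichletEnergy (n := n) p V < ⊤) :
    dirichletEnergy (m := m) (n := n) p univ (transplant e b V) < ⊤ := by
  have hp0 : 0 < p := by linarith
  obtain ⟨D, hD, hDp⟩ := exists_hasBddWeakMFDerivOn_of_lt hVE
  set A := Metric.closedBall c δ with hAdef
  have hA : IsCompact A := isCompact_closedBall c δ
  set D₀ := A.indicator D
  have hD₀ : HasBddWeakMFDerivOn univ V D₀ := by
    have := hD.indicator_compl isOpen_univ hA.isClosed.isOpen_compl (subset_univ _) hVb
    rwa [compl_compl] at this
  have hout : ∀ y ∉ A, D₀ y = 0 := fun y hy ↦ indicator_of_notMem hy _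
  have hp' : ∫⁻ x, tangentMapENorm (V x) (D₀ x) ^ p ≠ ⊤ := by
    refine ne_top_of_le_ne_top hDp.ne (lintegral_mono fun x ↦ ?_)
    by_cases hx : x ∈ A
    · simp only [D₀, indicator_of_mem hx, le_refl]
    · simp only [hout x hx, tangentMapENorm_zero, ENNReal.zero_rpow_of_pos hp0, zero_le]
  -- Since the differential vanishes off a bounded set, its p-integrability gives its integrability,
  -- which the tests by unbounded functions require.
  have h1 : ∫⁻ x, tangentMapENorm (V x) (D₀ x) ≠ ⊤ := by
    have : IsFiniteMeasure (volume.restrict A) := ⟨by simpa using hA.measure_lt_top⟩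
    rw [← setLIntegral_eq_of_support_subset (s := A)]
    · exact lintegral_ne_top_of_lintegral_rpow_ne_top hp
        (ne_top_of_le_ne_top hp' (setLIntegral_le_lintegral _ _))
    · intro x hx
      by_contra h
      exact hx (by simp only [hout x h, tangentMapENorm_zero])
  have hae : AEMeasurable (fun x ↦ tangentMapENorm (V x) (D₀ x)) := by
    have := hD₀.aemeasurable_tangentMapENorm isOpen_univ hV
    rwa [Measure.restrict_univ] at this
  refine (iInf₂_le _ (hasWeakMFDerivOn_transplant hm he hδ hT hV hVb hD₀ hout h1)).trans_lt ?_
  have hF : IsClosed (e.symm '' A) :=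
    (hA.image_of_continuousOn (e.symm.continuousOn.mono hT)).isClosed
  have hpt : ∀ x, hilbertSchmidtENorm (V := TangentSpace (𝓡 m) x)
      (W := TangentSpace (𝓡 n) (transplant e b V x)) (transplant e
      (0 : EuclideanSpace ℝ (Fin m) →L[ℝ] EuclideanSpace ℝ (Fin n))
      (fun y ↦ (D₀ y).comp (mfderivModel m m e (e.symm y))) x) ^ p ≤
      (e.symm '' A).indicator (fun x ↦ (m * K : ENNReal) ^ p *
        tangentMapENorm (V (e x)) (D₀ (e x)) ^ p) x := fun x ↦ by
    by_cases hx : x ∈ e.symm '' A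
    · rw [indicator_of_mem hx, ← ENNReal.mul_rpow_of_nonneg _ _ hp0.le]
      gcongr
      obtain ⟨y, hy, rfl⟩ := hx
      have h2 : ∀ v, tangentENorm (transplant e b V (e.symm y)) (transplant e
          (0 : EuclideanSpace ℝ (Fin m) →L[ℝ] EuclideanSpace ℝ (Fin n))
          (fun y ↦ (D₀ y).comp (mfderivModel m m e (e.symm y))) (e.symm y) v) ≤
          (K * tangentMapENorm (V y) (D₀ y)) * tangentENorm (e.symm y) v := fun v ↦ by
        rw [transplant_symm _ _ (hT hy), transplant_symm _ _ (hT hy)]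
        refine (tangentENorm_apply_le _ (D₀ y) _).trans ?_
        rw [mul_comm (K : ENNReal), mul_assoc]
        gcongr
        exact hKD y hy v
      refine (hilbertSchmidtENorm_tangent_le _ _ _ h2).trans_eq ?_
      rw [e.right_inv (hT hy), mul_assoc]
    · rw [indicator_of_notMem hx]
      have h2 : ∀ v, tangentENorm (transplant e b V x) (transplant e
          (0 : EuclideanSpace ℝ (Fin m) →L[ℝ] EuclideanSpace ℝ (Fin n))
          (fun y ↦ (D₀ y).comp (mfderivModel m m e (e.symm y))) x v) ≤
          0 * tangentENorm x v := fun v ↦ by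
        have h3 : transplant e (0 : EuclideanSpace ℝ (Fin m) →L[ℝ] EuclideanSpace ℝ (Fin n))
            (fun y ↦ (D₀ y).comp (mfderivModel m m e (e.symm y))) x = 0 :=
          transplant_eq_const (fun y hy ↦ by rw [hout y hy, ContinuousLinearMap.zero_comp]) hx
        rw [h3, _root_.zero_apply, tangentENorm_zero]
        exact zero_le
      refine (ENNReal.rpow_le_rpow (hilbertSchmidtENorm_tangent_le _ _ _ h2) hp0.le).trans ?_
      rw [mul_zero, ENNReal.zero_rpow_of_pos hp0]
  rw [Measure.restrict_univ]
  refine (lintegral_mono hpt).trans_lt ?_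
  have hc : (m * K : ENNReal) ^ p ≠ ⊤ := ENNReal.rpow_ne_top_of_nonneg hp0.le (by finiteness)
  rw [lintegral_indicator hF.measurableSet, lintegral_const_mul' _ _ hc]
  refine ENNReal.mul_lt_top hc.lt_top ?_
  refine (lintegral_comp_chart_le (G := fun y ↦ tangentMapENorm (V y) (D₀ y) ^ p) hA hT hK
    (hae.pow_const p)).trans_lt ?_
  exact ENNReal.mul_lt_top ENNReal.coe_lt_top hp'.lt_top

end Transplant

/-! ### Integrals of fractional kernels -/

section FractionalKernel

open scoped NNReal

variable {m : ℕ}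

theorem enorm_rpow_of_pos {r a : ℝ} (hr : 0 < r) : ‖r‖ₑ ^ a = ENNReal.ofReal (r ^ a) := by
  rw [Real.enorm_eq_ofReal hr.le, ENNReal.ofReal_rpow_of_pos hr]

/-- In polar coordinates the integrand is r^(P - β - 1) near 0, integrable as β < P, and r^(-1 - β)
near infinity. -/
theorem lintegral_min_enorm_rpow_mul_lt_top (hm : 0 < m) {β P : ℝ} (hβ : 0 < β) (hP : β < P) :
    ∫⁻ z : EuclideanSpace ℝ (Fin m), min (‖z‖ₑ ^ P) 1 * ‖z‖ₑ ^ (-(m + β)) < ⊤ := by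
  have : Nonempty (Fin m) := ⟨⟨0, hm⟩⟩
  set f : ℝ → ℝ := fun r ↦ min (r ^ P) 1 * r ^ (-(m + β))
  have hm1 : ((m - 1 : ℕ) : ℝ) = m - 1 := by
    rw [Nat.cast_sub hm, Nat.cast_one]
  have hfm : Measurable fun y : ℝ ↦ y ^ (m - 1) • f y := by
    simp only [f, smul_eq_mul]
    fun_prop
  have h1 : Integrable (fun z : EuclideanSpace ℝ (Fin m) ↦ f ‖z‖) := by
    rw [integrable_fun_norm_addHaar, finrank_euclideanSpace_fin,
      ← Ioc_union_Ioi_eq_Ioi zero_le_one]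
    refine IntegrableOn.union ?_ ?_
    · have h2 : IntegrableOn (fun y : ℝ ↦ y ^ (P - β - 1)) (Ioc 0 1) :=
        (intervalIntegrable_iff_integrableOn_Ioc_of_le zero_le_one).1
          (intervalIntegral.intervalIntegrable_rpow' (by linarith))
      refine Integrable.mono' h2 hfm.aestronglyMeasurable ?_
      filter_upwards [ae_restrict_mem measurableSet_Ioc] with y hy
      rw [Real.norm_of_nonneg (by have := hy.1; simp only [f, smul_eq_mul]; positivity),
        ← Real.rpow_natCast, hm1]
      have := hy.1
      calc y ^ ((m : ℝ) - 1) • f y ≤ y ^ ((m : ℝ) - 1) * (y ^ P * y ^ (-(m + β))) := by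
            rw [smul_eq_mul]
            exact mul_le_mul_of_nonneg_left (mul_le_mul_of_nonneg_right (min_le_left _ _)
              (by positivity)) (by positivity)
        _ = _ := by
            rw [← Real.rpow_add hy.1, ← Real.rpow_add hy.1]
            congr 1
            ring
    · have h2 := integrableOn_Ioi_rpow_of_lt (a := -1 - β) (by linarith) zero_lt_one
      refine Integrable.mono' h2 hfm.aestronglyMeasurable ?_
      filter_upwards [ae_restrict_mem measurableSet_Ioi] with y hy
      have hy0 : 0 < y := zero_lt_one.trans hy
      rw [Real.norm_of_nonneg (by simp only [f, smul_eq_mul]; positivity),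
        ← Real.rpow_natCast, hm1]
      calc y ^ ((m : ℝ) - 1) • f y ≤ y ^ ((m : ℝ) - 1) * (1 * y ^ (-(m + β))) := by
            rw [smul_eq_mul]
            exact mul_le_mul_of_nonneg_left (mul_le_mul_of_nonneg_right (min_le_right _ _)
              (by positivity)) (by positivity)
        _ = _ := by
            rw [one_mul, ← Real.rpow_add hy0]
            congr 1
            ring
  refine lt_of_le_of_lt (lintegral_mono fun z ↦ ?_) h1.2
  rcases eq_or_ne z 0 with rfl | hz
  · rw [enorm_zero, ENNReal.zero_rpow_of_pos (hβ.trans hP), min_eq_left zero_le, zero_mul]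
    exact zero_le
  · have hz0 : 0 < ‖z‖ := norm_pos_iff.2 hz
    rw [← enorm_norm z, enorm_rpow_of_pos hz0, enorm_rpow_of_pos hz0, ← ENNReal.ofReal_one,
      ← ENNReal.ofReal_min, ← ENNReal.ofReal_mul (by positivity),
      Real.enorm_eq_ofReal (by simp only [f]; positivity)]

theorem setLIntegral_eq_mul_comp_add_smul (c : EuclideanSpace ℝ (Fin m)) {ρ : ℝ} (hρ : 0 < ρ)
    {A : Set (EuclideanSpace ℝ (Fin m))} (f : EuclideanSpace ℝ (Fin m) → ENNReal) :
    ∫⁻ x in A, f x =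
      ENNReal.ofReal (ρ ^ (m : ℝ)) * ∫⁻ x in (fun x ↦ c + ρ • x) ⁻¹' A, f (c + ρ • x) := by
  rw [setLIntegral_comp_add_smul c hρ, ← mul_assoc, ← ENNReal.ofReal_mul (by positivity),
    ← Real.rpow_add hρ, add_neg_cancel, Real.rpow_zero, ENNReal.ofReal_one, one_mul]

theorem edist_add_smul (c x y : EuclideanSpace ℝ (Fin m)) {ρ : ℝ} (hρ : 0 < ρ) :
    edist (c + ρ • x) (c + ρ • y) = ENNReal.ofReal ρ * edist x y := by
  rw [edist_add_left, edist_dist, edist_dist, dist_smul₀, Real.norm_of_nonneg hρ.le,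
    ENNReal.ofReal_mul hρ.le]

/-- The integral of a fractional kernel off a ball. -/
theorem exists_lintegral_edist_rpow_neg_le (hm : 0 < m) {β : ℝ} (hβ : 0 < β) :
    ∃ K : ℝ≥0, ∀ (r : ℝ≥0) (x : EuclideanSpace ℝ (Fin m)),
      ∫⁻ y in {y | (r : ENNReal) ≤ edist x y}, edist x y ^ (-(m + β)) ≤ K * (r : ENNReal) ^ (-β) := by
  set K := ∫⁻ z : EuclideanSpace ℝ (Fin m), min (‖z‖ₑ ^ (β + 1)) 1 * ‖z‖ₑ ^ (-(m + β)) with hK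
  have hK' : K < ⊤ := lintegral_min_enorm_rpow_mul_lt_top hm hβ (by linarith)
  -- The summand 1 keeps the constant nonzero, so that the right-hand side is ⊤ for `r = 0`.
  refine ⟨K.toNNReal + 1, fun r x ↦ ?_⟩
  rcases eq_or_ne r 0 with rfl | hr
  · rw [ENNReal.coe_zero, ENNReal.zero_rpow_of_neg (by linarith), ENNReal.mul_top (by simp)]
    exact le_top
  have hr0 : 0 < (r : ℝ) := NNReal.coe_pos.2 (pos_iff_ne_zero.2 hr)
  rw [setLIntegral_eq_mul_comp_add_smul x hr0]
  have h1 : ∀ z : EuclideanSpace ℝ (Fin m), edist x (x + (r : ℝ) • z) = r * ‖z‖ₑ := fun z ↦ by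
    have := edist_add_smul x 0 z hr0
    rwa [smul_zero, add_zero, edist_zero_left, ENNReal.ofReal_coe_nnreal] at this
  have h2 : (fun z ↦ x + (r : ℝ) • z) ⁻¹' {y | (r : ENNReal) ≤ edist x y} = {z | 1 ≤ ‖z‖ₑ} := by
    ext z
    simp only [mem_preimage, mem_ofPred_eq, h1]
    exact (ENNReal.mul_le_mul_iff_right (a := (r : ENNReal)) (b := 1) (by simpa using hr)
      ENNReal.coe_ne_top (c := ‖z‖ₑ)) |> fun h ↦ by rwa [mul_one] at h
  have hr1 : ENNReal.ofReal ((r : ℝ) ^ (m : ℝ)) * (r : ENNReal) ^ (-(m + β)) = (r : ENNReal) ^ (-β) := by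
    rw [← ENNReal.ofReal_rpow_of_pos hr0, ENNReal.ofReal_coe_nnreal,
      ← ENNReal.rpow_add _ _ (by simpa using hr) ENNReal.coe_ne_top]
    congr 1
    ring
  rw [h2]
  have hmeas : MeasurableSet {z : EuclideanSpace ℝ (Fin m) | 1 ≤ ‖z‖ₑ} :=
    (isClosed_le continuous_const continuous_enorm).measurableSet
  calc _ = ENNReal.ofReal ((r : ℝ) ^ (m : ℝ)) * ∫⁻ z : EuclideanSpace ℝ (Fin m) in {z | 1 ≤ ‖z‖ₑ},
        (r : ENNReal) ^ (-(m + β)) * ‖z‖ₑ ^ (-(m + β)) := by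
        congr 1
        refine lintegral_congr fun z ↦ ?_
        rw [h1, ENNReal.mul_rpow_of_ne_top ENNReal.coe_ne_top enorm_ne_top]
    _ = (r : ENNReal) ^ (-β) * ∫⁻ z : EuclideanSpace ℝ (Fin m) in {z | 1 ≤ ‖z‖ₑ},
        ‖z‖ₑ ^ (-(m + β)) := by
        rw [lintegral_const_mul _ (by fun_prop), ← mul_assoc, hr1]
    _ ≤ (r : ENNReal) ^ (-β) * K := by
        gcongr
        rw [hK, ← lintegral_indicator hmeas]
        refine lintegral_mono fun z ↦ ?_
        by_cases hz : 1 ≤ ‖z‖ₑ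
        · rw [indicator_of_mem (by exact hz), min_eq_right (ENNReal.one_le_rpow hz (by linarith)),
            one_mul]
        · rw [indicator_of_notMem (by exact hz)]
          exact zero_le
    _ ≤ _ := by
        rw [mul_comm, ENNReal.coe_add, ENNReal.coe_toNNReal hK'.ne]
        gcongr
        exact le_self_add

end FractionalKernel

/-! ### The Gagliardo energy of compositions -/

section Gagliardo

open scoped NNReal

variable {m : ℕ} {N : Type*} [EMetricSpace N]

theorem gagliardoEnergy_eq (s p : ℝ) (A : Set (EuclideanSpace ℝ (Fin m)))
    (u : EuclideanSpace ℝ (Fin m) → N) : gagliardoEnergy m s p A u =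
      ∫⁻ x in A, ∫⁻ y in A, edist (u x) (u y) ^ p / edist x y ^ (m + s * p) := by
  rw [gagliardoEnergy, EuclideanSpace.euclideanHausdorffMeasure_eq_volume]

/-- The two integrals give ρ^(-2m), the kernel gives ρ^(m + s p). -/
theorem gagliardoEnergy_comp_add_smul {s p : ℝ} (hsp : 0 ≤ s * p) (A : Set (EuclideanSpace ℝ (Fin m)))
    (u : EuclideanSpace ℝ (Fin m) → N) (c : EuclideanSpace ℝ (Fin m)) {ρ : ℝ} (hρ : 0 < ρ) :
    gagliardoEnergy m s p ((fun x ↦ c + ρ • x) ⁻¹' A) (fun x ↦ u (c + ρ • x)) =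
      ENNReal.ofReal (ρ ^ (s * p - m)) * gagliardoEnergy m s p A u := by
  simp only [gagliardoEnergy_eq]
  set α := (m : ℝ) + s * p
  have hα : 0 ≤ α := by positivity
  have h1 : ∀ x y : EuclideanSpace ℝ (Fin m), edist (u (c + ρ • x)) (u (c + ρ • y)) ^ p / edist x y ^ α =
      ENNReal.ofReal (ρ ^ α) *
        (edist (u (c + ρ • x)) (u (c + ρ • y)) ^ p / edist (c + ρ • x) (c + ρ • y) ^ α) := fun x y ↦ by
    have h2 : ENNReal.ofReal (ρ ^ α) ≠ 0 := by
      rw [Ne, ENNReal.ofReal_eq_zero, not_le]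
      positivity
    rw [edist_add_smul _ _ _ hρ, ENNReal.mul_rpow_of_nonneg _ _ hα, ENNReal.ofReal_rpow_of_pos hρ,
      div_eq_mul_inv, div_eq_mul_inv, ENNReal.mul_inv (Or.inl h2) (Or.inl ENNReal.ofReal_ne_top),
      mul_left_comm, ← mul_assoc (ENNReal.ofReal _), ENNReal.mul_inv_cancel h2 ENNReal.ofReal_ne_top,
      one_mul]
  simp only [h1]
  have h3 : ∀ x : EuclideanSpace ℝ (Fin m), ∫⁻ y in (fun x ↦ c + ρ • x) ⁻¹' A, ENNReal.ofReal (ρ ^ α) *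
      (edist (u (c + ρ • x)) (u (c + ρ • y)) ^ p / edist (c + ρ • x) (c + ρ • y) ^ α) =
      ENNReal.ofReal (ρ ^ (s * p)) *
        ∫⁻ y in A, edist (u (c + ρ • x)) (u y) ^ p / edist (c + ρ • x) y ^ α := fun x ↦ by
    rw [lintegral_const_mul' _ _ ENNReal.ofReal_ne_top, setLIntegral_comp_add_smul c hρ
      (fun y ↦ edist (u (c + ρ • x)) (u y) ^ p / edist (c + ρ • x) y ^ α), ← mul_assoc,
      ← ENNReal.ofReal_mul (by positivity), ← Real.rpow_add hρ]
    congr 3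
    ring
  simp only [h3]
  rw [lintegral_const_mul' _ _ ENNReal.ofReal_ne_top, setLIntegral_comp_add_smul c hρ
    (fun x ↦ ∫⁻ y in A, edist (u x) (u y) ^ p / edist x y ^ α), ← mul_assoc,
    ← ENNReal.ofReal_mul (by positivity), ← Real.rpow_add hρ]
  rfl

variable [MeasurableSpace N] [BorelSpace N] [SecondCountableTopology N]

/-- The energy of a composition with a Lipschitz map is controlled by a density that is composed with
the map. -/
theorem exists_gagliardoEnergy_comp_le (hm : 0 < m) {s p : ℝ} (hs : 0 < s) (hp : 1 ≤ p) (L : ℝ≥0) :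
    ∃ C : ℝ≥0, ∀ (φ : EuclideanSpace ℝ (Fin m) → EuclideanSpace ℝ (Fin m))
      (u : EuclideanSpace ℝ (Fin m) → N), LipschitzWith L φ →
      (∀ x ∈ Metric.ball (0 : EuclideanSpace ℝ (Fin m)) 4, ‖φ x‖ ≤ 1) → Measurable u →
      gagliardoEnergy m s p (Metric.ball 0 4) (fun x ↦ u (φ x)) ≤
        C * ∫⁻ x in Metric.ball 0 4, ∫⁻ ξ in Metric.ball 0 1,
          edist (u (φ x)) (u ξ) ^ p / edist (φ x) ξ ^ (m + s * p) := by
  have hp0 : 0 < p := by linarith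
  set α : ℝ := (m : ℝ) + s * p with hα
  have hα0 : 0 < α := by positivity
  have : Nonempty (Fin m) := ⟨⟨0, hm⟩⟩
  obtain ⟨K, hK⟩ := exists_lintegral_edist_rpow_neg_le hm hα0
  set c : ℝ≥0 := L + 1
  set w₁ := volume (Metric.ball (0 : EuclideanSpace ℝ (Fin m)) 1)
  have hw₁0 : w₁ ≠ 0 := (Metric.measure_ball_pos _ _ one_pos).ne'
  have hw₁t : w₁ ≠ ⊤ := measure_ball_lt_top.ne
  set C₁ : ENNReal := 2 ^ (p - 1) * (ENNReal.ofReal ((1 / 8 : ℝ) ^ m) * w₁)⁻¹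
  have hC₁ : C₁ ≠ ⊤ := by
    refine ENNReal.mul_ne_top (ENNReal.rpow_ne_top_of_nonneg (by linarith) (by simp)) ?_
    rw [ENNReal.inv_ne_top]
    exact mul_ne_zero (by rw [Ne, ENNReal.ofReal_eq_zero, not_le]; positivity) hw₁0
  refine ⟨2 * C₁.toNNReal * (K * c ^ α), fun φ u hφ hφ1 hu ↦ ?_⟩
  rw [gagliardoEnergy_eq]
  set B4 := Metric.ball (0 : EuclideanSpace ℝ (Fin m)) 4
  set B1 := Metric.ball (0 : EuclideanSpace ℝ (Fin m)) 1
  -- The triangle inequality is applied through `u ξ`, averaged over a ball of points ξ of the unit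
  -- ball that are close to both `φ x` and `φ y` in the sense of `T`. This replaces `u (φ y)` by `u
  -- ξ`; afterwards y appears only in the kernel and can be integrated out.
  set T : Set (EuclideanSpace ℝ (Fin m) × EuclideanSpace ℝ (Fin m) × EuclideanSpace ℝ (Fin m)) :=
    {q | edist (φ q.1) q.2.2 ≤ c * edist q.1 q.2.1}
  have hφm := hφ.continuous.measurable
  have hT : MeasurableSet T := measurableSet_le (by fun_prop) (by fun_prop)
  set k : EuclideanSpace ℝ (Fin m) × EuclideanSpace ℝ (Fin m) × EuclideanSpace ℝ (Fin m) → ENNReal :=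
    T.indicator fun q ↦ edist q.1 q.2.1 ^ (-(m + α)) * edist (u (φ q.1)) (u q.2.2) ^ p with hk
  have hkm : Measurable k := by
    refine Measurable.indicator (.mul (by fun_prop) (Measurable.pow_const ?_ p)) hT
    exact (hu.comp (by fun_prop)).edist (hu.comp (by fun_prop))
  set H : EuclideanSpace ℝ (Fin m) × EuclideanSpace ℝ (Fin m) → ENNReal :=
    fun q ↦ ∫⁻ ξ in B1, k (q.1, q.2, ξ) with hH
  have hHm : Measurable H := by
    have : Measurable fun q : (EuclideanSpace ℝ (Fin m) × EuclideanSpace ℝ (Fin m)) ×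
        EuclideanSpace ℝ (Fin m) ↦ k (q.1.1, q.1.2, q.2) := hkm.comp (by fun_prop)
    exact this.lintegral_prod_right'
  have hpt : ∀ x ∈ B4, ∀ y ∈ B4, edist (u (φ x)) (u (φ y)) ^ p / edist x y ^ α ≤
      C₁ * (H (x, y) + H (y, x)) := by
    intro x hx y hy
    rcases eq_or_ne x y with rfl | hxy
    · rw [edist_self, ENNReal.zero_rpow_of_pos hp0, ENNReal.zero_div]
      exact zero_le
    set t := dist x y with ht
    have ht0 : 0 < t := dist_pos.2 hxy
    have ht8 : t < 8 := by
      have := dist_triangle_right x y 0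
      rw [mem_ball_iff_norm, sub_zero] at hx hy
      rw [dist_zero_right, dist_zero_right] at this
      linarith
    set X := φ x
    set Y := φ y
    have hXY : ‖X - Y‖ ≤ L * t := by
      rw [← dist_eq_norm]
      exact hφ.dist_le_mul x y
    have hXX := hφ1 x hx
    have hYY := hφ1 y hy
    -- The midpoint of X and Y, pulled towards the origin so that the ball of radius t/8 about it
    -- stays in the unit ball; t < 8 makes the factor positive.
    set z₀ := (1 - t / 8) • (1 / 2 : ℝ) • (X + Y)
    set B := Metric.ball z₀ (t / 8)
    have hmid : ‖(1 / 2 : ℝ) • (X + Y)‖ ≤ 1 := by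
      rw [norm_smul, Real.norm_of_nonneg (by norm_num)]
      linarith [norm_add_le X Y]
    have hBB : B ⊆ B1 := fun ξ hξ ↦ by
      rw [mem_ball_iff_norm] at hξ
      rw [mem_ball_zero_iff]
      have h1 : ‖z₀‖ ≤ 1 - t / 8 := by
        rw [norm_smul, Real.norm_of_nonneg (by linarith)]
        exact mul_le_of_le_one_right (by linarith) hmid
      linarith [norm_sub_norm_le ξ z₀]
    have hnear : ∀ ξ ∈ B, ∀ Z, ‖Z - (1 / 2 : ℝ) • (X + Y)‖ ≤ L * t / 2 → edist Z ξ ≤ c * edist x y := by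
      intro ξ hξ Z hZ
      rw [mem_ball_iff_norm'] at hξ
      have h1 : ‖(1 / 2 : ℝ) • (X + Y) - z₀‖ ≤ t / 8 := by
        have : (1 / 2 : ℝ) • (X + Y) - z₀ = (t / 8) • (1 / 2 : ℝ) • (X + Y) := by
          simp only [z₀]
          module
        rw [this, norm_smul, Real.norm_of_nonneg (by linarith)]
        exact mul_le_of_le_one_right (by linarith) hmid
      have h2 : ‖Z - ξ‖ ≤ c * t := by
        have h3 : Z - ξ = (Z - (1 / 2 : ℝ) • (X + Y)) + ((1 / 2 : ℝ) • (X + Y) - z₀) + (z₀ - ξ) := by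
          abel
        have h4 : (c : ℝ) = L + 1 := rfl
        rw [h3, h4]
        refine norm_add₃_le.trans ?_
        nlinarith [L.2]
      rw [edist_dist, edist_dist, ENNReal.coe_nnreal_eq, ← ENNReal.ofReal_mul c.coe_nonneg, dist_eq_norm]
      exact ENNReal.ofReal_le_ofReal h2
    have hnX : ∀ ξ ∈ B, (x, y, ξ) ∈ T := fun ξ hξ ↦ by
      refine hnear ξ hξ X ?_
      have : X - (1 / 2 : ℝ) • (X + Y) = (1 / 2 : ℝ) • (X - Y) := by module
      rw [this, norm_smul, Real.norm_of_nonneg (by norm_num)]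
      linarith
    have hnY : ∀ ξ ∈ B, (y, x, ξ) ∈ T := fun ξ hξ ↦ by
      change edist Y ξ ≤ c * edist y x
      rw [edist_comm y x]
      refine hnear ξ hξ Y ?_
      have : Y - (1 / 2 : ℝ) • (X + Y) = (1 / 2 : ℝ) • (Y - X) := by module
      rw [this, norm_smul, Real.norm_of_nonneg (by norm_num), norm_sub_rev]
      linarith
    have htE : edist x y = ENNReal.ofReal t := edist_dist x y
    have htE0 : edist x y ≠ 0 := by simpa using hxy
    have htEt : edist x y ≠ ⊤ := edist_ne_top x y
    have hvol : volume B = ENNReal.ofReal ((1 / 8 : ℝ) ^ m) * w₁ * edist x y ^ (m : ℝ) := by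
      rw [Measure.addHaar_ball _ _ (by positivity), finrank_euclideanSpace_fin, htE,
        ENNReal.ofReal_rpow_of_pos ht0, Real.rpow_natCast, mul_right_comm,
        ← ENNReal.ofReal_mul (by positivity), ← mul_pow]
      congr 4
      ring
    have hvol0 : volume B ≠ 0 := (Metric.measure_ball_pos _ _ (by positivity)).ne'
    have hvolt : volume B ≠ ⊤ := measure_ball_lt_top.ne
    -- The volume of `B` is proportional to t^m, which turns the exponent m + α of `k` back into α.
    have hkey : volume B * (edist (u X) (u Y) ^ p * edist x y ^ (-(m + α))) ≤
        2 ^ (p - 1) * (H (x, y) + H (y, x)) := by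
      calc _ = ∫⁻ ξ in B, edist (u X) (u Y) ^ p * edist x y ^ (-(m + α)) := by
            rw [setLIntegral_const, mul_comm]
        _ ≤ ∫⁻ ξ in B, 2 ^ (p - 1) * (k (x, y, ξ) + k (y, x, ξ)) := by
            refine setLIntegral_mono' Metric.isOpen_ball.measurableSet fun ξ hξ ↦ ?_
            simp only [hk, indicator_of_mem (hnX ξ hξ), indicator_of_mem (hnY ξ hξ),
              edist_comm y x]
            rw [← mul_add, mul_comm, mul_left_comm]
            gcongr
            refine le_trans ?_ (ENNReal.rpow_add_le_mul_rpow_add_rpow _ _ hp)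
            gcongr
            exact edist_triangle_right _ _ _
        _ ≤ ∫⁻ ξ in B1, 2 ^ (p - 1) * (k (x, y, ξ) + k (y, x, ξ)) := lintegral_mono_set hBB
        _ = _ := by
            have hk1 : Measurable fun ξ ↦ k (x, y, ξ) := hkm.comp (by fun_prop)
            rw [lintegral_const_mul' _ _ (ENNReal.rpow_ne_top_of_nonneg (by linarith) (by simp)),
              lintegral_add_left hk1]
    have hsplit : edist (u X) (u Y) ^ p * edist x y ^ (-(m + α)) =
        edist (u X) (u Y) ^ p / edist x y ^ α * (edist x y ^ (m : ℝ))⁻¹ := by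
      rw [neg_add, ENNReal.rpow_add _ _ htE0 htEt, ENNReal.rpow_neg, ENNReal.rpow_neg,
        div_eq_mul_inv, mul_assoc, mul_comm ((edist x y ^ (m : ℝ))⁻¹)]
    have hm0 : edist x y ^ (m : ℝ) ≠ 0 := by simp [htE0]
    have hmt : edist x y ^ (m : ℝ) ≠ ⊤ := ENNReal.rpow_ne_top_of_nonneg (by simp) htEt
    rw [hsplit, hvol] at hkey
    set W := ENNReal.ofReal ((1 / 8 : ℝ) ^ m) * w₁
    have hW0 : W ≠ 0 := mul_ne_zero (by rw [Ne, ENNReal.ofReal_eq_zero, not_le]; positivity) hw₁0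
    have hWt : W ≠ ⊤ := ENNReal.mul_ne_top ENNReal.ofReal_ne_top hw₁t
    have h5 : W * edist x y ^ (m : ℝ) * (edist (u X) (u Y) ^ p / edist x y ^ α *
        (edist x y ^ (m : ℝ))⁻¹) = W * (edist (u X) (u Y) ^ p / edist x y ^ α) := by
      rw [mul_assoc, mul_left_comm (edist x y ^ (m : ℝ)), ENNReal.mul_inv_cancel hm0 hmt, mul_one]
    rw [h5] at hkey
    calc _ = W⁻¹ * (W * (edist (u X) (u Y) ^ p / edist x y ^ α)) := by
          rw [← mul_assoc, ENNReal.inv_mul_cancel hW0 hWt, one_mul]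
      _ ≤ W⁻¹ * (2 ^ (p - 1) * (H (x, y) + H (y, x))) := by gcongr
      _ = _ := by
          simp only [C₁, W]
          ring
  -- For fixed x and ξ, `T` says that y is at distance at least ‖φ x - ξ‖ / c from x, so the
  -- integral of the kernel of exponent m + α over y is of order ‖φ x - ξ‖^(-α).
  have hinner : ∀ x, ∫⁻ y in B4, H (x, y) ≤
      K * c ^ α * ∫⁻ ξ in B1, edist (u (φ x)) (u ξ) ^ p / edist (φ x) ξ ^ α := by
    intro x
    have hk1 : Measurable fun q : EuclideanSpace ℝ (Fin m) × EuclideanSpace ℝ (Fin m) ↦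
      k (x, q.1, q.2) := hkm.comp (by fun_prop)
    simp only [hH]
    rw [lintegral_lintegral_swap hk1.aemeasurable,
      ← lintegral_const_mul' _ _ (by rw [← ENNReal.coe_rpow_of_nonneg _ hα0.le]; finiteness)]
    refine lintegral_mono fun ξ ↦ ?_
    rcases eq_or_ne (φ x) ξ with hx | hx
    · have : ∀ y, k (x, y, ξ) = 0 := fun y ↦ by
        simp only [hk, indicator, hx, edist_self, ENNReal.zero_rpow_of_pos hp0, mul_zero, ite_self]
      simp only [this, lintegral_zero, zero_le]
    set r : ℝ≥0 := (edist (φ x) ξ / c).toNNReal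
    have hc0 : (c : ENNReal) ≠ 0 := by simp [c]
    have hr : (r : ENNReal) = edist (φ x) ξ / c :=
      ENNReal.coe_toNNReal (ENNReal.div_ne_top (edist_ne_top _ _) hc0)
    have hTr : ∀ y, (x, y, ξ) ∈ T ↔ (r : ENNReal) ≤ edist x y := fun y ↦ by
      rw [hr, ENNReal.div_le_iff' hc0 ENNReal.coe_ne_top]
      rfl
    calc _ ≤ ∫⁻ y, k (x, y, ξ) := setLIntegral_le_lintegral _ _
      _ = ∫⁻ y in {y | (r : ENNReal) ≤ edist x y}, edist x y ^ (-(m + α)) *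
          edist (u (φ x)) (u ξ) ^ p := by
          rw [← lintegral_indicator (measurableSet_le (by fun_prop) (by fun_prop))]
          refine lintegral_congr fun y ↦ ?_
          simp only [hk, indicator, hTr, mem_ofPred_eq]
      _ = (∫⁻ y in {y | (r : ENNReal) ≤ edist x y}, edist x y ^ (-(m + α))) *
          edist (u (φ x)) (u ξ) ^ p := lintegral_mul_const _ (by fun_prop)
      _ ≤ K * (r : ENNReal) ^ (-α) * edist (u (φ x)) (u ξ) ^ p := by
          gcongr
          exact hK r x
      _ = _ := by
          rw [hr, ENNReal.rpow_neg, ENNReal.div_rpow_of_nonneg _ _ hα0.le, ENNReal.inv_div]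
          · simp only [div_eq_mul_inv]
            ring
          · exact Or.inl (ENNReal.rpow_ne_top_of_nonneg hα0.le ENNReal.coe_ne_top)
          · exact Or.inl (by simp [ENNReal.rpow_eq_zero_iff, hc0])
  calc _ ≤ ∫⁻ x in B4, ∫⁻ y in B4, C₁ * (H (x, y) + H (y, x)) :=
        setLIntegral_mono' Metric.isOpen_ball.measurableSet fun x hx ↦
          setLIntegral_mono' Metric.isOpen_ball.measurableSet fun y hy ↦ hpt x hx y hy
    _ = C₁ * ((∫⁻ x in B4, ∫⁻ y in B4, H (x, y)) + ∫⁻ x in B4, ∫⁻ y in B4, H (y, x)) := by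
        rw [← lintegral_add_left hHm.lintegral_prod_right', ← lintegral_const_mul' _ _ hC₁]
        refine lintegral_congr fun x ↦ ?_
        have hH1 : Measurable fun y ↦ H (x, y) := hHm.comp (by fun_prop)
        rw [lintegral_const_mul' _ _ hC₁, lintegral_add_left hH1]
    _ = C₁ * (2 * ∫⁻ x in B4, ∫⁻ y in B4, H (x, y)) := by
        have hH2 : Measurable fun q : EuclideanSpace ℝ (Fin m) × EuclideanSpace ℝ (Fin m) ↦
          H (q.2, q.1) := hHm.comp (by fun_prop)
        rw [lintegral_lintegral_swap (f := fun x y ↦ H (y, x)) hH2.aemeasurable, two_mul]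
    _ ≤ C₁ * (2 * ∫⁻ x in B4, K * c ^ α *
          ∫⁻ ξ in B1, edist (u (φ x)) (u ξ) ^ p / edist (φ x) ξ ^ α) := by
        gcongr with x
        exact hinner x
    _ = _ := by
        rw [lintegral_const_mul' _ _ (by rw [← ENNReal.coe_rpow_of_nonneg _ hα0.le]; finiteness)]
        push_cast
        rw [ENNReal.coe_toNNReal hC₁, ENNReal.coe_rpow_of_nonneg _ hα0.le]
        ring

end Gagliardo

/-! ### Opening and gluing for the Gagliardo energy -/

section GagliardoConst

open scoped NNReal

variable {N : Type*} [EMetricSpace N] [MeasurableSpace N] [BorelSpace N] [SecondCountableTopology N]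

theorem measurable_gagliardo_integrand {X : Type*} [EMetricSpace X] [MeasurableSpace X]
    [BorelSpace X] [SecondCountableTopology X] {U : X → N} (hU : Measurable U) (p α : ℝ) :
    Measurable fun q : X × X ↦ edist (U q.1) (U q.2) ^ p / edist q.1 q.2 ^ α :=
  (((hU.comp measurable_fst).edist (hU.comp measurable_snd)).pow_const p).div
    ((measurable_fst.edist measurable_snd).pow_const α)

/-- The energy of a map that is constant off a set is controlled by the energy near this set. -/
theorem gagliardoEnergy_univ_le {X : Type*} [EMetricSpace X] [MeasurableSpace X] [BorelSpace X]
    [SecondCountableTopology X] {m : ℕ} [SFinite (μHE[m] : Measure X)] {s p : ℝ} (hp : 0 < p)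
    {F O : Set X} (hO : MeasurableSet O) (hF : MeasurableSet F) (hFO : F ⊆ O) {U : X → N} {b : N}
    (hU : Measurable U) (hUb : ∀ x ∉ F, U x = b) {K : ENNReal}
    (hK : ∀ x ∈ F, ∫⁻ y in Oᶜ, edist x y ^ (-(m + s * p)) ∂μHE[m] ≤ K) :
    gagliardoEnergy m s p univ U ≤
      gagliardoEnergy m s p O U + 2 * (K * ∫⁻ x in F, edist (U x) b ^ p ∂μHE[m]) := by
  simp only [gagliardoEnergy, Measure.restrict_univ]
  set α := (m : ℝ) + s * p
  set μ : Measure X := μHE[m]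
  set k : X × X → ENNReal := fun q ↦ edist (U q.1) (U q.2) ^ p / edist q.1 q.2 ^ α with hk
  have hkm : Measurable k := measurable_gagliardo_integrand hU p α
  have hkx : ∀ x, Measurable fun y ↦ k (x, y) := fun x ↦ hkm.comp measurable_prodMk_left
  have hout : ∀ x ∈ O, ∫⁻ y in Oᶜ, k (x, y) ∂μ ≤ F.indicator (fun x ↦ K * edist (U x) b ^ p) x := by
    intro x _
    have h1 : ∫⁻ y in Oᶜ, k (x, y) ∂μ = ∫⁻ y in Oᶜ, edist x y ^ (-α) * edist (U x) b ^ p ∂μ := by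
      refine setLIntegral_congr_fun hO.compl fun y hy ↦ ?_
      simp only [hk, hUb y fun h ↦ hy (hFO h), ENNReal.rpow_neg, div_eq_mul_inv, mul_comm]
    rw [h1]
    by_cases hx : x ∈ F
    · rw [indicator_of_mem hx, lintegral_mul_const _ (by fun_prop)]
      gcongr
      exact hK x hx
    · simp only [hUb x hx, edist_self, ENNReal.zero_rpow_of_pos hp, mul_zero, lintegral_zero, zero_le]
  have h2 : ∫⁻ x in O, ∫⁻ y in Oᶜ, k (x, y) ∂μ ∂μ ≤ K * ∫⁻ x in F, edist (U x) b ^ p ∂μ := by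
    calc _ ≤ ∫⁻ x in O, F.indicator (fun x ↦ K * edist (U x) b ^ p) x ∂μ :=
          setLIntegral_mono' hO hout
      _ ≤ ∫⁻ x, F.indicator (fun x ↦ K * edist (U x) b ^ p) x ∂μ := setLIntegral_le_lintegral _ _
      _ = _ := by
          have hd : Measurable fun x ↦ edist (U x) b ^ p :=
            (measurable_edist_left.comp hU).pow_const p
          rw [lintegral_indicator hF, lintegral_const_mul _ hd]
  have h3 : ∫⁻ x in Oᶜ, ∫⁻ y in O, k (x, y) ∂μ ∂μ = ∫⁻ x in O, ∫⁻ y in Oᶜ, k (x, y) ∂μ ∂μ := by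
    rw [lintegral_lintegral_swap (f := fun x y ↦ k (x, y)) hkm.aemeasurable]
    refine lintegral_congr fun y ↦ lintegral_congr fun x ↦ ?_
    simp only [hk, edist_comm]
  have h4 : ∫⁻ x in Oᶜ, ∫⁻ y in Oᶜ, k (x, y) ∂μ ∂μ = 0 := by
    rw [setLIntegral_congr_fun hO.compl (g := fun _ ↦ 0) fun x hx ↦ ?_, lintegral_zero]
    rw [setLIntegral_congr_fun hO.compl (g := fun _ ↦ 0) fun y hy ↦ ?_, lintegral_zero]
    simp only [hk, hUb x fun h ↦ hx (hFO h), hUb y fun h ↦ hy (hFO h), edist_self,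
      ENNReal.zero_rpow_of_pos hp, ENNReal.zero_div]
  calc ∫⁻ x, ∫⁻ y, k (x, y) ∂μ ∂μ =
        ∫⁻ x, (∫⁻ y in O, k (x, y) ∂μ) + (∫⁻ y in Oᶜ, k (x, y) ∂μ) ∂μ :=
        lintegral_congr fun x ↦ (lintegral_add_compl _ hO).symm
    _ = (∫⁻ x, ∫⁻ y in O, k (x, y) ∂μ ∂μ) + ∫⁻ x, ∫⁻ y in Oᶜ, k (x, y) ∂μ ∂μ :=
        lintegral_add_left hkm.lintegral_prod_right' _
    _ = ((∫⁻ x in O, ∫⁻ y in O, k (x, y) ∂μ ∂μ) + ∫⁻ x in O, ∫⁻ y in Oᶜ, k (x, y) ∂μ ∂μ) +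
        ((∫⁻ x in O, ∫⁻ y in Oᶜ, k (x, y) ∂μ ∂μ) + 0) := by
        rw [← lintegral_add_compl (fun x ↦ ∫⁻ y in O, k (x, y) ∂μ) hO,
          ← lintegral_add_compl (fun x ↦ ∫⁻ y in Oᶜ, k (x, y) ∂μ) hO, h3, h4]
    _ ≤ _ := by
        rw [add_zero, add_assoc, ← two_mul]
        gcongr

variable {m : ℕ}

-- Between the radii ρ and R the map is equal to `b`. The pairs whose second point lies in this
-- shell have bounded distance, and already control `edist (v x) b ^ p`.
omit [BorelSpace N] [SecondCountableTopology N] in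
theorem exists_lintegral_edist_rpow_le_gagliardoEnergy (hm : 0 < m) {s p : ℝ} (hs : 0 < s)
    (hp : 0 < p) {ρ R : ℝ} (hρ : 0 ≤ ρ) (hρR : ρ < R) :
    ∃ C : ℝ≥0, ∀ (v : EuclideanSpace ℝ (Fin m) → N) (b : N), Measurable v →
      (∀ x ∉ Metric.closedBall (0 : EuclideanSpace ℝ (Fin m)) ρ, v x = b) →
      ∫⁻ x, edist (v x) b ^ p ≤ C * gagliardoEnergy m s p (Metric.ball 0 R) v := by
  have : Nonempty (Fin m) := ⟨⟨0, hm⟩⟩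
  set α := (m : ℝ) + s * p
  have hα : 0 ≤ α := by positivity
  have hR : 0 < R := by linarith
  set F := Metric.closedBall (0 : EuclideanSpace ℝ (Fin m)) ρ
  set O := Metric.ball (0 : EuclideanSpace ℝ (Fin m)) R
  have hFO : F ⊆ O := Metric.closedBall_subset_ball hρR
  set a := volume (O \ F)
  have ha0 : a ≠ 0 := by
    refine (IsOpen.measure_pos _ (Metric.isOpen_ball.sdiff Metric.isClosed_closedBall) ?_).ne'
    obtain ⟨z, hz⟩ := exists_norm_eq (EuclideanSpace ℝ (Fin m)) (c := (ρ + R) / 2) (by linarith)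
    exact ⟨z, by rw [mem_ball_zero_iff]; linarith, by rw [mem_closedBall_zero_iff]; linarith⟩
  have hat : a ≠ ⊤ := ne_top_of_le_ne_top measure_ball_lt_top.ne (measure_mono sdiff_subset)
  set d : ENNReal := ENNReal.ofReal (2 * R) ^ α
  have hd0 : d ≠ 0 := by simp [d, hR, hα]
  have hdt : d ≠ ⊤ := ENNReal.rpow_ne_top_of_nonneg hα ENNReal.ofReal_ne_top
  refine ⟨(a⁻¹ * d).toNNReal, fun v b hv hvb ↦ ?_⟩
  rw [ENNReal.coe_toNNReal (ENNReal.mul_ne_top (ENNReal.inv_ne_top.2 ha0) hdt), gagliardoEnergy_eq]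
  have h1 : ∀ x ∈ O, d⁻¹ * a * edist (v x) b ^ p ≤
      ∫⁻ y in O, edist (v x) (v y) ^ p / edist x y ^ α := by
    intro x hx
    calc d⁻¹ * a * edist (v x) b ^ p = ∫⁻ y in O \ F, d⁻¹ * edist (v x) b ^ p := by
          rw [setLIntegral_const]
          ring
      _ ≤ ∫⁻ y in O \ F, edist (v x) (v y) ^ p / edist x y ^ α := by
          refine setLIntegral_mono' (Metric.isOpen_ball.sdiff Metric.isClosed_closedBall).measurableSet
            fun y hy ↦ ?_
          rw [hvb y hy.2, div_eq_mul_inv, mul_comm]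
          gcongr
          rw [edist_dist]
          refine ENNReal.rpow_le_rpow (ENNReal.ofReal_le_ofReal ?_) hα
          have h2 := dist_triangle_right x y 0
          have h3 := Metric.mem_ball.1 hx
          have h4 := Metric.mem_ball.1 hy.1
          linarith
      _ ≤ _ := lintegral_mono_set sdiff_subset
  calc ∫⁻ x, edist (v x) b ^ p = ∫⁻ x in O, edist (v x) b ^ p := by
        refine (setLIntegral_eq_of_support_subset fun x hx ↦ ?_).symm
        by_contra h
        exact hx (by simp only [hvb x fun h' ↦ h (hFO h'), edist_self, ENNReal.zero_rpow_of_pos hp])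
    _ = a⁻¹ * d * ∫⁻ x in O, d⁻¹ * a * edist (v x) b ^ p := by
        rw [lintegral_const_mul' _ _ (ENNReal.mul_ne_top (ENNReal.inv_ne_top.2 hd0) hat), ← mul_assoc,
          mul_assoc a⁻¹, ← mul_assoc d, ENNReal.mul_inv_cancel hd0 hdt, one_mul,
          ENNReal.inv_mul_cancel ha0 hat, one_mul]
    _ ≤ _ := mul_le_mul_right (setLIntegral_mono' Metric.isOpen_ball.measurableSet h1) _

/-- The pairs with a point off the larger ball contribute only if the other point is in the smaller
one, so their distance is at least R - ρ. Integrating the kernel leaves the L^p distance to `b`,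
which the energy on the larger ball controls. -/
theorem exists_gagliardoEnergy_univ_le (hm : 0 < m) {s p : ℝ} (hs : 0 < s) (hp : 0 < p) {ρ R : ℝ}
    (hρ : 0 ≤ ρ) (hρR : ρ < R) :
    ∃ C : ℝ≥0, ∀ (v : EuclideanSpace ℝ (Fin m) → N) (b : N), Measurable v →
      (∀ x ∉ Metric.closedBall (0 : EuclideanSpace ℝ (Fin m)) ρ, v x = b) →
      gagliardoEnergy m s p univ v ≤ C * gagliardoEnergy m s p (Metric.ball 0 R) v := by
  obtain ⟨C, hC⟩ := exists_lintegral_edist_rpow_le_gagliardoEnergy (N := N) hm hs hp hρ hρR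
  obtain ⟨K, hK⟩ := exists_lintegral_edist_rpow_neg_le hm (mul_pos hs hp)
  have hr0 : 0 < R - ρ := by linarith
  set r := (R - ρ).toNNReal
  have hr : (r : ENNReal) ≠ 0 := by simpa [r] using hρR
  set K' : ENNReal := K * (r : ENNReal) ^ (-(s * p))
  have hK' : K' ≠ ⊤ := by
    refine ENNReal.mul_ne_top ENNReal.coe_ne_top ?_
    rw [ENNReal.rpow_neg, ENNReal.inv_ne_top]
    simp [ENNReal.rpow_eq_zero_iff, hr]
  refine ⟨1 + 2 * (K'.toNNReal * C), fun v b hv hvb ↦ ?_⟩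
  have : SFinite (μHE[m] : Measure (EuclideanSpace ℝ (Fin m))) := by
    rw [EuclideanSpace.euclideanHausdorffMeasure_eq_volume]
    infer_instance
  refine (gagliardoEnergy_univ_le hp Metric.isOpen_ball.measurableSet
    Metric.isClosed_closedBall.measurableSet (Metric.closedBall_subset_ball hρR) hv hvb
    (K := K') fun x hx ↦ ?_).trans ?_
  · rw [EuclideanSpace.euclideanHausdorffMeasure_eq_volume]
    refine le_trans (lintegral_mono_set fun y hy ↦ ?_) (hK r x)
    rw [mem_ofPred_eq, edist_dist]
    refine ENNReal.ofReal_le_ofReal ?_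
    rw [mem_compl_iff, Metric.mem_ball, not_lt] at hy
    have h1 := dist_triangle y x 0
    rw [dist_comm y x] at h1
    have h2 := Metric.mem_closedBall.1 hx
    linarith
  · rw [EuclideanSpace.euclideanHausdorffMeasure_eq_volume]
    have h1 := (setLIntegral_le_lintegral (Metric.closedBall 0 ρ) _).trans (hC v b hv hvb)
    refine (add_le_add_right (mul_le_mul_right (mul_le_mul_right h1 K') 2) _).trans_eq ?_
    push_cast
    rw [ENNReal.coe_toNNReal hK']
    ring

/-- The averaging lemma is applied to the density z ↦ ∫ d(w z, w ξ)^p / |z - ξ|^(m + s p) dξ over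
the unit ball, which bounds the energy of the opened map on the ball of radius 4. The map is
constant beyond radius 3, so this bounds its energy on the whole space. -/
theorem exists_opening_gagliardoEnergy_le (hm : 0 < m) {s p : ℝ} (hs : 0 < s) (hp : 1 ≤ p) :
    ∃ C : ℝ≥0, ∀ (l : ℝ) (u : EuclideanSpace ℝ (Fin m) → N) (c : ENNReal), 1 / 2 ≤ l → l < 1 →
      Measurable u → c ≠ ⊤ → gagliardoEnergy m s p (Metric.ball 0 1) u < c →
      ∃ (v : EuclideanSpace ℝ (Fin m) → N) (b : N), Measurable v ∧
        (∀ x ∈ Metric.ball 0 1, v x = u (l • x)) ∧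
        (∀ x ∉ Metric.closedBall (0 : EuclideanSpace ℝ (Fin m)) 3, v x = b) ∧
        gagliardoEnergy m s p univ v ≤ C * c := by
  have hp0 : 0 < p := by linarith
  obtain ⟨C₁, hC₁⟩ := exists_gagliardoEnergy_univ_le (N := N) hm hs hp0 (ρ := 3) (R := 4)
    (by norm_num) (by norm_num)
  obtain ⟨C₂, hC₂⟩ := exists_gagliardoEnergy_comp_le (N := N) hm hs hp 16
  obtain ⟨C₃, hC₃⟩ := exists_forall_exists_opening (m := m)
  refine ⟨C₁ * (C₂ * (C₃ * 2 ^ m)), fun l u c hl hl1 hu _ huc ↦ ?_⟩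
  have hl0 : 0 < l := by linarith
  set w : EuclideanSpace ℝ (Fin m) → N := fun x ↦ u (l • x)
  have hw : Measurable w := hu.comp (measurable_const_smul l)
  have hwE : gagliardoEnergy m s p (Metric.ball 0 1) w ≤ 2 ^ m * c := by
    have h1 := gagliardoEnergy_comp_add_smul (mul_nonneg hs.le hp0.le) (Metric.ball 0 1) u 0 hl0
    simp only [zero_add] at h1
    have h2 : Metric.ball (0 : EuclideanSpace ℝ (Fin m)) 1 ⊆ (fun x ↦ l • x) ⁻¹' Metric.ball 0 1 :=
      fun x hx ↦ by
        rw [mem_ball_zero_iff] at hx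
        rw [mem_preimage, mem_ball_zero_iff, norm_smul, Real.norm_of_nonneg hl0.le]
        nlinarith [norm_nonneg x]
    calc gagliardoEnergy m s p (Metric.ball 0 1) w ≤
          gagliardoEnergy m s p ((fun x ↦ l • x) ⁻¹' Metric.ball 0 1) w := by
          rw [gagliardoEnergy_eq, gagliardoEnergy_eq]
          exact (lintegral_mono fun x ↦ lintegral_mono_set h2).trans (lintegral_mono_set h2)
      _ ≤ _ := by
          rw [h1]
          refine mul_le_mul' ?_ huc.le
          rw [← ENNReal.ofReal_ofNat 2, ← ENNReal.ofReal_pow (by norm_num)]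
          refine ENNReal.ofReal_le_ofReal ?_
          calc l ^ (s * p - m) ≤ l ^ (-m : ℝ) :=
                Real.rpow_le_rpow_of_exponent_ge hl0 hl1.le (by have := mul_pos hs hp0; linarith)
            _ ≤ (1 / 2 : ℝ) ^ (-m : ℝ) := Real.rpow_le_rpow_of_nonpos (by norm_num) hl (by simp)
            _ = _ := by
                rw [Real.rpow_neg (by norm_num), Real.rpow_natCast]
                simp
  have hG : Measurable fun z ↦ ∫⁻ ξ in Metric.ball 0 1,
      edist (w z) (w ξ) ^ p / edist z ξ ^ (m + s * p) :=
    (measurable_gagliardo_integrand hw p (m + s * p)).lintegral_prod_right'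
  obtain ⟨a, ha, -, haG⟩ := hC₃ _ (fun _ ↦ True) hG (Eventually.of_forall fun _ ↦ trivial)
  have hL := lipschitzWith_opening (le_refl (0 : ℝ)) zero_le_one a
  have hv : Measurable fun x ↦ w (opening 0 a x) := hw.comp hL.continuous.measurable
  have hvb : ∀ x ∉ Metric.closedBall (0 : EuclideanSpace ℝ (Fin m)) 3, w (opening 0 a x) = w a :=
    fun x hx ↦ by
      rw [mem_closedBall_zero_iff, not_le] at hx
      rw [opening_zero_of_ge ha (by linarith [norm_sub_norm_le x a])]
  refine ⟨_, w a, hv, fun x hx ↦ ?_, hvb, ?_⟩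
  · rw [opening_of_norm_le_one zero_le_one ha (mem_ball_zero_iff.1 hx).le]
  · refine (hC₁ _ _ hv hvb).trans ?_
    push_cast
    rw [mul_assoc, mul_assoc, mul_assoc]
    gcongr
    refine (hC₂ (opening 0 a) w hL (fun x _ ↦ norm_opening_le le_rfl zero_le_one ha
      (by norm_num)) hw).trans ?_
    gcongr
    refine haG.trans ?_
    gcongr
    rw [← gagliardoEnergy_eq]
    exact hwE

/-- The values of the glued map at two points are joined by at most three jumps, through the
constants `b i` and `b j`. Each jump is that of a single `V i`, or of `Γ`, between the same two
points; hence the factor 3^p. -/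
theorem gagliardoEnergy_glue_le {ι : Type*} [Countable ι] {s p : ℝ} (hp : 0 < p)
    {O A : ι → Set (EuclideanSpace ℝ (Fin m))} (hO : Pairwise (Function.onFun Disjoint O))
    (hAO : ∀ j, A j ⊆ O j) {Γ : EuclideanSpace ℝ (Fin m) → N}
    {V : ι → EuclideanSpace ℝ (Fin m) → N} {b : ι → N} (hΓ : Measurable Γ)
    (hV : ∀ j, Measurable (V j)) (hΓb : ∀ j, ∀ x ∈ O j, Γ x = b j)
    (hVb : ∀ j, ∀ x ∉ A j, V j x = b j) :
    gagliardoEnergy m s p univ (glue O V Γ) ≤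
      3 ^ p * (gagliardoEnergy m s p univ Γ + ∑' j, gagliardoEnergy m s p univ (V j)) := by
  have hnot : ∀ {j i x}, x ∈ O j → i ≠ j → V i x = b i := fun {j i x} hx hne ↦
    hVb i x fun hxi ↦ disjoint_left.1 (hO hne) (hAO i hxi) hx
  have hpt : ∀ x y, edist (glue O V Γ x) (glue O V Γ y) ^ p ≤
      3 ^ p * (edist (Γ x) (Γ y) ^ p + ∑' j, edist (V j x) (V j y) ^ p) := by
    intro x y
    set T := edist (Γ x) (Γ y) ^ p + ∑' j, edist (V j x) (V j y) ^ p
    have hΓT : edist (Γ x) (Γ y) ≤ T ^ p⁻¹ :=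
      (ENNReal.le_rpow_inv_iff hp).2 le_self_add
    have hVT : ∀ j, edist (V j x) (V j y) ≤ T ^ p⁻¹ := fun j ↦
      (ENNReal.le_rpow_inv_iff hp).2 ((ENNReal.le_tsum j).trans le_add_self)
    have h3 : ∀ {r : ENNReal}, r ≤ T ^ p⁻¹ + T ^ p⁻¹ + T ^ p⁻¹ → r ^ p ≤ 3 ^ p * T := fun {r} hr ↦ by
      calc r ^ p ≤ (3 * T ^ p⁻¹) ^ p := by
            gcongr
            exact hr.trans_eq (by ring)
        _ = _ := by rw [ENNReal.mul_rpow_of_nonneg _ _ hp.le, ENNReal.rpow_inv_rpow hp.ne']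
    apply h3
    by_cases hx : ∃ i, x ∈ O i
    · obtain ⟨i, hi⟩ := hx
      rw [glue_of_mem hO V Γ hi]
      by_cases hy : ∃ j, y ∈ O j
      · obtain ⟨j, hj⟩ := hy
        rw [glue_of_mem hO V Γ hj]
        rcases eq_or_ne i j with rfl | hij
        · exact (hVT i).trans (le_add_self)
        · refine (edist_triangle4 _ (b i) (b j) _).trans (add_le_add_three ?_ ?_ ?_)
          · rw [← hnot hj hij]
            exact hVT i
          · rw [← hΓb i x hi, ← hΓb j y hj]
            exact hΓT
          · rw [← hnot hi hij.symm]
            exact hVT j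
      · push Not at hy
        rw [glue_of_notMem V Γ hy]
        refine (edist_triangle _ (b i) _).trans (le_trans (add_le_add ?_ ?_) le_self_add)
        · rw [← hVb i y fun h ↦ hy i (hAO i h)]
          exact hVT i
        · rw [← hΓb i x hi]
          exact hΓT
    · push Not at hx
      rw [glue_of_notMem V Γ hx]
      by_cases hy : ∃ j, y ∈ O j
      · obtain ⟨j, hj⟩ := hy
        rw [glue_of_mem hO V Γ hj]
        refine (edist_triangle _ (b j) _).trans (le_trans (add_le_add ?_ ?_) le_self_add)
        · rw [← hΓb j y hj]
          exact hΓT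
        · rw [← hVb j x fun h ↦ hx j (hAO j h)]
          exact hVT j
      · push Not at hy
        rw [glue_of_notMem V Γ hy]
        exact hΓT.trans le_add_self
  simp only [gagliardoEnergy_eq, Measure.restrict_univ]
  set α := (m : ℝ) + s * p
  have h3t : (3 : ENNReal) ^ p ≠ ⊤ := ENNReal.rpow_ne_top_of_nonneg hp.le (by simp)
  have hΓm := measurable_gagliardo_integrand hΓ p α
  have hVm := fun j ↦ measurable_gagliardo_integrand (hV j) p α
  calc _ ≤ ∫⁻ x, ∫⁻ y, 3 ^ p * (edist (Γ x) (Γ y) ^ p / edist x y ^ α +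
        ∑' j, edist (V j x) (V j y) ^ p / edist x y ^ α) := by
        gcongr with x y
        simp only [div_eq_mul_inv]
        rw [ENNReal.tsum_mul_right, ← add_mul, ← mul_assoc]
        gcongr
        exact hpt x y
    _ = _ := by
        rw [← lintegral_tsum fun j ↦ (hVm j).lintegral_prod_right'.aemeasurable,
          ← lintegral_add_left hΓm.lintegral_prod_right', ← lintegral_const_mul' _ _ h3t]
        refine lintegral_congr fun x ↦ ?_
        have h4 : ∀ j, AEMeasurable fun y ↦ edist (V j x) (V j y) ^ p / edist x y ^ α :=
          fun j ↦ ((hVm j).comp measurable_prodMk_left).aemeasurable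
        have h5 : Measurable fun y ↦ edist (Γ x) (Γ y) ^ p / edist x y ^ α :=
          hΓm.comp measurable_prodMk_left
        rw [lintegral_const_mul' _ _ h3t, ← lintegral_tsum h4, lintegral_add_left h5]

/-- Near the diagonal the Lipschitz bound gives |x - y|^p, which the kernel can take as s < 1. -/
theorem LipschitzWith.gagliardoEnergy_univ_lt_top (hm : 0 < m) {s p : ℝ} (hs : 0 < s) (hs1 : s < 1)
    (hp : 0 < p) {Γ : EuclideanSpace ℝ (Fin m) → N} {L : ℝ≥0} (hΓ : LipschitzWith L Γ) {b : N}
    {ρ : ℝ} (hρ : 0 ≤ ρ) (hb : ∀ x ∉ Metric.closedBall (0 : EuclideanSpace ℝ (Fin m)) ρ, Γ x = b) :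
    gagliardoEnergy m s p univ Γ < ⊤ := by
  obtain ⟨C, hC⟩ := exists_gagliardoEnergy_univ_le (N := N) hm hs hp hρ (lt_add_one ρ)
  refine (hC Γ b hΓ.continuous.measurable hb).trans_lt (ENNReal.mul_lt_top ENNReal.coe_lt_top ?_)
  set B := Metric.ball (0 : EuclideanSpace ℝ (Fin m)) (ρ + 1)
  set α := (m : ℝ) + s * p
  set I := ∫⁻ z : EuclideanSpace ℝ (Fin m), min (‖z‖ₑ ^ p) 1 * ‖z‖ₑ ^ (-α)
  have hI : I < ⊤ := lintegral_min_enorm_rpow_mul_lt_top hm (mul_pos hs hp) (by nlinarith)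
  set c : ENNReal := (L : ENNReal) ^ p * ENNReal.ofReal (2 * (ρ + 1) + 1) ^ p
  have hc : c ≠ ⊤ := ENNReal.mul_ne_top (ENNReal.rpow_ne_top_of_nonneg hp.le ENNReal.coe_ne_top)
    (ENNReal.rpow_ne_top_of_nonneg hp.le ENNReal.ofReal_ne_top)
  rw [gagliardoEnergy_eq]
  have h1 : ∀ x ∈ B, ∫⁻ y in B, edist (Γ x) (Γ y) ^ p / edist x y ^ α ≤ c * I := by
    intro x hx
    calc _ ≤ ∫⁻ y in B, c * (min (‖y - x‖ₑ ^ p) 1 * ‖y - x‖ₑ ^ (-α)) := by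
          refine setLIntegral_mono' Metric.isOpen_ball.measurableSet fun y hy ↦ ?_
          have h2 : edist x y = ‖y - x‖ₑ := by rw [edist_comm, edist_eq_enorm_sub]
          rw [← mul_assoc, ENNReal.rpow_neg, div_eq_mul_inv, h2, mul_assoc (_ ^ p : ENNReal)]
          gcongr
          refine (ENNReal.rpow_le_rpow (hΓ x y) hp.le).trans ?_
          rw [h2, ENNReal.mul_rpow_of_nonneg _ _ hp.le]
          gcongr
          rcases le_total (‖y - x‖ₑ ^ p) 1 with h | h
          · rw [min_eq_left h]
            refine le_mul_of_one_le_left zero_le (ENNReal.one_le_rpow ?_ hp)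
            rw [← ENNReal.ofReal_one]
            exact ENNReal.ofReal_le_ofReal (by linarith)
          · rw [min_eq_right h, mul_one]
            gcongr
            rw [← h2, edist_dist]
            refine ENNReal.ofReal_le_ofReal ?_
            have h3 := dist_triangle_right x y 0
            have h4 := Metric.mem_ball.1 hx
            have h5 := Metric.mem_ball.1 hy
            linarith
      _ ≤ ∫⁻ y, c * (min (‖y - x‖ₑ ^ p) 1 * ‖y - x‖ₑ ^ (-α)) := setLIntegral_le_lintegral _ _
      _ = c * I := by
          rw [lintegral_const_mul' _ _ hc,
            lintegral_sub_right_eq_self (fun z ↦ min (‖z‖ₑ ^ p) 1 * ‖z‖ₑ ^ (-α)) x]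
  refine (setLIntegral_mono' Metric.isOpen_ball.measurableSet h1).trans_lt ?_
  rw [setLIntegral_const]
  exact ENNReal.mul_lt_top (ENNReal.mul_lt_top hc.lt_top hI) measure_ball_lt_top

end GagliardoConst

/-! ### The volume of the manifold and transplanted Gagliardo energies -/

section ManifoldMeasure

open scoped NNReal

theorem ENNReal.rpow_inv_le_of_le_mul {α : ℝ} (hα : 0 ≤ α) {K : ℝ≥0} (hK : 0 < K) {a b : ENNReal}
    (h : a ≤ K * b) : (b ^ α)⁻¹ ≤ (K : ENNReal) ^ α * (a ^ α)⁻¹ := by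
  have h0 : (K : ENNReal) ^ α ≠ 0 := by simp [ENNReal.rpow_eq_zero_iff, hK.ne']
  have h1 : (K : ENNReal) ^ α ≠ ⊤ := ENNReal.rpow_ne_top_of_nonneg hα ENNReal.coe_ne_top
  calc (b ^ α)⁻¹ = (K : ENNReal) ^ α * ((K : ENNReal) ^ α * b ^ α)⁻¹ := by
        rw [ENNReal.mul_inv (Or.inl h0) (Or.inl h1), ← mul_assoc, ENNReal.mul_inv_cancel h0 h1,
          one_mul]
    _ ≤ _ := by
        rw [← ENNReal.mul_rpow_of_nonneg _ _ hα]
        gcongr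

variable {m : ℕ} {M : Type*} [EMetricSpace M] [MeasurableSpace M] [BorelSpace M]
  [ChartedSpace (EuclideanSpace ℝ (Fin m)) M] [IsManifold (𝓡 m) ∞ M]
  [RiemannianBundle (fun x : M ↦ TangentSpace (𝓡 m) x)]
  [IsContMDiffRiemannianBundle (𝓡 m) ∞ (EuclideanSpace ℝ (Fin m))
    (fun x : M ↦ TangentSpace (𝓡 m) x)] [IsRiemannianManifold (𝓡 m) M]

-- The image of a compact ball under a Lipschitz inverse chart has finite Hausdorff measure.
variable (m M) in
theorem isLocallyFiniteMeasure_euclideanHausdorffMeasure :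
    IsLocallyFiniteMeasure (μHE[m] : Measure M) := by
  refine ⟨fun x₀ ↦ ?_⟩
  obtain ⟨δ, hδ, C, -, hT, hC, -⟩ := exists_bilipschitz_chartAt (m := m) x₀
  set e := chartAt (EuclideanSpace ℝ (Fin m)) x₀
  set A := Metric.closedBall (e x₀) δ
  refine ⟨e.symm '' A, ?_, ?_⟩
  · have := e.symm.image_mem_nhds (s := A) (x := e x₀) (e.map_source (mem_chart_source _ x₀))
      (Metric.closedBall_mem_nhds _ hδ)
    rwa [e.left_inv (mem_chart_source _ x₀)] at this
  · have hA : IsCompact A := isCompact_closedBall _ _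
    have h1 := lintegral_comp_chart_le (G := A.indicator 1) hA hT (fun y hy z hz ↦ (hC y hy z hz).1)
      (measurable_one.indicator hA.measurableSet).aemeasurable
    have hF : IsClosed (e.symm '' A) :=
      (hA.image_of_continuousOn (e.symm.continuousOn.mono hT)).isClosed
    rw [lintegral_indicator_one hA.measurableSet, setLIntegral_congr_fun (g := fun _ ↦ 1)
      hF.measurableSet fun x hx ↦ ?_, setLIntegral_one] at h1
    · exact h1.trans_lt (ENNReal.mul_lt_top ENNReal.coe_lt_top hA.measure_lt_top)
    · obtain ⟨y, hy, rfl⟩ := hx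
      simp only [e.right_inv (hT hy), indicator_of_mem hy, Pi.one_apply]

omit [MeasurableSpace M] [BorelSpace M] [IsManifold (𝓡 m) ∞ M]
  [RiemannianBundle (fun x : M ↦ TangentSpace (𝓡 m) x)]
  [IsContMDiffRiemannianBundle (𝓡 m) ∞ (EuclideanSpace ℝ (Fin m))
    (fun x : M ↦ TangentSpace (𝓡 m) x)] [IsRiemannianManifold (𝓡 m) M] in
theorem secondCountableTopology_of_compact_or_euclidean (hM : CompactSpace M ∨
    ∃ Φ : M ≃ₘ⟮𝓡 m, 𝓡 m⟯ EuclideanSpace ℝ (Fin m), Isometry Φ) : SecondCountableTopology M := by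
  rcases hM with hM | ⟨Φ, -⟩
  · have : SigmaCompactSpace M := inferInstance
    exact ChartedSpace.secondCountable_of_sigmaCompact (EuclideanSpace ℝ (Fin m)) M
  · exact Φ.toHomeomorph.secondCountableTopology

/-- If `M` is compact, the kernel is bounded and the volume finite; if it is Euclidean, the bound on
ℝ^m is transported by the isometry. This uniform bound and second countability are all that is used
of the alternative. -/
theorem exists_lintegral_edist_rpow_neg_le_of_compact_or_euclidean (hm : 0 < m)
    (hM : CompactSpace M ∨ ∃ Φ : M ≃ₘ⟮𝓡 m, 𝓡 m⟯ EuclideanSpace ℝ (Fin m), Isometry Φ) {β : ℝ}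
    (hβ : 0 < β) {η : ℝ≥0} (hη : 0 < η) :
    ∃ K : ENNReal, K ≠ ⊤ ∧ ∀ x : M,
      ∫⁻ y in {y | (η : ENNReal) ≤ edist x y}, edist x y ^ (-(m + β)) ∂μHE[m] ≤ K := by
  have hη' : (η : ENNReal) ≠ 0 := by simpa using hη.ne'
  have hneg : ∀ r : ℝ, (η : ENNReal) ^ r ≠ ⊤ := fun r ↦ by simp [ENNReal.rpow_eq_top_iff, hη']
  rcases hM with hM | ⟨Φ, hΦ⟩
  · have := isLocallyFiniteMeasure_euclideanHausdorffMeasure m M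
    refine ⟨(η : ENNReal) ^ (-(m + β)) * (μHE[m] : Measure M) univ,
      ENNReal.mul_ne_top (hneg _) isCompact_univ.measure_lt_top.ne, fun x ↦ ?_⟩
    calc _ ≤ ∫⁻ y in {y | (η : ENNReal) ≤ edist x y}, (η : ENNReal) ^ (-(m + β)) ∂μHE[m] := by
          refine setLIntegral_mono' (isClosed_le continuous_const
            (continuous_const.edist continuous_id)).measurableSet fun y hy ↦ ?_
          rw [ENNReal.rpow_neg, ENNReal.rpow_neg]
          gcongr
          exact hy
      _ ≤ _ := by
          rw [setLIntegral_const]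
          gcongr
          exact subset_univ _
  · obtain ⟨K, hK⟩ := exists_lintegral_edist_rpow_neg_le hm hβ
    refine ⟨K * (η : ENNReal) ^ (-β), ENNReal.mul_ne_top ENNReal.coe_ne_top (hneg _), fun x ↦ ?_⟩
    have h1 := (IsometryEquiv.mk Φ.toEquiv hΦ).measurePreserving_euclideanHausdorffMeasure m
    rw [EuclideanSpace.euclideanHausdorffMeasure_eq_volume] at h1
    refine le_trans (le_of_eq ?_) (hK η (Φ x))
    rw [← h1.setLIntegral_comp_preimage_emb Φ.toHomeomorph.measurableEmbedding
      (fun y ↦ edist (Φ x) y ^ (-(m + β)))]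
    have h2 : ∀ y, edist (Φ x) (Φ y) = edist x y := fun y ↦ hΦ x y
    refine congrArg₂ _ ?_ (funext fun y ↦ (congrArg (· ^ (-(m + β))) (h2 y)).symm)
    congr 1
    ext y
    exact (by rw [h2 y] : (η : ENNReal) ≤ edist (Φ x) (Φ y) ↔ (η : ENNReal) ≤ edist x y).symm

variable {N : Type*} [EMetricSpace N] [MeasurableSpace N] [BorelSpace N] [SecondCountableTopology N]

/-- Pairs of points in the image of the large ball are compared with pairs in ℝ^m by the bilipschitz
chart. For the others, compactness separates the image of the smaller ball, off which the map is
constant, from the exterior by some η > 0; this is why δ' < δ. -/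
theorem gagliardoEnergy_transplant_lt_top (hm : 0 < m) (hM : CompactSpace M ∨
      ∃ Φ : M ≃ₘ⟮𝓡 m, 𝓡 m⟯ EuclideanSpace ℝ (Fin m), Isometry Φ)
    {s p : ℝ} (hs : 0 < s) (hp : 0 < p) {e : OpenPartialHomeomorph M (EuclideanSpace ℝ (Fin m))}
    {c : EuclideanSpace ℝ (Fin m)} {δ δ' : ℝ} (hδ' : 0 ≤ δ') (hδ : δ' < δ)
    (hT : Metric.closedBall c δ ⊆ e.target) {K : ℝ≥0} (hK0 : 0 < K) (hK : ∀ y ∈ Metric.closedBall c δ,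
      ∀ z ∈ Metric.closedBall c δ, edist (e.symm y) (e.symm z) ≤ K * edist y z ∧
        edist y z ≤ K * edist (e.symm y) (e.symm z))
    {V : EuclideanSpace ℝ (Fin m) → N} {b : N} (hV : Measurable V)
    (hVb : ∀ y ∉ Metric.closedBall c δ', V y = b) (hVE : gagliardoEnergy m s p univ V < ⊤) :
    gagliardoEnergy m s p univ (transplant e b V) < ⊤ := by
  have := secondCountableTopology_of_compact_or_euclidean hM
  have := isLocallyFiniteMeasure_euclideanHausdorffMeasure m M
  set A := Metric.closedBall c δ
  set A' := Metric.closedBall c δ'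
  have hA : IsCompact A := isCompact_closedBall c δ
  have hA' : IsCompact A' := isCompact_closedBall c δ'
  have hAA' : A' ⊆ A := Metric.closedBall_subset_closedBall hδ.le
  have hO : IsCompact (e.symm '' A) := hA.image_of_continuousOn (e.symm.continuousOn.mono hT)
  have hF : IsCompact (e.symm '' A') :=
    hA'.image_of_continuousOn (e.symm.continuousOn.mono (hAA'.trans hT))
  have hball : IsOpen (e.symm '' Metric.ball c δ) :=
    e.symm.isOpen_image_of_subset_source Metric.isOpen_ball (Metric.ball_subset_closedBall.trans hT)
  obtain ⟨η, hη, hηd⟩ := Metric.exists_pos_forall_lt_edist hF hball.isClosed_compl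
    (disjoint_compl_right_iff_subset.2 (image_mono (Metric.closedBall_subset_ball hδ)))
  obtain ⟨K', hK', hK'x⟩ := exists_lintegral_edist_rpow_neg_le_of_compact_or_euclidean hm hM
    (mul_pos hs hp) hη
  set α := (m : ℝ) + s * p
  have hα : 0 ≤ α := by positivity
  have h1 := gagliardoEnergy_univ_le hp hO.isClosed.measurableSet hF.isClosed.measurableSet
    (image_mono hAA') (measurable_transplant e b hV) (m := m) (s := s)
    (fun x hx ↦ transplant_eq_const hVb hx) fun x hx ↦ le_trans (lintegral_mono_set fun y hy ↦ ?_)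
      (hK'x x)
  · refine h1.trans_lt (ENNReal.add_lt_top.2 ⟨?_, ENNReal.mul_lt_top (by simp)
      (ENNReal.mul_lt_top hK'.lt_top ?_)⟩)
    · set k := fun q : EuclideanSpace ℝ (Fin m) × EuclideanSpace ℝ (Fin m) ↦
        edist (V q.1) (V q.2) ^ p / edist q.1 q.2 ^ α
      have hk : Measurable k := measurable_gagliardo_integrand hV p α
      have hKα : (K : ENNReal) ^ α ≠ ⊤ := ENNReal.rpow_ne_top_of_nonneg hα ENNReal.coe_ne_top
      rw [gagliardoEnergy_eq, Measure.restrict_univ] at hVE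
      rw [gagliardoEnergy]
      calc _ ≤ 
          ∫⁻ x in e.symm '' A, (K : ENNReal) ^ α * ((K ^ m : ℝ≥0) * ∫⁻ y, k (e x, y)) ∂μHE[m] := by
            refine setLIntegral_mono' hO.isClosed.measurableSet fun x hx ↦ ?_
            refine le_trans (setLIntegral_mono' (g := fun y ↦ (K : ENNReal) ^ α * k (e x, e y))
              hO.isClosed.measurableSet fun y hy ↦ ?_) ?_
            · obtain ⟨x', hx', rfl⟩ := hx
              obtain ⟨y', hy', rfl⟩ := hy
              simp only [k, transplant_symm b V (hT hx'), transplant_symm b V (hT hy'),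
                e.right_inv (hT hx'), e.right_inv (hT hy'), div_eq_mul_inv]
              rw [mul_left_comm]
              gcongr
              exact ENNReal.rpow_inv_le_of_le_mul hα hK0 (hK x' hx' y' hy').2
            · rw [lintegral_const_mul' _ _ hKα]
              gcongr
              exact lintegral_comp_chart_le (G := fun y ↦ k (e x, y)) hA hT
                (fun y hy z hz ↦ (hK y hy z hz).1) (hk.comp measurable_prodMk_left).aemeasurable
        _ = (K : ENNReal) ^ α * ((K ^ m : ℝ≥0) * ∫⁻ x in e.symm '' A, (∫⁻ y, k (e x, y)) ∂μHE[m]) := by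
            rw [lintegral_const_mul' _ _ hKα, lintegral_const_mul' _ _ ENNReal.coe_ne_top]
        _ ≤ (K : ENNReal) ^ α * ((K ^ m : ℝ≥0) * ((K ^ m : ℝ≥0) * ∫⁻ x, ∫⁻ y, k (x, y))) := by
            gcongr
            exact lintegral_comp_chart_le (G := fun x ↦ ∫⁻ y, k (x, y)) hA hT
              (fun y hy z hz ↦ (hK y hy z hz).1) hk.lintegral_prod_right'.aemeasurable
        _ < ⊤ := ENNReal.mul_lt_top hKα.lt_top (ENNReal.mul_lt_top ENNReal.coe_lt_top
            (ENNReal.mul_lt_top ENNReal.coe_lt_top hVE))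
    · have hρ : 0 ≤ ‖c‖ + δ' := by positivity
      obtain ⟨C, hC⟩ := exists_lintegral_edist_rpow_le_gagliardoEnergy (N := N) hm hs hp hρ
        (lt_add_one _)
      have h2 := hC V b hV fun x hx ↦ hVb x fun h ↦ hx <| by
        rw [mem_closedBall_iff_norm] at h
        rw [mem_closedBall_zero_iff]
        linarith [norm_sub_norm_le x c]
      have h3 : gagliardoEnergy m s p (Metric.ball 0 (‖c‖ + δ' + 1)) V ≤ gagliardoEnergy m s p univ V :=
        (lintegral_mono fun x ↦ lintegral_mono_set (subset_univ _)).trans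
          (lintegral_mono_set (subset_univ _))
      calc _ = ∫⁻ x in e.symm '' A', edist (V (e x)) b ^ p ∂μHE[m] := by
            refine setLIntegral_congr_fun hF.isClosed.measurableSet fun x hx ↦ ?_
            obtain ⟨y, hy, rfl⟩ := hx
            rw [transplant_symm b V (hT (hAA' hy)), e.right_inv (hT (hAA' hy))]
        _ ≤ (K ^ m : ℝ≥0) * ∫⁻ y, edist (V y) b ^ p :=
            lintegral_comp_chart_le (G := fun y ↦ edist (V y) b ^ p) hA' (hAA'.trans hT)
              (fun y hy z hz ↦ (hK y (hAA' hy) z (hAA' hz)).1)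
              ((measurable_edist_left.comp hV).pow_const p).aemeasurable
        _ < ⊤ := ENNReal.mul_lt_top ENNReal.coe_lt_top
            (h2.trans_lt (ENNReal.mul_lt_top ENNReal.coe_lt_top (h3.trans_lt hVE)))
  · exact (hηd x hx y fun h ↦ hy (image_mono Metric.ball_subset_closedBall h)).le

end ManifoldMeasure

/-! ### Concentrating weighted copies of maps -/

section Concentration

open scoped NNReal

variable {m : ℕ}

/-- A cubic grid of mesh 8ρ with Q points per side, where ρ solves Q^m ρ^σ = t. Then Q ρ = t^(1/σ)
Q^(1 - m/σ) tends to 0 because σ < m. -/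
theorem exists_packing {σ t : ℝ} (hσ : 0 < σ) (hσm : σ < m) (ht : 0 < t) :
    ∃ (Q : ℕ) (c : (Fin m → Fin Q) → EuclideanSpace ℝ (Fin m)) (ρ : ℝ), 0 < ρ ∧
      (Q : ℝ) ^ m * ρ ^ σ = t ∧
      Pairwise (Function.onFun Disjoint fun i ↦ Metric.ball (c i) (4 * ρ)) ∧
      ∀ i, Metric.ball (c i) (4 * ρ) ⊆ Metric.closedBall 0 (1 / 2) := by
  -- The quantity is (8 m + 4) ρ Q: the centres have norm at most 8 m ρ Q, and the radii 4ρ are at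
  -- most 4 ρ Q.
  have hlim : Tendsto (fun Q : ℕ ↦ t ^ (1 / σ) * (Q : ℝ) ^ (-(m / σ - 1)) * (8 * m + 4)) atTop
      (𝓝 (t ^ (1 / σ) * 0 * (8 * m + 4))) :=
    (((tendsto_rpow_neg_atTop (by rw [sub_pos, one_lt_div hσ]; exact hσm)).comp
      tendsto_natCast_atTop_atTop).const_mul _).mul_const _
  rw [mul_zero, zero_mul] at hlim
  obtain ⟨Q, hQ, hQ1⟩ := ((hlim.eventually_le_const (by norm_num : (0 : ℝ) < 1 / 2)).and
    (eventually_ge_atTop 1)).exists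
  have hQ0 : (0 : ℝ) < Q := by exact_mod_cast hQ1
  have hQ1' : (1 : ℝ) ≤ Q := by exact_mod_cast hQ1
  set ρ : ℝ := (t / (Q : ℝ) ^ m) ^ (1 / σ)
  have hρ : 0 < ρ := by positivity
  have hρQ : ρ * Q = t ^ (1 / σ) * (Q : ℝ) ^ (-(m / σ - 1)) := by
    rw [show -((m : ℝ) / σ - 1) = -((m : ℝ) * (1 / σ)) + 1 by ring, Real.rpow_add hQ0,
      Real.rpow_one, Real.rpow_neg hQ0.le, Real.rpow_mul hQ0.le, Real.rpow_natCast,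
      show ρ = t ^ (1 / σ) / ((Q : ℝ) ^ m) ^ (1 / σ) from Real.div_rpow ht.le (by positivity) _]
    ring
  rw [← hρQ] at hQ
  set c : (Fin m → Fin Q) → EuclideanSpace ℝ (Fin m) := fun f ↦
    WithLp.toLp 2 fun a ↦ 8 * ρ * (f a : ℝ) with hc
  refine ⟨Q, c, ρ, hρ, ?_, fun f g hfg ↦ ?_, fun f x hx ↦ ?_⟩
  · rw [← Real.rpow_mul (by positivity), one_div_mul_cancel hσ.ne', Real.rpow_one]
    field_simp
  · refine Metric.ball_disjoint_ball ?_
    obtain ⟨a, ha⟩ := Function.ne_iff.1 hfg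
    have h1 : (1 : ℝ) ≤ |(f a : ℝ) - (g a : ℝ)| := by
      have h2 : (1 : ℤ) ≤ |((f a : ℕ) : ℤ) - ((g a : ℕ) : ℤ)| :=
        Int.one_le_abs (sub_ne_zero.2 fun h ↦ ha (Fin.ext (by exact_mod_cast h)))
      exact_mod_cast h2
    have h2 := PiLp.norm_apply_le (c f - c g) a
    have h3 : (c f - c g) a = 8 * ρ * ((f a : ℝ) - (g a : ℝ)) := by simp [hc]; ring
    rw [h3, Real.norm_eq_abs, abs_mul, abs_of_pos (by positivity : 0 < 8 * ρ)] at h2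
    rw [dist_eq_norm]
    nlinarith
  · have h1 : ‖c f‖ ≤ m * (8 * ρ * Q) := by
      rw [EuclideanSpace.norm_eq]
      refine Real.sqrt_le_iff.2 ⟨by positivity, ?_⟩
      calc ∑ a, ‖c f a‖ ^ 2 ≤ ∑ _a : Fin m, (8 * ρ * Q) ^ 2 := by
            refine Finset.sum_le_sum fun a _ ↦ ?_
            have h2 : (f a : ℝ) ≤ Q := by exact_mod_cast (f a).2.le
            simp only [hc, Real.norm_eq_abs, sq_abs]
            gcongr
        _ = m * (8 * ρ * Q) ^ 2 := by simp
        _ ≤ (m * (8 * ρ * Q)) ^ 2 := by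
            have h3 : (m : ℝ) ≤ (m : ℝ) ^ 2 := by exact_mod_cast Nat.le_self_pow two_ne_zero m
            rw [mul_pow (m : ℝ)]
            exact mul_le_mul_of_nonneg_right h3 (sq_nonneg _)
    rw [mem_ball_iff_norm] at hx
    rw [mem_closedBall_zero_iff]
    nlinarith [norm_sub_norm_le x (c f)]

variable {X : Type*} [MeasurableSpace X]

variable (m) in
/-- An energy of maps `ℝ^m → X` that scales with the power `σ` of the length, and is subadditive
when maps are inserted into balls on which a given map is constant. -/
structure IsGluableEnergy (σ : ℝ) (G : ℝ≥0) (F : (EuclideanSpace ℝ (Fin m) → X) → ENNReal) :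
    Prop where
  const (b : X) : F (fun _ ↦ b) = 0
  scale (u : EuclideanSpace ℝ (Fin m) → X) (c : EuclideanSpace ℝ (Fin m)) (ρ : ℝ) (hρ : 0 < ρ) :
    F (fun x ↦ u (c + ρ • x)) ≤ ENNReal.ofReal (ρ ^ (-σ)) * F u
  transition (b b' : X) : ∃ Γ : EuclideanSpace ℝ (Fin m) → X, Measurable Γ ∧
    (∀ x ∈ Metric.closedBall (0 : EuclideanSpace ℝ (Fin m)) 1, Γ x = b) ∧
    (∀ x ∉ Metric.closedBall (0 : EuclideanSpace ℝ (Fin m)) 2, Γ x = b') ∧ F Γ < ⊤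
  glue_le (ι : Type) [Countable ι] (c : ι → EuclideanSpace ℝ (Fin m)) (ρ : ι → ℝ)
    (Γ : EuclideanSpace ℝ (Fin m) → X) (V : ι → EuclideanSpace ℝ (Fin m) → X) (b : ι → X)
    (hρ : ∀ i, 0 < ρ i)
    (hd : Pairwise (Function.onFun Disjoint fun i ↦ Metric.ball (c i) (4 * ρ i)))
    (hΓ : Measurable Γ) (hV : ∀ i, Measurable (V i))
    (hΓb : ∀ i, ∀ x ∈ Metric.ball (c i) (4 * ρ i), Γ x = b i)
    (hVb : ∀ i, ∀ x ∉ Metric.closedBall (c i) (3 * ρ i), V i x = b i) :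
    F (glue (fun i ↦ Metric.ball (c i) (4 * ρ i)) V Γ) ≤ G * (F Γ + ∑' i, F (V i))

namespace IsGluableEnergy

variable {σ : ℝ} {G : ℝ≥0} {F : (EuclideanSpace ℝ (Fin m) → X) → ENNReal}

theorem comp_inv_smul_sub_le (h : IsGluableEnergy m σ G F) (u : EuclideanSpace ℝ (Fin m) → X)
    (c : EuclideanSpace ℝ (Fin m)) {ρ : ℝ} (hρ : 0 < ρ) :
    F (fun x ↦ u (ρ⁻¹ • (x - c))) ≤ ENNReal.ofReal (ρ ^ σ) * F u := by
  have h1 := h.scale u (-(ρ⁻¹ • c)) ρ⁻¹ (inv_pos.2 hρ)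
  rw [Real.inv_rpow hρ.le, Real.rpow_neg hρ.le, inv_inv] at h1
  convert h1 using 5
  rw [smul_sub]
  abel

omit [MeasurableSpace X] in
theorem comp_inv_smul_sub_eq {u : EuclideanSpace ℝ (Fin m) → X} {b : X} {R : ℝ}
    (hu : ∀ x ∉ Metric.closedBall (0 : EuclideanSpace ℝ (Fin m)) R, u x = b)
    {c : EuclideanSpace ℝ (Fin m)} {ρ : ℝ} (hρ : 0 < ρ) :
    ∀ x ∉ Metric.closedBall c (R * ρ), u (ρ⁻¹ • (x - c)) = b := fun x hx ↦ by
  refine hu _ fun h ↦ hx ?_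
  rw [mem_closedBall_zero_iff, norm_smul, norm_inv, Real.norm_of_nonneg hρ.le,
    inv_mul_le_iff₀ hρ] at h
  rw [mem_closedBall_iff_norm]
  linarith

/-- The copies of `v` in the balls of a packing are glued into the constant `b`, which has no
energy. Each costs ρ^σ times the energy of `v`, and together Q^m ρ^σ = t times. -/
theorem exists_repetition (h : IsGluableEnergy m σ G F) (hσ : 0 < σ) (hσm : σ < m)
    {v : EuclideanSpace ℝ (Fin m) → X} {b : X} (hv : Measurable v)
    (hvb : ∀ x ∉ Metric.closedBall (0 : EuclideanSpace ℝ (Fin m)) 3, v x = b) {t : ℝ} (ht : 0 < t) :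
    ∃ (W : EuclideanSpace ℝ (Fin m) → X) (Q : ℕ) (c : (Fin m → Fin Q) → EuclideanSpace ℝ (Fin m))
      (ρ : ℝ), Measurable W ∧ (∀ x ∉ Metric.closedBall 0 (1 / 2), W x = b) ∧
      F W ≤ G * (ENNReal.ofReal t * F v) ∧ 0 < ρ ∧ (Q : ℝ) ^ m * ρ ^ σ = t ∧
      Pairwise (Function.onFun Disjoint fun i ↦ Metric.ball (c i) ρ) ∧
      (∀ i, Metric.ball (c i) ρ ⊆ Metric.closedBall 0 (1 / 2)) ∧
      ∀ i, ∀ x ∈ Metric.ball 0 1, W (c i + ρ • x) = v x := by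
  obtain ⟨Q, c, ρ, hρ, hQ, hd, hc⟩ := exists_packing hσ hσm ht
  have hs : ∀ i, Metric.ball (c i) ρ ⊆ Metric.ball (c i) (4 * ρ) :=
    fun i ↦ Metric.ball_subset_ball (by linarith)
  set V : (Fin m → Fin Q) → EuclideanSpace ℝ (Fin m) → X := fun i x ↦ v (ρ⁻¹ • (x - c i))
  have hV : ∀ i, Measurable (V i) := fun i ↦
    hv.comp ((measurable_id.sub_const (c i)).const_smul ρ⁻¹)
  refine ⟨glue (fun i ↦ Metric.ball (c i) (4 * ρ)) V fun _ ↦ b, Q, c, ρ,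
    measurable_glue hd (fun _ ↦ Metric.isOpen_ball.measurableSet) hV measurable_const,
    fun x hx ↦ glue_of_notMem _ _ fun i hi ↦ hx (hc i hi), ?_, hρ, hQ,
    fun i j hij ↦ (hd hij).mono (hs i) (hs j), fun i ↦ (hs i).trans (hc i), fun i x hx ↦ ?_⟩
  · refine (h.glue_le _ c (fun _ ↦ ρ) (fun _ ↦ b) V (fun _ ↦ b) (fun _ ↦ hρ) hd measurable_const hV
      (fun _ _ _ ↦ rfl) fun i ↦ comp_inv_smul_sub_eq hvb hρ).trans ?_
    rw [h.const, zero_add]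
    gcongr
    calc ∑' i, F (V i) ≤ ∑' _i : Fin m → Fin Q, ENNReal.ofReal (ρ ^ σ) * F v :=
          ENNReal.tsum_le_tsum fun i ↦ h.comp_inv_smul_sub_le v (c i) hρ
      _ = _ := by
          rw [← hQ, ENNReal.ofReal_mul (by positivity), tsum_fintype, Finset.sum_const,
            Finset.card_univ, Fintype.card_fun, Fintype.card_fin, Fintype.card_fin, nsmul_eq_mul,
            mul_assoc, ENNReal.ofReal_pow (by positivity), ENNReal.ofReal_natCast, Nat.cast_pow]
  · rw [glue_of_mem hd _ _ (j := i)]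
    · simp only [V, add_sub_cancel_left, smul_smul, inv_mul_cancel₀ hρ.ne', one_smul]
    · rw [mem_ball_zero_iff] at hx
      rw [mem_ball_iff_norm, add_sub_cancel_left, norm_smul, Real.norm_of_nonneg hρ.le]
      nlinarith

/-- Weighted copies of countably many maps, concentrated in a ball. -/
theorem exists_concentration (h : IsGluableEnergy m σ G F) (hσ : 0 < σ) (hσm : σ < m)
    {v : ℕ → EuclideanSpace ℝ (Fin m) → X} {b : ℕ → X} (hv : ∀ k, Measurable (v k))
    (hvb : ∀ k, ∀ x ∉ Metric.closedBall (0 : EuclideanSpace ℝ (Fin m)) 3, v k x = b k)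
    {t : ℕ → ℝ} (ht : ∀ k, 0 < t k) (hsum : ∑' k, ENNReal.ofReal (t k) * F (v k) ≠ ⊤)
    (c₀ : EuclideanSpace ℝ (Fin m)) {δ : ℝ} (hδ : 0 < δ) :
    ∃ V : EuclideanSpace ℝ (Fin m) → X, Measurable V ∧
      (∀ x ∉ Metric.closedBall c₀ δ, V x = b 0) ∧ F V < ⊤ ∧
      ∀ k, ∃ (Q : ℕ) (c : (Fin m → Fin Q) → EuclideanSpace ℝ (Fin m)) (ρ : ℝ), 0 < ρ ∧
        (Q : ℝ) ^ m * ρ ^ σ = t k ∧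
        Pairwise (Function.onFun Disjoint fun i ↦ Metric.ball (c i) ρ) ∧
        (∀ i, Metric.ball (c i) ρ ⊆ Metric.closedBall c₀ δ) ∧
        ∀ i, ∀ x ∈ Metric.ball 0 1, V (c i + ρ • x) = v k x := by
  have hm : 0 < m := by
    have : (0 : ℝ) < m := hσ.trans hσm
    exact_mod_cast this
  choose Γ hΓ hΓb hΓb' hΓE using fun k ↦ h.transition (b k) (b 0)
  -- `τ k` is the scale of the k-th cluster, small enough for the transition from `b k` to `b 0` to
  -- cost at most 2^(-k) and for the clusters to be disjoint.
  have hτ : ∀ k, ∃ τ : ℝ, 0 < τ ∧ τ ≤ δ / 64 * (1 / 2) ^ k ∧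
      ENNReal.ofReal (τ ^ σ) * F (Γ k) ≤ ENNReal.ofReal ((1 / 2) ^ k) := by
    intro k
    have h1 : Tendsto (fun τ : ℝ ↦ ENNReal.ofReal (τ ^ σ) * F (Γ k)) (𝓝[>] 0) (𝓝 0) := by
      have h2 : Tendsto (fun τ : ℝ ↦ τ ^ σ) (𝓝[>] 0) (𝓝 0) := by
        have := (Real.continuousAt_rpow_const (0 : ℝ) σ (Or.inr hσ.le)).tendsto
        rw [Real.zero_rpow hσ.ne'] at this
        exact this.mono_left nhdsWithin_le_nhds
      have h3 := ENNReal.Tendsto.mul_const (ENNReal.tendsto_ofReal h2) (Or.inr (hΓE k).ne)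
      simpa using h3
    have h4 : (0 : ENNReal) < ENNReal.ofReal ((1 / 2) ^ k) := by simp
    obtain ⟨τ, h5, h6⟩ := ((h1.eventually_le_const h4).and (Ioc_mem_nhdsGT
      (show (0 : ℝ) < δ / 64 * (1 / 2) ^ k by positivity))).exists
    exact ⟨τ, h6.1, h6.2, h5⟩
  choose τ hτ0 hτδ hτE using hτ
  -- The weight is divided in advance by the factor `τ k ^ σ` that the scaling of the cluster will
  -- produce.
  choose W Q c ρ hW hWb hWE hρ hQ hd hc hWv using fun k ↦ h.exists_repetition hσ hσm (hv k) (hvb k)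
    (t := t k / τ k ^ σ) (div_pos (ht k) (Real.rpow_pos_of_pos (hτ0 k) σ))
  set o : EuclideanSpace ℝ (Fin m) := EuclideanSpace.single ⟨0, hm⟩ 1
  have ho : ‖o‖ = 1 := by simp [o]
  -- Centres on a ray, at distances (δ/2) 2^(-k) from `c₀`. Consecutive ones are (δ/4) 2^(-k) apart,
  -- more than the sum of the radii 4 τ ≤ (δ/16) 2^(-k).
  set a : ℕ → EuclideanSpace ℝ (Fin m) := fun k ↦ c₀ + (δ / 2 * (1 / 2) ^ k) • o
  have hpow : ∀ k : ℕ, (0 : ℝ) < (1 / 2) ^ k := fun k ↦ by positivity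
  have ha : ∀ k, Metric.ball (a k) (4 * τ k) ⊆ Metric.closedBall c₀ δ := fun k x hx ↦ by
    have h1 : dist (a k) c₀ = δ / 2 * (1 / 2) ^ k := by
      rw [dist_eq_norm, add_sub_cancel_left, norm_smul, ho, mul_one, Real.norm_of_nonneg]
      have := hpow k
      positivity
    have h2 : (1 / 2 : ℝ) ^ k ≤ 1 := pow_le_one₀ (by norm_num) (by norm_num)
    rw [Metric.mem_ball] at hx
    rw [Metric.mem_closedBall]
    nlinarith [dist_triangle x (a k) c₀, hτδ k]
  have had : Pairwise (Function.onFun Disjoint fun k ↦ Metric.ball (a k) (4 * τ k)) := by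
    refine (pairwise_disjoint_on _).2 fun k j hkj ↦ Metric.ball_disjoint_ball ?_
    have h1 : (1 / 2 : ℝ) ^ j ≤ 1 / 2 * (1 / 2) ^ k := by
      rw [← pow_succ']
      exact pow_le_pow_of_le_one (by norm_num) (by norm_num) hkj
    have h2 : dist (a k) (a j) = δ / 2 * ((1 / 2) ^ k - (1 / 2) ^ j) := by
      rw [dist_eq_norm, add_sub_add_left_eq_sub, ← sub_smul, norm_smul, ho, mul_one, ← mul_sub,
        Real.norm_of_nonneg]
      exact mul_nonneg (by positivity) (by linarith [hpow k])
    rw [h2]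
    nlinarith [hτδ k, hτδ j, hpow k, hpow j]
  set o₁ : Unit → Set (EuclideanSpace ℝ (Fin m)) := fun _ ↦ Metric.ball 0 (4 * (1 / 4))
  have ho₁ : Pairwise (Function.onFun Disjoint o₁) := Subsingleton.pairwise
  -- The repetition `W k`, equal to `b k` off the ball of radius 1/2, is inserted into the unit
  -- ball, where the transition is `b k`; the result is `b 0` near infinity, whatever `k`.
  set U : ℕ → EuclideanSpace ℝ (Fin m) → X := fun k ↦ glue o₁ (fun _ ↦ W k) (Γ k)
  have hU : ∀ k, Measurable (U k) := fun k ↦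
    measurable_glue ho₁ (fun _ ↦ Metric.isOpen_ball.measurableSet) (fun _ ↦ hW k) (hΓ k)
  have hUb : ∀ k, ∀ x ∉ Metric.closedBall (0 : EuclideanSpace ℝ (Fin m)) 3, U k x = b 0 :=
    fun k x hx ↦ by
    rw [mem_closedBall_zero_iff] at hx
    simp only [U]
    rw [glue_of_notMem]
    · refine hΓb' k x ?_
      rw [mem_closedBall_zero_iff]
      linarith
    · intro _ hx'
      rw [mem_ball_zero_iff] at hx'
      linarith
  have hUE : ∀ k, F (U k) ≤ G * (F (Γ k) + F (W k)) := fun k ↦ by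
    refine (h.glue_le Unit (fun _ ↦ 0) (fun _ ↦ 1 / 4) (Γ k) (fun _ ↦ W k) (fun _ ↦ b k)
      (fun _ ↦ by norm_num) ho₁ (hΓ k) (fun _ ↦ hW k) (fun _ x hx ↦ hΓb k x ?_)
      fun _ x hx ↦ hWb k x fun h ↦ hx (Metric.closedBall_subset_closedBall (by norm_num) h)).trans_eq ?_
    · exact Metric.ball_subset_closedBall (Metric.ball_subset_ball (by norm_num) hx)
    · simp
  set O : ℕ → Set (EuclideanSpace ℝ (Fin m)) := fun k ↦ Metric.ball (a k) (4 * τ k)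
  set V : ℕ → EuclideanSpace ℝ (Fin m) → X := fun k x ↦ U k ((τ k)⁻¹ • (x - a k))
  have hV : ∀ k, Measurable (V k) := fun k ↦
    (hU k).comp ((measurable_id.sub_const (a k)).const_smul (τ k)⁻¹)
  have hVE : ∀ k, F (V k) ≤ G * (ENNReal.ofReal ((1 / 2) ^ k) +
      G * (ENNReal.ofReal (t k) * F (v k))) := fun k ↦ by
    have hτσ := Real.rpow_pos_of_pos (hτ0 k) σ
    refine (h.comp_inv_smul_sub_le (U k) (a k) (hτ0 k)).trans ?_
    calc _ ≤ ENNReal.ofReal (τ k ^ σ) * (G * (F (Γ k) +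
          G * (ENNReal.ofReal (t k / τ k ^ σ) * F (v k)))) := by
          gcongr
          exact (hUE k).trans (by gcongr; exact hWE k)
      _ = G * (ENNReal.ofReal (τ k ^ σ) * F (Γ k) + G * (ENNReal.ofReal (τ k ^ σ) *
          ENNReal.ofReal (t k / τ k ^ σ) * F (v k))) := by ring
      _ ≤ _ := by
          rw [← ENNReal.ofReal_mul hτσ.le, mul_div_cancel₀ _ hτσ.ne']
          gcongr
          exact hτE k
  refine ⟨glue O V fun _ ↦ b 0, measurable_glue had (fun _ ↦ Metric.isOpen_ball.measurableSet) hV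
    measurable_const, fun x hx ↦ glue_of_notMem _ _ fun k hk ↦ hx (ha k hk), ?_, fun k ↦ ?_⟩
  · refine (h.glue_le ℕ a τ (fun _ ↦ b 0) V (fun _ ↦ b 0) hτ0 had measurable_const hV
      (fun _ _ _ ↦ rfl) fun k ↦ comp_inv_smul_sub_eq (hUb k) (hτ0 k)).trans_lt ?_
    rw [h.const, zero_add]
    refine ENNReal.mul_lt_top ENNReal.coe_lt_top
      ((ENNReal.tsum_le_tsum hVE).trans_lt ?_)
    rw [ENNReal.tsum_mul_left, ENNReal.tsum_add, ENNReal.tsum_mul_left]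
    refine ENNReal.mul_lt_top ENNReal.coe_lt_top (ENNReal.add_lt_top.2 ⟨?_,
      ENNReal.mul_lt_top ENNReal.coe_lt_top hsum.lt_top⟩)
    exact (summable_geometric_two.tsum_ofReal_lt_top)
  · have hs : ∀ i, ∀ x ∈ Metric.ball (0 : EuclideanSpace ℝ (Fin m)) 1,
        c k i + ρ k • x ∈ Metric.ball (c k i) (ρ k) := fun i x hx ↦ by
      rw [mem_ball_zero_iff] at hx
      rw [mem_ball_iff_norm, add_sub_cancel_left, norm_smul, Real.norm_of_nonneg (hρ k).le]
      nlinarith [hρ k]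
    have hmap : ∀ i, ∀ x ∈ Metric.ball (a k + τ k • c k i) (τ k * ρ k),
        (τ k)⁻¹ • (x - a k) ∈ Metric.ball (c k i) (ρ k) := fun i x hx ↦ by
      rw [mem_ball_iff_norm] at hx ⊢
      have h1 : (τ k)⁻¹ • (x - a k) - c k i = (τ k)⁻¹ • (x - (a k + τ k • c k i)) := by
        rw [← sub_sub x (a k), smul_sub _ _ (τ k • _), smul_smul, inv_mul_cancel₀ (hτ0 k).ne', one_smul]
      rwa [h1, norm_smul, norm_inv, Real.norm_of_nonneg (hτ0 k).le, inv_mul_lt_iff₀ (hτ0 k)]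
    have hin : ∀ i, ∀ x ∈ Metric.ball (a k + τ k • c k i) (τ k * ρ k), x ∈ O k := fun i x hx ↦ by
      have h1 := hc k i (hmap i x hx)
      rw [mem_closedBall_zero_iff, norm_smul, norm_inv, Real.norm_of_nonneg (hτ0 k).le,
        inv_mul_le_iff₀ (hτ0 k)] at h1
      rw [mem_ball_iff_norm]
      linarith [hτ0 k]
    refine ⟨Q k, fun i ↦ a k + τ k • c k i, τ k * ρ k, mul_pos (hτ0 k) (hρ k), ?_, fun i j hij ↦ ?_,
      fun i x hx ↦ ha k (hin i x hx), fun i x hx ↦ ?_⟩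
    · rw [Real.mul_rpow (hτ0 k).le (hρ k).le, mul_left_comm, hQ]
      exact mul_div_cancel₀ _ (Real.rpow_pos_of_pos (hτ0 k) σ).ne'
    · exact disjoint_left.2 fun x hx hx' ↦ disjoint_left.1 (hd k hij) (hmap i x hx) (hmap j x hx')
    · have h2 : (τ k)⁻¹ • (a k + τ k • c k i + (τ k * ρ k) • x - a k) = c k i + ρ k • x := by
        rw [mul_smul, add_assoc, add_sub_cancel_left, ← smul_add, smul_smul,
          inv_mul_cancel₀ (hτ0 k).ne', one_smul]
      rw [glue_of_mem had _ _ (j := k)]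
      · simp only [V, h2, U]
        rw [glue_of_mem ho₁ _ _ (j := ()), hWv k i x hx]
        have h3 := hc k i (hs i x hx)
        rw [mem_closedBall_zero_iff] at h3
        rw [mem_ball_zero_iff]
        linarith
      · refine hin i _ ?_
        rw [mem_ball_iff_norm, add_sub_cancel_left, norm_smul,
          Real.norm_of_nonneg (mul_pos (hτ0 k) (hρ k)).le]
        rw [mem_ball_zero_iff] at hx
        nlinarith [mul_pos (hτ0 k) (hρ k)]

end IsGluableEnergy

end Concentration

/-! ### The two gluable energies -/

section GluableEnergies

open scoped NNReal

variable {m n : ℕ} {N : Type*} [EMetricSpace N] [ChartedSpace (EuclideanSpace ℝ (Fin n)) N]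
  [IsManifold (𝓡 n) ∞ N] [RiemannianBundle (fun y : N ↦ TangentSpace (𝓡 n) y)]
  [IsContMDiffRiemannianBundle (𝓡 n) ∞ (EuclideanSpace ℝ (Fin n))
    (fun y : N ↦ TangentSpace (𝓡 n) y)] [IsRiemannianManifold (𝓡 n) N]
  [MeasurableSpace N] [BorelSpace N] [SecondCountableTopology N]

omit [IsManifold (𝓡 n) ∞ N] [IsContMDiffRiemannianBundle (𝓡 n) ∞ (EuclideanSpace ℝ (Fin n))
    (fun y : N ↦ TangentSpace (𝓡 n) y)] [IsRiemannianManifold (𝓡 n) N]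
  [MeasurableSpace N] [BorelSpace N] [SecondCountableTopology N] in
theorem bddDirichletEnergy_const {p : ℝ} (hp : 0 < p) (b : N) :
    bddDirichletEnergy (m := m) (n := n) p (fun _ ↦ b) = 0 := by
  have h : HasBddWeakMFDerivOn (m := m) (n := n) univ (fun _ ↦ b) fun _ ↦ 0 :=
    hasBddWeakMFDerivOn_of_eq_const isOpen_univ (fun _ _ ↦ rfl) fun _ _ ↦ rfl
  refine le_antisymm (h.bddDirichletEnergy_le.trans_eq ?_) zero_le
  simp [hp]

/-- Nearly optimal differentials, with errors that sum up to ε over the countable family, are glued.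
-/
theorem bddDirichletEnergy_glue_le {ι : Type*} [Countable ι] {p : ℝ} (hp : 1 ≤ p)
    {O A : ι → Set (EuclideanSpace ℝ (Fin m))} (hO : Pairwise (Function.onFun Disjoint O))
    (hOo : ∀ j, IsOpen (O j)) (hA : ∀ j, IsClosed (A j)) (hAO : ∀ j, A j ⊆ O j)
    {Γ : EuclideanSpace ℝ (Fin m) → N} {V : ι → EuclideanSpace ℝ (Fin m) → N} {b : ι → N}
    (hΓ : Measurable Γ) (hV : ∀ j, Measurable (V j)) (hΓb : ∀ j, ∀ x ∈ O j, Γ x = b j)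
    (hVb : ∀ j, ∀ x ∉ A j, V j x = b j) :
    bddDirichletEnergy (n := n) p (glue O V Γ) ≤
      bddDirichletEnergy (n := n) p Γ + ∑' j, bddDirichletEnergy (n := n) p (V j) := by
  refine ENNReal.le_of_forall_pos_le_add fun ε hε hfin ↦ ?_
  have hΓt : bddDirichletEnergy (n := n) p Γ ≠ ⊤ := (lt_of_le_of_lt le_self_add hfin).ne
  have hSt : ∑' j, bddDirichletEnergy (n := n) p (V j) ≠ ⊤ :=
    (lt_of_le_of_lt le_add_self hfin).ne
  have hε2 : (ε / 2 : ℝ≥0) ≠ 0 := by positivity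
  obtain ⟨ε', hε', hε's⟩ := ENNReal.exists_pos_sum_of_countable
    (ENNReal.coe_ne_zero.2 hε2) ι
  obtain ⟨DΓ, hDΓ, hDΓp⟩ := exists_hasBddWeakMFDerivOn_of_lt
    (ENNReal.lt_add_right hΓt (ENNReal.coe_ne_zero.2 hε2))
  choose D hD hDp using fun j ↦ exists_hasBddWeakMFDerivOn_of_lt (ENNReal.lt_add_right
    (ENNReal.ne_top_of_tsum_ne_top hSt j) (ENNReal.coe_ne_zero.2 (hε' j).ne'))
  have hle : (∫⁻ x, tangentMapENorm (Γ x) (DΓ x) ^ p) +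
      ∑' j, ∫⁻ x, tangentMapENorm (V j x) (D j x) ^ p ≤
      bddDirichletEnergy (n := n) p Γ + ∑' j, bddDirichletEnergy (n := n) p (V j) + ε := by
    calc _ ≤ (bddDirichletEnergy (n := n) p Γ + (ε / 2 : ℝ≥0)) +
          ∑' j, (bddDirichletEnergy (n := n) p (V j) + ε' j) :=
          add_le_add hDΓp.le (ENNReal.tsum_le_tsum fun j ↦ (hDp j).le)
      _ ≤ (bddDirichletEnergy (n := n) p Γ + (ε / 2 : ℝ≥0)) +
          (∑' j, bddDirichletEnergy (n := n) p (V j) + (ε / 2 : ℝ≥0)) := by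
          rw [ENNReal.tsum_add]
          gcongr
      _ = _ := by
          rw [add_add_add_comm, ← ENNReal.coe_add, add_halves]
  obtain ⟨D', hD', hD'p⟩ := HasBddWeakMFDerivOn.glue hp hO hOo hA hAO hΓ hV hΓb hVb hDΓ hD
    (ne_top_of_le_ne_top (ENNReal.add_lt_top.2 ⟨hfin, ENNReal.coe_lt_top⟩).ne hle)
  exact hD'.bddDirichletEnergy_le.trans (hD'p.trans hle)

theorem isGluableEnergy_bddDirichletEnergy [ConnectedSpace N] {p : ℝ} (hp : 1 ≤ p) :
    IsGluableEnergy m (m - p) 1 (bddDirichletEnergy (m := m) (n := n) (N := N) p) where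
  const b := bddDirichletEnergy_const (by linarith) b
  scale u c ρ hρ := by
    rw [neg_sub]
    exact bddDirichletEnergy_comp_add_smul_le (by linarith) u c hρ
  transition b b' := by
    obtain ⟨Γ, h1, h2, h3, h4⟩ := exists_transition_bddDirichletEnergy_lt_top (m := m) (n := n)
      (by linarith : 0 < p) b b'
    exact ⟨Γ, h1.measurable, h2, h3, h4⟩
  glue_le ι _ c ρ Γ V b hρ hd hΓ hV hΓb hVb := by
    rw [ENNReal.coe_one, one_mul]
    exact bddDirichletEnergy_glue_le hp hd (fun _ ↦ Metric.isOpen_ball)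
      (fun _ ↦ Metric.isClosed_closedBall) (fun j ↦ Metric.closedBall_subset_ball
        (by linarith [hρ j])) hΓ hV hΓb hVb

omit [MeasurableSpace N] [BorelSpace N] [SecondCountableTopology N] in
theorem gagliardoEnergy_const {X : Type*} [EMetricSpace X] [MeasurableSpace X] [BorelSpace X]
    {s p : ℝ} (hp : 0 < p) (A : Set X) (b : N) : gagliardoEnergy m s p A (fun _ ↦ b) = 0 := by
  simp [gagliardoEnergy, hp]

theorem isGluableEnergy_gagliardoEnergy (n : ℕ) [ChartedSpace (EuclideanSpace ℝ (Fin n)) N]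
  [IsManifold (𝓡 n) ∞ N] [RiemannianBundle (fun y : N ↦ TangentSpace (𝓡 n) y)]
  [IsContMDiffRiemannianBundle (𝓡 n) ∞ (EuclideanSpace ℝ (Fin n))
    (fun y : N ↦ TangentSpace (𝓡 n) y)] [IsRiemannianManifold (𝓡 n) N] [ConnectedSpace N] (hm : 0 < m) {s p : ℝ} (hs : 0 < s)
    (hs1 : s < 1) (hp : 1 ≤ p) : IsGluableEnergy m (m - s * p) (3 ^ p : ℝ≥0)
      (gagliardoEnergy (M := EuclideanSpace ℝ (Fin m)) (N := N) m s p univ) where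
  const b := gagliardoEnergy_const (by linarith) univ b
  scale u c ρ hρ := by
    rw [neg_sub]
    exact (gagliardoEnergy_comp_add_smul (by positivity) univ u c hρ).le
  transition b b' := by
    obtain ⟨Γ, C, -, h2, h3, -, -, h4⟩ := exists_contMDiff_transition (n := n) m b b'
    exact ⟨Γ, h4.continuous.measurable, h2, h3,
      h4.gagliardoEnergy_univ_lt_top hm hs hs1 (by linarith) zero_le_two h3⟩
  glue_le ι _ c ρ Γ V b hρ hd hΓ hV hΓb hVb := by
    refine (gagliardoEnergy_glue_le (by linarith) hd (fun j ↦ Metric.closedBall_subset_ball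
        (by linarith [hρ j])) hΓ hV hΓb hVb).trans_eq ?_
    rw [ENNReal.coe_rpow_of_nonneg _ (by linarith), ENNReal.coe_ofNat]

variable {M : Type*} [EMetricSpace M] [MeasurableSpace M] [BorelSpace M]
  [ChartedSpace (EuclideanSpace ℝ (Fin m)) M] [IsManifold (𝓡 m) ∞ M]
  [RiemannianBundle (fun x : M ↦ TangentSpace (𝓡 m) x)]
  [IsContMDiffRiemannianBundle (𝓡 m) ∞ (EuclideanSpace ℝ (Fin m))
    (fun x : M ↦ TangentSpace (𝓡 m) x)] [IsRiemannianManifold (𝓡 m) M]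

/-- A gluable energy on `ℝ^m` that is bounded by the energy `E_{s,p}` on the unit ball for suitable
extensions, and that bounds the energy of maps transplanted to a manifold. -/
theorem exists_isGluableEnergy [ConnectedSpace N] (hm : 0 < m) (hM : CompactSpace M ∨
      ∃ Φ : M ≃ₘ⟮𝓡 m, 𝓡 m⟯ EuclideanSpace ℝ (Fin m), Isometry Φ)
    {s p : ℝ} (hs : 0 < s) (hs1 : s ≤ 1) (hp : 1 ≤ p)
    {e : OpenPartialHomeomorph M (EuclideanSpace ℝ (Fin m))}
    (he : e ∈ atlas (EuclideanSpace ℝ (Fin m)) M) {c₀ : EuclideanSpace ℝ (Fin m)} {δ : ℝ}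
    (hδ : 0 < δ) (hT : Metric.closedBall c₀ δ ⊆ e.target) {K : ℝ≥0} (hK0 : 0 < K)
    (hK : ∀ y ∈ Metric.closedBall c₀ δ, ∀ z ∈ Metric.closedBall c₀ δ,
      edist (e.symm y) (e.symm z) ≤ K * edist y z ∧ edist y z ≤ K * edist (e.symm y) (e.symm z))
    (hKD : ∀ y ∈ Metric.closedBall c₀ δ, ∀ v : EuclideanSpace ℝ (Fin m),
      ‖mfderivModel m m e (e.symm y) v‖ₑ ≤ K * tangentENorm (e.symm y) v) :
    ∃ (G C : ℝ≥0) (F : (EuclideanSpace ℝ (Fin m) → N) → ENNReal),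
      IsGluableEnergy m (m - s * p) G F ∧
      (∀ (l : ℝ) (u : EuclideanSpace ℝ (Fin m) → N) (c : ENNReal), 1 / 2 ≤ l → l < 1 →
        Measurable u → c ≠ ⊤ → sobolevEnergy m n s p (Metric.ball 0 1) u < c →
        ∃ (v : EuclideanSpace ℝ (Fin m) → N) (b : N), Measurable v ∧
          (∀ x ∈ Metric.ball 0 1, v x = u (l • x)) ∧
          (∀ x ∉ Metric.closedBall (0 : EuclideanSpace ℝ (Fin m)) 3, v x = b) ∧ F v ≤ C * c) ∧
      ∀ (V : EuclideanSpace ℝ (Fin m) → N) (b : N), Measurable V →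
        (∀ x ∉ Metric.closedBall c₀ (δ / 2), V x = b) → F V < ⊤ →
        sobolevEnergy m n s p univ (transplant e b V) < ⊤ := by
  rcases hs1.lt_or_eq with hs1 | rfl
  · obtain ⟨C, hC⟩ := exists_opening_gagliardoEnergy_le (N := N) hm hs hp
    refine ⟨_, C, _, isGluableEnergy_gagliardoEnergy n hm hs hs1 hp, ?_, ?_⟩
    · simpa only [sobolevEnergy, hs1.ne, if_false] using hC
    · intro V b hV hVb hVE
      simp only [sobolevEnergy, hs1.ne, if_false]
      exact gagliardoEnergy_transplant_lt_top hm hM hs (by linarith) (half_pos hδ).le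
        (half_lt_self hδ) hT hK0 hK hV hVb hVE
  · obtain ⟨C, hC⟩ := exists_opening_bddDirichletEnergy_le (m := m) (n := n) (N := N) hp
    refine ⟨_, C, _, by rw [one_mul]; exact isGluableEnergy_bddDirichletEnergy (n := n) hp, ?_, ?_⟩
    · simpa only [sobolevEnergy, if_true] using hC
    · intro V b hV hVb hVE
      simp only [sobolevEnergy, if_true]
      exact dirichletEnergy_transplant_lt_top hm hp he hδ hT (fun y hy z hz ↦ (hK y hy z hz).1) hKD
        hV (fun y hy ↦ hVb y fun h ↦ hy (Metric.closedBall_subset_closedBall (by linarith) h)) hVE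

end GluableEnergies

/-! ### From the manifold back to balls of a chart -/

section Localization

open scoped NNReal

theorem MeasureTheory.sum_setLIntegral_le {X ι : Type*} [MeasurableSpace X] [Fintype ι]
    {μ : Measure X} {B : ι → Set X} (hB : ∀ i, MeasurableSet (B i))
    (hd : Pairwise (Function.onFun Disjoint B)) {A : Set X} (hA : ∀ i, B i ⊆ A) (f : X → ENNReal) :
    ∑ i, ∫⁻ x in B i, f x ∂μ ≤ ∫⁻ x in A, f x ∂μ := by
  rw [← tsum_fintype (L := .unconditional _), ← lintegral_iUnion hB hd]
  exact lintegral_mono_set (iUnion_subset hA)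

variable {m : ℕ} {M : Type*} [EMetricSpace M] [MeasurableSpace M] [BorelSpace M]

theorem lintegral_comp_chart_symm_le
    {e : OpenPartialHomeomorph M (EuclideanSpace ℝ (Fin m))} {A : Set (EuclideanSpace ℝ (Fin m))}
    (hA : IsCompact A) (hT : A ⊆ e.target) {K : ℝ≥0}
    (hK : ∀ y ∈ A, ∀ z ∈ A, edist y z ≤ K * edist (e.symm y) (e.symm z)) (G : M → ENNReal) :
    ∫⁻ y in A, G (e.symm y) ≤ (K ^ m : ℝ≥0) * ∫⁻ x in e.symm '' A, G x ∂μHE[m] := by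
  classical
  have hF : IsClosed (e.symm '' A) :=
    (hA.image_of_continuousOn (e.symm.continuousOn.mono hT)).isClosed
  have hFs : e.symm '' A ⊆ e.source := by
    rintro x ⟨y, hy, rfl⟩
    exact e.map_target (hT hy)
  rcases A.eq_empty_or_nonempty with rfl | ⟨y₀, -⟩
  · simp
  -- `G` is arbitrary: it will be an energy density whose measurability is unknown. A measurable
  -- minorant with the same integral is transported instead.
  obtain ⟨g, hg, hgG, hgi⟩ := exists_measurable_le_lintegral_eq (volume.restrict A)
    (fun y ↦ G (e.symm y))
  rw [hgi]
  have hs : Measurable (A.piecewise e.symm fun _ ↦ e.symm y₀) :=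
    (e.symm.continuousOn.mono hT).measurable_piecewise continuousOn_const hA.measurableSet
  have hge : Measurable ((e.symm '' A).indicator fun x ↦ g (e x)) := by
    have h1 : Measurable ((e.symm '' A).piecewise e fun _ ↦ 0) :=
      (e.continuousOn.mono hFs).measurable_piecewise continuousOn_const hF.measurableSet
    have h2 : (e.symm '' A).indicator (fun x ↦ g (e x)) =
        (e.symm '' A).indicator (fun x ↦ g ((e.symm '' A).piecewise e (fun _ ↦ 0) x)) :=
      indicator_congr fun x hx ↦ by rw [piecewise_eq_of_mem _ _ _ hx]
    rw [h2]
    exact (hg.comp h1).indicator hF.measurableSet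
  have h1 := lintegral_comp_le_of_measure_preimage_le (μ := volume.restrict A)
    (ν := (μHE[m] : Measure M)) hs (C := K ^ m) (fun S hS ↦ ?_) hge.aemeasurable
  · refine le_trans (le_of_eq (setLIntegral_congr_fun hA.measurableSet fun y hy ↦ ?_))
      (h1.trans (mul_le_mul_right ?_ _))
    · change g y = (e.symm '' A).indicator (fun x ↦ g (e x)) (A.piecewise e.symm (fun _ ↦ e.symm y₀) y)
      rw [piecewise_eq_of_mem _ _ _ hy, indicator_of_mem (mem_image_of_mem e.symm hy),
        e.right_inv (hT hy)]
    · rw [lintegral_indicator hF.measurableSet]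
      refine setLIntegral_mono' hF.measurableSet fun x hx ↦ (hgG _).trans_eq ?_
      exact congrArg G (e.left_inv (hFs hx))
  · rw [Measure.restrict_apply (hs hS), ← EuclideanSpace.euclideanHausdorffMeasure_eq_volume]
    refine euclideanHausdorffMeasure_preimage_inter_le (fun x hx y hy ↦ ?_) m S
    rw [piecewise_eq_of_mem _ _ _ hx, piecewise_eq_of_mem _ _ _ hy]
    exact hK _ hx _ hy

theorem preimage_add_smul_ball_one (c : EuclideanSpace ℝ (Fin m)) {ρ : ℝ} (hρ : 0 < ρ) :
    (fun x : EuclideanSpace ℝ (Fin m) ↦ c + ρ • x) ⁻¹' Metric.ball c ρ = Metric.ball 0 1 := by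
  have := preimage_add_smul_ball c 0 hρ 1
  rwa [smul_zero, add_zero, mul_one] at this

section Gagliardo

variable {N : Type*} [EMetricSpace N]

/-- The weight ρ^(m - s p) undoes the scaling, so each term is an energy on one of the disjoint
balls, and the sum is at most the energy on `A` of `W` read in the chart. The chart costs powers of
`K`. -/
theorem sum_gagliardoEnergy_chart_le {s p : ℝ} (hsp : 0 ≤ s * p)
    {e : OpenPartialHomeomorph M (EuclideanSpace ℝ (Fin m))} {A : Set (EuclideanSpace ℝ (Fin m))}
    (hA : IsCompact A) (hT : A ⊆ e.target) {K : ℝ≥0} (hK0 : 0 < K)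
    (hK : ∀ y ∈ A, ∀ z ∈ A, edist (e.symm y) (e.symm z) ≤ K * edist y z ∧
      edist y z ≤ K * edist (e.symm y) (e.symm z))
    (W : M → N) {ι : Type*} [Fintype ι] {c : ι → EuclideanSpace ℝ (Fin m)} {ρ : ℝ} (hρ : 0 < ρ)
    (hd : Pairwise (Function.onFun Disjoint fun i ↦ Metric.ball (c i) ρ))
    (hc : ∀ i, Metric.ball (c i) ρ ⊆ A) :
    ∑ i, ENNReal.ofReal (ρ ^ (m - s * p)) *
      gagliardoEnergy m s p (Metric.ball 0 1) (fun x ↦ W (e.symm (c i + ρ • x))) ≤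
      ((K : ENNReal) ^ (m + s * p) * ((K ^ m : ℝ≥0) * (K ^ m : ℝ≥0))) *
        gagliardoEnergy m s p univ W := by
  set α := (m : ℝ) + s * p
  have hα : 0 ≤ α := by positivity
  have hKα : (K : ENNReal) ^ α ≠ ⊤ := ENNReal.rpow_ne_top_of_nonneg hα ENNReal.coe_ne_top
  set k : M → M → ENNReal := fun x y ↦ edist (W x) (W y) ^ p / edist x y ^ α
  have h1 : ∀ i, ENNReal.ofReal (ρ ^ (m - s * p)) *
      gagliardoEnergy m s p (Metric.ball 0 1) (fun x ↦ W (e.symm (c i + ρ • x))) =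
      ∫⁻ x in Metric.ball (c i) ρ, ∫⁻ y in Metric.ball (c i) ρ,
        edist (W (e.symm x)) (W (e.symm y)) ^ p / edist x y ^ α := fun i ↦ by
    have h2 := gagliardoEnergy_comp_add_smul hsp (Metric.ball (c i) ρ) (fun y ↦ W (e.symm y)) (c i) hρ
    rw [preimage_add_smul_ball_one (c i) hρ] at h2
    rw [h2, ← mul_assoc, ← ENNReal.ofReal_mul (by positivity), ← Real.rpow_add hρ,
      sub_add_sub_cancel, sub_self, Real.rpow_zero, ENNReal.ofReal_one, one_mul, gagliardoEnergy_eq]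
  simp only [h1]
  calc _ ≤ ∑ i, ∫⁻ x in Metric.ball (c i) ρ, ∫⁻ y in A,
        edist (W (e.symm x)) (W (e.symm y)) ^ p / edist x y ^ α :=
        Finset.sum_le_sum fun i _ ↦ lintegral_mono fun x ↦ lintegral_mono_set (hc i)
    _ ≤ ∫⁻ x in A, ∫⁻ y in A, edist (W (e.symm x)) (W (e.symm y)) ^ p / edist x y ^ α :=
        sum_setLIntegral_le (fun i ↦ Metric.isOpen_ball.measurableSet) hd hc _
    _ ≤ ∫⁻ x in A, (K : ENNReal) ^ α * ((K ^ m : ℝ≥0) * ∫⁻ y, k (e.symm x) y ∂μHE[m]) := by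
        refine setLIntegral_mono' hA.measurableSet fun x hx ↦ ?_
        calc _ ≤ ∫⁻ y in A, (K : ENNReal) ^ α * k (e.symm x) (e.symm y) := by
              refine setLIntegral_mono' hA.measurableSet fun y hy ↦ ?_
              simp only [k, div_eq_mul_inv]
              rw [mul_left_comm]
              gcongr
              exact ENNReal.rpow_inv_le_of_le_mul hα hK0 (hK x hx y hy).1
          _ ≤ _ := by
              rw [lintegral_const_mul' _ _ hKα]
              gcongr
              exact (lintegral_comp_chart_symm_le hA hT (fun y hy z hz ↦ (hK y hy z hz).2)
                (fun y ↦ k (e.symm x) y)).trans (by gcongr; exact Measure.restrict_le_self)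
    _ = (K : ENNReal) ^ α * ((K ^ m : ℝ≥0) * ∫⁻ x in A, ∫⁻ y, k (e.symm x) y ∂μHE[m]) := by
        rw [lintegral_const_mul' _ _ hKα, lintegral_const_mul' _ _ ENNReal.coe_ne_top]
    _ ≤ (K : ENNReal) ^ α * ((K ^ m : ℝ≥0) * ((K ^ m : ℝ≥0) *
          ∫⁻ x, ∫⁻ y, k x y ∂μHE[m] ∂μHE[m])) := by
        gcongr
        exact (lintegral_comp_chart_symm_le hA hT (fun y hy z hz ↦ (hK y hy z hz).2)
          (fun x ↦ ∫⁻ y, k x y ∂μHE[m])).trans (by gcongr; exact Measure.restrict_le_self)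
    _ = _ := by
        rw [gagliardoEnergy, Measure.restrict_univ]
        ring

end Gagliardo

section Dirichlet

variable [ChartedSpace (EuclideanSpace ℝ (Fin m)) M]

variable {n : ℕ} {N : Type*} [EMetricSpace N] [ChartedSpace (EuclideanSpace ℝ (Fin n)) N]

omit [MeasurableSpace M] [BorelSpace M] in
theorem HasWeakMFDerivOn.comp_chart_symm_add_smul {W : M → N}
    {D : M → EuclideanSpace ℝ (Fin m) →L[ℝ] EuclideanSpace ℝ (Fin n)}
    (hD : HasWeakMFDerivOn univ W fun x ↦ D x)
    {e : OpenPartialHomeomorph M (EuclideanSpace ℝ (Fin m))}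
    (he : e ∈ atlas (EuclideanSpace ℝ (Fin m)) M) {c : EuclideanSpace ℝ (Fin m)} {ρ : ℝ} (hρ : 0 < ρ)
    (hT : Metric.ball c ρ ⊆ e.target) :
    HasWeakMFDerivOn (Metric.ball 0 1) (fun x ↦ W (e.symm (c + ρ • x)))
      (fun x ↦ (ρ • (D (e.symm (c + ρ • x))).comp (mfderivModel m m e.symm (c + ρ • x)) :
        EuclideanSpace ℝ (Fin m) →L[ℝ] EuclideanSpace ℝ (Fin n))) := by
  intro f hf hfl e' he'
  obtain rfl := chartedSpaceSelf_atlas.1 he'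
  have h2 : ∀ y, mfderiv (𝓡 m) (𝓡 m) (OpenPartialHomeomorph.refl (EuclideanSpace ℝ (Fin m))).symm y =
    ContinuousLinearMap.id ℝ _ := fun y ↦ mfderiv_id
  have h3 : (OpenPartialHomeomorph.refl (EuclideanSpace ℝ (Fin m))).target ∩
      (OpenPartialHomeomorph.refl (EuclideanSpace ℝ (Fin m))).symm ⁻¹' Metric.ball 0 1 =
      Metric.ball 0 1 := univ_inter _
  simp only [h2]
  rw [h3]
  have h1 := hD f hf hfl e he
  rw [preimage_univ, inter_univ] at h1
  have h4 := h1.comp e.open_target (φ := fun x ↦ c + ρ • x) (U' := Metric.ball 0 1)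
    (fun x hx ↦ hT (by rwa [← preimage_add_smul_ball_one c hρ] at hx)) fun x _ ↦
    ⟨univ, univ_mem, ρ.toNNReal, (ρ ^ (-m : ℝ)).toNNReal, ?_, fun S ↦ ?_⟩
  · refine h4.congr_ae Metric.isOpen_ball (ae_of_all _ fun _ ↦ rfl) (ae_of_all _ fun x ↦ ?_)
    have h5 : fderiv ℝ (fun x : EuclideanSpace ℝ (Fin m) ↦ c + ρ • x) x =
        ρ • ContinuousLinearMap.id ℝ _ := by
      rw [fderiv_const_add, fderiv_fun_const_smul differentiableAt_fun_id, fderiv_fun_id]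
    have h6 : ∀ (F : EuclideanSpace ℝ (Fin n) →L[ℝ] ℝ)
        (L : EuclideanSpace ℝ (Fin m) →L[ℝ] EuclideanSpace ℝ (Fin n))
        (T : EuclideanSpace ℝ (Fin m) →L[ℝ] EuclideanSpace ℝ (Fin m)),
        (F.comp (L.comp T)).comp (ρ • ContinuousLinearMap.id ℝ _) =
          F.comp ((ρ • L.comp T).comp (ContinuousLinearMap.id ℝ _)) := fun F L T ↦ by
      ext
      simp
    simp only [h5]
    exact h6 (mfderivReal n f _) _ (mfderivModel m m e.symm _)
  · refine LipschitzWith.lipschitzOnWith (.of_dist_le_mul fun x y ↦ ?_)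
    rw [dist_add_left, dist_smul₀, Real.norm_of_nonneg hρ.le, Real.coe_toNNReal _ hρ.le]
  · rw [inter_univ, ← (measurableEmbedding_add_smul c hρ).map_apply, map_add_smul_volume c hρ]
    rfl

variable [RiemannianBundle (fun x : M ↦ TangentSpace (𝓡 m) x)]
  [RiemannianBundle (fun y : N ↦ TangentSpace (𝓡 n) y)]

omit [MeasurableSpace M] [BorelSpace M] in
theorem hilbertSchmidtENorm_smul_comp_le (x : EuclideanSpace ℝ (Fin m)) (z : M) (y : N)
    (L : EuclideanSpace ℝ (Fin m) →L[ℝ] EuclideanSpace ℝ (Fin n))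
    (T : EuclideanSpace ℝ (Fin m) →L[ℝ] EuclideanSpace ℝ (Fin m)) {ρ : ℝ} (hρ : 0 ≤ ρ) {K : ℝ≥0}
    (hT : ∀ v, tangentENorm z (T v) ≤ K * ‖v‖ₑ) :
    hilbertSchmidtENorm (V := TangentSpace (𝓡 m) x) (W := TangentSpace (𝓡 n) y)
      (ρ • L.comp T : EuclideanSpace ℝ (Fin m) →L[ℝ] EuclideanSpace ℝ (Fin n)) ≤
      ENNReal.ofReal ρ * (m * m * K) *
        hilbertSchmidtENorm (V := TangentSpace (𝓡 m) z) (W := TangentSpace (𝓡 n) y) L := by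
  have h1 := tangentENorm_apply_le_hilbertSchmidtENorm z y L
  generalize hilbertSchmidtENorm (V := TangentSpace (𝓡 m) z) (W := TangentSpace (𝓡 n) y) L = h at h1 ⊢
  refine (hilbertSchmidtENorm_tangent_le x y _ (c := ENNReal.ofReal ρ * (m * h * K))
    fun v ↦ ?_).trans_eq (by ring)
  rw [_root_.smul_apply, tangentENorm_smul, Real.enorm_eq_ofReal hρ, tangentENorm_euclideanSpace,
    mul_assoc, mul_assoc ((m : ENNReal) * h)]
  gcongr
  exact (h1 _).trans (mul_le_mul_right (hT v) _)

/-- A single weak differential of `W` serves for all the balls at once, so the infimum over it is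
taken last. The powers of ρ cancel: ρ^(m - p) is the weight, ρ^p comes from the differential and
ρ^(-m) from the volume. -/
theorem sum_dirichletEnergy_chart_le (hm : 0 < m) {p : ℝ} (hp : 1 ≤ p)
    {e : OpenPartialHomeomorph M (EuclideanSpace ℝ (Fin m))}
    (he : e ∈ atlas (EuclideanSpace ℝ (Fin m)) M) {A : Set (EuclideanSpace ℝ (Fin m))}
    (hA : IsCompact A) (hT : A ⊆ e.target) {K : ℝ≥0} (hK0 : 0 < K)
    (hK : ∀ y ∈ A, ∀ z ∈ A, edist y z ≤ K * edist (e.symm y) (e.symm z))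
    (hKD : ∀ y ∈ A, ∀ v : EuclideanSpace ℝ (Fin m),
      tangentENorm (e.symm y) (mfderivModel m m e.symm y v) ≤ K * ‖v‖ₑ)
    (W : M → N) {ι : Type*} [Fintype ι] {c : ι → EuclideanSpace ℝ (Fin m)} {ρ : ℝ} (hρ : 0 < ρ)
    (hd : Pairwise (Function.onFun Disjoint fun i ↦ Metric.ball (c i) ρ))
    (hc : ∀ i, Metric.ball (c i) ρ ⊆ A) :
    ∑ i, ENNReal.ofReal (ρ ^ (m - p)) *
      dirichletEnergy (m := m) (n := n) p (Metric.ball 0 1) (fun x ↦ W (e.symm (c i + ρ • x))) ≤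
      ((m * m * K : ENNReal) ^ p * (K ^ m : ℝ≥0)) * dirichletEnergy (m := m) (n := n) p univ W := by
  have hp0 : 0 < p := by linarith
  have hC : (m * m * K : ENNReal) ^ p ≠ ⊤ := ENNReal.rpow_ne_top_of_nonneg hp0.le (by finiteness)
  have hC0 : ((m * m * K : ENNReal) ^ p * (K ^ m : ℝ≥0)) ≠ 0 := by
    simp [ENNReal.rpow_eq_zero_iff, hm.ne', hK0.ne', hp0, hp0.le]
  conv_rhs => rw [dirichletEnergy]
  rw [ENNReal.mul_iInf_of_ne hC0 (ENNReal.mul_ne_top hC ENNReal.coe_ne_top)]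
  refine le_iInf fun D ↦ ?_
  rw [ENNReal.mul_iInf_of_ne hC0 (ENNReal.mul_ne_top hC ENNReal.coe_ne_top)]
  refine le_iInf fun hD ↦ ?_
  set D₀ : M → EuclideanSpace ℝ (Fin m) →L[ℝ] EuclideanSpace ℝ (Fin n) := D
  set g : M → ENNReal := fun x ↦ hilbertSchmidtENorm (D x) ^ p
  have h1 : ∀ i, ENNReal.ofReal (ρ ^ (m - p)) *
      dirichletEnergy (m := m) (n := n) p (Metric.ball 0 1) (fun x ↦ W (e.symm (c i + ρ • x))) ≤
      (m * m * K : ENNReal) ^ p * ∫⁻ y in Metric.ball (c i) ρ, g (e.symm y) := fun i ↦ by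
    have hpt : ∀ x ∈ Metric.ball (0 : EuclideanSpace ℝ (Fin m)) 1,
        hilbertSchmidtENorm (V := TangentSpace (𝓡 m) x)
          (W := TangentSpace (𝓡 n) (W (e.symm (c i + ρ • x))))
          (ρ • (D₀ (e.symm (c i + ρ • x))).comp (mfderivModel m m e.symm (c i + ρ • x)) :
              EuclideanSpace ℝ (Fin m) →L[ℝ] EuclideanSpace ℝ (Fin n)) ^ p ≤
          (ENNReal.ofReal (ρ ^ p) * (m * m * K : ENNReal) ^ p) * g (e.symm (c i + ρ • x)) := by
      intro x hx
      rw [← preimage_add_smul_ball_one (c i) hρ] at hx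
      simp only [g]
      rw [← ENNReal.ofReal_rpow_of_pos hρ, ← ENNReal.mul_rpow_of_nonneg _ _ hp0.le,
        ← ENNReal.mul_rpow_of_nonneg _ _ hp0.le]
      exact ENNReal.rpow_le_rpow (hilbertSchmidtENorm_smul_comp_le x (e.symm (c i + ρ • x)) _ _ _ hρ.le
        (hKD _ (hc i hx))) hp0.le
    have h2 : dirichletEnergy (m := m) (n := n) p (Metric.ball 0 1)
        (fun x ↦ W (e.symm (c i + ρ • x))) ≤ (ENNReal.ofReal (ρ ^ p) * (m * m * K : ENNReal) ^ p) *
          (ENNReal.ofReal (ρ ^ (-m : ℝ)) * ∫⁻ y in Metric.ball (c i) ρ, g (e.symm y)) := by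
      refine (iInf₂_le _ (HasWeakMFDerivOn.comp_chart_symm_add_smul (D := D₀) hD he hρ ((hc i).trans hT))).trans ?_
      rw [EuclideanSpace.euclideanHausdorffMeasure_eq_volume]
      refine (setLIntegral_mono' Metric.isOpen_ball.measurableSet hpt).trans_eq ?_
      rw [lintegral_const_mul' _ _ (ENNReal.mul_ne_top ENNReal.ofReal_ne_top hC),
        ← setLIntegral_comp_add_smul (c i) hρ (A := Metric.ball (c i) ρ) (fun y ↦ g (e.symm y)),
        preimage_add_smul_ball_one (c i) hρ]
    refine (mul_le_mul_right h2 _).trans_eq ?_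
    calc _ = (ENNReal.ofReal (ρ ^ (m - p)) * ENNReal.ofReal (ρ ^ p) * ENNReal.ofReal (ρ ^ (-m : ℝ))) *
          ((m * m * K : ENNReal) ^ p * ∫⁻ y in Metric.ball (c i) ρ, g (e.symm y)) := by ring
      _ = _ := by
          rw [← ENNReal.ofReal_mul (by positivity), ← ENNReal.ofReal_mul (by positivity),
            ← Real.rpow_add hρ, ← Real.rpow_add hρ, sub_add_cancel, add_neg_cancel, Real.rpow_zero,
            ENNReal.ofReal_one, one_mul]
  refine (Finset.sum_le_sum fun i _ ↦ h1 i).trans ?_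
  rw [← Finset.mul_sum, mul_assoc (_ ^ p)]
  refine mul_le_mul_right ?_ _
  refine (sum_setLIntegral_le (fun i ↦ Metric.isOpen_ball.measurableSet) hd hc _).trans ?_
  refine (lintegral_comp_chart_symm_le hA hT hK g).trans ?_
  gcongr
  exact subset_univ _

/-- The rescaled energies of a map on disjoint balls of a chart are bounded by its energy. -/
theorem exists_sum_sobolevEnergy_chart_le (hm : 0 < m) {s p : ℝ} (hs : 0 < s) (hp : 1 ≤ p)
    {e : OpenPartialHomeomorph M (EuclideanSpace ℝ (Fin m))}
    (he : e ∈ atlas (EuclideanSpace ℝ (Fin m)) M) {A : Set (EuclideanSpace ℝ (Fin m))}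
    (hA : IsCompact A) (hT : A ⊆ e.target) {K : ℝ≥0} (hK0 : 0 < K)
    (hK : ∀ y ∈ A, ∀ z ∈ A, edist (e.symm y) (e.symm z) ≤ K * edist y z ∧
      edist y z ≤ K * edist (e.symm y) (e.symm z))
    (hKD : ∀ y ∈ A, ∀ v : EuclideanSpace ℝ (Fin m),
      tangentENorm (e.symm y) (mfderivModel m m e.symm y v) ≤ K * ‖v‖ₑ) :
    ∃ C : ENNReal, C ≠ ⊤ ∧ ∀ (W : M → N) (ι : Type) [Fintype ι] (c : ι → EuclideanSpace ℝ (Fin m))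
      (ρ : ℝ), 0 < ρ → Pairwise (Function.onFun Disjoint fun i ↦ Metric.ball (c i) ρ) →
      (∀ i, Metric.ball (c i) ρ ⊆ A) →
      ∑ i, ENNReal.ofReal (ρ ^ (m - s * p)) *
        sobolevEnergy m n s p (Metric.ball 0 1) (fun x ↦ W (e.symm (c i + ρ • x))) ≤
        C * sobolevEnergy m n s p univ W := by
  have hp0 : 0 < p := by linarith
  rcases eq_or_ne s 1 with rfl | hs1
  · refine ⟨_, ENNReal.mul_ne_top (ENNReal.rpow_ne_top_of_nonneg (x := m * m * K) hp0.le
      (by finiteness)) (ENNReal.coe_ne_top (r := K ^ m)), fun W ι _ c ρ hρ hd hc ↦ ?_⟩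
    simp only [sobolevEnergy, if_true, one_mul]
    exact sum_dirichletEnergy_chart_le hm hp he hA hT hK0 (fun y hy z hz ↦ (hK y hy z hz).2) hKD W
      hρ hd hc
  · refine ⟨_, ENNReal.mul_ne_top (ENNReal.rpow_ne_top_of_nonneg (x := K) (y := m + s * p)
      (by positivity) ENNReal.coe_ne_top) (ENNReal.mul_ne_top (ENNReal.coe_ne_top (r := K ^ m))
      (ENNReal.coe_ne_top (r := K ^ m))), fun W ι _ c ρ hρ hd hc ↦ ?_⟩
    simp only [sobolevEnergy, hs1, if_false]
    exact sum_gagliardoEnergy_chart_le (by positivity) hA hT hK0 hK W hρ hd hc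

end Dirichlet

end Localization

/-! ### Lower semicontinuity of the relaxed energy -/

section RelaxedEnergy

open scoped NNReal

/-- The Kuratowski embedding followed by the homeomorphism of a normed space with its unit ball.
Almost everywhere convergence in `N` can then be handled through L¹ distances of bounded functions
on sets of finite measure. -/
theorem TopologicalSpace.exists_isInducing_norm_le_one (X : Type*) [TopologicalSpace X]
    [MetrizableSpace X] [SeparableSpace X] :
    ∃ Ψ : X → lp (fun _ : ℕ ↦ ℝ) ⊤, IsInducing Ψ ∧ ∀ x, ‖Ψ x‖ ≤ 1 := by
  let _ := metrizableSpaceMetric X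
  obtain ⟨f, hf⟩ := KuratowskiEmbedding.exists_isometric_embedding X
  refine ⟨fun x ↦ Homeomorph.unitBall (f x), IsInducing.subtypeVal.comp
    (Homeomorph.unitBall.isInducing.comp hf.isEmbedding.isInducing), fun x ↦ ?_⟩
  exact (mem_ball_zero_iff.1 (Homeomorph.unitBall (f x)).2).le

variable {m n : ℕ} {N : Type*} [EMetricSpace N] [ChartedSpace (EuclideanSpace ℝ (Fin n)) N]
  [RiemannianBundle (fun y : N ↦ TangentSpace (𝓡 n) y)]

theorem dirichletEnergy_le_of_ae_eq {p : ℝ} {A : Set (EuclideanSpace ℝ (Fin m))} (hA : IsOpen A)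
    {u u' : EuclideanSpace ℝ (Fin m) → N} (h : u =ᵐ[volume.restrict A] u') :
    dirichletEnergy (m := m) (n := n) p A u' ≤ dirichletEnergy (m := m) (n := n) p A u := by
  refine le_iInf₂ fun D hD ↦ ?_
  set D₀ : EuclideanSpace ℝ (Fin m) → EuclideanSpace ℝ (Fin m) →L[ℝ] EuclideanSpace ℝ (Fin n) := D
  have hD' : HasWeakMFDerivOn A u' fun x ↦ D₀ x := by
    intro f hf hfl e' he'
    have h1 := hD f hf hfl e' he'
    obtain rfl := chartedSpaceSelf_atlas.1 he'
    have h3 : (OpenPartialHomeomorph.refl (EuclideanSpace ℝ (Fin m))).target ∩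
        (OpenPartialHomeomorph.refl (EuclideanSpace ℝ (Fin m))).symm ⁻¹' A = A := univ_inter _
    rw [h3] at h1 ⊢
    refine h1.congr_ae hA ?_ ?_
    · filter_upwards [h] with x hx
      exact congrArg f hx
    · filter_upwards [h] with x hx
      have h4 : ∀ (T : EuclideanSpace ℝ (Fin m) →L[ℝ] EuclideanSpace ℝ (Fin n)),
        (mfderivReal n f (u x)).comp T = (mfderivReal n f (u' x)).comp T := fun T ↦ by rw [hx]
      exact h4 _
  refine (iInf₂_le _ hD').trans_eq ?_
  rw [EuclideanSpace.euclideanHausdorffMeasure_eq_volume]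
  refine lintegral_congr_ae ?_
  filter_upwards [h] with x hx
  have h4 : ∀ y y' : N, y = y' → hilbertSchmidtENorm (V := TangentSpace (𝓡 m) x)
      (W := TangentSpace (𝓡 n) y') (D₀ x) ^ p = hilbertSchmidtENorm (V := TangentSpace (𝓡 m) x)
      (W := TangentSpace (𝓡 n) y) (D₀ x) ^ p := by
    rintro y y' rfl
    rfl
  exact h4 _ _ hx

theorem sobolevEnergy_le_of_ae_eq {s p : ℝ} {A : Set (EuclideanSpace ℝ (Fin m))} (hA : IsOpen A)
    {u u' : EuclideanSpace ℝ (Fin m) → N} (h : u =ᵐ[volume.restrict A] u') :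
    sobolevEnergy m n s p A u' ≤ sobolevEnergy m n s p A u := by
  unfold sobolevEnergy
  split_ifs
  · exact dirichletEnergy_le_of_ae_eq hA h
  · rw [gagliardoEnergy_eq, gagliardoEnergy_eq]
    refine le_of_eq (lintegral_congr_ae ?_)
    filter_upwards [h] with x hx
    refine lintegral_congr_ae ?_
    filter_upwards [h] with y hy
    simp only [hx, hy]

theorem relaxedEnergy_le_of_ae_eq {s p : ℝ} {A : Set (EuclideanSpace ℝ (Fin m))}
    {u u' : EuclideanSpace ℝ (Fin m) → N} (h : u =ᵐ[volume.restrict A] u') :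
    relaxedEnergy m n s p A u' ≤ relaxedEnergy m n s p A u := by
  refine le_iInf₂ fun v hv ↦ le_iInf fun hvu ↦ iInf₂_le_of_le v hv (iInf_le_of_le ?_ le_rfl)
  rw [EuclideanSpace.euclideanHausdorffMeasure_eq_volume] at hvu ⊢
  filter_upwards [hvu, h] with x hx hx'
  rwa [← hx']

variable [MeasurableSpace N] [BorelSpace N] [SecondCountableTopology N]

/-- The relaxed energy is lower semicontinuous along contractions converging to the identity. -/
theorem exists_lt_relaxedEnergy_comp_smul {s p : ℝ} {u : EuclideanSpace ℝ (Fin m) → N}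
    (hu : Measurable u) {R : ENNReal} (hR : R < relaxedEnergy m n s p (Metric.ball 0 1) u) :
    ∃ l : ℝ, 1 / 2 ≤ l ∧ l < 1 ∧
      R < relaxedEnergy m n s p (Metric.ball 0 1) (fun x ↦ u (l • x)) := by
  -- Otherwise the relaxed energies of the contractions are at most `R`, and a diagonal choice of
  -- smooth maps converges to `u` with energies at most `R'`, a number strictly between `R` and the
  -- relaxed energy of `u`.
  by_contra! hcon
  obtain ⟨R', hRR', hR'⟩ := exists_between hR
  obtain ⟨Ψ, hΨ, hΨ1⟩ := TopologicalSpace.exists_isInducing_norm_le_one N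
  set B := Metric.ball (0 : EuclideanSpace ℝ (Fin m)) 1
  have hB : MeasurableSet B := Metric.isOpen_ball.measurableSet
  have : IsFiniteMeasure (volume.restrict B) := ⟨by simpa using measure_ball_lt_top⟩
  have hsm : ∀ {w : EuclideanSpace ℝ (Fin m) → N}, Measurable w →
      AEStronglyMeasurable (fun x ↦ Ψ (w x)) volume := fun hw ↦
    hΨ.continuous.comp_aestronglyMeasurable hw.aestronglyMeasurable
  have hbdd : ∀ a b : N, ‖Ψ a - Ψ b‖ₑ ≤ 2 := fun a b ↦ by
    refine (enorm_sub_le).trans ?_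
    rw [← one_add_one_eq_two]
    gcongr <;> rw [← ofReal_norm] <;> exact ENNReal.ofReal_le_one.2 (hΨ1 _)
  have hF : Integrable (B.indicator fun x ↦ Ψ (u x)) := by
    rw [integrable_indicator_iff hB]
    exact Integrable.of_bound (hsm hu).restrict 1 (ae_of_all _ fun x ↦ hΨ1 _)
  have key : ∀ j : ℕ, ∃ w : EuclideanSpace ℝ (Fin m) → N, ContMDiffOn (𝓡 m) (𝓡 n) ∞ w B ∧
      sobolevEnergy m n s p B w ≤ R' ∧
      ∫⁻ x in B, ‖Ψ (w x) - Ψ (u x)‖ₑ ≤ 2 * ENNReal.ofReal ((1 / 2) ^ j) := by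
    intro j
    have hj : ENNReal.ofReal ((1 / 2) ^ j) ≠ 0 := by simp
    -- As l ≥ 1/2, the image of the volume under the contraction has density l^(-m) ≤ 2^m.
    obtain ⟨δ, hδ, hδF⟩ := hF.exists_lintegral_comp_sub_le (2 ^ m) hj
    obtain ⟨l, hl, hlδ, hl1⟩ : ∃ l : ℝ, 1 / 2 ≤ l ∧ 1 - l ≤ δ ∧ l < 1 :=
      ⟨max (1 / 2) (1 - δ), le_max_left _ _, by linarith [le_max_right (1 / 2) (1 - δ)],
        max_lt (by norm_num) (by linarith)⟩
    have hl0 : 0 < l := by linarith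
    have hlB : ∀ x ∈ B, l • x ∈ B := fun x hx ↦ by
      rw [mem_ball_zero_iff] at hx ⊢
      rw [norm_smul, Real.norm_of_nonneg hl0.le]
      nlinarith [norm_nonneg x]
    have h1 : ∫⁻ x in B, ‖Ψ (u (l • x)) - Ψ (u x)‖ₑ ≤ ENNReal.ofReal ((1 / 2) ^ j) := by
      refine le_trans (le_of_eq (setLIntegral_congr_fun hB fun x hx ↦ ?_)) (hδF B (fun x ↦ l • x) hB
        (measurable_const_smul l) ?_ fun x hx ↦ ?_)
      · rw [indicator_of_mem hx, indicator_of_mem (hlB x hx)]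
      · have h2 := map_add_smul_volume (0 : EuclideanSpace ℝ (Fin m)) hl0
        simp only [zero_add] at h2
        refine (Measure.map_mono Measure.restrict_le_self (measurable_const_smul l)).trans ?_
        rw [h2]
        refine Measure.le_iff.2 fun S _ ↦ ?_
        rw [Measure.smul_apply, Measure.smul_apply, smul_eq_mul, ENNReal.smul_def, smul_eq_mul]
        gcongr
        calc ENNReal.ofReal (l ^ (-m : ℝ)) ≤ ENNReal.ofReal ((1 / 2 : ℝ) ^ (-m : ℝ)) :=
              ENNReal.ofReal_le_ofReal (Real.rpow_le_rpow_of_nonpos (by norm_num) hl (by simp))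
          _ = _ := by
              rw [Real.rpow_neg (by norm_num), Real.rpow_natCast]
              simp [ENNReal.ofReal_pow]
      · rw [dist_eq_norm, show l • x - x = (l - 1) • x by rw [sub_smul, one_smul], norm_smul, Real.norm_eq_abs, abs_sub_comm,
          abs_of_pos (by linarith)]
        rw [mem_ball_zero_iff] at hx
        nlinarith
    have h2 := (hcon l hl hl1).trans_lt hRR'
    simp only [relaxedEnergy, iInf_lt_iff] at h2
    obtain ⟨v, hv, hvu, hvE⟩ := h2
    rw [EuclideanSpace.euclideanHausdorffMeasure_eq_volume] at hvu
    have hul : AEStronglyMeasurable (fun x ↦ Ψ (u (l • x))) volume :=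
      hsm (hu.comp (measurable_const_smul l))
    have h3 : Tendsto (fun k ↦ ∫⁻ x in B, ‖Ψ (v k x) - Ψ (u (l • x))‖ₑ) atTop (𝓝 0) := by
      have h4 := tendsto_lintegral_of_dominated_convergence' (μ := volume.restrict B)
        (F := fun k x ↦ ‖Ψ (v k x) - Ψ (u (l • x))‖ₑ) (f := fun _ ↦ 0) (fun _ ↦ 2) (fun k ↦ ?_)
        (fun k ↦ ae_of_all _ fun x ↦ hbdd _ _) ?_ ?_
      · simpa using h4
      · exact (((hΨ.continuous.comp_continuousOn (hv k).continuousOn).aestronglyMeasurable hB).sub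
          hul.restrict).enorm
      · rw [lintegral_const]
        exact ENNReal.mul_ne_top (by simp) (measure_ne_top _ _)
      · filter_upwards [hvu] with x hx
        have h5 := ((hΨ.continuous.tendsto _).comp hx).sub_const (Ψ (u (l • x)))
        rw [sub_self] at h5
        simpa using h5.enorm
    -- The energy is below `R'` for infinitely many indices, and the L¹ distance is small for all
    -- large ones.
    obtain ⟨k, hk, hk'⟩ := ((frequently_lt_of_liminf_lt (by isBoundedDefault) hvE).and_eventually
      (h3.eventually_le_const (pos_iff_ne_zero.2 hj))).exists
    refine ⟨v k, hv k, hk.le, ?_⟩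
    calc _ ≤ ∫⁻ x in B, (‖Ψ (v k x) - Ψ (u (l • x))‖ₑ + ‖Ψ (u (l • x)) - Ψ (u x)‖ₑ) := by
          refine lintegral_mono fun x ↦ ?_
          rw [← sub_add_sub_cancel (Ψ (v k x)) (Ψ (u (l • x))) (Ψ (u x))]
          exact enorm_add_le _ _
      _ = (∫⁻ x in B, ‖Ψ (v k x) - Ψ (u (l • x))‖ₑ) + ∫⁻ x in B, ‖Ψ (u (l • x)) - Ψ (u x)‖ₑ :=
          lintegral_add_right' _ (hul.sub (hsm hu)).enorm.restrict
      _ ≤ _ := by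
          rw [two_mul]
          exact add_le_add hk' h1
  choose w hw hwE hwu using key
  refine hR'.not_ge ((iInf₂_le_of_le w hw (iInf_le_of_le ?_ le_rfl)).trans
    (liminf_le_of_frequently_le' (Eventually.of_forall hwE).frequently))
  rw [EuclideanSpace.euclideanHausdorffMeasure_eq_volume]
  have hmeas : ∀ j, AEMeasurable (fun x ↦ ‖Ψ (w j x) - Ψ (u x)‖ₑ) (volume.restrict B) := fun j ↦
    (((hΨ.continuous.comp_continuousOn (hw j).continuousOn).aestronglyMeasurable hB).sub
      (hsm hu).restrict).enorm
  -- The L¹ distances are summable, so at almost every point the distances are summable and tend to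
  -- 0; no subsequence is needed.
  have hsum : ∫⁻ x in B, ∑' j, ‖Ψ (w j x) - Ψ (u x)‖ₑ ≠ ⊤ := by
    rw [lintegral_tsum hmeas]
    refine ne_top_of_le_ne_top ?_ (ENNReal.tsum_le_tsum hwu)
    rw [ENNReal.tsum_mul_left]
    exact ENNReal.mul_ne_top (by simp) summable_geometric_two.tsum_ofReal_ne_top
  filter_upwards [ae_lt_top' (AEMeasurable.tsum hmeas) hsum] with x hx
  rw [hΨ.tendsto_nhds_iff, tendsto_iff_edist_tendsto_0]
  simpa only [Function.comp_apply, edist_eq_enorm_sub] using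
    ENNReal.tendsto_atTop_zero_of_tsum_ne_top hx.ne

end RelaxedEnergy

/-! ### Lower bound for the energies of an approximation -/

section UniformBoundedness

open scoped NNReal

variable {m n : ℕ} {M : Type*} [EMetricSpace M] [MeasurableSpace M] [BorelSpace M]

/-- In the chart, null sets of `M` have null preimages, by the antilipschitz bound on `e.symm`. -/
theorem ae_comp_chart_symm_add_smul {e : OpenPartialHomeomorph M (EuclideanSpace ℝ (Fin m))}
    {A : Set (EuclideanSpace ℝ (Fin m))} (hA : IsCompact A) (hT : A ⊆ e.target) {K : ℝ≥0}
    (hK : ∀ y ∈ A, ∀ z ∈ A, edist y z ≤ K * edist (e.symm y) (e.symm z)) {P : M → Prop}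
    (hP : ∀ᵐ x ∂(μHE[m] : Measure M), P x) {c : EuclideanSpace ℝ (Fin m)} {ρ : ℝ} (hρ : 0 < ρ)
    (hc : Metric.ball c ρ ⊆ A) :
    ∀ᵐ x ∂volume.restrict (Metric.ball (0 : EuclideanSpace ℝ (Fin m)) 1),
      P (e.symm (c + ρ • x)) := by
  set Z := toMeasurable (μHE[m] : Measure M) {x | ¬ P x}
  have hZ : (μHE[m] : Measure M) Z = 0 := by rw [measure_toMeasurable]; exact hP
  have hZm : MeasurableSet Z := measurableSet_toMeasurable _ _
  have h1 : ∫⁻ y in A, Z.indicator 1 (e.symm y) = 0 := by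
    refine le_antisymm ((lintegral_comp_chart_symm_le hA hT hK _).trans ?_) zero_le
    refine (mul_le_mul_right (setLIntegral_le_lintegral _ _) _).trans ?_
    rw [lintegral_indicator_one hZm, hZ, mul_zero]
  have h2 : ∫⁻ x in Metric.ball (0 : EuclideanSpace ℝ (Fin m)) 1,
      Z.indicator 1 (e.symm (c + ρ • x)) = (0 : ENNReal) := by
    rw [← preimage_add_smul_ball_one c hρ,
      setLIntegral_comp_add_smul c hρ (fun y ↦ Z.indicator 1 (e.symm y)),
      le_antisymm ((lintegral_mono_set hc).trans_eq h1) zero_le, mul_zero]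
  have hm : AEMeasurable (fun x ↦ (Z.indicator 1 (e.symm (c + ρ • x)) : ENNReal))
      (volume.restrict (Metric.ball (0 : EuclideanSpace ℝ (Fin m)) 1)) := by
    have h3 : ContinuousOn (fun x ↦ e.symm (c + ρ • x))
        (Metric.ball (0 : EuclideanSpace ℝ (Fin m)) 1) :=
      e.symm.continuousOn.comp (by fun_prop) fun x hx ↦ hT (hc (by
        rwa [← preimage_add_smul_ball_one c hρ] at hx))
    exact (measurable_one.indicator hZm).comp_aemeasurable
      (h3.aemeasurable Metric.isOpen_ball.measurableSet)
  filter_upwards [(lintegral_eq_zero_iff' hm).1 h2] with x hx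
  by_contra hPx
  have h4 : e.symm (c + ρ • x) ∈ Z := subset_toMeasurable _ _ hPx
  simp [indicator_of_mem h4] at hx

variable [ChartedSpace (EuclideanSpace ℝ (Fin m)) M] [IsManifold (𝓡 m) ∞ M]
  {N : Type*} [EMetricSpace N]
  [ChartedSpace (EuclideanSpace ℝ (Fin n)) N]
  [RiemannianBundle (fun y : N ↦ TangentSpace (𝓡 n) y)]

/-- A weak-bounded approximation bounds the relaxed energy of the maps of which it contains scaled
copies. -/
theorem card_mul_relaxedEnergy_le {s p : ℝ} {e : OpenPartialHomeomorph M (EuclideanSpace ℝ (Fin m))}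
    (he : e ∈ atlas (EuclideanSpace ℝ (Fin m)) M) {A : Set (EuclideanSpace ℝ (Fin m))}
    (hA : IsCompact A) (hT : A ⊆ e.target) {K : ℝ≥0}
    (hK : ∀ y ∈ A, ∀ z ∈ A, edist y z ≤ K * edist (e.symm y) (e.symm z))
    {W : ℕ → M → N} (hW : ∀ l, ContMDiff (𝓡 m) (𝓡 n) ∞ (W l)) {U : M → N}
    (hWU : ∀ᵐ x ∂(μHE[m] : Measure M), Tendsto (fun l ↦ W l x) atTop (𝓝 (U x)))
    {ι : Type} [Fintype ι] {c : ι → EuclideanSpace ℝ (Fin m)} {ρ : ℝ} (hρ : 0 < ρ)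
    (hc : ∀ i, Metric.ball (c i) ρ ⊆ A) {C : ENNReal}
    (hC : ∀ l, ∑ i, ENNReal.ofReal (ρ ^ (m - s * p)) *
      sobolevEnergy m n s p (Metric.ball 0 1) (fun x ↦ W l (e.symm (c i + ρ • x))) ≤ C)
    {u : EuclideanSpace ℝ (Fin m) → N}
    (hu : ∀ i, ∀ x ∈ Metric.ball (0 : EuclideanSpace ℝ (Fin m)) 1, U (e.symm (c i + ρ • x)) = u x)
    {R : ENNReal} (hR : R < relaxedEnergy m n s p (Metric.ball 0 1) u) :
    Fintype.card ι * (ENNReal.ofReal (ρ ^ (m - s * p)) * R) ≤ C := by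
  have h1 : ∀ i, ∀ᶠ l in atTop, R <
      sobolevEnergy m n s p (Metric.ball 0 1) (fun x ↦ W l (e.symm (c i + ρ • x))) := fun i ↦ by
    refine eventually_lt_of_lt_liminf (hR.trans_le ?_) (by isBoundedDefault)
    refine iInf₂_le_of_le _ (fun l ↦ ?_) (iInf_le_of_le ?_ le_rfl)
    · refine (hW l).comp_contMDiffOn ((contMDiffOn_symm_of_mem_maximalAtlas
        (IsManifold.subset_maximalAtlas he)).comp (t := e.target) ?_ fun x hx ↦ hT (hc i (by
          rwa [← preimage_add_smul_ball_one (c i) hρ] at hx)))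
      exact (contMDiff_iff_contDiff.2 (by fun_prop)).contMDiffOn
    · rw [EuclideanSpace.euclideanHausdorffMeasure_eq_volume]
      filter_upwards [ae_comp_chart_symm_add_smul hA hT hK hWU hρ (hc i),
        ae_restrict_mem Metric.isOpen_ball.measurableSet] with x hx hxB
      rwa [hu i x hxB] at hx
  -- There are finitely many copies, so one index `l` is good for all of them.
  obtain ⟨l, hl⟩ := (eventually_all.2 h1).exists
  refine le_trans ?_ (hC l)
  rw [← nsmul_eq_mul, ← Finset.card_univ, ← Finset.sum_const]
  exact Finset.sum_le_sum fun i _ ↦ mul_le_mul_right (hl i).le _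

end UniformBoundedness

/-! ### The uniform boundedness argument -/

theorem mainTheorem5 (m n : ℕ) (hm : 0 < m)
    -- a Riemannian manifold of dimension `m`, compact or Euclidean
    {M : Type*} [EMetricSpace M] [MeasurableSpace M] [BorelSpace M]
    [ChartedSpace (EuclideanSpace ℝ (Fin m)) M] [IsManifold (𝓡 m) ∞ M]
    [RiemannianBundle (fun x : M ↦ TangentSpace (𝓡 m) x)]
    [IsContMDiffRiemannianBundle (𝓡 m) ∞ (EuclideanSpace ℝ (Fin m))
      (fun x : M ↦ TangentSpace (𝓡 m) x)]
    [IsRiemannianManifold (𝓡 m) M] [Nonempty M]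
    (hM : CompactSpace M ∨
      ∃ Φ : M ≃ₘ⟮𝓡 m, 𝓡 m⟯ EuclideanSpace ℝ (Fin m), Isometry Φ)
    -- a connected Riemannian manifold of dimension `n`
    {N : Type*} [EMetricSpace N] [MeasurableSpace N] [BorelSpace N] [SecondCountableTopology N]
    [ChartedSpace (EuclideanSpace ℝ (Fin n)) N] [IsManifold (𝓡 n) ∞ N]
    [RiemannianBundle (fun y : N ↦ TangentSpace (𝓡 n) y)]
    [IsContMDiffRiemannianBundle (𝓡 n) ∞ (EuclideanSpace ℝ (Fin n))
      (fun y : N ↦ TangentSpace (𝓡 n) y)]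
    [IsRiemannianManifold (𝓡 n) N] [ConnectedSpace N]
    (s r p q : ℝ) (hs : 0 < s) (hs1 : s ≤ 1) (hr : 0 < r) (hr1 : r ≤ 1) (hp : 1 ≤ p) (hq : 1 ≤ q)
    (hspq : s * p = r * q) (hspm : s * p < m)
    (happrox : ∀ u : M → N, MemSobolevMap m n s p u → HasWeakBoundedApprox m n r q u) :
    ∃ C : ℝ, 0 < C ∧ ∀ u : EuclideanSpace ℝ (Fin m) → N,
      AEMeasurable u (volume.restrict (Metric.ball 0 1)) →
        relaxedEnergy m n r q (Metric.ball 0 1) u ≤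
          ENNReal.ofReal C * sobolevEnergy m n s p (Metric.ball 0 1) u := by
  classical
  obtain ⟨x₀⟩ := ‹Nonempty M›
  obtain ⟨δ, hδ, K, hK0, hT, hK, hKD⟩ := exists_bilipschitz_chartAt (m := m) x₀
  set e := chartAt (EuclideanSpace ℝ (Fin m)) x₀
  have he : e ∈ atlas (EuclideanSpace ℝ (Fin m)) M := chart_mem_atlas _ x₀
  set A := Metric.closedBall (e x₀) δ
  have hA : IsCompact A := isCompact_closedBall _ _
  obtain ⟨G, C, F, hF, hopen, htrans⟩ := exists_isGluableEnergy (n := n) (N := N) hm hM hs hs1 hp he hδ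
    hT hK0 hK fun y hy v ↦ (hKD y hy v).2
  obtain ⟨C', hC', hsum⟩ := exists_sum_sobolevEnergy_chart_le (n := n) (N := N) hm hr hq he hA hT hK0
    hK fun y hy v ↦ (hKD y hy v).1
  have hσ : 0 < m - s * p := sub_pos.2 hspm
  have hσm : m - s * p < m := by nlinarith [mul_pos hs (zero_lt_one.trans_le hp)]
  by_contra! hcon
  -- The factor 2^k will make the energies of the clusters summable, and k + 1 will contradict the
  -- bound on the approximation.
  have hw : ∀ k : ℕ, (0 : ℝ) < (k + 1) * 2 ^ k := fun k ↦ by positivity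
  have hbad : ∀ k : ℕ, ∃ (l : ℝ) (u : EuclideanSpace ℝ (Fin m) → N)
      (v : EuclideanSpace ℝ (Fin m) → N) (b : N) (R : NNReal), 0 < R ∧
      R < relaxedEnergy m n r q (Metric.ball 0 1) (fun x ↦ u (l • x)) ∧ Measurable v ∧
      (∀ x ∈ Metric.ball 0 1, v x = u (l • x)) ∧
      (∀ x ∉ Metric.closedBall (0 : EuclideanSpace ℝ (Fin m)) 3, v x = b) ∧
      F v ≤ C * (R / ENNReal.ofReal ((k + 1) * 2 ^ k)) := by
    intro k
    obtain ⟨u, hu, huk⟩ := hcon _ (hw k)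
    have hu' := hu.ae_eq_mk
    -- A finite number below the relaxed energy, which may be infinite.
    obtain ⟨R, hR1, hR2⟩ := ENNReal.lt_iff_exists_nnreal_btwn.1
      (huk.trans_le (relaxedEnergy_le_of_ae_eq hu'.symm))
    obtain ⟨l, hl, hl1, hRl⟩ := exists_lt_relaxedEnergy_comp_smul hu.measurable_mk hR2
    have hk0 : ENNReal.ofReal ((k + 1) * 2 ^ k) ≠ 0 := by simpa using hw k
    obtain ⟨v, b, hv, hvu, hvb, hvF⟩ := hopen l (hu.mk u) (R / ENNReal.ofReal ((k + 1) * 2 ^ k)) hl hl1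
      hu.measurable_mk (ENNReal.div_ne_top ENNReal.coe_ne_top hk0)
      ((sobolevEnergy_le_of_ae_eq Metric.isOpen_ball hu').trans_lt <| by
        rw [ENNReal.lt_div_iff_mul_lt (Or.inl hk0) (Or.inl ENNReal.ofReal_ne_top), mul_comm]
        exact hR1)
    exact ⟨l, hu.mk u, v, b, R, by exact_mod_cast zero_le.trans_lt hR1, hRl, hv, hvu, hvb, hvF⟩
  choose l u v b R hR0 hR hv hvu hvb hvF using hbad
  -- With the weight (k + 1) / R k, the copies of `v k` cost at most a constant times 2^(-k),
  -- whereas their relaxed energies `E_{r,q}` add up to more than k + 1.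
  obtain ⟨V, hV, hVb, hVF, hcopies⟩ := hF.exists_concentration hσ hσm hv hvb
    (t := fun k ↦ (k + 1) / R k) (fun k ↦ by have := hR0 k; positivity) (by
      have h1 : ∀ k, ENNReal.ofReal ((k + 1) / R k) * F (v k) ≤
          C * ENNReal.ofReal ((1 / 2) ^ k) := fun k ↦ by
        refine (mul_le_mul_right (hvF k) _).trans_eq ?_
        have h2 : (R k : ENNReal) / ENNReal.ofReal ((k + 1) * 2 ^ k) =
            ENNReal.ofReal (R k / ((k + 1) * 2 ^ k)) := by
          rw [ENNReal.ofReal_div_of_pos (hw k), ENNReal.ofReal_coe_nnreal]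
        rw [h2, mul_left_comm, ← ENNReal.ofReal_mul (by positivity)]
        congr 2
        have h3 : (R k : ℝ) ≠ 0 := by exact_mod_cast (hR0 k).ne'
        have h4 : (k + 1 : ℝ) ≠ 0 := by positivity
        field_simp
        rw [← mul_pow]
        norm_num
      refine ne_top_of_le_ne_top ?_ (ENNReal.tsum_le_tsum h1)
      rw [ENNReal.tsum_mul_left]
      exact ENNReal.mul_ne_top ENNReal.coe_ne_top summable_geometric_two.tsum_ofReal_ne_top)
    (e x₀) (half_pos hδ)
  -- The single use of the hypothesis on approximations: one map contains copies of all the bad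
  -- maps, so one bound `E` serves for every `k`.
  obtain ⟨W, hW, hWU, E, hE⟩ := happrox (transplant e (b 0) V)
    ⟨(measurable_transplant e (b 0) hV).aemeasurable, htrans V (b 0) hV hVb hVF⟩
  have hbound : ∀ k : ℕ, (k + 1 : ENNReal) ≤ C' * E := by
    intro k
    obtain ⟨Q, c, ρ, hρ, hQ, hd, hc, hcV⟩ := hcopies k
    have hcA : ∀ i, Metric.ball (c i) ρ ⊆ A := fun i ↦
      (hc i).trans (Metric.closedBall_subset_closedBall (by linarith))
    -- By `hspq` the weight ρ^(m - r q) is ρ^(m - s p). Multiplied by the number Q^m of copies it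
    -- gives (k + 1) / R k, and the factor `R k` cancels.
    have h1 := card_mul_relaxedEnergy_le he hA hT (fun y hy z hz ↦ (hK y hy z hz).2) hW hWU hρ hcA
      (C := C' * E) (fun l ↦ (hsum (W l) _ c ρ hρ hd hcA).trans (mul_le_mul_right (hE l) _))
      (u := fun x ↦ u k (l k • x)) (fun i x hx ↦ ?_) (hR k)
    · refine le_trans (le_of_eq ?_) h1
      rw [Fintype.card_fun, Fintype.card_fin, Fintype.card_fin, ← hspq, ← mul_assoc,
        ← ENNReal.ofReal_natCast (Q ^ m), ← ENNReal.ofReal_mul (by positivity), Nat.cast_pow, hQ,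
        ← ENNReal.ofReal_coe_nnreal, ← ENNReal.ofReal_mul (by positivity),
        div_mul_cancel₀ _ (by exact_mod_cast (hR0 k).ne')]
      rw [ENNReal.ofReal_add (by positivity) zero_le_one, ENNReal.ofReal_natCast, ENNReal.ofReal_one]
    · have h2 : c i + ρ • x ∈ Metric.ball (c i) ρ := by
        rwa [← preimage_add_smul_ball_one (c i) hρ] at hx
      rw [transplant_symm _ _ (hT (hcA i h2)), hcV i x hx, hvu k x hx]
  obtain ⟨k, hk⟩ := ENNReal.exists_nat_gt (ENNReal.mul_ne_top hC' ENNReal.coe_ne_top : C' * E ≠ ⊤)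
  exact (hk.trans_le (le_self_add.trans (hbound k))).false
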